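/- Let $n\ge 3$, let $F_n$ be the free group of rank $n$, and fix a real number $k\ge 4$. Let $cv_0(F_n)$ be the set of minimal free simplicial metric $F_n$-trees (with the natural simplicial structure: every vertex has valence at least three) whose quotient graph has volume one, up to equivariant isometry; ${\rm Out}(F_n)$ acts on it by change of marking. A free factor of $F_n$ is a subgroup $A$ with $F_n=A*B$ for some subgroup $B$. A free factor $A$ of rank $\ell$ is *$k$-short* for $T\in cv_0(F_n)$ if, for some identification of $A$ with the fundamental group of the rose $R_\ell$ with $\ell$ petals of length one, there is an $A$-equivariant $k$-Lipschitz map $\tilde R_\ell\to T$, defined on the universal covering of $R_\ell$, which maps vertices to vertices. Two trees are *$\ell$-tied* if some free factor of rank $\ell$ is $k$-short for both of them. Put $d_{ng}^\ell(T,T)=0$, and for $T\ne T'$ let $d_{ng}^\ell(T,T')$ be the minimal $s\ge 1$ for which there is a chain $T=T_0,\dots,T_s=T'$ in $cv_0(F_n)$ with $T_i,T_{i+1}$ $\ell$-tied for all $i$. For $1\le\ell\le n-2$ let ${\cal FF}_\ell$ be the graph whose vertices are the conjugacy classes of free factors of rank $n-1$, where two distinct classes are joined by an edge if they have representatives whose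 intersection contains a free factor of $F_n$ of rank $\ell$. Let ${\cal FF}$ be the free factor graph: vertices are the conjugacy classes of proper nontrivial free factors, and two distinct classes are joined by an edge if they have nested representatives. Let ${\cal FS}$ be the first barycentric subdivision of the free splitting graph: vertices are the nontrivial minimal graph of groups decompositions of $F_n$ with trivial edge groups, that is, the minimal simplicial $F_n$-trees with trivial edge stabilizers and all valences at least three, up to equivariant isomorphism; two distinct vertices are joined by an edge if one is a collapse of the other. All graphs carry the path metric (on vertices) with edges of length one. A map $f:X\to Y$ between metric spaces with isometric actions of a group $\Gamma$ is a *coarsely $\Gamma$-equivariant quasi-isometry* with constant $L$ if $d(f(x),f(y))\le L\,d(x,y)+L$ and $d(x,y)\le L\,d(f(x),f(y))+L$ for all $x,y\in X$, every point of $Y$ is at distance at most $L$ from $f(X)$, and $d(gf(x),f(gx))\le L$ for all $g\in\Gamma$, $x\in X$. Then the following holds. 1. For $1\le \ell\le n-1$, any two points of $cv_0(F_n)$ are joined by a chain of successively $\ell$-tied trees, and $d_{ng}^\ell$ is a distance on $cv_0(F_n)$. 2. There is a map $\Upsilon$ which associates to each $T\in cv_0(F_n)$ the conjugacy class of a free factor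 of rank $n-1$ which is $k$-short for $T$. For each $1\le\ell\le n-2$ the graph ${\cal FF}_\ell$ is connected, and there is a number $L$ such that every such map $\Upsilon$ is a coarsely ${\rm Out}(F_n)$-equivariant quasi-isometry $(cv_0(F_n),d_{ng}^\ell)\to{\cal FF}_\ell$ with constant $L$. 3. The free factor graph ${\cal FF}$ is connected, and the vertex inclusion $\iota:{\cal FF}_1\to{\cal FF}$ is a coarsely ${\rm Out}(F_n)$-equivariant quasi-isometry. Moreover, with a constant which does not depend on $\Upsilon$, every composition $\iota\circ\Upsilon:(cv_0(F_n),d_{ng}^1)\to{\cal FF}$, with $\Upsilon$ as in 2, is a coarsely ${\rm Out}(F_n)$-equivariant quasi-isometry. 4. The graph ${\cal FS}$ is connected, and the map $\Upsilon_{\cal FS}:(cv_0(F_n),d_{ng}^{n-1})\to{\cal FS}$ which forgets the lengths of the edges of a tree is a coarsely ${\rm Out}(F_n)$-equivariant quasi-isometry. -/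

import Mathlib

noncomputable section

namespace OuterSpace

/-- The free group `F_n` on `n` generators. -/
abbrev F (n : ℕ) : Type := FreeGroup (Fin n)

/-! ### The outer automorphism group -/

/-- The group of inner automorphisms. -/
def Inn (n : ℕ) : Subgroup (MulAut (F n)) := (MulAut.conj (G := F n)).range

instance (n : ℕ) : (Inn n).Normal where
  conj_mem := by
    rintro _ ⟨h, rfl⟩ φ
    refine ⟨φ h, ?_⟩
    ext x
    simp [MulAut.conj_apply]

/-- `Out(F_n) = Aut(F_n) / Inn(F_n)`. -/
abbrev Out (n : ℕ) : Type := MulAut (F n) ⧸ Inn n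

/-- An action of `Aut(F_n)` for which inner automorphisms act trivially descends to `Out(F_n)`. -/
@[reducible]
def outAction (n : ℕ) (X : Type*) [MulAction (MulAut (F n)) X]
    (h : ∀ (g : F n) (x : X), MulAut.conj g • x = x) : MulAction (Out n) X :=
  MulAction.compHom X (QuotientGroup.lift (Inn n) (MulAction.toPermHom (MulAut (F n)) X) (by
    rintro _ ⟨g, rfl⟩
    ext x
    exact h g x))

/-! ### Free splittings

A graph of groups decomposition of `F_n` with trivial edge groups is encoded, up to conjugation, by
its Bass-Serre tree up to equivariant isomorphism. -/

/-- A minimal simplicial `F_n`-tree with trivial edge stabilizers and with its natural simplicial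
structure, i.e. every vertex has valence at least three (so there is at least one edge). Inversions
cannot occur, because their squares would fix an edge and `F_n` is torsion free. -/
structure FreeSplitting (n : ℕ) where
  V : Type
  graph : SimpleGraph V
  isTree : graph.IsTree
  ρ : F n →* (graph ≃g graph)
  edge_stab : ∀ (g : F n) (v w : V), graph.Adj v w → ρ g v = v → ρ g w = w → g = 1
  minimal : ∀ S : Set V, S.Nonempty → (∀ (g : F n), ∀ v ∈ S, ρ g v ∈ S) →
    (graph.induce S).Connected → S = Set.univ
  valence : ∀ v : V, 3 ≤ (graph.neighborSet v).encard

namespace FreeSplitting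

variable {n : ℕ}

/-- Equivariant isomorphism of simplicial trees. -/
def Iso (S T : FreeSplitting n) : Prop :=
  ∃ f : S.graph ≃g T.graph, ∀ (g : F n) (v : S.V), f (S.ρ g v) = T.ρ g (f v)

/-- `T` is a collapse of `S`: there is an equivariant map from the vertices of `S` onto those of `T`
whose fibres are subtrees, such that the edges of `T` are exactly the images of the edges of `S`
which are not collapsed to a point. -/
def IsCollapse (S T : FreeSplitting n) : Prop :=
  ∃ f : S.V → T.V,
    (∀ (g : F n) (v : S.V), f (S.ρ g v) = T.ρ g (f v)) ∧
    (∀ w : T.V, (S.graph.induce (f ⁻¹' {w})).Connected) ∧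
    (∀ w w' : T.V, T.graph.Adj w w' ↔
      w ≠ w' ∧ ∃ v v' : S.V, f v = w ∧ f v' = w' ∧ S.graph.Adj v v')

/-- Change of marking: the action is precomposed with `φ⁻¹`. -/
def twist (φ : MulAut (F n)) (T : FreeSplitting n) : FreeSplitting n where
  V := T.V
  graph := T.graph
  isTree := T.isTree
  ρ := T.ρ.comp (φ⁻¹ : MulAut (F n)).toMonoidHom
  edge_stab g v w h hv hw := by
    have := T.edge_stab (φ⁻¹ g) v w h hv hw
    simpa using this
  minimal S hS hinv hc := T.minimal S hS (fun g v hv => by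
    have := hinv (φ g) v hv
    simpa using this) hc
  valence := T.valence

theorem ρ_conj (S : FreeSplitting n) (g h : F n) (v : S.V) :
    S.ρ g (S.ρ ((MulAut.conj g)⁻¹ h) v) = S.ρ h (S.ρ g v) := by
  rw [← RelIso.mul_apply, ← RelIso.mul_apply, ← map_mul, ← map_mul]
  simp [mul_assoc]

instance setoid (n : ℕ) : Setoid (FreeSplitting n) where
  r := Iso
  iseqv :=
    { refl := fun S => ⟨RelIso.refl _, fun _ _ => rfl⟩
      symm := by
        rintro S T ⟨f, hf⟩
        refine ⟨f.symm, fun g v => ?_⟩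
        apply f.injective
        simp [hf]
      trans := by
        rintro S T U ⟨f, hf⟩ ⟨f', hf'⟩
        exact ⟨f.trans f', fun g v => by simp [hf, hf']⟩ }

end FreeSplitting

/-- Vertices of the (barycentrically subdivided) free splitting graph. -/
def FSVertex (n : ℕ) : Type 1 := Quotient (FreeSplitting.setoid n)

/-- The class of a free splitting. -/
def FSVertex.mk {n : ℕ} (S : FreeSplitting n) : FSVertex n := Quotient.mk _ S

instance (n : ℕ) : MulAction (MulAut (F n)) (FSVertex n) where
  smul φ := Quotient.map (FreeSplitting.twist φ) (by
    rintro S T ⟨f, hf⟩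
    exact ⟨f, fun g v => hf _ v⟩)
  one_smul := by
    rintro ⟨S⟩
    exact Quotient.sound ⟨RelIso.refl _, fun g v => rfl⟩
  mul_smul φ ψ := by
    rintro ⟨S⟩
    exact Quotient.sound ⟨RelIso.refl _, fun g v => rfl⟩

instance (n : ℕ) : MulAction (Out n) (FSVertex n) := outAction n _ (by
  rintro g ⟨S⟩
  refine Quotient.sound ⟨S.ρ g, fun h v => ?_⟩
  exact S.ρ_conj g h v)

/-- The first barycentric subdivision `FS` of the free splitting graph: two distinct vertices are
joined by an edge if one is a collapse of the other. -/
def FS (n : ℕ) : SimpleGraph (FSVertex n) :=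
  SimpleGraph.fromRel fun x y => ∃ S T : FreeSplitting n,
    FSVertex.mk S = x ∧ FSVertex.mk T = y ∧ S.IsCollapse T

/-! ### Outer space -/

/-- A minimal free simplicial `F_n`-tree, with an invariant positive length for each edge, whose
quotient has volume one. The last field says that some finite set of edges meets each orbit of
edges exactly once and has total length one. The values of `len` off the edges are irrelevant. -/
structure MetricTree (n : ℕ) extends FreeSplitting n where
  free : ∀ (g : F n) (v : V), ρ g v = v → g = 1
  len : Sym2 V → ℝ
  len_pos : ∀ e ∈ graph.edgeSet, 0 < len e
  len_inv : ∀ (g : F n), ∀ e ∈ graph.edgeSet, len (e.map (ρ g)) = len e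
  volume_one : ∃ D : Finset (Sym2 V), (∀ e ∈ D, e ∈ graph.edgeSet) ∧
    (∀ e ∈ graph.edgeSet, ∃! d, d ∈ D ∧ ∃ g : F n, d.map (ρ g) = e) ∧
    ∑ e ∈ D, len e = 1

namespace MetricTree

variable {n : ℕ}

/-- The path metric of the tree, between vertices. -/
def dist (T : MetricTree n) (v w : T.V) : ℝ :=
  ⨅ p : T.graph.Walk v w, (p.edges.map T.len).sum

/-- Equivariant isometry (it respects the natural simplicial structures). -/
def Iso (S T : MetricTree n) : Prop :=
  ∃ f : S.graph ≃g T.graph, (∀ (g : F n) (v : S.V), f (S.ρ g v) = T.ρ g (f v)) ∧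
    ∀ e ∈ S.graph.edgeSet, T.len (e.map f) = S.len e

/-- Change of marking: the action is precomposed with `φ⁻¹`. -/
def twist (φ : MulAut (F n)) (T : MetricTree n) : MetricTree n where
  toFreeSplitting := T.toFreeSplitting.twist φ
  free g v h := by
    have := T.free (φ⁻¹ g) v h
    simpa using this
  len := T.len
  len_pos := T.len_pos
  len_inv g e he := T.len_inv (φ⁻¹ g) e he
  volume_one := by
    obtain ⟨D, h1, h2, h3⟩ := T.volume_one
    have key : ∀ d e : Sym2 T.V, (∃ g : F n, d.map ((T.toFreeSplitting.twist φ).ρ g) = e) ↔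
        ∃ g : F n, d.map (T.ρ g) = e := by
      intro d e
      constructor
      · rintro ⟨g, hg⟩
        exact ⟨φ⁻¹ g, hg⟩
      · rintro ⟨g, hg⟩
        refine ⟨φ g, ?_⟩
        change d.map (T.ρ (φ⁻¹ (φ g))) = e
        simpa using hg
    refine ⟨D, h1, fun e he => ?_, h3⟩
    obtain ⟨d, hd, hu⟩ := h2 e he
    exact ⟨d, ⟨hd.1, (key d e).2 hd.2⟩, fun d' hd' => hu d' ⟨hd'.1, (key d' e).1 hd'.2⟩⟩

theorem map_edge {V W : Type} {G : SimpleGraph V} {H : SimpleGraph W} (f : G ≃g H)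
    {e : Sym2 V} (he : e ∈ G.edgeSet) : e.map f ∈ H.edgeSet := by
  induction e with
  | _ v w => exact f.map_rel_iff.2 he

instance setoid (n : ℕ) : Setoid (MetricTree n) where
  r := Iso
  iseqv :=
    { refl := fun S => ⟨RelIso.refl _, fun _ _ => rfl, fun e _ => by
        induction e with
        | _ v w => rfl⟩
      symm := by
        rintro S T ⟨f, hf, hl⟩
        refine ⟨f.symm, fun g v => ?_, fun e he => ?_⟩
        · apply f.injective
          simp [hf]
        · rw [← hl _ (map_edge f.symm he)]
          congr 1
          induction e with
          | _ v w => simp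
      trans := by
        rintro S T U ⟨f, hf, hl⟩ ⟨f', hf', hl'⟩
        refine ⟨f.trans f', fun g v => by simp [hf, hf'], fun e he => ?_⟩
        rw [← hl e he, ← hl' _ (map_edge f he)]
        congr 1
        induction e with
        | _ v w => rfl }

end MetricTree

/-- The space `cv_0(F_n)` (as a set). -/
def Cv0 (n : ℕ) : Type 1 := Quotient (MetricTree.setoid n)

/-- The class of a tree. -/
def Cv0.mk {n : ℕ} (T : MetricTree n) : Cv0 n := Quotient.mk _ T

instance (n : ℕ) : MulAction (MulAut (F n)) (Cv0 n) where
  smul φ := Quotient.map (MetricTree.twist φ) (by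
    rintro S T ⟨f, hf, hl⟩
    exact ⟨f, fun g v => hf _ v, hl⟩)
  one_smul := by
    rintro ⟨S⟩
    exact Quotient.sound ⟨RelIso.refl _, fun g v => rfl, fun e _ => by
      induction e with
      | _ v w => rfl⟩
  mul_smul φ ψ := by
    rintro ⟨S⟩
    exact Quotient.sound ⟨RelIso.refl _, fun g v => rfl, fun e _ => by
      induction e with
      | _ v w => rfl⟩

instance (n : ℕ) : MulAction (Out n) (Cv0 n) := outAction n _ (by
  rintro g ⟨S⟩
  refine Quotient.sound ⟨S.ρ g, fun h v => ?_, fun e he => S.len_inv g e he⟩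
  exact S.toFreeSplitting.ρ_conj g h v)

/-- The map `cv_0(F_n) → FS` which forgets the edge lengths. -/
def Upsilon {n : ℕ} : Cv0 n → FSVertex n :=
  Quotient.map MetricTree.toFreeSplitting (by
    rintro S T ⟨f, hf, _⟩
    exact ⟨f, hf⟩)

/-! ### Free factors -/

/-- `A` is a free factor of `F_n`, i.e. `F_n = A * B` for some subgroup `B`. -/
def IsFreeFactor {n : ℕ} (A : Subgroup (F n)) : Prop :=
  ∃ B : Subgroup (F n), Function.Bijective (Monoid.Coprod.lift A.subtype B.subtype)

/-- `A` is a free factor of `F_n` which is free of rank `r`. -/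
def IsFreeFactorOfRank {n : ℕ} (r : ℕ) (A : Subgroup (F n)) : Prop :=
  IsFreeFactor A ∧ Nonempty (FreeGroup (Fin r) ≃* A)

theorem IsFreeFactor.map {n : ℕ} (φ : MulAut (F n)) {A : Subgroup (F n)} (hA : IsFreeFactor A) :
    IsFreeFactor (A.map φ.toMonoidHom) := by
  obtain ⟨B, hB⟩ := hA
  refine ⟨B.map φ.toMonoidHom, ?_⟩
  let eA := φ.subgroupMap A
  let eB := φ.subgroupMap B
  let e := MulEquiv.coprodCongr eA eB
  have h : (Monoid.Coprod.lift (A.map φ.toMonoidHom).subtype (B.map φ.toMonoidHom).subtype).comp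
      e.toMonoidHom = φ.toMonoidHom.comp (Monoid.Coprod.lift A.subtype B.subtype) := by
    ext x
    · simp only [MonoidHom.comp_apply, MulEquiv.toMonoidHom_eq_coe, MonoidHom.coe_coe,
        Monoid.Coprod.lift_apply_inl]
      rfl
    · simp only [MonoidHom.comp_apply, MulEquiv.toMonoidHom_eq_coe, MonoidHom.coe_coe,
        Monoid.Coprod.lift_apply_inr]
      rfl
  have h2 : Function.Bijective ((Monoid.Coprod.lift (A.map φ.toMonoidHom).subtype
      (B.map φ.toMonoidHom).subtype) ∘ e) := by
    have : ((Monoid.Coprod.lift (A.map φ.toMonoidHom).subtype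
      (B.map φ.toMonoidHom).subtype) ∘ e) = φ ∘ (Monoid.Coprod.lift A.subtype B.subtype) := by
      funext x
      exact DFunLike.congr_fun h x
    rw [this]
    exact φ.bijective.comp hB
  exact (Function.Bijective.of_comp_iff _ e.bijective).1 h2

theorem IsFreeFactorOfRank.map {n r : ℕ} (φ : MulAut (F n)) {A : Subgroup (F n)}
    (hA : IsFreeFactorOfRank r A) : IsFreeFactorOfRank r (A.map φ.toMonoidHom) := by
  obtain ⟨h, ⟨e⟩⟩ := hA
  exact ⟨h.map φ, ⟨e.trans (φ.subgroupMap A)⟩⟩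

/-- Conjugacy of subgroups. -/
def conjSetoid (n : ℕ) : Setoid (Subgroup (F n)) where
  r A B := ∃ g : F n, A.map (MulAut.conj g).toMonoidHom = B
  iseqv :=
    { refl := fun A => ⟨1, by ext x; simp⟩
      symm := by
        rintro A B ⟨g, rfl⟩
        refine ⟨g⁻¹, ?_⟩
        rw [Subgroup.map_map]
        convert Subgroup.map_id A
        ext x
        simp [mul_assoc]
      trans := by
        rintro A B C ⟨g, rfl⟩ ⟨h, rfl⟩
        refine ⟨h * g, ?_⟩
        rw [Subgroup.map_map]
        congr 1
        ext x
        simp }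

/-- Conjugacy classes of subgroups of `F_n`. -/
def SubgroupConj (n : ℕ) : Type := Quotient (conjSetoid n)

/-- The conjugacy class of a subgroup. -/
def SubgroupConj.mk {n : ℕ} (A : Subgroup (F n)) : SubgroupConj n := Quotient.mk _ A

instance (n : ℕ) : MulAction (MulAut (F n)) (SubgroupConj n) where
  smul φ := Quotient.map (fun A : Subgroup (F n) => A.map φ.toMonoidHom) (by
    rintro A B ⟨g, rfl⟩
    refine ⟨φ g, ?_⟩
    simp only [Subgroup.map_map]
    congr 1
    ext x
    simp)
  one_smul := by
    rintro ⟨A⟩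
    exact congrArg SubgroupConj.mk (Subgroup.map_id A)
  mul_smul φ ψ := by
    rintro ⟨A⟩
    exact congrArg SubgroupConj.mk (Subgroup.map_map A φ.toMonoidHom ψ.toMonoidHom).symm

/-- `Out(F_n)` acts by `φ • [A] = [φ(A)]`. -/
instance (n : ℕ) : MulAction (Out n) (SubgroupConj n) := outAction n _ (by
  rintro g ⟨A⟩
  exact (Quotient.sound (s := conjSetoid n) ⟨g, rfl⟩ :
    SubgroupConj.mk A = SubgroupConj.mk (A.map (MulAut.conj g).toMonoidHom)).symm)

/-- Conjugacy classes of free factors of rank `n - 1`, with the action of `Out(F_n)`. -/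
def CorankOne (n : ℕ) : SubMulAction (Out n) (SubgroupConj n) where
  carrier := {c | ∃ A : Subgroup (F n), IsFreeFactorOfRank (n - 1) A ∧ SubgroupConj.mk A = c}
  smul_mem' := by
    rintro ⟨φ⟩ _ ⟨A, hA, rfl⟩
    exact ⟨A.map φ.toMonoidHom, hA.map φ, rfl⟩

/-- Conjugacy classes of proper nontrivial free factors, with the action of `Out(F_n)`. -/
def ProperFactor (n : ℕ) : SubMulAction (Out n) (SubgroupConj n) where
  carrier := {c | ∃ A : Subgroup (F n), IsFreeFactor A ∧ A ≠ ⊥ ∧ A ≠ ⊤ ∧ SubgroupConj.mk A = c}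
  smul_mem' := by
    rintro ⟨φ⟩ _ ⟨A, hA, h1, h2, rfl⟩
    refine ⟨A.map φ.toMonoidHom, hA.map φ, ?_, ?_, rfl⟩
    · rwa [Ne, Subgroup.map_eq_bot_iff_of_injective A φ.injective]
    · intro h
      apply h2
      apply Subgroup.map_injective (f := φ.toMonoidHom) φ.injective
      rw [h]
      exact (Subgroup.map_top_of_surjective φ.toMonoidHom φ.surjective).symm

/-- The free factor graph: classes joined by an edge if some representatives are nested. -/
def FF (n : ℕ) : SimpleGraph (ProperFactor n) :=
  SimpleGraph.fromRel fun c d => ∃ A B : Subgroup (F n),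
    SubgroupConj.mk A = c ∧ SubgroupConj.mk B = d ∧ A < B

/-- The graph `FF_ℓ`: classes of corank one free factors, joined by an edge if the intersection of
some representatives contains a free factor of rank `ℓ`. -/
def FFl (n ℓ : ℕ) : SimpleGraph (CorankOne n) :=
  SimpleGraph.fromRel fun c d => ∃ A B C : Subgroup (F n),
    SubgroupConj.mk A = c ∧ SubgroupConj.mk B = d ∧ IsFreeFactorOfRank ℓ C ∧ C ≤ A ⊓ B

/-! ### Short free factors and the electrified distances -/

/-- The subgroup `A`, of rank `r`, is `k`-short for the tree `T`: for some identification of `A`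
with the fundamental group of the rose with `r` petals of length one, there is an `A`-equivariant
`k`-Lipschitz map from the universal covering of this rose to `T` which maps vertices to vertices.
The vertices of the universal covering form a copy of `FreeGroup (Fin r)` with its word metric, and
such a map may be taken to be linear on edges, hence is given by its values at the vertices. -/
def IsShort {n : ℕ} (k : ℝ) (r : ℕ) (A : Subgroup (F n)) (T : MetricTree n) : Prop :=
  ∃ (φ : FreeGroup (Fin r) ≃* A) (f : FreeGroup (Fin r) → T.V),
    (∀ g h : FreeGroup (Fin r), f (g * h) = T.ρ (φ g : F n) (f h)) ∧
    ∀ g h : FreeGroup (Fin r), T.dist (f g) (f h) ≤ k * (FreeGroup.norm (g⁻¹ * h) : ℝ)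

/-- `A` is a free factor of rank `r` which is `k`-short for the point `x` of `cv_0(F_n)`. -/
def IsShortFactor {n : ℕ} (k : ℝ) (r : ℕ) (A : Subgroup (F n)) (x : Cv0 n) : Prop :=
  IsFreeFactorOfRank r A ∧ ∃ T : MetricTree n, Cv0.mk T = x ∧ IsShort k r A T

/-- Two points of `cv_0(F_n)` are `ℓ`-tied. -/
def Tied {n : ℕ} (k : ℝ) (ℓ : ℕ) (x y : Cv0 n) : Prop :=
  ∃ A : Subgroup (F n), IsShortFactor k ℓ A x ∧ IsShortFactor k ℓ A y

/-- There is a chain of length `s` of successively `ℓ`-tied trees from `x` to `y`. -/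
def IsTiedChain {n : ℕ} (k : ℝ) (ℓ : ℕ) (x y : Cv0 n) (s : ℕ) : Prop :=
  ∃ u : ℕ → Cv0 n, u 0 = x ∧ u s = y ∧ ∀ i < s, Tied k ℓ (u i) (u (i + 1))

open Classical in
/-- The distance `d_ng^ℓ` (which depends on `k`). -/
def ngDist {n : ℕ} (k : ℝ) (ℓ : ℕ) (x y : Cv0 n) : ℕ :=
  if x = y then 0 else sInf {s : ℕ | 1 ≤ s ∧ IsTiedChain k ℓ x y s}

/-- `Υ` assigns to each point of `cv_0(F_n)` a `k`-short corank one free factor. -/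
def IsShortFactorMap {n : ℕ} (k : ℝ) (Υ : Cv0 n → CorankOne n) : Prop :=
  ∀ x : Cv0 n, ∃ A : Subgroup (F n),
    IsShortFactor k (n - 1) A x ∧ SubgroupConj.mk A = (Υ x : SubgroupConj n)

/-! ### Coarse geometry -/

/-- A distance with values in `ℕ`. -/
def IsDistance {X : Type*} (d : X → X → ℕ) : Prop :=
  (∀ x y, d x y = 0 ↔ x = y) ∧ (∀ x y, d x y = d y x) ∧ ∀ x y z, d x z ≤ d x y + d y z

/-- `f` is a coarsely `Γ`-equivariant quasi-isometry, with constant `L`. -/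
def IsEquivariantQI (Γ : Type*) [Group Γ] {X Y : Type*} [MulAction Γ X] [MulAction Γ Y] (L : ℝ)
    (dX : X → X → ℕ) (dY : Y → Y → ℕ) (f : X → Y) : Prop :=
  (∀ x y, (dY (f x) (f y) : ℝ) ≤ L * dX x y + L) ∧
  (∀ x y, (dX x y : ℝ) ≤ L * dY (f x) (f y) + L) ∧
  (∀ y, ∃ x, (dY (f x) y : ℝ) ≤ L) ∧
  ∀ (g : Γ) (x : X), (dY (g • f x) (f (g • x)) : ℝ) ≤ L

end OuterSpace

end

open OuterSpace

/-! All four assertions are reduced to one combinatorial object: the bases of the free group,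
regarded as sets, where two bases are adjacent (`BAdj`) if after removing one element from each they
generate conjugate corank one free factors. A tree in outer space determines bases: choose a subtree
meeting each vertex orbit exactly once; the elements which move it to an adjacent translate, one out
of each inverse pair, form a basis (`isBasis_of_isTransversal`). Bases read off from the same tree
are at distance at most two (`IsGeometric.near`), so outer space maps coarsely to the bases.

The main estimate is `MetricTree.exists_near_of_short`: if the elements of `C`, a basis of a proper
free factor, move a vertex of `T` by at most `k`, then some basis containing `C` is at a distance
bounded in terms of `n` and `k` from a basis read off from `T`. The Cayley tree of a basis
containing `C` is subdivided, mapped to `T` and folded. While the component of the image of the part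
labelled by `C` has a proper stabilizer, `C` extends to a basis adjacent to one of the current tree
(`exists_bAdj_of_compStab`), so these folds cost nothing. Once the stabilizer is the whole group,
this component is an invariant tree. Since `T` has volume one, averaging yields an edge of `T` over
which it has at most `n * k` edges. As long as folding does not decrease their number, the
complement of the orbit of an edge over it keeps its stabilizers and provides nearby bases; the
number can drop at most `n * k` times (`TreeOver.exists_near_geometric`).

Conversely, adjacent bases yield roses joined by two ties, for all ranks up to `n - 1`: the common
factor becomes short when all petals but one shrink (`BAdj.chain`). Hence every chain of bases
becomes a chain of trees of comparable length.

A corank one factor is spanned by part of a basis, which compares the bases with the graphs on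
corank one factors. These are compared with the free factor graph by enlarging factors to corank
one, and by shrinking intersections to rank one. For free splittings, a rose collapses to the HNN
splitting over a corank one factor. That this splitting depends on the factor alone is
`stable_letter_unique`, proved with Fox derivatives and the triviality of units in the group ring.
In the other direction, every free splitting is a collapse of a point of outer space, by blowing up
its vertices, and two points which resolve the same splitting are close because they share the
complement of an edge (`chain_of_isResolution`). -/

noncomputable section

namespace OuterSpace

/-! ### Trees: cuts, potentials, locally injective maps -/

section Trees

variable {V W : Type*} {G : SimpleGraph V}

theorem reachable_invariant {α : Type*} {χ : V → α} (h : ∀ x y, G.Adj x y → χ x = χ y) {a b : V}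
    (hab : G.Reachable a b) : χ a = χ b := by
  obtain ⟨p⟩ := hab
  induction p with
  | nil => rfl
  | cons hadj _ ih => exact (h _ _ hadj).trans ih

theorem reachable_of_closed {P : V → Prop} (h : ∀ x y, G.Adj x y → P x → P y) {a b : V}
    (hab : G.Reachable a b) (ha : P a) : P b := by
  obtain ⟨p⟩ := hab
  induction p with
  | nil => exact ha
  | cons hadj _ ih => exact ih (h _ _ hadj ha)

/-- `G` with the edge joining `a` and `b` removed. -/
def cut (G : SimpleGraph V) (a b : V) : SimpleGraph V := G.deleteEdges {s(a, b)}

theorem cut_adj {a b x y : V} : (cut G a b).Adj x y ↔ G.Adj x y ∧ s(x, y) ≠ s(a, b) := by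
  simp [cut]

theorem cut_le (a b : V) : cut G a b ≤ G := SimpleGraph.deleteEdges_le _

/-- After the removal of an edge the given function is constant on components but differs at the
endpoints, so every edge is a bridge. Every tree constructed below is recognised in this way, mostly
by a parity function. -/
theorem isTree_of_cut (hc : G.Connected)
    (h : ∀ a b, G.Adj a b → ∃ χ : V → Prop, χ a ≠ χ b ∧
      ∀ x y, G.Adj x y → s(x, y) ≠ s(a, b) → χ x = χ y) : G.IsTree := by
  refine ⟨hc, ?_⟩
  rw [SimpleGraph.isAcyclic_iff_forall_adj_isBridge]
  intro a b hab hr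
  obtain ⟨χ, h1, h2⟩ := h a b hab
  exact h1 (reachable_invariant (fun x y hxy => h2 x y (cut_adj.1 hxy).1 (cut_adj.1 hxy).2) hr)

theorem not_reachable_cut (hG : G.IsAcyclic) {a b : V} (hab : G.Adj a b) :
    ¬ (cut G a b).Reachable a b :=
  SimpleGraph.isAcyclic_iff_forall_adj_isBridge.1 hG hab

theorem cut_reachable_or (hG : G.Connected) (a b x : V) :
    (cut G a b).Reachable a x ∨ (cut G a b).Reachable b x := by
  refine reachable_of_closed (P := fun x => (cut G a b).Reachable a x ∨ (cut G a b).Reachable b x)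
    ?_ (hG a x) (Or.inl (SimpleGraph.Reachable.refl _))
  intro x y hxy hx
  by_cases he : s(x, y) = s(a, b)
  · rcases Sym2.eq_iff.1 he with ⟨rfl, rfl⟩ | ⟨rfl, rfl⟩
    · exact Or.inr (SimpleGraph.Reachable.refl _)
    · exact Or.inl (SimpleGraph.Reachable.refl _)
  · have := (cut_adj.2 ⟨hxy, he⟩).reachable
    exact hx.imp (fun h => h.trans this) (fun h => h.trans this)

/-- A cocycle on the edges of a tree is the coboundary of a function on the vertices. -/
theorem exists_potential {M : Type*} [Group M] (hG : G.IsTree) (c : V → V → M)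
    (hc : ∀ v w, G.Adj v w → c w v = (c v w)⁻¹) (x₀ : V) :
    ∃ Φ : V → M, Φ x₀ = 1 ∧ ∀ v w, G.Adj v w → Φ w = Φ v * c v w := by
  classical
  -- The product of the cocycle along a walk. The potential at a vertex is this product along the
  -- path from `x₀`.
  let pr : ∀ {v w : V}, G.Walk v w → M := fun {v w} p =>
    SimpleGraph.Walk.rec (motive := fun _ _ _ => M) 1 (fun {u v _} _ _ r => c u v * r) p
  have hpr : ∀ {u v w : V} (p : G.Walk u v) (h : G.Adj v w), pr (p.concat h) = pr p * c v w := by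
    intro u v w p h
    induction p with
    | nil => simp [pr, SimpleGraph.Walk.concat]
    | cons h' p ih =>
      have : pr (SimpleGraph.Walk.cons h' (p.concat h)) = c _ _ * pr (p.concat h) := rfl
      rw [SimpleGraph.Walk.concat_cons, this, ih, ← mul_assoc]
  choose P hP hu using fun w => hG.existsUnique_path x₀ w
  refine ⟨fun w => pr (P w), ?_, ?_⟩
  · have : P x₀ = SimpleGraph.Walk.nil := (hu x₀ _ SimpleGraph.Walk.IsPath.nil).symm
    change pr (P x₀) = 1
    rw [this]
  · intro v w hvw
    -- The paths from `x₀` to adjacent vertices differ by the edge joining them, appended to one or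
    -- to the other.
    by_cases hv : v ∈ (P w).support
    · have := hG.isAcyclic.path_concat (hP v) (hP w) hvw hv
      change pr (P w) = _
      rw [this, hpr]
    · have hw := hG.isAcyclic.mem_support_of_ne_mem_support_of_adj_of_isPath (hP v) (hP w) hvw hv
      have := hG.isAcyclic.path_concat (hP w) (hP v) hvw.symm hw
      change pr (P w) = pr (P v) * c v w
      rw [this, hpr, hc v w hvw, inv_mul_cancel_right]

theorem eq_of_potential {M : Type*} [Group M] (hG : G.Connected) {c : V → V → M} {Φ Ψ : V → M}
    (h1 : ∀ v w, G.Adj v w → Φ w = Φ v * c v w) (h2 : ∀ v w, G.Adj v w → Ψ w = Ψ v * c v w)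
    {x₀ : V} (m : M) (h0 : Φ x₀ = m * Ψ x₀) (v : V) : Φ v = m * Ψ v := by
  refine reachable_of_closed (P := fun v => Φ v = m * Ψ v) ?_ (hG x₀ v) h0
  intro x y hxy hx
  rw [h1 x y hxy, h2 x y hxy, hx, mul_assoc]

/-- In an acyclic graph a walk is a path as soon as no two consecutive edges coincide. Two
consecutive edges of a path with the same image would be a fold. -/
theorem map_isPath_of_locally_injective {T : SimpleGraph W} (hT : T.IsAcyclic) (f : G →g T)
    (hf : ∀ x y z, G.Adj x y → G.Adj x z → f y = f z → y = z) {a b : V} {p : G.Walk a b}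
    (hp : p.IsPath) : (p.map f).IsPath := by
  rw [hT.isPath_iff_isChain, SimpleGraph.Walk.edges_map]
  induction p with
  | nil => simp
  | @cons u v w h p ih =>
    rw [SimpleGraph.Walk.edges_cons, List.map_cons]
    rw [SimpleGraph.Walk.cons_isPath_iff] at hp
    refine List.isChain_cons.2 ⟨?_, ih hp.1⟩
    cases p with
    | nil => simp
    | @cons _ v' _ h' p' =>
      intro y hy
      simp only [SimpleGraph.Walk.edges_cons, List.map_cons, List.head?_cons,
        Option.mem_some_iff] at hy
      subst hy
      intro he
      simp only [Sym2.map_mk] at he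
      have hne : u ≠ v' := by
        rintro rfl
        exact hp.2 (by simp)
      rcases Sym2.eq_iff.1 he with ⟨h1, h2⟩ | ⟨h1, _⟩
      · exact (f.map_adj h).ne h1
      · exact hne (hf v u v' h.symm h' h1)

/-- The image of a path between two points of a fibre is a closed path, hence trivial. -/
theorem injective_of_locally_injective {T : SimpleGraph W} (hT : T.IsAcyclic) (hG : G.Connected)
    (f : G →g T) (hf : ∀ x y z, G.Adj x y → G.Adj x z → f y = f z → y = z) :
    Function.Injective f := by
  classical
  intro a b hab
  obtain ⟨p, hp⟩ := (hG a b).exists_isPath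
  have h1 := map_isPath_of_locally_injective hT f hf hp
  have h2 : ((p.map f).copy hab rfl).IsPath := by rwa [SimpleGraph.Walk.isPath_copy]
  have h4 := (SimpleGraph.Walk.length_eq_zero_iff).2 (SimpleGraph.Walk.isPath_iff_nil.1 h2)
  rw [SimpleGraph.Walk.length_copy, SimpleGraph.Walk.length_map] at h4
  exact SimpleGraph.Walk.eq_of_length_eq_zero h4

/-- An injective morphism between trees reflects adjacency. -/
theorem adj_of_injective {T : SimpleGraph W} (hT : T.IsAcyclic) (hG : G.Connected)
    (f : G →g T) (hf : Function.Injective f) {a b : V} (h : T.Adj (f a) (f b)) : G.Adj a b := by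
  obtain ⟨p, hp⟩ := (hG a b).exists_isPath
  have h1 : (p.map f).IsPath := hp.map hf
  have h2 : (SimpleGraph.Walk.cons h SimpleGraph.Walk.nil).IsPath := by
    simp [SimpleGraph.Walk.cons_isPath_iff, h.ne]
  have h3 := congrArg (fun q => q.1.length)
    ((hT.subsingleton_path _ _).elim ⟨_, h1⟩ ⟨_, h2⟩)
  simp only [SimpleGraph.Walk.length_map, SimpleGraph.Walk.length_cons,
    SimpleGraph.Walk.length_nil, zero_add] at h3
  exact SimpleGraph.Walk.adj_of_length_eq_one h3

/-! ### Connected sets of vertices -/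

/-- The graph of all edges of `G` with both endpoints in `X`. -/
def within (G : SimpleGraph V) (X : Set V) : SimpleGraph V where
  Adj x y := G.Adj x y ∧ x ∈ X ∧ y ∈ X
  symm := ⟨fun _ _ h => ⟨h.1.symm, h.2.2, h.2.1⟩⟩
  loopless := ⟨fun _ h => h.1.ne rfl⟩

/-- `X` spans a connected (or empty) subgraph. -/
def ConnectedOn (G : SimpleGraph V) (X : Set V) : Prop :=
  ∀ x ∈ X, ∀ y ∈ X, (within G X).Reachable x y

theorem within_mono {H : SimpleGraph V} {X Y : Set V} (hGH : G ≤ H) (h : X ⊆ Y) :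
    within G X ≤ within H Y := fun _ _ hxy => ⟨hGH hxy.1, h hxy.2.1, h hxy.2.2⟩

theorem within_le (X : Set V) : within G X ≤ G := fun _ _ h => h.1

theorem ConnectedOn.mono {H : SimpleGraph V} {X : Set V} (h : G ≤ H) (hX : ConnectedOn G X) :
    ConnectedOn H X := fun x hx y hy => (hX x hx y hy).mono (within_mono h subset_rfl)

theorem connectedOn_singleton (x : V) : ConnectedOn G {x} := by
  rintro _ rfl _ rfl
  exact SimpleGraph.Reachable.refl _

theorem ConnectedOn.insert_of_adj {X : Set V} (hX : ConnectedOn G X) {x z : V} (hx : x ∈ X)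
    (hxz : G.Adj x z) : ConnectedOn G (insert z X) := by
  have h0 : within G X ≤ within G (insert z X) := within_mono le_rfl (Set.subset_insert _ _)
  have h1 : (within G (insert z X)).Reachable x z :=
    SimpleGraph.Adj.reachable ⟨hxz, Set.mem_insert_of_mem _ hx, Set.mem_insert _ _⟩
  have h2 : ∀ y ∈ insert z X, (within G (insert z X)).Reachable x y := by
    rintro y (rfl | hy)
    · exact h1
    · exact (hX x hx y hy).mono h0
  exact fun a ha b hb => (h2 a ha).symm.trans (h2 b hb)

theorem ConnectedOn.union {X Y : Set V} (hX : ConnectedOn G X) (hY : ConnectedOn G Y) {x y : V}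
    (hx : x ∈ X) (hy : y ∈ Y) (hxy : G.Adj x y) : ConnectedOn G (X ∪ Y) := by
  have h1 : (within G (X ∪ Y)).Reachable x y :=
    SimpleGraph.Adj.reachable ⟨hxy, Or.inl hx, Or.inr hy⟩
  have h2 : ∀ z ∈ X ∪ Y, (within G (X ∪ Y)).Reachable x z := by
    rintro z (hz | hz)
    · exact (hX x hx z hz).mono (within_mono le_rfl Set.subset_union_left)
    · exact h1.trans ((hY y hy z hz).mono (within_mono le_rfl Set.subset_union_right))
  exact fun a ha b hb => (h2 a ha).symm.trans (h2 b hb)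

theorem connectedOn_of_induce {X : Set V} (h : (G.induce X).Preconnected) : ConnectedOn G X := by
  intro x hx y hy
  have := h ⟨x, hx⟩ ⟨y, hy⟩
  let f : G.induce X →g within G X := ⟨Subtype.val, fun {a b} hab => ⟨hab, a.2, b.2⟩⟩
  exact this.map f

theorem ConnectedOn.induce_connected {X : Set V} (h : ConnectedOn G X) (hX : X.Nonempty) :
    (G.induce X).Connected := by
  have hne : Nonempty X := hX.to_subtype
  refine ⟨fun a b => ?_⟩
  have key : ∀ y : V, (within G X).Reachable a y → ∀ hy : y ∈ X, (G.induce X).Reachable a ⟨y, hy⟩ := by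
    intro y hy
    have := reachable_of_closed (G := within G X)
      (P := fun y => ∃ hy : y ∈ X, (G.induce X).Reachable a ⟨y, hy⟩) ?_ hy
      ⟨a.2, SimpleGraph.Reachable.refl _⟩
    · exact fun _ => this.2
    · rintro x y hxy ⟨hx, hr⟩
      refine ⟨hxy.2.2, hr.trans (SimpleGraph.Adj.reachable ?_)⟩
      exact hxy.1
  exact key b (h a a.2 b b.2) b.2

theorem connectedOn_component {H : SimpleGraph V} (x : V) :
    ConnectedOn H {y | H.Reachable x y} := by
  have key : ∀ y, H.Reachable x y → (within H {y | H.Reachable x y}).Reachable x y := by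
    intro y hy
    refine reachable_of_closed
      (P := fun y => H.Reachable x y ∧ (within H {y | H.Reachable x y}).Reachable x y) ?_ hy
      ⟨SimpleGraph.Reachable.refl _, SimpleGraph.Reachable.refl _⟩ |>.2
    rintro a b hab ⟨h1, h2⟩
    have h3 := h1.trans hab.reachable
    exact ⟨h3, h2.trans (SimpleGraph.Adj.reachable ⟨hab, h1, h3⟩)⟩
  exact fun a ha b hb => (key a ha).symm.trans (key b hb)

/-- In a tree, an edge joining two vertices of a connected subgraph belongs to it. -/
theorem adj_of_reachable {H : SimpleGraph V} (hG : G.IsAcyclic) (hH : H ≤ G) {x y : V}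
    (hr : H.Reachable x y) (hxy : G.Adj x y) : H.Adj x y := by
  by_contra hn
  refine not_reachable_cut hG hxy (hr.mono fun a b hab => cut_adj.2 ⟨hH hab, fun he => hn ?_⟩)
  rcases Sym2.eq_iff.1 he with ⟨rfl, rfl⟩ | ⟨rfl, rfl⟩
  · exact hab
  · exact hab.symm

end Trees

end OuterSpace

end

noncomputable section

namespace OuterSpace

/-! ### Bases of free groups, as sets -/

section Bases

variable {Γ : Type*} [Group Γ]

/-- The set `B` freely generates a subgroup. -/
def IsFreeSet (B : Set Γ) : Prop := Function.Injective (FreeGroup.lift ((↑) : B → Γ))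

/-- The set `B` freely generates the group. -/
def IsBasis (B : Set Γ) : Prop := Function.Bijective (FreeGroup.lift ((↑) : B → Γ))

theorem IsBasis.isFreeSet {B : Set Γ} (hB : IsBasis B) : IsFreeSet B := hB.1

theorem IsBasis.closure_eq {B : Set Γ} (hB : IsBasis B) : Subgroup.closure B = ⊤ := by
  rw [FreeGroup.closure_eq_range, MonoidHom.range_eq_top]
  exact hB.2

theorem IsFreeSet.isBasis {B : Set Γ} (hB : IsFreeSet B) (h : Subgroup.closure B = ⊤) :
    IsBasis B := by
  refine ⟨hB, ?_⟩
  rwa [FreeGroup.closure_eq_range, MonoidHom.range_eq_top] at h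

/-- Freeness without reduced words: a homomorphism from the ambient group to the abstract free group
is a left inverse of the evaluation map. -/
theorem isFreeSet_of_extend {B : Set Γ} (Ψ : Γ →* FreeGroup B)
    (hΨ : ∀ b : B, Ψ b = FreeGroup.of b) : IsFreeSet B := by
  have h : Ψ.comp (FreeGroup.lift ((↑) : B → Γ)) = MonoidHom.id _ := by
    ext b
    simp [hΨ]
  exact Function.LeftInverse.injective (g := Ψ) fun x => DFunLike.congr_fun h x

/-- A freely generating set has the universal property. -/
theorem IsBasis.exists_hom {B : Set Γ} (hB : IsBasis B) {M : Type*} [Group M] (f : Γ → M) :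
    ∃ φ : Γ →* M, ∀ b ∈ B, φ b = f b := by
  let e := MulEquiv.ofBijective (FreeGroup.lift ((↑) : B → Γ)) hB
  have he : ∀ x, e x = FreeGroup.lift ((↑) : B → Γ) x := fun _ => rfl
  refine ⟨(FreeGroup.lift fun b : B => f b).comp e.symm.toMonoidHom, fun b hb => ?_⟩
  have : e.symm b = FreeGroup.of ⟨b, hb⟩ := by
    rw [MulEquiv.symm_apply_eq, he, FreeGroup.lift_apply_of]
  simp [this]

theorem IsFreeSet.mono {B C : Set Γ} (hB : IsFreeSet B) (h : C ⊆ B) : IsFreeSet C := by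
  have : FreeGroup.lift ((↑) : C → Γ) =
      (FreeGroup.lift ((↑) : B → Γ)).comp (FreeGroup.map (Set.inclusion h)) := by
    ext c
    simp
  unfold IsFreeSet
  rw [this]
  exact hB.comp (FreeGroup.map_injective (Set.inclusion_injective h))

/-- The group freely generated by a free set. -/
def IsFreeSet.equiv {B : Set Γ} (hB : IsFreeSet B) : FreeGroup B ≃* Subgroup.closure B :=
  (MonoidHom.ofInjective hB).trans (MulEquiv.subgroupCongr (FreeGroup.closure_eq_range B).symm)

theorem IsFreeSet.equiv_of {B : Set Γ} (hB : IsFreeSet B) (b : B) :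
    (hB.equiv (FreeGroup.of b) : Γ) = b := by
  change FreeGroup.lift ((↑) : B → Γ) (FreeGroup.of b) = b
  simp

theorem hom_eqOn_closure {M : Type*} [Group M] {B : Set Γ} {φ ψ : Subgroup.closure B →* M}
    (h : ∀ (b : Γ) (hb : b ∈ B), φ ⟨b, Subgroup.subset_closure hb⟩ =
      ψ ⟨b, Subgroup.subset_closure hb⟩) : φ = ψ := by
  ext ⟨x, hx⟩
  induction hx using Subgroup.closure_induction with
  | mem x hx => exact h x hx
  | one => exact (map_one φ).trans (map_one ψ).symm
  | mul x y hx hy h1 h2 =>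
    exact (map_mul φ ⟨x, hx⟩ ⟨y, hy⟩).trans
      ((congrArg₂ (· * ·) h1 h2).trans (map_mul ψ ⟨x, hx⟩ ⟨y, hy⟩).symm)
  | inv x hx h1 =>
    exact (map_inv φ ⟨x, hx⟩).trans ((congrArg (·⁻¹) h1).trans (map_inv ψ ⟨x, hx⟩).symm)

/-- The universal property of `B ∪ D` gives a homomorphism to the free group on `C ∪ D` which on the
common closure of `B` and `C` inverts the evaluation, and which sends the elements of `D` to their
letters. Disjointness keeps the two prescriptions from conflicting. -/
theorem IsBasis.replace {B C D : Set Γ} (hB : IsBasis (B ∪ D)) (hd : Disjoint B D)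
    (hC : IsFreeSet C) (h : Subgroup.closure C = Subgroup.closure B) : IsBasis (C ∪ D) := by
  classical
  have hcl : Subgroup.closure (C ∪ D) = ⊤ := by
    rw [Subgroup.closure_union, h, ← Subgroup.closure_union, hB.closure_eq]
  have hCl : ∀ b ∈ B, b ∈ Subgroup.closure C := fun b hb => h ▸ Subgroup.subset_closure hb
  let j : Subgroup.closure C →* FreeGroup ↑(C ∪ D) :=
    (FreeGroup.map (Set.inclusion Set.subset_union_left)).comp hC.equiv.symm.toMonoidHom
  obtain ⟨Ψ, hΨ⟩ := hB.exists_hom (fun b : Γ =>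
    if hb : b ∈ B then j ⟨b, hCl b hb⟩ else if hb : b ∈ C ∪ D then FreeGroup.of ⟨b, hb⟩ else 1)
  refine (isFreeSet_of_extend Ψ ?_).isBasis hcl
  have key : Ψ.comp (Subgroup.closure B).subtype =
      j.comp (MulEquiv.subgroupCongr h.symm).toMonoidHom := by
    refine hom_eqOn_closure fun b hb => ?_
    have := hΨ b (Or.inl hb)
    rw [dif_pos hb] at this
    exact this
  rintro ⟨b, hb | hb⟩
  · have h1 : b ∈ Subgroup.closure B := h ▸ Subgroup.subset_closure hb
    have h2 := DFunLike.congr_fun key ⟨b, h1⟩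
    have h3 : hC.equiv.symm ⟨b, Subgroup.subset_closure hb⟩ = FreeGroup.of ⟨b, hb⟩ := by
      rw [MulEquiv.symm_apply_eq]
      exact Subtype.ext (hC.equiv_of ⟨b, hb⟩).symm
    change Ψ b = FreeGroup.map _ (hC.equiv.symm ⟨b, Subgroup.subset_closure hb⟩) at h2
    rw [h2, h3, FreeGroup.map.of]
  · have h1 : b ∉ B := fun h' => Set.disjoint_left.1 hd h' hb
    have := hΨ b (Or.inr hb)
    rw [dif_neg h1, dif_pos (Set.mem_union_right C hb)] at this
    exact this

/-- The exponent sum of `b` is a homomorphism to the integers which kills `S` but not `b`. -/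
theorem IsBasis.notMem_closure {B S : Set Γ} (hB : IsBasis B) {b : Γ} (hb : b ∈ B)
    (hS : S ⊆ B) (hbS : b ∉ S) : b ∉ Subgroup.closure S := by
  classical
  obtain ⟨φ, hφ⟩ := hB.exists_hom (fun x : Γ => if x = b then Multiplicative.ofAdd (1 : ℤ) else 1)
  intro hcl
  have h1 : Subgroup.closure S ≤ φ.ker := by
    rw [Subgroup.closure_le]
    intro x hx
    have := hφ x (hS hx)
    rw [if_neg (by rintro rfl; exact hbS hx)] at this
    exact this
  have h2 : φ b = 1 := h1 hcl
  rw [hφ b hb, if_pos rfl] at h2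
  have : (1 : ℤ) = 0 := Multiplicative.ofAdd.injective h2
  omega

theorem IsBasis.eq_of_subset {B S : Set Γ} (hB : IsBasis B) (hS : S ⊆ B)
    (h : Subgroup.closure S = ⊤) : S = B := by
  refine Set.Subset.antisymm hS fun b hb => ?_
  by_contra hn
  exact hB.notMem_closure hb hS hn (h ▸ Subgroup.mem_top b)

theorem IsBasis.image {Γ' : Type*} [Group Γ'] {B : Set Γ} (hB : IsBasis B) (φ : Γ ≃* Γ') :
    IsBasis (φ '' B) := by
  have hcl : Subgroup.closure (φ '' B) = ⊤ := by
    have := (MonoidHom.map_closure φ.toMonoidHom B).symm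
    rw [hB.closure_eq, Subgroup.map_top_of_surjective _ φ.surjective] at this
    exact this
  classical
  obtain ⟨Ψ, hΨ⟩ := hB.exists_hom (fun b : Γ =>
    if hb : φ b ∈ φ '' B then FreeGroup.of (⟨φ b, hb⟩ : ↑(φ '' B)) else 1)
  refine (isFreeSet_of_extend (Ψ.comp φ.symm.toMonoidHom) ?_).isBasis hcl
  rintro ⟨_, b, hb, rfl⟩
  have := hΨ b hb
  rw [dif_pos ⟨b, hb, rfl⟩] at this
  simpa using this

theorem IsFreeSet.of_subgroup {A : Subgroup Γ} {B : Set A} (hB : IsFreeSet B) :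
    IsFreeSet (Subtype.val '' B : Set Γ) := by
  let e : B ≃ (Subtype.val '' B : Set Γ) := Equiv.Set.image _ _ Subtype.val_injective
  have h : (FreeGroup.lift ((↑) : (Subtype.val '' B : Set Γ) → Γ)).comp
      (FreeGroup.freeGroupCongr e).toMonoidHom = A.subtype.comp (FreeGroup.lift ((↑) : B → A)) := by
    ext b
    simp [e]
  have h2 : Function.Injective ((FreeGroup.lift ((↑) : (Subtype.val '' B : Set Γ) → Γ)) ∘
      (FreeGroup.freeGroupCongr e)) := by
    have : ((FreeGroup.lift ((↑) : (Subtype.val '' B : Set Γ) → Γ)) ∘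
      (FreeGroup.freeGroupCongr e)) = A.subtype ∘ (FreeGroup.lift ((↑) : B → A)) := by
      funext x
      exact DFunLike.congr_fun h x
    rw [this]
    exact A.subtype_injective.comp hB
  exact (Function.Injective.of_comp_iff' _ (FreeGroup.freeGroupCongr e).bijective).1 h2

theorem closure_of_subgroup {A : Subgroup Γ} {B : Set A} (hB : Subgroup.closure B = ⊤) :
    Subgroup.closure (Subtype.val '' B : Set Γ) = A := by
  have := (MonoidHom.map_closure A.subtype B).symm
  rw [hB, ← MonoidHom.range_eq_map, Subgroup.range_subtype] at this
  exact this

theorem isFreeSet_range {ι : Type*} {c : ι → Γ} (hc : Function.Injective (FreeGroup.lift c)) :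
    IsFreeSet (Set.range c) ∧ Function.Injective c := by
  have hinj : Function.Injective c := by
    intro i j hij
    refine FreeGroup.of_injective (hc ?_)
    simpa using hij
  refine ⟨?_, hinj⟩
  let e := Equiv.ofInjective c hinj
  have h2 : Function.Injective ((FreeGroup.lift ((↑) : Set.range c → Γ)) ∘
      (FreeGroup.freeGroupCongr e)) := by
    have : ((FreeGroup.lift ((↑) : Set.range c → Γ)) ∘
      (FreeGroup.freeGroupCongr e)) = FreeGroup.lift c := by
      have h : (FreeGroup.lift ((↑) : Set.range c → Γ)).comp
        (FreeGroup.freeGroupCongr e).toMonoidHom = FreeGroup.lift c := by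
        ext b
        simp [e]
      rw [← h]
      rfl
    rwa [this]
  exact (Function.Injective.of_comp_iff' _ (FreeGroup.freeGroupCongr e).bijective).1 h2

theorem isBasis_range_of (n : ℕ) : IsBasis (Set.range (FreeGroup.of : Fin n → F n)) := by
  refine (isFreeSet_range (c := (FreeGroup.of : Fin n → F n)) ?_).1.isBasis
    (FreeGroup.closure_range_of _)
  rw [FreeGroup.lift_of_eq_id]
  exact Function.injective_id

/-- Homomorphisms to a group of order two are counted in two ways, as $2^n$ and as $2^{|B|}$. -/
theorem IsBasis.finite_and_ncard {n : ℕ} {B : Set (F n)} (hB : IsBasis B) :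
    B.Finite ∧ B.ncard = n := by
  classical
  let Z := Multiplicative (ZMod 2)
  let e1 : (F n →* Z) ≃ (Fin n → Z) := FreeGroup.lift.symm
  let e2 : (F n →* Z) ≃ (B → Z) :=
    (MulEquiv.ofBijective _ hB).symm.monoidHomCongrLeftEquiv.trans FreeGroup.lift.symm
  let e : (B → Z) ≃ (Fin n → Z) := e2.symm.trans e1
  have hfin : Finite (B → Z) := Finite.of_equiv _ e.symm
  have hB' : Finite B := by
    have hinj : Function.Injective
        (fun b : B => Pi.mulSingle (M := fun _ : B => Z) b (Multiplicative.ofAdd (1 : ZMod 2))) := by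
      intro b b' h
      by_contra hne
      have := congrFun h b
      simp only [Pi.mulSingle_eq_same, Pi.mulSingle_eq_of_ne hne] at this
      exact absurd this (by decide)
    exact Finite.of_injective _ hinj
  refine ⟨B.toFinite, ?_⟩
  have h1 := Nat.card_congr e
  rw [Nat.card_fun, Nat.card_fun] at h1
  have h2 : Nat.card Z = 2 := by
    change Nat.card (ZMod 2) = 2
    simp
  rw [h2] at h1
  have := Nat.pow_right_injective le_rfl h1
  simpa using this

end Bases

end OuterSpace

end

noncomputable section

namespace OuterSpace

/-! ### Groups acting freely on trees -/

section Actions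

variable {Γ V : Type*} [Group Γ] [MulAction Γ V] {G : SimpleGraph V}

/-- The group `Γ` acts on the vertices of `G` by automorphisms of `G`. -/
def IsInvariant (Γ : Type*) [Group Γ] {V : Type*} [MulAction Γ V] (G : SimpleGraph V) : Prop :=
  ∀ (g : Γ) (x y : V), G.Adj x y → G.Adj (g • x) (g • y)

/-- No nontrivial element fixes a vertex. -/
def IsFreeAction (Γ V : Type*) [Group Γ] [MulAction Γ V] : Prop :=
  ∀ (g : Γ) (x : V), g • x = x → g = 1

theorem IsInvariant.adj_iff (h : IsInvariant Γ G) (g : Γ) (x y : V) :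
    G.Adj (g • x) (g • y) ↔ G.Adj x y := by
  refine ⟨fun hxy => ?_, h g x y⟩
  simpa using h g⁻¹ _ _ hxy

theorem IsInvariant.reachable (h : IsInvariant Γ G) (g : Γ) {x y : V} (hr : G.Reachable x y) :
    G.Reachable (g • x) (g • y) := by
  refine reachable_of_closed (P := fun y => G.Reachable (g • x) (g • y)) ?_ hr
    (SimpleGraph.Reachable.refl _)
  exact fun a b hab ha => ha.trans (h g a b hab).reachable

theorem IsInvariant.reachable_iff (h : IsInvariant Γ G) (g : Γ) {x y : V} :
    G.Reachable (g • x) (g • y) ↔ G.Reachable x y := by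
  refine ⟨fun hr => ?_, h.reachable g⟩
  simpa using h.reachable g⁻¹ hr

theorem IsFreeAction.eq_of_smul_eq (h : IsFreeAction Γ V) {g g' : Γ} {x : V}
    (hx : g • x = g' • x) : g = g' := by
  have : (g'⁻¹ * g) • x = x := by rw [mul_smul, hx, inv_smul_smul]
  have := h _ _ this
  rwa [inv_mul_eq_one, eq_comm] at this

/-- A connected set of vertices which contains at most one point of each (free) orbit. -/
structure IsPartialTransversal (Γ : Type*) [Group Γ] {V : Type*} [MulAction Γ V]
    (G : SimpleGraph V) (X : Set V) : Prop where
  conn : ConnectedOn G X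
  uniq : ∀ x ∈ X, ∀ g : Γ, g • x ∈ X → g = 1

/-- A connected set of vertices which contains exactly one point of each orbit. -/
structure IsTransversal (Γ : Type*) [Group Γ] {V : Type*} [MulAction Γ V]
    (G : SimpleGraph V) (X : Set V) : Prop extends IsPartialTransversal Γ G X where
  cover : ∀ v : V, ∃ g : Γ, g • v ∈ X

/-- The nontrivial elements which move `X` to a set adjacent to `X`. -/
def steps (Γ : Type*) [Group Γ] {V : Type*} [MulAction Γ V] (G : SimpleGraph V) (X : Set V) :
    Set Γ := {g | g ≠ 1 ∧ ∃ x ∈ X, ∃ y ∈ X, G.Adj x (g • y)}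

/-- `B` contains exactly one of `s`, `s⁻¹` for all `s ∈ S`, and nothing else. -/
structure IsHalf (B S : Set Γ) : Prop where
  sub : B ⊆ S
  cover : ∀ s ∈ S, s ∈ B ∨ s⁻¹ ∈ B
  inv_notMem : ∀ b ∈ B, b⁻¹ ∉ B

theorem IsHalf.closure_eq {B S : Set Γ} (h : IsHalf B S) :
    Subgroup.closure B = Subgroup.closure S := by
  refine le_antisymm (Subgroup.closure_mono h.sub) ?_
  rw [Subgroup.closure_le]
  intro s hs
  rcases h.cover s hs with h1 | h1
  · exact Subgroup.subset_closure h1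
  · exact inv_mem_iff.1 (Subgroup.subset_closure h1)

theorem inv_mem_steps (hG : IsInvariant Γ G) {X : Set V} {g : Γ} (hg : g ∈ steps Γ G X) :
    g⁻¹ ∈ steps Γ G X := by
  obtain ⟨h1, x, hx, y, hy, hxy⟩ := hg
  refine ⟨inv_ne_one.2 h1, y, hy, x, hx, ?_⟩
  have := (hG g⁻¹ _ _ hxy).symm
  simpa using this

/-- A partial transversal can be extended to a transversal for the orbits which meet its connected
component. -/
theorem exists_partialTransversal_extending (hG : IsInvariant Γ G) (hfree : IsFreeAction Γ V)
    {P : Set V} (hP : IsPartialTransversal Γ G P) :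
    ∃ X, P ⊆ X ∧ IsPartialTransversal Γ G X ∧
      ∀ x₀ ∈ P, ∀ v, G.Reachable x₀ v → ∃ g : Γ, g • v ∈ X := by
  obtain ⟨X, hPX, hX⟩ := zorn_subset_nonempty {X | IsPartialTransversal Γ G X} (by
    intro c hc hchain hcne
    refine ⟨⋃₀ c, ⟨?_, ?_⟩, fun s hs => Set.subset_sUnion_of_mem hs⟩
    · rintro x ⟨s, hs, hxs⟩ y ⟨t, ht, hyt⟩
      rcases hchain.total hs ht with h | h
      · exact ((hc ht).conn x (h hxs) y hyt).mono (within_mono le_rfl (Set.subset_sUnion_of_mem ht))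
      · exact ((hc hs).conn x hxs y (h hyt)).mono (within_mono le_rfl (Set.subset_sUnion_of_mem hs))
    · rintro x ⟨s, hs, hxs⟩ g ⟨t, ht, hyt⟩
      rcases hchain.total hs ht with h | h
      · exact (hc ht).uniq x (h hxs) g hyt
      · exact (hc hs).uniq x hxs g (h hyt)) P hP
  have hXp : IsPartialTransversal Γ G X := hX.1
  refine ⟨X, hPX, hXp, ?_⟩
  intro x₀ hx₀ v hv
  -- If the orbit of a vertex meets `X`, so does that of a neighbour: otherwise a translate of the
  -- neighbour could be added to `X`, against maximality.
  refine reachable_of_closed (P := fun v => ∃ g : Γ, g • v ∈ X) ?_ hv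
    ⟨1, by simpa using hPX hx₀⟩
  rintro a b hab ⟨g, hg⟩
  by_contra hn
  push Not at hn
  have hadj := hG g a b hab
  have hmem : insert (g • b) X ∈ {X | IsPartialTransversal Γ G X} := by
    refine ⟨hXp.conn.insert_of_adj hg hadj, ?_⟩
    rintro x (rfl | hx) h (hhx | hhx)
    · exact hfree h _ hhx
    · rw [← mul_smul] at hhx
      exact absurd hhx (hn _)
    · have : (h⁻¹ * g) • b = x := by rw [mul_smul, ← hhx, inv_smul_smul]
      exact absurd (this ▸ hx) (hn _)
    · exact hXp.uniq x hx h hhx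
  have := hX.2 hmem (Set.subset_insert _ _) (Set.mem_insert _ _)
  exact hn g this

theorem isPartialTransversal_singleton (hfree : IsFreeAction Γ V) (x : V) :
    IsPartialTransversal Γ G {x} :=
  ⟨connectedOn_singleton x, by rintro _ rfl g hg; exact hfree g _ hg⟩

theorem exists_transversal_extending (hG : IsInvariant Γ G) (hfree : IsFreeAction Γ V)
    (hc : G.Preconnected) {P : Set V} (hP : IsPartialTransversal Γ G P) (hne : P.Nonempty) :
    ∃ X, P ⊆ X ∧ IsTransversal Γ G X := by
  obtain ⟨X, hPX, hX, h⟩ := exists_partialTransversal_extending hG hfree hP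
  obtain ⟨x₀, hx₀⟩ := hne
  exact ⟨X, hPX, hX, fun v => h x₀ hx₀ v (hc x₀ v)⟩

theorem exists_transversal (hG : IsInvariant Γ G) (hfree : IsFreeAction Γ V)
    (hc : G.Connected) : ∃ X, IsTransversal Γ G X := by
  obtain ⟨x⟩ := hc.nonempty
  obtain ⟨X, -, hX⟩ := exists_transversal_extending hG hfree hc.preconnected (P := {x})
    (isPartialTransversal_singleton hfree x) ⟨x, rfl⟩
  exact ⟨X, hX⟩

theorem IsTransversal.nonempty {X : Set V} (hX : IsTransversal Γ G X) (x : V) : X.Nonempty := by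
  obtain ⟨g, hg⟩ := hX.cover x
  exact ⟨_, hg⟩

/-- The element which moves the transversal to the vertex `v`. -/
def IsTransversal.pos {X : Set V} (hX : IsTransversal Γ G X) (v : V) : Γ := (hX.cover v).choose⁻¹

theorem IsTransversal.pos_inv_smul_mem {X : Set V} (hX : IsTransversal Γ G X) (v : V) :
    (hX.pos v)⁻¹ • v ∈ X := by
  rw [IsTransversal.pos, inv_inv]
  exact (hX.cover v).choose_spec

theorem IsTransversal.pos_eq {X : Set V} (hX : IsTransversal Γ G X) {v : V} {g : Γ}
    (h : g⁻¹ • v ∈ X) : hX.pos v = g := by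
  have := hX.uniq _ h ((hX.pos v)⁻¹ * g) (by
    rw [mul_smul, smul_inv_smul]
    exact hX.pos_inv_smul_mem v)
  rwa [inv_mul_eq_one] at this

theorem IsTransversal.pos_smul {X : Set V} (hX : IsTransversal Γ G X) (g : Γ) (v : V) :
    hX.pos (g • v) = g * hX.pos v := by
  apply hX.pos_eq
  rw [mul_inv_rev, mul_smul, inv_smul_smul]
  exact hX.pos_inv_smul_mem v

theorem IsTransversal.pos_of_mem {X : Set V} (hX : IsTransversal Γ G X) {v : V} (h : v ∈ X) :
    hX.pos v = 1 := hX.pos_eq (by simpa using h)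

theorem IsTransversal.step_of_adj (hG : IsInvariant Γ G) {X : Set V} (hX : IsTransversal Γ G X)
    {v w : V} (h : G.Adj v w) :
    (hX.pos v)⁻¹ * hX.pos w = 1 ∨ (hX.pos v)⁻¹ * hX.pos w ∈ steps Γ G X := by
  by_cases h1 : (hX.pos v)⁻¹ * hX.pos w = 1
  · exact Or.inl h1
  · refine Or.inr ⟨h1, _, hX.pos_inv_smul_mem v, _, hX.pos_inv_smul_mem w, ?_⟩
    rw [mul_smul, smul_inv_smul]
    exact hG _ _ _ h

/-- The stabilizer of a connected component is generated by the steps of a transversal. -/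
theorem mem_closure_of_reachable {H : SimpleGraph V} (hH : IsInvariant Γ H)
    {X : Set V} (huniq : ∀ x ∈ X, ∀ g : Γ, g • x ∈ X → g = 1) {x₀ : V} (hx₀ : x₀ ∈ X)
    (hcov : ∀ v, H.Reachable x₀ v → ∃ g : Γ, g • v ∈ X) {g : Γ} {y : V} (hy : y ∈ X)
    (hr : H.Reachable x₀ (g • y)) : g ∈ Subgroup.closure (steps Γ H X) := by
  have key := reachable_of_closed (P := fun v => H.Reachable x₀ v ∧
      ∀ g : Γ, g⁻¹ • v ∈ X → g ∈ Subgroup.closure (steps Γ H X)) ?_ hr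
      ⟨SimpleGraph.Reachable.refl _, ?_⟩
  · exact key.2 g (by simpa using hy)
  · rintro a b hab ⟨h1, h2⟩
    refine ⟨h1.trans hab.reachable, fun h hh => ?_⟩
    obtain ⟨k, hk⟩ := hcov a h1
    have hk1 := h2 k⁻¹ (by simpa using hk)
    by_cases he : k * h = 1
    · rw [mul_eq_one_iff_inv_eq] at he
      exact he ▸ hk1
    · have : k * h ∈ steps Γ H X := by
        refine ⟨he, _, hk, _, hh, ?_⟩
        rw [mul_smul, smul_inv_smul]
        exact hH _ _ _ hab
      have := mul_mem hk1 (Subgroup.subset_closure this)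
      simpa using this
  · intro g hg
    have := huniq _ hx₀ g⁻¹ hg
    rw [inv_eq_one] at this
    exact this ▸ one_mem _

theorem reachable_of_mem_closure {H : SimpleGraph V} (hH : IsInvariant Γ H)
    {X : Set V} (hX : ConnectedOn H X) {x₀ : V} (hx₀ : x₀ ∈ X) {g : Γ}
    (hg : g ∈ Subgroup.closure (steps Γ H X)) : H.Reachable x₀ (g • x₀) := by
  have hX' : ∀ x ∈ X, H.Reachable x₀ x := fun x hx => (hX x₀ hx₀ x hx).mono (within_le X)
  induction hg using Subgroup.closure_induction with
  | mem g hg =>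
    obtain ⟨-, x, hx, y, hy, hxy⟩ := hg
    exact ((hX' x hx).trans hxy.reachable).trans (hH.reachable g (hX' y hy).symm)
  | one => simp
  | mul g h _ _ h1 h2 =>
    rw [mul_smul]
    exact h1.trans (hH.reachable g h2)
  | inv g _ h1 =>
    have := hH.reachable g⁻¹ h1.symm
    simpa using this

/-- A group which acts freely on a tree is free, with one basis element for each pair of opposite
steps of a transversal. -/
theorem isBasis_of_isTransversal (hT : G.IsTree) (hG : IsInvariant Γ G)
    {X : Set V} (hX : IsTransversal Γ G X) {B : Set Γ}
    (hB : IsHalf B (steps Γ G X)) : IsBasis B := by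
  classical
  obtain ⟨v₀⟩ := hT.connected.nonempty
  obtain ⟨x₀, hx₀⟩ := hX.nonempty v₀
  have hcl : Subgroup.closure B = ⊤ := by
    rw [hB.closure_eq, eq_top_iff]
    intro g _
    exact mem_closure_of_reachable hG hX.uniq hx₀ (fun v _ => hX.cover v) hx₀
      (hT.connected x₀ (g • x₀))
  -- The label of a step is its letter, inverse steps getting inverse letters. All other elements,
  -- in particular `1`, are labelled trivially.
  let l : Γ → FreeGroup B := fun g => if h : g ∈ B then FreeGroup.of ⟨g, h⟩ else
    if h : g⁻¹ ∈ B then (FreeGroup.of ⟨g⁻¹, h⟩)⁻¹ else 1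
  have hl : ∀ g ∈ steps Γ G X, l g⁻¹ = (l g)⁻¹ := by
    intro g hg
    rcases hB.cover g hg with h | h
    · have h' := hB.inv_notMem g h
      simp [l, h, h']
    · have h' := hB.inv_notMem _ h
      rw [inv_inv] at h'
      simp [l, h, h']
  have hl1 : l 1 = 1 := by
    have h1 : (1 : Γ) ∉ B := fun h => (hB.sub h).1 rfl
    simp [l, h1]
  let c : V → V → FreeGroup B := fun v w => l ((hX.pos v)⁻¹ * hX.pos w)
  -- Along an edge the position relative to the translates of `X` changes by a step or not at all,
  -- so the labels form a cocycle on the tree.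
  obtain ⟨Φ, h0, hΦ⟩ := exists_potential hT c (by
    intro v w hvw
    have : (hX.pos w)⁻¹ * hX.pos v = ((hX.pos v)⁻¹ * hX.pos w)⁻¹ := by group
    rcases hX.step_of_adj hG hvw with h | h
    · simp only [c]
      rw [this, h, inv_one, hl1, inv_one]
    · simp only [c]
      rw [this, hl _ h]) x₀
  have hΦX : ∀ x ∈ X, Φ x = 1 := by
    intro x hx
    refine (reachable_of_closed (P := fun x => x ∈ X ∧ Φ x = 1) ?_ (hX.conn x₀ hx₀ x hx)
      ⟨hx₀, h0⟩).2
    rintro a b ⟨hab, ha, hb⟩ ⟨-, h1⟩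
    refine ⟨hb, ?_⟩
    rw [hΦ a b hab, h1]
    simp [c, hX.pos_of_mem ha, hX.pos_of_mem hb, hl1]
  have hequiv : ∀ (g : Γ) (v : V), Φ (g • v) = Φ (g • x₀) * Φ v := by
    intro g v
    refine eq_of_potential (Φ := fun v => Φ (g • v)) (Ψ := Φ) (c := c) (x₀ := x₀) hT.connected ?_ hΦ
      _ (by rw [h0, mul_one]) v
    intro v w hvw
    change Φ (g • w) = Φ (g • v) * _
    rw [hΦ _ _ (hG g v w hvw)]
    simp only [c, hX.pos_smul, mul_inv_rev]
    congr 2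
    group
  -- Labels depend on relative positions only, so the potential is equivariant up to its value at `g
  -- • x₀`. This makes its restriction to the orbit of `x₀` a homomorphism, which sends each basis
  -- element to its letter.
  let Ψ : Γ →* FreeGroup B := MonoidHom.mk' (fun g => Φ (g • x₀)) (fun g h => by
    rw [mul_smul, hequiv g (h • x₀)])
  refine (isFreeSet_of_extend Ψ ?_).isBasis hcl
  rintro ⟨b, hb⟩
  obtain ⟨-, x, hx, y, hy, hxy⟩ := hB.sub hb
  change Φ (b • x₀) = _
  have h1 := hequiv b y
  rw [hΦX y hy, mul_one, hΦ _ _ hxy, hΦX x hx, one_mul] at h1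
  rw [← h1]
  simp [c, hX.pos_smul, hX.pos_of_mem hx, hX.pos_of_mem hy, l, hb]

/-- By Zorn's lemma: a maximal set without inverse pairs meets every pair, because no element of `S`
is its own inverse. The prescribed part `B₀` serves to keep given elements inside the basis. -/
theorem exists_isHalf_extending {S B₀ : Set Γ}
    (hne : ∀ s ∈ S, s⁻¹ ≠ s) (h0 : B₀ ⊆ S) (h1 : ∀ b ∈ B₀, b⁻¹ ∉ B₀) :
    ∃ B, B₀ ⊆ B ∧ IsHalf B S := by
  obtain ⟨B, hB0, hB⟩ := zorn_subset_nonempty {B | B ⊆ S ∧ ∀ b ∈ B, b⁻¹ ∉ B} (by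
    intro c hc hchain hcne
    refine ⟨⋃₀ c, ⟨Set.sUnion_subset fun s hs => (hc hs).1, ?_⟩,
      fun s hs => Set.subset_sUnion_of_mem hs⟩
    rintro b ⟨s, hs, hbs⟩ ⟨t, ht, hbt⟩
    rcases hchain.total hs ht with h | h
    · exact (hc ht).2 b (h hbs) hbt
    · exact (hc hs).2 b hbs (h hbt)) B₀ ⟨h0, h1⟩
  refine ⟨B, hB0, hB.1.1, ?_, hB.1.2⟩
  intro s hs
  by_contra hn
  push Not at hn
  refine hn.1 (hB.2 (y := insert s B) ⟨?_, ?_⟩ (Set.subset_insert _ _) (Set.mem_insert _ _))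
  · exact Set.insert_subset hs hB.1.1
  · rintro b (rfl | hb) (h | h)
    · exact hne _ hs h
    · exact hn.2 h
    · rw [← h, inv_inv] at hn
      exact hn.2 hb
    · exact hB.1.2 b hb h

/-- `B` is a basis of `Γ` read off from a transversal of the free `Γ`-tree `G`. -/
def IsGeometric (G : SimpleGraph V) (B : Set Γ) : Prop :=
  ∃ X : Set V, IsTransversal Γ G X ∧ IsHalf B (steps Γ G X)

theorem IsGeometric.isBasis (hT : G.IsTree) (hG : IsInvariant Γ G) {B : Set Γ}
    (hB : IsGeometric G B) : IsBasis B := by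
  obtain ⟨X, hX, hBX⟩ := hB
  exact isBasis_of_isTransversal hT hG hX hBX

theorem steps_inv_ne (htf : ∀ g : Γ, g * g = 1 → g = 1) {X : Set V} :
    ∀ s ∈ steps Γ G X, s⁻¹ ≠ s := by
  intro s hs h
  refine hs.1 (htf s ?_)
  nth_rewrite 1 [← h]
  exact inv_mul_cancel s

end Actions

/-! ### Cayley trees -/

section Cayley

variable {Γ : Type*} [Group Γ]

/-- The Cayley graph. -/
def cayley (B : Set Γ) : SimpleGraph Γ where
  Adj g h := g ≠ h ∧ (g⁻¹ * h ∈ B ∨ h⁻¹ * g ∈ B)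
  symm := ⟨fun _ _ h => ⟨h.1.symm, h.2.symm⟩⟩
  loopless := ⟨fun _ h => h.1 rfl⟩

theorem cayley_isInvariant (B : Set Γ) : IsInvariant Γ (cayley B) := by
  intro g x y h
  refine ⟨fun h' => h.1 (mul_left_cancel h'), ?_⟩
  have h1 : (g • x)⁻¹ * (g • y) = x⁻¹ * y := by simp [mul_assoc]
  have h2 : (g • y)⁻¹ * (g • x) = y⁻¹ * x := by simp [mul_assoc]
  rw [h1, h2]
  exact h.2

theorem isFreeAction_self : IsFreeAction Γ Γ := fun g x h => by simpa using h

theorem cayley_adj_mul {B : Set Γ} (g : Γ) {b : Γ} (hb : b ∈ B) (h1 : b ≠ 1) :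
    (cayley B).Adj g (g * b) := by
  refine ⟨fun h => h1 ?_, Or.inl (by simpa using hb)⟩
  simpa using h.symm

theorem cayley_reachable {B : Set Γ} (x : Γ) {g : Γ} (hg : g ∈ Subgroup.closure B) :
    (cayley B).Reachable x (x * g) := by
  induction hg using Subgroup.closure_induction generalizing x with
  | mem b hb =>
    by_cases h1 : b = 1
    · rw [h1, mul_one]
    · exact (cayley_adj_mul x hb h1).reachable
  | one => rw [mul_one]
  | mul g h _ _ h1 h2 =>
    rw [← mul_assoc]
    exact (h1 x).trans (h2 _)
  | inv g _ h1 =>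
    have := (h1 (x * g⁻¹)).symm
    simpa using this

/-- The parity with which a path from `1` crosses the edge from `h` to `h * b`. -/
theorem IsBasis.exists_parity {B : Set Γ} (hB : IsBasis B) (h b : Γ) :
    ∃ χ : Γ → ZMod 2, χ 1 = 0 ∧
      ∀ g : Γ, ∀ c ∈ B, (g = h ∧ c = b → χ (g * c) = χ g + 1) ∧
        (¬ (g = h ∧ c = b) → χ (g * c) = χ g) := by
  classical
  let δ : Γ → Γ → ZMod 2 := fun g c => if g = h ∧ c = b then 1 else 0
  -- Right translation by `c⁻¹`, with the second coordinate recording a crossing of the marked edge.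
  -- Permutations can be prescribed freely on a basis, so the parity of a group element is defined
  -- without writing it as a word.
  let σ : Γ → Equiv.Perm (Γ × ZMod 2) := fun c =>
    { toFun := fun p => (p.1 * c⁻¹, p.2 - δ (p.1 * c⁻¹) c)
      invFun := fun p => (p.1 * c, p.2 + δ p.1 c)
      left_inv := fun p => by simp
      right_inv := fun p => by simp }
  obtain ⟨Θ, hΘ⟩ := hB.exists_hom σ
  have hfst : ∀ (g : Γ) (p : Γ × ZMod 2), (Θ g⁻¹ p).1 = p.1 * g := by
    intro g
    have hg : g ∈ Subgroup.closure B := hB.closure_eq ▸ Subgroup.mem_top g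
    induction hg using Subgroup.closure_induction with
    | mem c hc =>
      intro p
      rw [map_inv, hΘ c hc]
      rfl
    | one => simp
    | mul g k _ _ h1 h2 =>
      intro p
      rw [mul_inv_rev, map_mul, Equiv.Perm.mul_apply, h2, h1, mul_assoc]
    | inv g _ h1 =>
      intro p
      have h2 := h1 (Θ g⁻¹⁻¹ p)
      rw [← Equiv.Perm.mul_apply, ← map_mul, mul_inv_cancel, map_one, Equiv.Perm.one_apply] at h2
      rw [h2, mul_inv_cancel_right]
  have hstep : ∀ g, ∀ c ∈ B, (Θ (g * c)⁻¹ (1, 0)).2 = (Θ g⁻¹ (1, 0)).2 + δ g c := by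
    intro g c hc
    have h1 : Θ c⁻¹ = (σ c)⁻¹ := by rw [map_inv, hΘ c hc]
    rw [mul_inv_rev, map_mul, Equiv.Perm.mul_apply, h1]
    have h2 : (Θ g⁻¹ (1, 0)).1 = g := by rw [hfst, one_mul]
    change (Θ g⁻¹ (1, 0)).2 + δ (Θ g⁻¹ (1, 0)).1 c = _
    rw [h2]
  refine ⟨fun g => (Θ g⁻¹ (1, 0)).2, by simp, fun g c hc => ⟨fun hd => ?_, fun hd => ?_⟩⟩
  · simp only [hstep g c hc, δ, if_pos hd]
  · simp only [hstep g c hc, δ, if_neg hd, add_zero]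

theorem IsBasis.ne_one {B : Set Γ} (hB : IsBasis B) {b : Γ} (hb : b ∈ B) : b ≠ 1 := by
  intro h
  have := hB.notMem_closure hb (Set.empty_subset B) (Set.notMem_empty b)
  rw [h] at this
  exact this (one_mem _)

theorem IsBasis.inv_notMem {B : Set Γ} (hB : IsBasis B) {b : Γ} (hb : b ∈ B) : b⁻¹ ∉ B := by
  intro h
  by_cases he : b⁻¹ = b
  · obtain ⟨φ, hφ⟩ := hB.exists_hom (fun _ : Γ => Multiplicative.ofAdd (1 : ℤ))
    have h1 := hφ b⁻¹ h
    rw [map_inv, hφ b hb] at h1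
    have : (-1 : ℤ) = 1 := Multiplicative.ofAdd.injective h1
    omega
  · refine hB.notMem_closure hb (S := {b⁻¹}) (Set.singleton_subset_iff.2 h) (fun h' => he h'.symm) ?_
    exact inv_mem_iff.1 (Subgroup.subset_closure rfl)

/-- Connectedness is generation by `B`. The parity of the crossings of an edge separates its
endpoints and is unchanged across all other edges. -/
theorem IsBasis.cayley_isTree {B : Set Γ} (hB : IsBasis B) : (cayley B).IsTree := by
  refine isTree_of_cut ⟨fun x y => ?_⟩ ?_
  · have := cayley_reachable (B := B) x (g := x⁻¹ * y) (hB.closure_eq ▸ Subgroup.mem_top _)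
    simpa using this
  · have key : ∀ a b : Γ, a⁻¹ * b ∈ B → ∃ χ : Γ → Prop, χ a ≠ χ b ∧
        ∀ x y, (cayley B).Adj x y → s(x, y) ≠ s(a, b) → χ x = χ y := by
      intro a b hab
      obtain ⟨χ, -, hχ⟩ := hB.exists_parity a (a⁻¹ * b)
      refine ⟨fun x => χ x = 0, ?_, ?_⟩
      · have := (hχ a _ hab).1 ⟨rfl, rfl⟩
        rw [mul_inv_cancel_left] at this
        simp only [this, ne_eq, eq_iff_iff]
        generalize χ a = t
        revert t
        decide
      · have h' : ∀ x y, x⁻¹ * y ∈ B → s(x, y) ≠ s(a, b) → χ x = χ y := by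
          intro x y hxy hne
          have := (hχ x _ hxy).2 (by
            rintro ⟨rfl, h2⟩
            exact hne (by rw [mul_left_cancel h2]))
          rw [mul_inv_cancel_left] at this
          exact this.symm
        rintro x y ⟨-, h1 | h1⟩ hne
        · simp only [h' x y h1 hne]
        · simp only [h' y x h1 (by rwa [Sym2.eq_swap])]
    rintro a b ⟨-, h1 | h1⟩
    · exact key a b h1
    · obtain ⟨χ, h2, h3⟩ := key b a h1
      exact ⟨χ, h2.symm, fun x y hxy hne => h3 x y hxy (by rwa [Sym2.eq_swap (a := b)])⟩

/-- A free factor of the whole group is a free factor of each subgroup which contains it: a basis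
of it extends to a basis of the subgroup. -/
theorem IsBasis.exists_extend_to_subgroup {B C : Set Γ} (hB : IsBasis B) (hC : C ⊆ B)
    (htf : ∀ g : Γ, g * g = 1 → g = 1) {A : Subgroup Γ} (hA : C ⊆ A) :
    ∃ D : Set Γ, C ⊆ D ∧ IsFreeSet D ∧ Subgroup.closure D = A := by
  have hT := hB.cayley_isTree
  have hinv : IsInvariant A (cayley B) := fun g x y h => cayley_isInvariant B (g : Γ) x y h
  have hfree : IsFreeAction A Γ := fun g x h => Subtype.ext (isFreeAction_self (g : Γ) x h)
  -- The subgroup acts freely on the Cayley tree of `B`. When the transversal contains `1`, the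
  -- elements of `C` are steps, because each of them moves `1` to a neighbour; so they can be
  -- included in the basis of `A`.
  obtain ⟨X, h1X, hX⟩ := exists_transversal_extending hinv hfree hT.connected.preconnected (P := {1})
    (isPartialTransversal_singleton hfree 1) ⟨1, rfl⟩
  have h1 : (1 : Γ) ∈ X := h1X rfl
  obtain ⟨D, hCD, hD⟩ := exists_isHalf_extending (S := steps A (cayley B) X)
    (B₀ := {c : A | (c : Γ) ∈ C})
    (steps_inv_ne (by
      intro g hg
      exact Subtype.ext (htf g (congrArg Subtype.val hg)))) (by
      intro c hc
      have hne : (c : Γ) ≠ 1 := hB.ne_one (hC hc)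
      refine ⟨fun h => hne (by rw [h]; rfl), 1, h1, 1, h1, ?_⟩
      have := cayley_adj_mul (B := B) 1 (hC hc) hne
      rw [one_mul] at this
      change (cayley B).Adj 1 ((c : Γ) * 1)
      rwa [mul_one]) (by
      intro b hb hb'
      exact hB.inv_notMem (hC hb) (hC hb'))
  have hbasis := isBasis_of_isTransversal hT hinv hX hD
  refine ⟨Subtype.val '' D, ?_, hbasis.isFreeSet.of_subgroup, closure_of_subgroup hbasis.closure_eq⟩
  intro c hc
  exact ⟨⟨c, hA hc⟩, hCD hc, rfl⟩

end Cayley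

end OuterSpace

end

noncomputable section

namespace OuterSpace

/-! ### Chains of bases -/

section Chains

variable {Γ : Type*} [Group Γ]

/-- Conjugation of subgroups. -/
def conjSub (g : Γ) (A : Subgroup Γ) : Subgroup Γ := A.map (MulAut.conj g).toMonoidHom

theorem mem_conjSub {g x : Γ} {A : Subgroup Γ} : x ∈ conjSub g A ↔ g⁻¹ * x * g ∈ A := by
  constructor
  · rintro ⟨a, ha, rfl⟩
    have : g⁻¹ * (MulAut.conj g).toMonoidHom a * g = a := by
      change g⁻¹ * (g * a * g⁻¹) * g = a
      group
    rwa [this]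
  · intro h
    refine ⟨_, h, ?_⟩
    change g * (g⁻¹ * x * g) * g⁻¹ = x
    group

theorem conjSub_one (A : Subgroup Γ) : conjSub 1 A = A := by
  ext x
  simp [mem_conjSub]

theorem conjSub_mul (g h : Γ) (A : Subgroup Γ) : conjSub (g * h) A = conjSub g (conjSub h A) := by
  ext x
  simp [mem_conjSub, mul_assoc]

theorem conjSub_eq_iff {g : Γ} {A A' : Subgroup Γ} : conjSub g A = A' ↔ A = conjSub g⁻¹ A' := by
  constructor
  · rintro rfl
    rw [← conjSub_mul, inv_mul_cancel, conjSub_one]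
  · rintro rfl
    rw [← conjSub_mul, mul_inv_cancel, conjSub_one]

/-- Two bases which, up to conjugation, share a corank one free factor. -/
def BAdj (B B' : Set Γ) : Prop :=
  IsBasis B ∧ IsBasis B' ∧ ∃ b ∈ B, ∃ b' ∈ B', ∃ g : Γ,
    conjSub g (Subgroup.closure (B \ {b})) = Subgroup.closure (B' \ {b'})

theorem BAdj.symm {B B' : Set Γ} (h : BAdj B B') : BAdj B' B := by
  obtain ⟨h1, h2, b, hb, b', hb', g, hg⟩ := h
  exact ⟨h2, h1, b', hb', b, hb, g⁻¹, (conjSub_eq_iff.1 hg).symm⟩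

/-- There is a chain of length at most `s` of successively adjacent bases. -/
inductive BNear : ℕ → Set Γ → Set Γ → Prop
  | refl (s : ℕ) (B : Set Γ) : BNear s B B
  | step {s : ℕ} {B B' B'' : Set Γ} : BNear s B B' → BAdj B' B'' → BNear (s + 1) B B''

theorem BNear.mono {s t : ℕ} {B B' : Set Γ} (h : BNear s B B') (hst : s ≤ t) : BNear t B B' := by
  induction h generalizing t with
  | refl s B => exact BNear.refl _ _
  | step _ h2 ih =>
    obtain ⟨t, rfl⟩ := Nat.exists_eq_add_of_le' (Nat.one_le_of_lt hst)
    exact BNear.step (ih (by omega)) h2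

theorem BNear.trans {s t : ℕ} {B B' B'' : Set Γ} (h : BNear s B B') (h' : BNear t B' B'') :
    BNear (s + t) B B'' := by
  induction h' with
  | refl t _ => exact h.mono (Nat.le_add_right _ _)
  | step _ h2 ih => exact BNear.step (ih h) h2

theorem BAdj.near {B B' : Set Γ} (h : BAdj B B') : BNear 1 B B' := BNear.step (BNear.refl 0 B) h

theorem BNear.symm {s : ℕ} {B B' : Set Γ} (h : BNear s B B') : BNear s B' B := by
  induction h with
  | refl s B => exact BNear.refl _ _
  | @step s _ _ _ _ h2 ih => exact (h2.symm.near.trans ih).mono (by omega)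

end Chains

/-! ### Bases read off from transversals which avoid a given edge -/

section Avoid

variable {Γ V : Type*} [Group Γ] [MulAction Γ V] {G : SimpleGraph V}

/-- The graph `G` with all translates of the edge from `p` to `q` removed. -/
def cutOrbit (Γ : Type*) [Group Γ] {V : Type*} [MulAction Γ V] (G : SimpleGraph V) (p q : V) :
    SimpleGraph V where
  Adj x y := G.Adj x y ∧ ∀ g : Γ, s(x, y) ≠ s(g • p, g • q)
  symm := ⟨fun x y h => ⟨h.1.symm, fun g => by rw [Sym2.eq_swap]; exact h.2 g⟩⟩
  loopless := ⟨fun _ h => h.1.ne rfl⟩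

theorem cutOrbit_le (p q : V) : cutOrbit Γ G p q ≤ G := fun _ _ h => h.1

theorem sym2_smul_eq {g : Γ} {x y x' y' : V} (h : s(g • x, g • y) = s(x', y')) :
    s(x, y) = s(g⁻¹ • x', g⁻¹ • y') := by
  rcases Sym2.eq_iff.1 h with ⟨rfl, rfl⟩ | ⟨rfl, rfl⟩
  · simp
  · simp [Sym2.eq_swap]

theorem cutOrbit_isInvariant (hG : IsInvariant Γ G) (p q : V) :
    IsInvariant Γ (cutOrbit Γ G p q) := by
  intro g x y h
  refine ⟨hG g x y h.1, fun k hk => h.2 (g⁻¹ * k) ?_⟩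
  rw [mul_smul, mul_smul]
  exact sym2_smul_eq hk

/-- The stabilizer of the connected component of a vertex. -/
def compStab {H : SimpleGraph V} (hH : IsInvariant Γ H) (x : V) : Subgroup Γ where
  carrier := {g | H.Reachable x (g • x)}
  one_mem' := by simp
  mul_mem' {g h} hg hh := by
    change H.Reachable x ((g * h) • x)
    rw [mul_smul]
    exact SimpleGraph.Reachable.trans hg (hH.reachable g hh)
  inv_mem' {g} hg := by
    have := (hH.reachable g⁻¹ hg).symm
    simpa using this

theorem mem_compStab {H : SimpleGraph V} (hH : IsInvariant Γ H) {x : V} {g : Γ} :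
    g ∈ compStab hH x ↔ H.Reachable x (g • x) := Iff.rfl

theorem compStab_smul {H : SimpleGraph V} (hH : IsInvariant Γ H) (x : V) (g : Γ) :
    compStab hH (g • x) = conjSub g (compStab hH x) := by
  ext h
  rw [mem_conjSub, mem_compStab, mem_compStab, ← hH.reachable_iff g (x := x), mul_smul, mul_smul,
    smul_inv_smul]

theorem closure_steps_eq_compStab {H : SimpleGraph V} (hH : IsInvariant Γ H) {X : Set V}
    (hX : IsPartialTransversal Γ H X) {x₀ : V} (hx₀ : x₀ ∈ X)
    (hcov : ∀ v, H.Reachable x₀ v → ∃ g : Γ, g • v ∈ X) :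
    Subgroup.closure (steps Γ H X) = compStab hH x₀ := by
  ext g
  exact ⟨fun hg => reachable_of_mem_closure hH hX.conn hx₀ hg,
    fun hg => mem_closure_of_reachable hH hX.uniq hx₀ hcov hx₀ hg⟩

/-- A transversal and a translate of it are joined by at most one edge. -/
theorem edge_unique (hT : G.IsAcyclic) (hG : IsInvariant Γ G) {X : Set V}
    (hX : IsPartialTransversal Γ G X) {g : Γ} (hg : g ≠ 1) {x x' y y' : V} (hx : x ∈ X)
    (hx' : x' ∈ X) (hy : y ∈ X) (hy' : y' ∈ X) (h : G.Adj x (g • y)) (h' : G.Adj x' (g • y')) :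
    x = x' ∧ y = y' := by
  by_contra hn
  have hdisj : ∀ z ∈ X, ∀ w ∈ X, z ≠ g • w := fun z hz w hw he => hg (hX.uniq w hw g (he ▸ hz))
  have hne : s(x', g • y') ≠ s(x, g • y) := by
    intro he
    rcases Sym2.eq_iff.1 he with ⟨h1, h2⟩ | ⟨h1, h2⟩
    · exact hn ⟨h1.symm, (smul_left_cancel g h2).symm⟩
    · exact hdisj _ hx' _ hy h1
  refine not_reachable_cut hT h ?_
  have h1 : (cut G x (g • y)).Reachable x x' := by
    refine SimpleGraph.Reachable.mono (G := within G X)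
      (fun a b hab => cut_adj.2 ⟨hab.1, fun he => ?_⟩) (hX.conn x hx x' hx')
    rcases Sym2.eq_iff.1 he with ⟨_, h2⟩ | ⟨h2, _⟩
    · exact hdisj _ hab.2.2 _ hy h2
    · exact hdisj _ hab.2.1 _ hy h2
  have h2 : (cut G x (g • y)).Reachable (g • y') (g • y) := by
    refine reachable_of_closed (P := fun z => (cut G x (g • y)).Reachable (g • y') (g • z)) ?_
      (hX.conn y' hy' y hy) (SimpleGraph.Reachable.refl _)
    intro a b hab ha
    refine ha.trans (SimpleGraph.Adj.reachable (cut_adj.2 ⟨hG g _ _ hab.1, fun he => ?_⟩))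
    rcases Sym2.eq_iff.1 he with ⟨h2, _⟩ | ⟨_, h2⟩
    · exact hdisj _ hx _ hab.2.1 h2.symm
    · exact hdisj _ hx _ hab.2.2 h2.symm
  exact (h1.trans (SimpleGraph.Adj.reachable (cut_adj.2 ⟨h', hne⟩))).trans h2

/-- No translate of the edge from `p` to `q` has both endpoints in `X`. -/
def Avoids (Γ : Type*) [Group Γ] {V : Type*} [MulAction Γ V] (X : Set V) (p q : V) : Prop :=
  ∀ g : Γ, g • p ∈ X → g • q ∉ X

theorem Avoids.connectedOn {X : Set V} {p q : V} (h : Avoids Γ X p q) (hX : ConnectedOn G X) :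
    ConnectedOn (cutOrbit Γ G p q) X := by
  intro x hx y hy
  refine SimpleGraph.Reachable.mono (G := within G X)
    (fun a b hab => ⟨⟨hab.1, fun g hg => ?_⟩, hab.2⟩) (hX x hx y hy)
  rcases Sym2.eq_iff.1 hg with ⟨rfl, rfl⟩ | ⟨rfl, rfl⟩
  · exact h g hab.2.1 hab.2.2
  · exact h g hab.2.2 hab.2.1

/-- The orbit of the edge accounts for exactly one inverse pair of steps, that of `s`, because a
transversal and a translate of it are joined by at most one edge. Deleting the orbit removes this
pair only, and the remaining steps generate the stabilizer of the component containing `X`. -/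
theorem exists_closure_diff_eq_compStab (hT : G.IsAcyclic) (hG : IsInvariant Γ G) {X : Set V}
    (hX : IsTransversal Γ G X) {B : Set Γ} (hB : IsHalf B (steps Γ G X)) {p q : V}
    (hpq : G.Adj p q) (hav : Avoids Γ X p q) {x₀ : V} (hx₀ : x₀ ∈ X) :
    ∃ t ∈ B, Subgroup.closure (B \ {t}) = compStab (cutOrbit_isInvariant hG p q) x₀ := by
  set s := (hX.pos p)⁻¹ * hX.pos q with hs
  have hp := hX.pos_inv_smul_mem p
  have hq := hX.pos_inv_smul_mem q
  have hs1 : s ≠ 1 := by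
    intro h
    rw [hs, inv_mul_eq_one] at h
    rw [← h] at hq
    exact hav _ hp hq
  have hse : G.Adj ((hX.pos p)⁻¹ • p) (s • (hX.pos q)⁻¹ • q) := by
    rw [hs, mul_smul, smul_inv_smul]
    exact hG _ _ _ hpq
  have hsS : s ∈ steps Γ G X := ⟨hs1, _, hp, _, hq, hse⟩
  have hsteps : ∀ g, g ∈ steps Γ (cutOrbit Γ G p q) X ↔
      g ∈ steps Γ G X ∧ g ≠ s ∧ g⁻¹ ≠ s := by
    intro g
    have hnot : ∀ g ∈ steps Γ (cutOrbit Γ G p q) X, g ≠ s := by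
      rintro g ⟨hg1, x, hx, y, hy, hxy⟩ rfl
      obtain ⟨rfl, rfl⟩ := edge_unique hT hG hX.toIsPartialTransversal hg1 hx hp hy hq hxy.1 hse
      refine hxy.2 (hX.pos p)⁻¹ ?_
      rw [hs, mul_smul, smul_inv_smul]
    constructor
    · intro hg
      refine ⟨?_, hnot g hg, hnot _ (inv_mem_steps (cutOrbit_isInvariant hG p q) hg)⟩
      obtain ⟨hg1, x, hx, y, hy, hxy⟩ := hg
      exact ⟨hg1, x, hx, y, hy, hxy.1⟩
    · rintro ⟨⟨hg1, x, hx, y, hy, hxy⟩, h1, h2⟩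
      refine ⟨hg1, x, hx, y, hy, hxy, fun k hk => ?_⟩
      have hpx : hX.pos x = 1 := hX.pos_of_mem hx
      have hpy : hX.pos (g • y) = g := by rw [hX.pos_smul, hX.pos_of_mem hy, mul_one]
      rcases Sym2.eq_iff.1 hk with ⟨h3, h4⟩ | ⟨h3, h4⟩
      · rw [h3, hX.pos_smul] at hpx
        rw [h4, hX.pos_smul] at hpy
        apply h1
        rw [← hpy, hs, eq_inv_of_mul_eq_one_left hpx]
      · rw [h3, hX.pos_smul] at hpx
        rw [h4, hX.pos_smul] at hpy
        apply h2
        rw [← hpy, hs, eq_inv_of_mul_eq_one_left hpx]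
        group
  have hcl : Subgroup.closure (steps Γ (cutOrbit Γ G p q) X) =
      compStab (cutOrbit_isInvariant hG p q) x₀ :=
    closure_steps_eq_compStab (cutOrbit_isInvariant hG p q)
      ⟨hav.connectedOn hX.conn, hX.uniq⟩ hx₀ (fun v _ => hX.cover v)
  obtain ⟨t, htB, ht⟩ : ∃ t ∈ B, t = s ∨ t⁻¹ = s := by
    rcases hB.cover s hsS with h | h
    · exact ⟨s, h, Or.inl rfl⟩
    · exact ⟨s⁻¹, h, Or.inr (inv_inv s)⟩
  refine ⟨t, htB, ?_⟩
  rw [← hcl]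
  refine IsHalf.closure_eq ⟨?_, ?_, ?_⟩
  · rintro b ⟨hb, hbt⟩
    refine (hsteps b).2 ⟨hB.sub hb, ?_, ?_⟩
    · rintro rfl
      rcases ht with h | h
      · exact hbt h.symm
      · rw [← h] at hb
        exact hB.inv_notMem t htB hb
    · intro hbs
      rcases ht with h | h
      · rw [← h] at hbs
        rw [← hbs] at htB
        exact hB.inv_notMem b hb htB
      · rw [← h] at hbs
        exact hbt (inv_injective hbs)
  · intro g hg
    obtain ⟨h1, h2, h3⟩ := (hsteps g).1 hg
    have h4 : g ≠ t := by
      rintro rfl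
      rcases ht with h | h
      · exact h2 h
      · exact h3 h
    have h5 : g⁻¹ ≠ t := by
      rintro rfl
      rcases ht with h | h
      · exact h3 h
      · rw [inv_inv] at h
        exact h2 h
    exact (hB.cover g h1).imp (fun h => ⟨h, h4⟩) (fun h => ⟨h, h5⟩)
  · exact fun b hb hb' => hB.inv_notMem b hb.1 hb'.1

/-- Each basis minus one element generates the stabilizer of a component of the complement of the
edge orbit. The two components are translates of each other, so their stabilizers are conjugate. -/
theorem bAdj_of_avoids (hT : G.IsTree) (hG : IsInvariant Γ G) {X X' : Set V}
    (hX : IsTransversal Γ G X) (hX' : IsTransversal Γ G X') {B B' : Set Γ}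
    (hB : IsHalf B (steps Γ G X)) (hB' : IsHalf B' (steps Γ G X')) {p q : V} (hpq : G.Adj p q)
    (hav : Avoids Γ X p q) (hav' : Avoids Γ X' p q) : BAdj B B' := by
  have hH := cutOrbit_isInvariant hG p q
  obtain ⟨x, hx⟩ := hX.nonempty p
  obtain ⟨g, hg⟩ := hX'.cover x
  obtain ⟨t, ht, h1⟩ := exists_closure_diff_eq_compStab hT.isAcyclic hG hX hB hpq hav hx
  obtain ⟨t', ht', h2⟩ := exists_closure_diff_eq_compStab hT.isAcyclic hG hX' hB' hpq hav' hg
  refine ⟨isBasis_of_isTransversal hT hG hX hB, isBasis_of_isTransversal hT hG hX' hB',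
    t, ht, t', ht', g, ?_⟩
  rw [h1, h2, compStab_smul]

theorem avoids_of_step (_hG : IsInvariant Γ G) {X : Set V} (hX : IsPartialTransversal Γ G X) {g : Γ}
    (hg : g ≠ 1) {x y : V} (hx : x ∈ X) (hy : y ∈ X) : Avoids Γ X x (g • y) := by
  intro h h1 h2
  have := hX.uniq x hx h h1
  rw [this, one_smul] at h2
  exact hg (hX.uniq y hy g h2)

theorem exists_geometric (htf : ∀ g : Γ, g * g = 1 → g = 1) {X : Set V} :
    ∃ B, IsHalf B (steps Γ G X) := by
  obtain ⟨B, -, hB⟩ := exists_isHalf_extending (S := steps Γ G X) (B₀ := ∅) (steps_inv_ne htf)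
    (Set.empty_subset _) (by simp)
  exact ⟨B, hB⟩

/-- The bases read off from a given tree are close to each other. -/
theorem IsGeometric.near (hT : G.IsTree) (hG : IsInvariant Γ G)
    (htf : ∀ g : Γ, g * g = 1 → g = 1) {B B' : Set Γ} (hB : IsGeometric G B)
    (hB' : IsGeometric G B') (hne : B.Nonempty) (htwo : B'.Nontrivial) : BNear 2 B B' := by
  obtain ⟨X, hX, hBX⟩ := hB
  obtain ⟨X', hX', hBX'⟩ := hB'
  obtain ⟨b, hb⟩ := hne
  obtain ⟨hb1, x, hx, y, hy, hxy⟩ := hBX.sub hb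
  have hav0 := avoids_of_step hG hX.toIsPartialTransversal hb1 hx hy
  -- If both transversals avoid this edge, one adjacency is enough. Otherwise a translate of it,
  -- from `p` to `q`, lies in `X'`, and `X'` is cut there into pieces `P₁` and `P₂` which will be
  -- glued differently.
  by_cases hav' : Avoids Γ X' x (b • y)
  · exact (bAdj_of_avoids hT hG hX hX' hBX hBX' hxy hav0 hav').near.mono (by omega)
  simp only [Avoids, not_forall, not_not] at hav'
  obtain ⟨g₀, hp, hq⟩ := hav'
  obtain ⟨p, hp0⟩ : ∃ p, g₀ • x = p := ⟨_, rfl⟩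
  obtain ⟨q, hq0⟩ : ∃ q, g₀ • b • y = q := ⟨_, rfl⟩
  have hpq : G.Adj p q := hp0 ▸ hq0 ▸ hG g₀ _ _ hxy
  rw [hp0] at hp
  rw [hq0] at hq
  have hav : Avoids Γ X p q := by
    intro h h1 h2
    rw [← hp0, ← mul_smul] at h1
    rw [← hq0, ← mul_smul] at h2
    exact hav0 _ h1 h2
  clear hav0 hp0 hq0 hxy hx hy
  let H := within (cut G p q) X'
  let P₁ : Set V := {z | z ∈ X' ∧ H.Reachable p z}
  let P₂ : Set V := {z | z ∈ X' ∧ H.Reachable q z}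
  have hp1 : p ∈ P₁ := ⟨hp, SimpleGraph.Reachable.refl _⟩
  have hq2 : q ∈ P₂ := ⟨hq, SimpleGraph.Reachable.refl _⟩
  have hcov : ∀ z ∈ X', z ∈ P₁ ∨ z ∈ P₂ := by
    intro z hz
    have := reachable_of_closed (P := fun z => H.Reachable p z ∨ H.Reachable q z) ?_
      (hX'.conn p hp z hz) (Or.inl (SimpleGraph.Reachable.refl _))
    · exact this.imp (fun h => ⟨hz, h⟩) (fun h => ⟨hz, h⟩)
    · rintro a c ⟨hac, ha, hc⟩ h
      by_cases he : s(a, c) = s(p, q)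
      · rcases Sym2.eq_iff.1 he with ⟨rfl, rfl⟩ | ⟨rfl, rfl⟩
        · exact Or.inr (SimpleGraph.Reachable.refl _)
        · exact Or.inl (SimpleGraph.Reachable.refl _)
      · have := SimpleGraph.Adj.reachable (G := H) ⟨cut_adj.2 ⟨hac, he⟩, ha, hc⟩
        exact h.imp (fun h => h.trans this) (fun h => h.trans this)
  have hdis : ∀ z, z ∈ P₁ → z ∉ P₂ := fun z h1 h2 =>
    not_reachable_cut hT.isAcyclic hpq ((h1.2.trans h2.2.symm).mono (within_le _))
  have hsub : ∀ (r : V), r ∈ X' → ConnectedOn G {z | z ∈ X' ∧ H.Reachable r z} := by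
    intro r hr
    have hset : {z | z ∈ X' ∧ H.Reachable r z} = {z | H.Reachable r z} := by
      ext z
      refine ⟨fun h => h.2, fun h => ⟨?_, h⟩⟩
      exact reachable_of_closed (P := fun z => z ∈ X') (fun a b (hab : H.Adj a b) _ => hab.2.2) h hr
    rw [hset]
    exact (connectedOn_component r).mono ((within_le _).trans (cut_le _ _))
  -- `X` is connected and meets the orbits of both `p` and `q`, so some edge of `X` leads from an
  -- orbit represented in `P₁` to one which is not. The pieces are glued along a translate of this
  -- edge.
  obtain ⟨a, c, hadj, ⟨ha, hc⟩, g, hga, hgc⟩ : ∃ a c, G.Adj a c ∧ (a ∈ X ∧ c ∈ X) ∧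
      ∃ g : Γ, g • a ∈ P₁ ∧ ∀ h : Γ, h • c ∉ P₁ := by
    by_contra hn
    obtain ⟨g1, h1⟩ := hX.cover p
    obtain ⟨g2, h2⟩ := hX.cover q
    have := reachable_of_closed (P := fun z => ∃ g : Γ, g • z ∈ P₁) ?_
      (hX.conn _ h1 _ h2) ⟨g1⁻¹, by simpa using hp1⟩
    · obtain ⟨h, hh⟩ := this
      rw [← mul_smul] at hh
      have := hX'.uniq q hq _ hh.1
      rw [this, one_smul] at hh
      exact hdis q hh hq2
    · rintro a c ⟨hac, ha, hc⟩ ⟨g, hg⟩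
      by_contra hn'
      push Not at hn'
      exact hn ⟨a, c, hac, ⟨ha, hc⟩, g, hg, hn'⟩
  obtain ⟨h, hh⟩ := hX'.cover c
  have hc2 : h • c ∈ P₂ := (hcov _ hh).resolve_left (hgc h)
  obtain ⟨k, hk⟩ : ∃ k, k = g * h⁻¹ := ⟨_, rfl⟩
  have hadj1 : G.Adj (g • a) (k • h • c) := by
    rw [hk, mul_smul, inv_smul_smul]
    exact hG g _ _ hadj
  -- Without a shift the gluing edge would join the pieces inside `X'`, so it would be the edge from
  -- `p` to `q`, which `X` avoids.
  have hk1 : k ≠ 1 := by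
    rintro rfl
    rw [one_smul] at hadj1
    by_cases he : s(g • a, h • c) = s(p, q)
    · have hgh : g = h := by rwa [eq_comm, mul_inv_eq_one] at hk
      subst hgh
      have h1 := sym2_smul_eq he
      rcases Sym2.eq_iff.1 h1 with ⟨rfl, rfl⟩ | ⟨rfl, rfl⟩
      · exact hav _ ha hc
      · exact hav _ hc ha
    · exact hdis (h • c) ⟨hh, hga.2.trans (SimpleGraph.Adj.reachable
        ⟨cut_adj.2 ⟨hadj1, he⟩, hga.1, hh⟩)⟩ hc2
  -- The intermediate transversal. Because `P₂` has been moved by `k ≠ 1`, it avoids the edge from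
  -- `p` to `q`, just as `X` does.
  let X₁ : Set V := P₁ ∪ {z | k⁻¹ • z ∈ P₂}
  have hX₁ : IsTransversal Γ G X₁ := by
    refine ⟨⟨?_, ?_⟩, ?_⟩
    · refine (hsub p hp).union (x := g • a) (y := k • h • c) ?_ hga (by simpa using hc2) hadj1
      intro z hz w hw
      have := (hsub q hq) _ hz _ hw
      have key := reachable_of_closed
        (P := fun w => (within G {z | k⁻¹ • z ∈ P₂}).Reachable z (k • w)) ?_ this (by simp)
      · simpa using key
      · intro u v huv hu
        refine hu.trans (SimpleGraph.Adj.reachable ⟨hG k _ _ huv.1, ?_, ?_⟩)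
        · change k⁻¹ • k • u ∈ P₂
          rw [inv_smul_smul]
          exact huv.2.1
        · change k⁻¹ • k • v ∈ P₂
          rw [inv_smul_smul]
          exact huv.2.2
    · rintro z (hz | hz) m (hm | hm)
      · exact hX'.uniq z hz.1 m hm.1
      · change k⁻¹ • m • z ∈ P₂ at hm
        rw [← mul_smul] at hm
        have := hX'.uniq z hz.1 _ hm.1
        rw [this, one_smul] at hm
        exact absurd hm (hdis z hz)
      · change k⁻¹ • z ∈ P₂ at hz
        have h1 : (m * k) • k⁻¹ • z = m • z := by rw [mul_smul, smul_inv_smul]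
        have := hX'.uniq _ hz.1 (m * k) (by rw [h1]; exact hm.1)
        rw [this, one_smul] at h1
        rw [h1] at hz
        exact absurd hz (hdis _ hm)
      · change k⁻¹ • m • z ∈ P₂ at hm
        change k⁻¹ • z ∈ P₂ at hz
        have h1 : (k⁻¹ * m * k) • k⁻¹ • z = k⁻¹ • m • z := by
          rw [mul_smul, mul_smul, smul_inv_smul]
        have := hX'.uniq _ hz.1 (k⁻¹ * m * k) (by rw [h1]; exact hm.1)
        rwa [mul_eq_one_iff_eq_inv, mul_eq_left] at this
    · intro v
      obtain ⟨m, hm⟩ := hX'.cover v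
      rcases hcov _ hm with h1 | h1
      · exact ⟨m, Or.inl h1⟩
      · refine ⟨k * m, Or.inr ?_⟩
        change k⁻¹ • (k * m) • v ∈ P₂
        rwa [mul_smul, inv_smul_smul]
  have hav1 : Avoids Γ X₁ p q := by
    rintro m (hm | hm) hm'
    · have := hX'.uniq p hp m hm.1
      rw [this, one_smul] at hm'
      rcases hm' with h1 | h1
      · exact hdis q h1 hq2
      · have := hX'.uniq q hq _ h1.1
        exact hk1 (inv_eq_one.1 this)
    · change k⁻¹ • m • p ∈ P₂ at hm
      rw [← mul_smul] at hm
      have := hX'.uniq p hp _ hm.1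
      rw [this, one_smul] at hm
      exact hdis p hp1 hm
  obtain ⟨B₁, hB₁⟩ := exists_geometric (G := G) htf (X := X₁)
  have hstep1 := bAdj_of_avoids hT hG hX hX₁ hBX hB₁ hpq hav hav1
  -- The second adjacency needs an edge avoided by both `X'` and `X₁`. A step of `X'` other than `k`
  -- and its inverse crosses such an edge; for this `B'` must have two elements.
  obtain ⟨b', hb', hbk, hbk'⟩ : ∃ b' ∈ B', b' ≠ k ∧ b' ≠ k⁻¹ := by
    obtain ⟨b1, hb1, b2, hb2, h12⟩ := htwo
    by_cases h1 : b1 = k ∨ b1 = k⁻¹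
    · refine ⟨b2, hb2, ?_, ?_⟩
      · rintro rfl
        rcases h1 with rfl | rfl
        · exact h12 rfl
        · exact hBX'.inv_notMem _ hb2 hb1
      · rintro rfl
        rcases h1 with rfl | rfl
        · exact hBX'.inv_notMem _ hb1 hb2
        · exact h12 rfl
    · push Not at h1
      exact ⟨b1, hb1, h1⟩
  obtain ⟨hb'1, x', hx', y', hy', hxy'⟩ := hBX'.sub hb'
  have hav2 := avoids_of_step hG hX'.toIsPartialTransversal hb'1 hx' hy'
  have hav3 : Avoids Γ X₁ x' (b' • y') := by
    rintro m (hm | hm) hm'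
    · have := hX'.uniq x' hx' m hm.1
      rw [this, one_smul] at hm'
      rcases hm' with h1 | h1
      · exact hb'1 (hX'.uniq y' hy' _ h1.1)
      · change k⁻¹ • b' • y' ∈ P₂ at h1
        rw [← mul_smul] at h1
        have := hX'.uniq y' hy' _ h1.1
        rw [inv_mul_eq_one] at this
        exact hbk this.symm
    · change k⁻¹ • m • x' ∈ P₂ at hm
      rw [← mul_smul] at hm
      have := hX'.uniq x' hx' _ hm.1
      rw [inv_mul_eq_one] at this
      subst this
      rcases hm' with h1 | h1
      · rw [← mul_smul] at h1
        have := hX'.uniq y' hy' _ h1.1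
        exact hbk' (eq_inv_of_mul_eq_one_right this)
      · change k⁻¹ • k • b' • y' ∈ P₂ at h1
        rw [inv_smul_smul] at h1
        exact hb'1 (hX'.uniq y' hy' _ h1.1)
  have hstep2 := bAdj_of_avoids hT hG hX₁ hX' hB₁ hBX' hxy' hav3 hav2
  exact hstep1.near.trans hstep2.near

end Avoid

end OuterSpace

end

noncomputable section

namespace OuterSpace

/-! ### Comparing trees along an edge -/

section Compare

variable {Γ V V' : Type*} [Group Γ] [MulAction Γ V] [MulAction Γ V'] {G : SimpleGraph V}
  {G' : SimpleGraph V'}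

/-- The path from `x` to `y` in the tree is unique, so it contains no edge whose removal leaves `x`
and `y` connected. -/
theorem cutOrbit_reachable_of_forall (hT : G.IsTree) {p r x y : V}
    (h : ∀ g : Γ, (cut G (g • p) (g • r)).Reachable x y) : (cutOrbit Γ G p r).Reachable x y := by
  obtain ⟨w, hw, hu⟩ := hT.existsUnique_path x y
  have hnot : ∀ g : Γ, s(g • p, g • r) ∉ w.edges := by
    intro g hg
    obtain ⟨w', hw'⟩ := (h g).exists_isPath
    have h1 : (w'.mapLe (cut_le (G := G) _ _)).IsPath := by simpa using hw'
    rw [← hu _ h1, SimpleGraph.Walk.edges_mapLe_eq_edges] at hg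
    exact (cut_adj.1 (SimpleGraph.Walk.edges_subset_edgeSet _ hg)).2 rfl
  refine ⟨w.transfer (cutOrbit Γ G p r) fun e he => ?_⟩
  induction e with
  | _ a b => exact ⟨w.edges_subset_edgeSet he, fun g hg => hnot g (hg ▸ he)⟩

theorem cutOrbit_le_cut (g : Γ) (p r : V) : cutOrbit Γ G p r ≤ cut G (g • p) (g • r) :=
  fun _ _ h => cut_adj.2 ⟨h.1, h.2 g⟩

/-- An equivariant map which maps edges to edges or to vertices. -/
structure IsTreeMap (Γ : Type*) [Group Γ] {V V' : Type*} [MulAction Γ V] [MulAction Γ V']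
    (G : SimpleGraph V) (G' : SimpleGraph V') (q : V → V') : Prop where
  equivariant : ∀ (g : Γ) (v : V), q (g • v) = g • q v
  adj : ∀ x y, G.Adj x y → q x = q y ∨ G'.Adj (q x) (q y)

/-- Paths which avoid the orbit in `G` are mapped to paths which avoid it in `G'`, because the edge
has no other preimage. Conversely, the two sides of a translate of the edge in `G` are mapped to the
two sides of its image, which is a bridge; so vertices separated in `G` remain separated. -/
theorem IsTreeMap.cutOrbit_reachable_iff {q : V → V'} (hq : IsTreeMap Γ G G' q) (hT : G.IsTree)
    (hT' : G'.IsTree) (hG : IsInvariant Γ G) (hG' : IsInvariant Γ G') {p r : V}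
    (hpr' : G'.Adj (q p) (q r))
    (huniq : ∀ x y, G.Adj x y → s(q x, q y) = s(q p, q r) → s(x, y) = s(p, r)) {x y : V} :
    (cutOrbit Γ G p r).Reachable x y ↔ (cutOrbit Γ G' (q p) (q r)).Reachable (q x) (q y) := by
  have huniq' : ∀ (g : Γ) (x y : V), G.Adj x y → s(q x, q y) = s(g • q p, g • q r) →
      s(x, y) = s(g • p, g • r) := by
    intro g x y hxy he
    have h1 := huniq (g⁻¹ • x) (g⁻¹ • y) (hG g⁻¹ _ _ hxy) (by
      rw [hq.equivariant, hq.equivariant]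
      have he' := congrArg (Sym2.map (fun z => g⁻¹ • z)) he
      simpa using he')
    have h2 := congrArg (Sym2.map (fun z => g • z)) h1
    simpa using h2
  have hcut : ∀ (g : Γ) (x y : V), (cut G (g • p) (g • r)).Reachable x y →
      (cut G' (g • q p) (g • q r)).Reachable (q x) (q y) := by
    intro g x y hr
    refine reachable_of_closed
      (P := fun y => (cut G' (g • q p) (g • q r)).Reachable (q x) (q y)) ?_ hr
      (SimpleGraph.Reachable.refl _)
    intro a b hab ha
    rw [cut_adj] at hab
    rcases hq.adj a b hab.1 with h | h
    · rwa [← h]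
    · exact ha.trans (SimpleGraph.Adj.reachable (cut_adj.2 ⟨h, fun he => hab.2 (huniq' g a b hab.1 he)⟩))
  constructor
  · intro hr
    refine reachable_of_closed
      (P := fun y => (cutOrbit Γ G' (q p) (q r)).Reachable (q x) (q y)) ?_ hr
      (SimpleGraph.Reachable.refl _)
    intro a b hab ha
    rcases hq.adj a b hab.1 with h | h
    · rwa [← h]
    · exact ha.trans (SimpleGraph.Adj.reachable ⟨h, fun g he => hab.2 g (huniq' g a b hab.1 he)⟩)
  · intro hr
    refine cutOrbit_reachable_of_forall hT fun g => ?_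
    by_contra hn
    have hr' := hr.mono (cutOrbit_le_cut g (q p) (q r))
    have hbr : ¬ (cut G' (g • q p) (g • q r)).Reachable (g • q p) (g • q r) :=
      not_reachable_cut hT'.isAcyclic (hG' g _ _ hpr')
    have hp : q (g • p) = g • q p := hq.equivariant g p
    have hr0 : q (g • r) = g • q r := hq.equivariant g r
    rcases cut_reachable_or hT.connected (g • p) (g • r) x with hx | hx <;>
      rcases cut_reachable_or hT.connected (g • p) (g • r) y with hy | hy
    · exact hn (hx.symm.trans hy)
    · have h1 := hcut g _ _ hx
      have h2 := hcut g _ _ hy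
      rw [hp] at h1
      rw [hr0] at h2
      exact hbr ((h1.trans hr').trans h2.symm)
    · have h1 := hcut g _ _ hx
      have h2 := hcut g _ _ hy
      rw [hr0] at h1
      rw [hp] at h2
      exact hbr ((h2.trans hr'.symm).trans h1.symm)
    · exact hn (hx.symm.trans hy)

/-- Removing the orbit of the edge from `p` to `r` leaves a single orbit of components. -/
def NonSep (Γ : Type*) [Group Γ] {V : Type*} [MulAction Γ V] (G : SimpleGraph V) (p r : V) : Prop :=
  ∃ g : Γ, (cutOrbit Γ G p r).Reachable p (g • r)

/-- Crossing a deleted edge leads to a translate of `p` or of `r`. Thus there are at most two orbits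
of components. -/
theorem exists_reachable_endpoint (hT : G.IsTree) (hG : IsInvariant Γ G) (p r v : V) :
    ∃ g : Γ, (cutOrbit Γ G p r).Reachable p (g • v) ∨ (cutOrbit Γ G p r).Reachable r (g • v) := by
  have hH := cutOrbit_isInvariant hG p r
  refine reachable_of_closed (P := fun v => ∃ g : Γ, (cutOrbit Γ G p r).Reachable p (g • v) ∨
    (cutOrbit Γ G p r).Reachable r (g • v)) ?_ (hT.connected p v) ⟨1, Or.inl (by simp)⟩
  rintro a b hab ⟨g, hg⟩
  by_cases h : ∃ k : Γ, s(a, b) = s(k • p, k • r)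
  · obtain ⟨k, hk⟩ := h
    rcases Sym2.eq_iff.1 hk with ⟨rfl, rfl⟩ | ⟨rfl, rfl⟩
    · exact ⟨k⁻¹, Or.inr (by simp)⟩
    · exact ⟨k⁻¹, Or.inl (by simp)⟩
  · push Not at h
    have h1 : (cutOrbit Γ G p r).Reachable (g • a) (g • b) :=
      hH.reachable g (SimpleGraph.Adj.reachable ⟨hab, h⟩)
    exact ⟨g, hg.imp (fun h => h.trans h1) (fun h => h.trans h1)⟩

theorem mem_component_of_connectedOn {H : SimpleGraph V} {X : Set V} (hX : ConnectedOn H X)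
    {x y : V} (hx : x ∈ X) (hy : y ∈ X) : H.Reachable x y := (hX x hx y hy).mono (within_le X)

/-- All components are translates of that of `p`, so a transversal grown inside this component is
one for the whole tree. It avoids the edge, whose endpoints cannot lie in one component. -/
theorem exists_basis_of_nonSep (hT : G.IsTree) (hG : IsInvariant Γ G) (hfree : IsFreeAction Γ V)
    (htf : ∀ g : Γ, g * g = 1 → g = 1) {p r : V} (hpr : G.Adj p r) (hns : NonSep Γ G p r) :
    ∃ B : Set Γ, IsGeometric G B ∧ ∃ t ∈ B, Subgroup.closure (B \ {t}) =
      compStab (cutOrbit_isInvariant hG p r) p := by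
  have hH := cutOrbit_isInvariant hG p r
  obtain ⟨X, hPX, hX, hcov⟩ := exists_partialTransversal_extending hH hfree
    (isPartialTransversal_singleton hfree p)
  have hp : p ∈ X := hPX rfl
  have hX' : IsTransversal Γ G X := by
    refine ⟨⟨hX.conn.mono (cutOrbit_le p r), hX.uniq⟩, fun v => ?_⟩
    obtain ⟨g, hg | hg⟩ := exists_reachable_endpoint hT hG p r v
    · obtain ⟨k, hk⟩ := hcov p rfl _ hg
      exact ⟨k * g, by rwa [mul_smul]⟩
    · obtain ⟨m, hm⟩ := hns
      obtain ⟨k, hk⟩ := hcov p rfl _ (hm.trans (hH.reachable m hg))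
      exact ⟨k * (m * g), by rwa [mul_smul, mul_smul]⟩
  have hav : Avoids Γ X p r := by
    intro g h1 h2
    have h3 := mem_component_of_connectedOn hX.conn h1 h2
    exact (adj_of_reachable hT.isAcyclic (cutOrbit_le p r) h3 (hG g _ _ hpr)).2 g rfl
  obtain ⟨B, hB⟩ := exists_geometric (G := G) htf (X := X)
  exact ⟨B, ⟨X, hX', hB⟩, exists_closure_diff_eq_compStab hT.isAcyclic hG hX' hB hpr hav hp⟩

/-- Transversals for the two orbits of components, grown from `p` and from `r`, are joined by the
edge itself. No step leads from one half to a translate of the other, so the basis splits into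
generators of the two stabilizers. -/
theorem exists_basis_of_not_nonSep (hT : G.IsTree) (hG : IsInvariant Γ G)
    (hfree : IsFreeAction Γ V) (htf : ∀ g : Γ, g * g = 1 → g = 1) {p r : V} (hpr : G.Adj p r)
    (hns : ¬ NonSep Γ G p r) :
    ∃ B₁ B₂ : Set Γ, IsGeometric G (B₁ ∪ B₂) ∧ Disjoint B₁ B₂ ∧
      Subgroup.closure B₁ = compStab (cutOrbit_isInvariant hG p r) p ∧
      Subgroup.closure B₂ = compStab (cutOrbit_isInvariant hG p r) r := by
  have hH := cutOrbit_isInvariant hG p r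
  obtain ⟨X, hPX, hX, hXcov⟩ := exists_partialTransversal_extending hH hfree
    (isPartialTransversal_singleton hfree p)
  obtain ⟨Y, hPY, hY, hYcov⟩ := exists_partialTransversal_extending hH hfree
    (isPartialTransversal_singleton hfree r)
  have hp : p ∈ X := hPX rfl
  have hr : r ∈ Y := hPY rfl
  have hXp : ∀ x ∈ X, (cutOrbit Γ G p r).Reachable p x :=
    fun x hx => mem_component_of_connectedOn hX.conn hp hx
  have hYr : ∀ x ∈ Y, (cutOrbit Γ G p r).Reachable r x :=
    fun x hx => mem_component_of_connectedOn hY.conn hr hx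
  have hXY : ∀ x ∈ X, ∀ y ∈ Y, ∀ g : Γ, ¬ (cutOrbit Γ G p r).Reachable x (g • y) := by
    intro x hx y hy g hxy
    exact hns ⟨g, ((hXp x hx).trans hxy).trans (hH.reachable g (hYr y hy).symm)⟩
  have hZ : IsTransversal Γ G (X ∪ Y) := by
    refine ⟨⟨?_, ?_⟩, fun v => ?_⟩
    · exact (hX.conn.mono (cutOrbit_le p r)).union (hY.conn.mono (cutOrbit_le p r)) hp hr hpr
    · rintro x (hx | hx) g (hg | hg)
      · exact hX.uniq x hx g hg
      · refine absurd ?_ (hXY x hx _ hg g⁻¹)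
        rw [inv_smul_smul]
      · exact absurd (SimpleGraph.Reachable.refl _) (hXY _ hg x hx g)
      · exact hY.uniq x hx g hg
    · obtain ⟨g, hg | hg⟩ := exists_reachable_endpoint hT hG p r v
      · obtain ⟨k, hk⟩ := hXcov p rfl _ hg
        exact ⟨k * g, Or.inl (by rwa [mul_smul])⟩
      · obtain ⟨k, hk⟩ := hYcov r rfl _ hg
        exact ⟨k * g, Or.inr (by rwa [mul_smul])⟩
  obtain ⟨B, hB⟩ := exists_geometric (G := G) htf (X := X ∪ Y)
  have hsub : ∀ Z ⊆ X ∪ Y, steps Γ (cutOrbit Γ G p r) Z ⊆ steps Γ G (X ∪ Y) := by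
    rintro Z hZ g ⟨h1, x, hx, y, hy, hxy⟩
    exact ⟨h1, x, hZ hx, y, hZ hy, hxy.1⟩
  have hsX := hsub X Set.subset_union_left
  have hsY := hsub Y Set.subset_union_right
  have hsteps : ∀ g ∈ steps Γ G (X ∪ Y), g ∈ steps Γ (cutOrbit Γ G p r) X ∨
      g ∈ steps Γ (cutOrbit Γ G p r) Y := by
    rintro g ⟨hg1, x, hx, y, hy, hxy⟩
    have hadj : (cutOrbit Γ G p r).Adj x (g • y) := by
      refine ⟨hxy, fun k hk => ?_⟩
      rcases Sym2.eq_iff.1 hk with ⟨rfl, h2⟩ | ⟨rfl, h2⟩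
      · have := hZ.uniq p (Or.inl hp) k hx
        rw [this, one_smul] at h2
        refine hg1 (hZ.uniq y hy g ?_)
        rw [h2]
        exact Or.inr hr
      · have := hZ.uniq r (Or.inr hr) k hx
        rw [this, one_smul] at h2
        refine hg1 (hZ.uniq y hy g ?_)
        rw [h2]
        exact Or.inl hp
    rcases hx with hx | hx <;> rcases hy with hy | hy
    · exact Or.inl ⟨hg1, x, hx, y, hy, hadj⟩
    · exact absurd hadj.reachable (hXY x hx y hy g)
    · refine absurd (hH.reachable g⁻¹ hadj.symm.reachable) ?_
      rw [inv_smul_smul]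
      exact hXY y hy x hx g⁻¹
    · exact Or.inr ⟨hg1, x, hx, y, hy, hadj⟩
  have hhalf : ∀ Z, steps Γ (cutOrbit Γ G p r) Z ⊆ steps Γ G (X ∪ Y) →
      IsHalf (B ∩ steps Γ (cutOrbit Γ G p r) Z) (steps Γ (cutOrbit Γ G p r) Z) := by
    intro Z hZ'
    refine ⟨Set.inter_subset_right, fun s hs => ?_, fun b hb hb' => hB.inv_notMem b hb.1 hb'.1⟩
    exact (hB.cover s (hZ' hs)).imp (fun h => ⟨h, hs⟩) (fun h => ⟨h, inv_mem_steps hH hs⟩)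
  refine ⟨B ∩ steps Γ (cutOrbit Γ G p r) X, B ∩ steps Γ (cutOrbit Γ G p r) Y, ?_, ?_, ?_, ?_⟩
  · have : B ∩ steps Γ (cutOrbit Γ G p r) X ∪ B ∩ steps Γ (cutOrbit Γ G p r) Y = B := by
      ext b
      refine ⟨fun h => h.elim (fun h => h.1) (fun h => h.1), fun h => ?_⟩
      exact (hsteps b (hB.sub h)).imp (fun h' => ⟨h, h'⟩) (fun h' => ⟨h, h'⟩)
    rw [this]
    exact ⟨_, hZ, hB⟩
  · rw [Set.disjoint_left]
    rintro g ⟨-, hg1, x, hx, y, hy, hxy⟩ ⟨-, -, x', hx', y', hy', hxy'⟩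
    obtain ⟨rfl, -⟩ := edge_unique hT.isAcyclic hG hZ.toIsPartialTransversal hg1 (Or.inl hx)
      (Or.inr hx') (Or.inl hy) (Or.inr hy') hxy.1 hxy'.1
    exact hXY x hx x hx' 1 (by simp)
  · rw [(hhalf X hsX).closure_eq]
    exact closure_steps_eq_compStab hH hX hp (fun v => hXcov p rfl v)
  · rw [(hhalf Y hsY).closure_eq]
    exact closure_steps_eq_compStab hH hY hr (fun v => hYcov r rfl v)

/-- The halves are exchanged one after the other. While one of them is exchanged, an element of the
other is omitted from both bases to exhibit the adjacency; this requires both halves to be nonempty.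
-/
theorem bNear_of_same_closures {B₁ B₂ C₁ C₂ : Set Γ} (hB : IsBasis (B₁ ∪ B₂)) (hC : IsBasis (C₁ ∪ C₂))
    (hdB : Disjoint B₁ B₂) (hdC : Disjoint C₁ C₂)
    (h1 : Subgroup.closure B₁ = Subgroup.closure C₁)
    (h2 : Subgroup.closure B₂ = Subgroup.closure C₂) (hne1 : Subgroup.closure B₁ ≠ ⊥)
    (hne2 : Subgroup.closure B₂ ≠ ⊥) : BNear 2 (B₁ ∪ B₂) (C₁ ∪ C₂) := by
  have key : ∀ {D E E' : Set Γ} {d : Γ}, d ∈ D → IsBasis (E ∪ D) → IsBasis (E' ∪ D) → Disjoint E D →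
      Disjoint E' D → Subgroup.closure E = Subgroup.closure E' → BAdj (E ∪ D) (E' ∪ D) := by
    intro D E E' d hd hE hE' hdis hdis' hcl
    refine ⟨hE, hE', d, Or.inr hd, d, Or.inr hd, 1, ?_⟩
    have h : ∀ {E : Set Γ}, Disjoint E D → (E ∪ D) \ {d} = E ∪ (D \ {d}) := by
      intro E hdis
      rw [Set.union_sdiff_distrib, Set.sdiff_singleton_eq_self
        (fun h => Set.disjoint_left.1 hdis h hd)]
    rw [conjSub_one, h hdis, h hdis', Subgroup.closure_union, Subgroup.closure_union, hcl]
  have hnonempty : ∀ {D : Set Γ}, Subgroup.closure D ≠ ⊥ → D.Nonempty := by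
    intro D hD
    rw [Set.nonempty_iff_ne_empty]
    rintro rfl
    exact hD Subgroup.closure_empty
  have hmid : IsBasis (C₁ ∪ B₂) :=
    hB.replace hdB (hC.isFreeSet.mono Set.subset_union_left) h1.symm
  have hdmid : Disjoint C₁ B₂ := by
    rw [Set.disjoint_left]
    intro x hx hx'
    refine hB.notMem_closure (Or.inr hx') (S := B₁) Set.subset_union_left
      (fun h => Set.disjoint_left.1 hdB h hx') ?_
    rw [h1]
    exact Subgroup.subset_closure hx
  obtain ⟨b, hb⟩ := hnonempty hne2
  obtain ⟨c, hc⟩ := hnonempty (h1 ▸ hne1)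
  have s1 := key hb hB hmid hdB hdmid h1
  have s2 : BAdj (B₂ ∪ C₁) (C₂ ∪ C₁) :=
    key hc (Set.union_comm C₁ B₂ ▸ hmid) (Set.union_comm C₁ C₂ ▸ hC) hdmid.symm hdC.symm h2
  rw [Set.union_comm B₂, Set.union_comm C₂] at s2
  exact s1.near.trans s2.near

/-- Free trees with edges whose complements have the same stabilizers carry close bases. -/
theorem exists_near_of_same_edge {G' : SimpleGraph V'} (hT : G.IsTree) (hT' : G'.IsTree)
    (hG : IsInvariant Γ G) (hG' : IsInvariant Γ G') (hfree : IsFreeAction Γ V)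
    (hfree' : IsFreeAction Γ V') (htf : ∀ g : Γ, g * g = 1 → g = 1) {p r : V} {p' r' : V'}
    (hpr : G.Adj p r) (hpr' : G'.Adj p' r')
    (hp : compStab (cutOrbit_isInvariant hG p r) p = compStab (cutOrbit_isInvariant hG' p' r') p')
    (hr : compStab (cutOrbit_isInvariant hG p r) r = compStab (cutOrbit_isInvariant hG' p' r') r')
    (hns : NonSep Γ G p r ↔ NonSep Γ G' p' r')
    (hne : ¬ NonSep Γ G p r → compStab (cutOrbit_isInvariant hG p r) p ≠ ⊥ ∧
      compStab (cutOrbit_isInvariant hG p r) r ≠ ⊥) :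
    ∃ B B' : Set Γ, IsGeometric G B ∧ IsGeometric G' B' ∧ BNear 2 B B' := by
  -- A nonseparating edge gives an adjacency at once. For a separating edge both halves of the basis
  -- are exchanged, which is why both stabilizers have to be nontrivial.
  by_cases h : NonSep Γ G p r
  · obtain ⟨B, hB, t, ht, h1⟩ := exists_basis_of_nonSep hT hG hfree htf hpr h
    obtain ⟨B', hB', t', ht', h2⟩ := exists_basis_of_nonSep hT' hG' hfree' htf hpr' (hns.1 h)
    have hadj : BAdj B B' := ⟨hB.isBasis hT hG, hB'.isBasis hT' hG', t, ht, t', ht', 1, by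
      rw [conjSub_one, h1, h2, hp]⟩
    exact ⟨B, B', hB, hB', hadj.near.mono (by omega)⟩
  · obtain ⟨B₁, B₂, hB, hd, h1, h2⟩ := exists_basis_of_not_nonSep hT hG hfree htf hpr h
    obtain ⟨C₁, C₂, hC, hd', h1', h2'⟩ := exists_basis_of_not_nonSep hT' hG' hfree' htf hpr'
      (fun h' => h (hns.2 h'))
    obtain ⟨hn1, hn2⟩ := hne h
    refine ⟨_, _, hB, hC, bNear_of_same_closures (hB.isBasis hT hG) (hC.isBasis hT' hG') hd hd'
      ?_ ?_ ?_ ?_⟩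
    · rw [h1, h1', hp]
    · rw [h2, h2', hr]
    · rwa [h1]
    · rwa [h2]

theorem nonSep_symm (hG : IsInvariant Γ G) {p r : V} (h : NonSep Γ G r p) : NonSep Γ G p r := by
  obtain ⟨g, hg⟩ := h
  have hcomm : cutOrbit Γ G r p = cutOrbit Γ G p r := by
    ext x y
    simp only [cutOrbit, Sym2.eq_swap (a := _ • r)]
  rw [hcomm] at hg
  refine ⟨g⁻¹, ?_⟩
  have := (cutOrbit_isInvariant hG p r).reachable g⁻¹ hg.symm
  simpa using this

/-- A separating edge of a leafless cofinite tree has nontrivial stabilizers on both sides. -/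
theorem compStab_ne_bot (hT : G.IsTree) (hG : IsInvariant Γ G)
    [Finite (MulAction.orbitRel.Quotient Γ V)]
    (hleaf : ∀ v, ∃ a b, a ≠ b ∧ G.Adj v a ∧ G.Adj v b) {p r : V}
    (hns : ¬ NonSep Γ G p r) : compStab (cutOrbit_isInvariant hG p r) p ≠ ⊥ := by
  classical
  intro hbot
  have hH := cutOrbit_isInvariant hG p r
  let K : Set V := {v | (cutOrbit Γ G p r).Reachable p v}
  -- With trivial stabilizer the component meets each vertex orbit at most once, so it is finite.
  have hinj : Function.Injective
      (fun v : K => (Quotient.mk _ v.1 : MulAction.orbitRel.Quotient Γ V)) := by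
    intro v w hvw
    have h1 : (MulAction.orbitRel Γ V) v.1 w.1 := Quotient.exact hvw
    obtain ⟨g, hg⟩ := MulAction.orbitRel_apply.1 h1
    have h2 : g ∈ compStab hH p := by
      have h3 : (cutOrbit Γ G p r).Reachable (g • p) (g • w.1) := hH.reachable g w.2
      have h4 : g • w.1 = v.1 := hg
      rw [h4] at h3
      exact SimpleGraph.Reachable.trans v.2 h3.symm
    rw [hbot, Subgroup.mem_bot] at h2
    apply Subtype.ext
    rw [← hg, h2]
    simp
  have hKfin : Finite K := Finite.of_injective _ hinj
  have hKne : Nonempty K := ⟨⟨p, SimpleGraph.Reachable.refl _⟩⟩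
  choose P hP hu using fun w => hT.existsUnique_path r w
  -- A vertex of the component farthest from `r` has a neighbour which is farther still. The edge to
  -- it is not deleted: it would either be the edge leading to `r` itself, or show that the edge
  -- does not separate. So the neighbour belongs to the component, a contradiction.
  obtain ⟨⟨v, hv⟩, hmax⟩ := Finite.exists_max (fun v : K => (P v.1).length)
  obtain ⟨w, hvw, hwp⟩ : ∃ w, G.Adj v w ∧ w ≠ (P v).penultimate := by
    obtain ⟨a, b, hab, ha, hb⟩ := hleaf v
    by_cases h : a = (P v).penultimate
    · exact ⟨b, hb, fun h' => hab (h.trans h'.symm)⟩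
    · exact ⟨a, ha, h⟩
  have hws : w ∉ (P v).support := fun h => hwp (hT.isAcyclic.eq_penultimate_of_adj_end (hP v) hvw h)
  have hw : w ∈ K := by
    refine SimpleGraph.Reachable.trans hv (SimpleGraph.Adj.reachable ⟨hvw, fun g hg => ?_⟩)
    rcases Sym2.eq_iff.1 hg with ⟨h1, h2⟩ | ⟨h1, h2⟩
    · have : g ∈ compStab hH p := by
        rw [mem_compStab, ← h1]
        exact hv
      rw [hbot, Subgroup.mem_bot] at this
      rw [this, one_smul] at h2
      rw [h2] at hws
      exact hws (P v).start_mem_support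
    · exact hns ⟨g, h1 ▸ hv⟩
  have h1 := hu w _ ((hP v).concat hws hvw)
  have h2 : (P v).length + 1 ≤ (P v).length := by
    have := hmax ⟨w, hw⟩
    simp only at this
    rw [← h1, SimpleGraph.Walk.length_concat] at this
    exact this
  omega

end Compare

end OuterSpace

end

noncomputable section

namespace OuterSpace

/-! ### Folding -/

section Folding

variable {Γ : Type} [Group Γ] {W : Type} [MulAction Γ W] {T : SimpleGraph W}

/-- A free group of rank at least three (in the form needed below). -/
structure IsLargeFree (Γ : Type) [Group Γ] : Prop where
  tf : ∀ g : Γ, g * g = 1 → g = 1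
  three : ∀ B : Set Γ, IsBasis B → ∃ a ∈ B, ∃ b ∈ B, ∃ c ∈ B, a ≠ b ∧ a ≠ c ∧ b ≠ c

/-- A `Γ`-tree with finitely many orbits of vertices and an equivariant morphism to `T`. -/
structure TreeOver (Γ : Type) [Group Γ] {W : Type} [MulAction Γ W] (T : SimpleGraph W) where
  V : Type
  [act : MulAction Γ V]
  G : SimpleGraph V
  isTree : G.IsTree
  inv : IsInvariant Γ G
  f : V → W
  equivariant : ∀ (g : Γ) (v : V), f (g • v) = g • f v
  hom : ∀ x y, G.Adj x y → T.Adj (f x) (f y)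
  fin : Finite (MulAction.orbitRel.Quotient Γ V)

attribute [instance] TreeOver.act TreeOver.fin

namespace TreeOver

theorem free (hW : IsFreeAction Γ W) (Y : TreeOver Γ T) : IsFreeAction Γ Y.V := by
  intro g x hx
  refine hW g (Y.f x) ?_
  rw [← Y.equivariant, hx]

/-- The number of orbits of vertices. -/
def size (Y : TreeOver Γ T) : ℕ := Nat.card (MulAction.orbitRel.Quotient Γ Y.V)

/-- `Y'` is the quotient graph of `Y` defined by `q`. -/
structure IsQuot (Y Y' : TreeOver Γ T) (q : Y.V → Y'.V) : Prop where
  surj : Function.Surjective q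
  equivariant : ∀ (g : Γ) (v : Y.V), q (g • v) = g • q v
  map : ∀ v, Y'.f (q v) = Y.f v
  adj : ∀ a b, Y'.G.Adj a b ↔ ∃ x y, q x = a ∧ q y = b ∧ Y.G.Adj x y

theorem IsQuot.isTreeMap {Y Y' : TreeOver Γ T} {q : Y.V → Y'.V} (h : IsQuot Y Y' q) :
    IsTreeMap Γ Y.G Y'.G q :=
  ⟨h.equivariant, fun x y hxy => Or.inr ((h.adj _ _).2 ⟨x, y, rfl, rfl, hxy⟩)⟩

/-- The morphism to `T`. -/
def toHom (Y : TreeOver Γ T) : Y.G →g T := ⟨Y.f, fun {x y} h => Y.hom x y h⟩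

/-- A locally injective morphism to a tree would be injective. -/
theorem exists_fold_pair (hT : T.IsTree) (Y : TreeOver Γ T) (h : ¬ Function.Injective Y.f) :
    ∃ x y₁ y₂, Y.G.Adj x y₁ ∧ Y.G.Adj x y₂ ∧ y₁ ≠ y₂ ∧ Y.f y₁ = Y.f y₂ := by
  by_contra hn
  refine h (injective_of_locally_injective hT.isAcyclic Y.isTree.connected Y.toHom ?_)
  intro x y z hxy hxz he
  by_contra hyz
  exact hn ⟨x, y, z, hxy, hxz, hyz, he⟩

end TreeOver

theorem common_neighbor_unique {V : Type*} {G : SimpleGraph V} (hG : G.IsAcyclic) {w w' u z : V}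
    (hne : w ≠ w') (h1 : G.Adj u w) (h2 : G.Adj u w') (h3 : G.Adj z w) (h4 : G.Adj z w') :
    u = z := by
  by_contra hn
  refine not_reachable_cut hG h1 ?_
  have e1 : (cut G u w).Adj u w' := cut_adj.2 ⟨h2, fun h => by
    rcases Sym2.eq_iff.1 h with ⟨_, h⟩ | ⟨h, _⟩
    · exact hne h.symm
    · exact h1.ne h⟩
  have e2 : (cut G u w).Adj z w' := cut_adj.2 ⟨h4, fun h => by
    rcases Sym2.eq_iff.1 h with ⟨h, _⟩ | ⟨h, _⟩
    · exact hn h.symm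
    · exact h3.ne h⟩
  have e3 : (cut G u w).Adj z w := cut_adj.2 ⟨h3, fun h => by
    rcases Sym2.eq_iff.1 h with ⟨h, _⟩ | ⟨h, _⟩
    · exact hn h.symm
    · exact h3.ne h⟩
  exact (e1.reachable.trans e2.symm.reachable).trans e3.reachable

/-- Serves to see that one orbit of edges is crossed by at most one basis element, so that two
orbits of folded edges cannot account for three basis elements. -/
theorem step_edges_ne {V : Type*} [MulAction Γ V] {G : SimpleGraph V} {X : Set V}
    (hX : IsPartialTransversal Γ G X) {B : Set Γ} (hB : IsHalf B (steps Γ G X)) {b b' : Γ}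
    (hb : b ∈ B) (hb' : b' ∈ B) {x y x' y' : V} (hx : x ∈ X) (hy : y ∈ X) (hx' : x' ∈ X)
    (hy' : y' ∈ X) {k : Γ} (h : s(x', b' • y') = s(k • x, k • b • y)) : b = b' := by
  rcases Sym2.eq_iff.1 h with ⟨h1, h2⟩ | ⟨h1, h2⟩
  · have hk := hX.uniq x hx k (h1 ▸ hx')
    rw [hk, one_smul] at h2
    have := hX.uniq y' hy' (b⁻¹ * b') (by rwa [mul_smul, h2, inv_smul_smul])
    rwa [inv_mul_eq_one] at this
  · rw [← mul_smul] at h1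
    have hk := hX.uniq y hy _ (h1 ▸ hx')
    have h3 := hX.uniq y' hy' (k⁻¹ * b') (by rwa [mul_smul, h2, inv_smul_smul])
    rw [inv_mul_eq_one] at h3
    rw [h3] at hk
    rw [eq_inv_of_mul_eq_one_left hk] at hb'
    exact absurd hb' (hB.inv_notMem b hb)

theorem IsTreeMap.same_edge {V V' : Type*} [MulAction Γ V] [MulAction Γ V'] {G : SimpleGraph V}
    {G' : SimpleGraph V'} {q : V → V'} (hq : IsTreeMap Γ G G' q) (hT : G.IsTree)
    (hT' : G'.IsTree) (hG : IsInvariant Γ G) (hG' : IsInvariant Γ G') {p r : V}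
    (hpr' : G'.Adj (q p) (q r))
    (huniq : ∀ x y, G.Adj x y → s(q x, q y) = s(q p, q r) → s(x, y) = s(p, r)) :
    (∀ v, compStab (cutOrbit_isInvariant hG p r) v =
      compStab (cutOrbit_isInvariant hG' (q p) (q r)) (q v)) ∧
    (NonSep Γ G p r ↔ NonSep Γ G' (q p) (q r)) := by
  have h := @IsTreeMap.cutOrbit_reachable_iff _ _ _ _ _ _ _ _ q hq hT hT' hG hG' p r hpr' huniq
  constructor
  · intro v
    ext g
    rw [mem_compStab, mem_compStab, h, hq.equivariant]
  · refine exists_congr fun g => ?_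
    rw [h, hq.equivariant]

namespace TreeOver

/-- A fold identifies the orbits of two neighbours of a vertex which have the same image. Only two
orbits of edges are involved, whereas a basis read off from `Y` crosses at least three orbits
outside the transversal. So some nonseparating edge is unaffected, and the complement of its orbit
yields close bases of both trees. -/
theorem exists_fold (hΓ : IsLargeFree Γ) (hW : IsFreeAction Γ W) (hT : T.IsTree)
    (Y : TreeOver Γ T) (h : ¬ Function.Injective Y.f) :
    ∃ (Y' : TreeOver Γ T) (q : Y.V → Y'.V), IsQuot Y Y' q ∧ Y'.size < Y.size ∧
      ∃ B B' : Set Γ, IsGeometric Y.G B ∧ IsGeometric Y'.G B' ∧ BNear 2 B B' := by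
  classical
  obtain ⟨x, y₁, y₂, hxy₁, hxy₂, hne, hf⟩ := Y.exists_fold_pair hT h
  have hfree := Y.free hW
  have horb : ∀ g : Γ, y₁ ≠ g • y₂ := by
    intro g hg
    have h1 : Y.f y₁ = g • Y.f y₂ := by rw [← Y.equivariant, ← hg]
    rw [hf] at h1
    have h2 := hW g _ h1.symm
    rw [h2, one_smul] at hg
    exact hne hg
  -- The quotient is realised on the vertices outside the orbit of `y₂`, with `g • y₂` sent to `g •
  -- y₁`. This makes sense because the action on `T` is free, so that `y₁` and `y₂` lie in different
  -- orbits.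
  let V' : Type := {v : Y.V // ∀ g : Γ, v ≠ g • y₂}
  let act' : MulAction Γ V' :=
    { smul := fun g v => ⟨g • v.1, fun k hk => v.2 (g⁻¹ * k) (by
        rw [mul_smul, ← hk, inv_smul_smul])⟩
      one_smul := fun v => Subtype.ext (one_smul Γ v.1)
      mul_smul := fun g k v => Subtype.ext (mul_smul g k v.1) }
  have hsmul : ∀ (g : Γ) (v : V'), (g • v).1 = g • v.1 := fun _ _ => rfl
  let q : Y.V → V' := fun v => if hv : ∃ g : Γ, v = g • y₂ then
    ⟨hv.choose • y₁, fun k hk => horb (hv.choose⁻¹ * k) (by rw [mul_smul, ← hk, inv_smul_smul])⟩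
    else ⟨v, fun g hg => hv ⟨g, hg⟩⟩
  have hq1 : ∀ g : Γ, (q (g • y₂)).1 = g • y₁ := by
    intro g
    have hv : ∃ k : Γ, g • y₂ = k • y₂ := ⟨g, rfl⟩
    have h1 : g = hv.choose := hfree.eq_of_smul_eq hv.choose_spec
    simp only [q, dif_pos hv]
    rw [← h1]
  have hq2 : ∀ v : V', q v.1 = v := by
    intro v
    have hv : ¬ ∃ k : Γ, v.1 = k • y₂ := fun ⟨k, hk⟩ => v.2 k hk
    simp only [q, dif_neg hv]
    rfl
  have hq3 : ∀ v : Y.V, (q v).1 = v ∨ ∃ g : Γ, v = g • y₂ ∧ (q v).1 = g • y₁ := by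
    intro v
    by_cases hv : ∃ k : Γ, v = k • y₂
    · obtain ⟨k, rfl⟩ := hv
      exact Or.inr ⟨k, rfl, hq1 k⟩
    · exact Or.inl (by simp only [q, dif_neg hv])
  have hqeq : ∀ v w, q v = q w → v ≠ w →
      ∃ g : Γ, (v = g • y₁ ∧ w = g • y₂) ∨ (v = g • y₂ ∧ w = g • y₁) := by
    intro v w hvw hn
    rcases hq3 v with h1 | ⟨g, h1, h1'⟩ <;> rcases hq3 w with h2 | ⟨k, h2, h2'⟩
    · exact absurd (h1.symm.trans ((congrArg Subtype.val hvw).trans h2)) hn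
    · exact ⟨k, Or.inl ⟨by rw [← h1, hvw, h2'], h2⟩⟩
    · exact ⟨g, Or.inr ⟨h1, by rw [← h2, ← hvw, h1']⟩⟩
    · have : g • y₁ = k • y₁ := by rw [← h1', hvw, h2']
      rw [hfree.eq_of_smul_eq this] at h1
      exact absurd (h1.trans h2.symm) hn
  have hqequiv : ∀ (g : Γ) (v : Y.V), q (g • v) = g • q v := by
    intro g v
    apply Subtype.ext
    rw [hsmul]
    by_cases hv : ∃ k : Γ, v = k • y₂
    · obtain ⟨k, rfl⟩ := hv
      rw [← mul_smul, hq1, hq1, mul_smul]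
    · have hv' : ¬ ∃ k : Γ, g • v = k • y₂ := by
        rintro ⟨k, hk⟩
        exact hv ⟨g⁻¹ * k, by rw [mul_smul, ← hk, inv_smul_smul]⟩
      simp only [q, dif_neg hv, dif_neg hv']
  let f' : V' → W := fun v => Y.f v.1
  have hf' : ∀ v, f' (q v) = Y.f v := by
    intro v
    rcases hq3 v with h1 | ⟨g, h1, h2⟩
    · exact congrArg Y.f h1
    · change Y.f (q v).1 = _
      rw [h2, h1, Y.equivariant, Y.equivariant, hf]
  let G' : SimpleGraph V' :=
    { Adj := fun a b => ∃ x y, q x = a ∧ q y = b ∧ Y.G.Adj x y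
      symm := ⟨fun a b ⟨x, y, h1, h2, h3⟩ => ⟨y, x, h2, h1, h3.symm⟩⟩
      loopless := ⟨fun a ⟨x, y, h1, h2, h3⟩ => (Y.hom x y h3).ne (by
        rw [← hf', ← hf', h1, h2])⟩ }
  have hqadj : ∀ x y, Y.G.Adj x y → G'.Adj (q x) (q y) := fun x y hxy => ⟨x, y, rfl, rfl, hxy⟩
  have hconn : G'.Connected := by
    obtain ⟨v₀⟩ := Y.isTree.connected.nonempty
    have hne : Nonempty V' := ⟨q v₀⟩
    refine ⟨fun a b => ?_⟩
    have key : G'.Reachable (q a.1) (q b.1) := reachable_of_closed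
      (P := fun v => G'.Reachable (q a.1) (q v))
      (fun u v huv hu => hu.trans (hqadj u v huv).reachable) (Y.isTree.connected a.1 b.1)
      (SimpleGraph.Reachable.refl _)
    rwa [hq2, hq2] at key
  have htree : G'.IsTree := by
    refine isTree_of_cut hconn ?_
    rintro a b ⟨a₀, b₀, ha, hb, hab⟩
    -- Counts, modulo two, crossings of the edges with the given image. The potential descends to
    -- the quotient, since `y₁` and `y₂` are joined to a common vertex by edges with the same image.
    let c : Y.V → Y.V → Multiplicative (ZMod 2) := fun v w =>
      if s(q v, q w) = s(a, b) then Multiplicative.ofAdd 1 else 1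
    obtain ⟨Φ, -, hΦ⟩ := exists_potential Y.isTree c (by
      intro v w _
      simp only [c]
      rw [Sym2.eq_swap]
      split_ifs
      · decide
      · simp) a₀
    have hΦq : ∀ v, Φ (q v).1 = Φ v := by
      intro v
      rcases hq3 v with h1 | ⟨g, h1, h2⟩
      · rw [h1]
      · rw [h2, h1, hΦ _ _ (Y.inv g _ _ hxy₁), hΦ _ _ (Y.inv g _ _ hxy₂)]
        have : q (g • y₁) = q (g • y₂) := by
          rw [← h1, ← h2, hq2]
        simp only [c, this]
    refine ⟨fun v => Φ v.1 = 1, ?_, ?_⟩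
    · have h1 := hΦ _ _ hab
      have h2 : c a₀ b₀ = Multiplicative.ofAdd 1 := by
        simp only [c]
        rw [if_pos (by rw [ha, hb])]
      rw [h2, ← hΦq, ← hΦq a₀, ha, hb] at h1
      simp only [h1, ne_eq, eq_iff_iff]
      generalize Φ a.1 = t
      revert t
      decide
    · rintro u v ⟨u₀, v₀, rfl, rfl, huv⟩ hne'
      have h1 := hΦ _ _ huv
      have h2 : c u₀ v₀ = 1 := by
        simp only [c]
        rw [if_neg hne']
      rw [h2, mul_one] at h1
      simp only [hΦq, h1]
  have hinv : IsInvariant Γ G' := by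
    rintro g a b ⟨x, y, rfl, rfl, hxy⟩
    rw [← hqequiv, ← hqequiv]
    exact hqadj _ _ (Y.inv g x y hxy)
  have hsurj : Function.Surjective q := fun v => ⟨v.1, hq2 v⟩
  let qo : MulAction.orbitRel.Quotient Γ Y.V → MulAction.orbitRel.Quotient Γ V' :=
    Quotient.map' q (by
      intro a b hab
      obtain ⟨g, hg⟩ := MulAction.orbitRel_apply.1 hab
      exact MulAction.orbitRel_apply.2 ⟨g, by rw [← hg]; exact (hqequiv g b).symm⟩)
  have hqo : Function.Surjective qo := by
    intro a
    induction a using Quotient.inductionOn' with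
    | h a => exact ⟨Quotient.mk'' a.1, congrArg Quotient.mk'' (hq2 a)⟩
  have hfin : Finite (MulAction.orbitRel.Quotient Γ V') := Finite.of_surjective _ hqo
  let Y' : TreeOver Γ T :=
    { V := V', act := act', G := G', isTree := htree, inv := hinv, f := f'
      equivariant := fun g v => Y.equivariant g v.1
      hom := by
        rintro a b ⟨x, y, rfl, rfl, hxy⟩
        rw [hf', hf']
        exact Y.hom x y hxy
      fin := hfin }
  have hquot : IsQuot Y Y' q := ⟨hsurj, hqequiv, hf', fun a b => Iff.rfl⟩
  refine ⟨Y', q, hquot, ?_, ?_⟩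
  -- Two distinct vertex orbits, those of `y₁` and `y₂`, have become one.
  · by_contra hle
    have hle' : Nat.card (MulAction.orbitRel.Quotient Γ Y.V) ≤
      Nat.card (MulAction.orbitRel.Quotient Γ V') := not_lt.1 hle
    have hbij := hqo.bijective_of_nat_card_le hle'
    have h1 : qo (Quotient.mk'' y₁) = qo (Quotient.mk'' y₂) := by
      have h2 : q y₁ = q y₂ := by
        have h3 : q y₁ = ⟨y₁, horb⟩ := hq2 ⟨y₁, horb⟩
        have h4 := hq1 1
        rw [one_smul, one_smul] at h4
        rw [h3]
        exact Subtype.ext h4.symm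
      exact congrArg Quotient.mk'' h2
    have h2 := Quotient.exact' (hbij.1 h1)
    obtain ⟨g, hg⟩ := MulAction.orbitRel_apply.1 h2
    exact horb g hg.symm
  · obtain ⟨X, hX⟩ := exists_transversal Y.inv hfree Y.isTree.connected
    obtain ⟨B, hB⟩ := exists_geometric (G := Y.G) hΓ.tf (X := X)
    -- An edge sharing its image with another one is a translate of one of the two folded edges.
    -- Anything else would close a circuit in the tree.
    have hfold : ∀ u w u' w', Y.G.Adj u w → Y.G.Adj u' w' → q u = q u' → q w = q w' →
        ¬ (u = u' ∧ w = w') → ∃ g : Γ, s(u, w) = s(g • x, g • y₁) ∨ s(u, w) = s(g • x, g • y₂) := by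
      have hnb : ∀ v w, q v = q w → v ≠ w → ∃ g : Γ, Y.G.Adj (g • x) v ∧ Y.G.Adj (g • x) w ∧
          (v = g • y₁ ∨ v = g • y₂) := by
        intro v w hvw hn
        obtain ⟨g, ⟨rfl, rfl⟩ | ⟨rfl, rfl⟩⟩ := hqeq v w hvw hn
        · exact ⟨g, Y.inv g _ _ hxy₁, Y.inv g _ _ hxy₂, Or.inl rfl⟩
        · exact ⟨g, Y.inv g _ _ hxy₂, Y.inv g _ _ hxy₁, Or.inr rfl⟩
      have hac := Y.isTree.isAcyclic
      intro u w u' w' huw huw' hu hw hn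
      by_cases hu' : u = u'
      · have hw' : w ≠ w' := fun h => hn ⟨hu', h⟩
        obtain ⟨g, h1, h2, h3⟩ := hnb w w' hw hw'
        have := common_neighbor_unique hac hw' huw (hu' ▸ huw') h1 h2
        rw [this]
        exact ⟨g, h3.imp (fun h => by rw [h]) (fun h => by rw [h])⟩
      · obtain ⟨g, h1, h2, h3⟩ := hnb u u' hu hu'
        by_cases hw' : w = w'
        · have := common_neighbor_unique hac hu' huw.symm (hw' ▸ huw'.symm) h1 h2
          rw [this]
          exact ⟨g, h3.imp (fun h => by rw [h, Sym2.eq_swap]) (fun h => by rw [h, Sym2.eq_swap])⟩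
        obtain ⟨k, h4, h5, h6⟩ := hnb w w' hw hw'
        by_cases hgw : g • x = w
        · rw [← hgw]
          exact ⟨g, h3.imp (fun h => by rw [h, Sym2.eq_swap]) (fun h => by rw [h, Sym2.eq_swap])⟩
        by_cases hku : k • x = u
        · rw [← hku]
          exact ⟨k, h6.imp (fun h => by rw [h]) (fun h => by rw [h])⟩
        exfalso
        have hfu : Y.f u = Y.f u' := by rw [← hf', ← hf' u', hu]
        refine not_reachable_cut hac huw ?_
        have e1 : (cut Y.G u w).Adj (g • x) u := cut_adj.2 ⟨h1, fun h => by
          rcases Sym2.eq_iff.1 h with ⟨h, _⟩ | ⟨h, _⟩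
          · exact h1.ne h
          · exact hgw h⟩
        have e2 : (cut Y.G u w).Adj (g • x) u' := cut_adj.2 ⟨h2, fun h => by
          rcases Sym2.eq_iff.1 h with ⟨h, _⟩ | ⟨h, _⟩
          · exact h1.ne h
          · exact hgw h⟩
        have e3 : (cut Y.G u w).Adj u' w' := cut_adj.2 ⟨huw', fun h => by
          rcases Sym2.eq_iff.1 h with ⟨h, _⟩ | ⟨h, _⟩
          · exact hu' h.symm
          · rw [← h] at huw
            exact (Y.hom _ _ huw).ne hfu⟩
        have e4 : (cut Y.G u w).Adj (k • x) w' := cut_adj.2 ⟨h5, fun h => by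
          rcases Sym2.eq_iff.1 h with ⟨h, _⟩ | ⟨h, _⟩
          · exact hku h
          · exact h4.ne h⟩
        have e5 : (cut Y.G u w).Adj (k • x) w := cut_adj.2 ⟨h4, fun h => by
          rcases Sym2.eq_iff.1 h with ⟨h, _⟩ | ⟨h, _⟩
          · exact hku h
          · exact h4.ne h⟩
        exact ((((e1.symm.reachable).trans e2.reachable).trans e3.reachable).trans
          e4.symm.reachable).trans e5.reachable
    obtain ⟨b, hb, a, c, ha, hc, hac, hnf⟩ : ∃ b ∈ B, ∃ a c, a ∈ X ∧ c ∈ X ∧ Y.G.Adj a (b • c) ∧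
        ∀ g : Γ, s(a, b • c) ≠ s(g • x, g • y₁) ∧ s(a, b • c) ≠ s(g • x, g • y₂) := by
      by_contra hn
      have hall : ∀ b ∈ B, ∃ a c, a ∈ X ∧ c ∈ X ∧
          ((∃ g : Γ, s(a, b • c) = s(g • x, g • y₁)) ∨ ∃ g : Γ, s(a, b • c) = s(g • x, g • y₂)) := by
        intro b hb
        obtain ⟨-, a, ha, c, hc, hac⟩ := hB.sub hb
        refine ⟨a, c, ha, hc, ?_⟩
        by_contra hn'
        push Not at hn'
        exact hn ⟨b, hb, a, c, ha, hc, hac, fun g => ⟨hn'.1 g, hn'.2 g⟩⟩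
      have hsame : ∀ y, ∀ b ∈ B, ∀ b' ∈ B,
          (∃ a c, a ∈ X ∧ c ∈ X ∧ ∃ g : Γ, s(a, b • c) = s(g • x, g • y)) →
          (∃ a c, a ∈ X ∧ c ∈ X ∧ ∃ g : Γ, s(a, b' • c) = s(g • x, g • y)) → b = b' := by
        rintro y b hb b' hb' ⟨a, c, ha, hc, g, hg⟩ ⟨a', c', ha', hc', g', hg'⟩
        refine step_edges_ne hX.toIsPartialTransversal hB hb hb' ha hc ha' hc' (k := g' * g⁻¹) ?_
        have h1 := congrArg (Sym2.map (fun z => (g' * g⁻¹) • z)) hg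
        simp only [Sym2.map_mk] at h1
        rw [h1, hg']
        simp [mul_smul]
      have hsplit : ∀ b ∈ B, (∃ a c, a ∈ X ∧ c ∈ X ∧ ∃ g : Γ, s(a, b • c) = s(g • x, g • y₁)) ∨
          (∃ a c, a ∈ X ∧ c ∈ X ∧ ∃ g : Γ, s(a, b • c) = s(g • x, g • y₂)) := by
        intro b hb
        obtain ⟨a, c, ha, hc, h1 | h1⟩ := hall b hb
        · exact Or.inl ⟨a, c, ha, hc, h1⟩
        · exact Or.inr ⟨a, c, ha, hc, h1⟩
      obtain ⟨b₁, hb₁, b₂, hb₂, b₃, hb₃, h12, h13, h23⟩ :=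
        hΓ.three B (isBasis_of_isTransversal Y.isTree Y.inv hX hB)
      rcases hsplit b₁ hb₁ with h1 | h1 <;> rcases hsplit b₂ hb₂ with h2 | h2 <;>
        rcases hsplit b₃ hb₃ with h3 | h3 <;>
        first
          | exact h12 (hsame _ _ hb₁ _ hb₂ h1 h2)
          | exact h13 (hsame _ _ hb₁ _ hb₃ h1 h3)
          | exact h23 (hsame _ _ hb₂ _ hb₃ h2 h3)
    have huniq : ∀ u w, Y.G.Adj u w → s(q u, q w) = s(q a, q (b • c)) → s(u, w) = s(a, b • c) := by
      intro u w huw he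
      by_contra hne'
      rcases Sym2.eq_iff.1 he with ⟨h1, h2⟩ | ⟨h1, h2⟩
      · obtain ⟨g, hg⟩ := hfold a (b • c) u w hac huw h1.symm h2.symm
          (fun h => hne' (by rw [h.1, h.2]))
        exact hg.elim (hnf g).1 (hnf g).2
      · obtain ⟨g, hg⟩ := hfold a (b • c) w u hac huw.symm h2.symm h1.symm
          (fun h => hne' (by rw [h.1, h.2, Sym2.eq_swap]))
        exact hg.elim (hnf g).1 (hnf g).2
    have hcmp := hquot.isTreeMap.same_edge Y.isTree Y'.isTree Y.inv Y'.inv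
      (hqadj _ _ hac) huniq
    -- The transversal avoids the edge and connects one endpoint to a translate of the other.
    have hns : NonSep Γ Y.G a (b • c) := by
      refine ⟨b⁻¹, ?_⟩
      rw [inv_smul_smul]
      exact mem_component_of_connectedOn ((avoids_of_step Y.inv hX.toIsPartialTransversal
        (hB.sub hb).1 ha hc).connectedOn hX.conn) ha hc
    exact exists_near_of_same_edge Y.isTree Y'.isTree Y.inv Y'.inv hfree (Y'.free hW) hΓ.tf hac
      (hqadj _ _ hac) (hcmp.1 a) (hcmp.1 (b • c)) hcmp.2 (fun h => absurd hns h)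

end TreeOver

end Folding

end OuterSpace

end

noncomputable section

namespace OuterSpace

/-! ### Descent: the total effect of a folding sequence -/

section Descent

variable {Γ : Type} [Group Γ] {W : Type} [MulAction Γ W] {T : SimpleGraph W}

theorem cutOrbit_comm {V : Type*} [MulAction Γ V] (G : SimpleGraph V) (p r : V) :
    cutOrbit Γ G r p = cutOrbit Γ G p r := by
  ext x y
  simp only [cutOrbit, Sym2.eq_swap (a := _ • r)]

theorem compStab_ne_bot_right {V : Type*} [MulAction Γ V] {G : SimpleGraph V} (hT : G.IsTree)
    (hG : IsInvariant Γ G) [Finite (MulAction.orbitRel.Quotient Γ V)]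
    (hleaf : ∀ v, ∃ a b, a ≠ b ∧ G.Adj v a ∧ G.Adj v b) {p r : V}
    (hns : ¬ NonSep Γ G p r) : compStab (cutOrbit_isInvariant hG p r) r ≠ ⊥ := by
  have h := compStab_ne_bot hT hG hleaf (p := r) (r := p) (fun h => hns (nonSep_symm hG h))
  have : compStab (cutOrbit_isInvariant hG p r) r = compStab (cutOrbit_isInvariant hG r p) r := by
    ext g
    rw [mem_compStab, mem_compStab, cutOrbit_comm]
  rwa [this]

theorem IsGeometric.of_bijective {V : Type*} [MulAction Γ V] {G : SimpleGraph V}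
    {f : V → W} (hequiv : ∀ (g : Γ) (v : V), f (g • v) = g • f v) (hf : Function.Bijective f)
    (hadj : ∀ x y, T.Adj (f x) (f y) ↔ G.Adj x y) {B : Set Γ} (hB : IsGeometric G B) :
    IsGeometric T B := by
  obtain ⟨X, hX, hB⟩ := hB
  have hsteps : steps Γ T (f '' X) = steps Γ G X := by
    ext g
    constructor
    · rintro ⟨h1, _, ⟨x, hx, rfl⟩, _, ⟨y, hy, rfl⟩, h⟩
      rw [← hequiv, hadj] at h
      exact ⟨h1, x, hx, y, hy, h⟩
    · rintro ⟨h1, x, hx, y, hy, h⟩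
      refine ⟨h1, _, ⟨x, hx, rfl⟩, _, ⟨y, hy, rfl⟩, ?_⟩
      rwa [← hequiv, hadj]
  refine ⟨f '' X, ⟨⟨?_, ?_⟩, ?_⟩, by rwa [hsteps]⟩
  · rintro _ ⟨x, hx, rfl⟩ _ ⟨y, hy, rfl⟩
    refine reachable_of_closed (P := fun y => (within T (f '' X)).Reachable (f x) (f y)) ?_
      (hX.conn x hx y hy) (SimpleGraph.Reachable.refl _)
    intro u v huv hu
    exact hu.trans (SimpleGraph.Adj.reachable
      ⟨(hadj _ _).2 huv.1, ⟨u, huv.2.1, rfl⟩, ⟨v, huv.2.2, rfl⟩⟩)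
  · rintro _ ⟨x, hx, rfl⟩ g ⟨y, hy, h⟩
    rw [← hequiv] at h
    exact hX.uniq x hx g (hf.1 h ▸ hy)
  · intro w
    obtain ⟨v, rfl⟩ := hf.2 w
    obtain ⟨g, hg⟩ := hX.cover v
    exact ⟨g, g • v, hg, hequiv g v⟩

/-- There is no proper invariant subtree. -/
def IsMinimalTree (Γ : Type*) [Group Γ] {W : Type*} [MulAction Γ W] (T : SimpleGraph W) : Prop :=
  ∀ S : Set W, S.Nonempty → (∀ g : Γ, ∀ v ∈ S, g • v ∈ S) → ConnectedOn T S → S = Set.univ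

namespace TreeOver

/-- The image is an invariant subtree. -/
theorem surjective (hmin : IsMinimalTree Γ T) (Y : TreeOver Γ T) : Function.Surjective Y.f := by
  rw [← Set.range_eq_univ]
  obtain ⟨v₀⟩ := Y.isTree.connected.nonempty
  refine hmin _ ⟨_, v₀, rfl⟩ ?_ ?_
  · rintro g _ ⟨v, rfl⟩
    exact ⟨g • v, Y.equivariant g v⟩
  · rintro _ ⟨x, rfl⟩ _ ⟨y, rfl⟩
    refine reachable_of_closed (P := fun y => (within T (Set.range Y.f)).Reachable (Y.f x) (Y.f y))
      ?_ (Y.isTree.connected x y) (SimpleGraph.Reachable.refl _)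
    intro u v huv hu
    exact hu.trans (SimpleGraph.Adj.reachable ⟨Y.hom u v huv, ⟨u, rfl⟩, ⟨v, rfl⟩⟩)

/-- The images of the edges form a connected subgraph through all vertices of the tree `T`, so no
edge of `T` is missing. -/
theorem exists_edge (hT : T.IsTree) (hmin : IsMinimalTree Γ T) (Y : TreeOver Γ T) {p r : W}
    (hpr : T.Adj p r) : ∃ a b, Y.G.Adj a b ∧ Y.f a = p ∧ Y.f b = r := by
  let H : SimpleGraph W :=
    { Adj := fun u v => ∃ a b, Y.G.Adj a b ∧ Y.f a = u ∧ Y.f b = v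
      symm := ⟨fun u v ⟨a, b, h, h1, h2⟩ => ⟨b, a, h.symm, h2, h1⟩⟩
      loopless := ⟨fun u ⟨a, b, h, h1, h2⟩ => (Y.hom a b h).ne (h1.trans h2.symm)⟩ }
  have hH : H ≤ T := by
    rintro _ _ ⟨a, b, h, rfl, rfl⟩
    exact Y.hom a b h
  obtain ⟨x, rfl⟩ := Y.surjective hmin p
  obtain ⟨y, rfl⟩ := Y.surjective hmin r
  have hr : H.Reachable (Y.f x) (Y.f y) := reachable_of_closed
    (P := fun y => H.Reachable (Y.f x) (Y.f y))
    (fun u v huv hu => hu.trans (SimpleGraph.Adj.reachable ⟨u, v, huv, rfl, rfl⟩))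
    (Y.isTree.connected x y) (SimpleGraph.Reachable.refl _)
  exact adj_of_reachable hT.isAcyclic hH hr hpr

/-- The oriented edges over an oriented edge of `T`. -/
def fibre (Y : TreeOver Γ T) (p r : W) : Set (Y.V × Y.V) :=
  {z | Y.G.Adj z.1 z.2 ∧ Y.f z.1 = p ∧ Y.f z.2 = r}

/-- The action on `T` is free, so two vertices of one orbit with the same image coincide. An edge
over a given one is therefore determined by the orbits of its endpoints, which are finite in number.
-/
theorem fibre_finite (hW : IsFreeAction Γ W) (Y : TreeOver Γ T) (p r : W) :
    (Y.fibre p r).Finite := by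
  have key : ∀ v w : Y.V, Y.f v = Y.f w →
      (Quotient.mk'' v : MulAction.orbitRel.Quotient Γ Y.V) = Quotient.mk'' w → v = w := by
    intro v w hvw h
    obtain ⟨g, hg⟩ := MulAction.orbitRel_apply.1 (Quotient.exact' h)
    have hg' : g • w = v := hg
    have h1 := hW g (Y.f w) (by rw [← Y.equivariant, hg', hvw])
    rw [← hg', h1, one_smul]
  refine Set.Finite.of_finite_image (f := fun z : Y.V × Y.V =>
    ((Quotient.mk'' z.1 : MulAction.orbitRel.Quotient Γ Y.V),
      (Quotient.mk'' z.2 : MulAction.orbitRel.Quotient Γ Y.V))) (Set.toFinite _) ?_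
  rintro ⟨a, b⟩ ⟨-, ha, hb⟩ ⟨a', b'⟩ ⟨-, ha', hb'⟩ h
  simp only [Prod.mk.injEq] at h ha hb ha' hb'
  rw [key a a' (by rw [ha, ha']) h.1, key b b' (by rw [hb, hb']) h.2]

/-- The number of edges over an oriented edge of `T`. -/
def count (Y : TreeOver Γ T) (p r : W) : ℕ := (Y.fibre p r).ncard

/-- No vertex is a leaf for the morphism to `T`. -/
def Leafless (Y : TreeOver Γ T) : Prop :=
  ∀ v, ∃ a b, Y.G.Adj v a ∧ Y.G.Adj v b ∧ Y.f a ≠ Y.f b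

theorem IsQuot.leafless {Y Y' : TreeOver Γ T} {q : Y.V → Y'.V} (hq : IsQuot Y Y' q)
    (h : Y.Leafless) : Y'.Leafless := by
  intro v
  obtain ⟨v, rfl⟩ := hq.surj v
  obtain ⟨a, b, ha, hb, hab⟩ := h v
  refine ⟨q a, q b, (hq.adj _ _).2 ⟨v, a, rfl, rfl, ha⟩, (hq.adj _ _).2 ⟨v, b, rfl, rfl, hb⟩, ?_⟩
  rwa [hq.map, hq.map]

theorem IsQuot.image_fibre {Y Y' : TreeOver Γ T} {q : Y.V → Y'.V} (hq : IsQuot Y Y' q) (p r : W) :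
    Prod.map q q '' Y.fibre p r = Y'.fibre p r := by
  ext ⟨a, b⟩
  constructor
  · rintro ⟨⟨x, y⟩, ⟨h, h1, h2⟩, he⟩
    obtain ⟨rfl, rfl⟩ := Prod.mk.inj he
    exact ⟨(hq.adj _ _).2 ⟨x, y, rfl, rfl, h⟩, (hq.map x).trans h1, (hq.map y).trans h2⟩
  · rintro ⟨h, h1, h2⟩
    obtain ⟨x, y, rfl, rfl, hxy⟩ := (hq.adj _ _).1 h
    exact ⟨(x, y), ⟨hxy, (hq.map x).symm.trans h1, (hq.map y).symm.trans h2⟩, rfl⟩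

theorem IsQuot.count_le (hW : IsFreeAction Γ W) {Y Y' : TreeOver Γ T} {q : Y.V → Y'.V}
    (hq : IsQuot Y Y' q) (p r : W) : Y'.count p r ≤ Y.count p r := by
  rw [count, ← hq.image_fibre]
  exact Set.ncard_image_le (Y.fibre_finite hW p r)

/-- The complements of the orbits of two edges have the same stabilizers. -/
def SameEdge (Y Y' : TreeOver Γ T) (a b : Y.V) (a' b' : Y'.V) : Prop :=
  compStab (cutOrbit_isInvariant Y.inv a b) a = compStab (cutOrbit_isInvariant Y'.inv a' b') a' ∧
  compStab (cutOrbit_isInvariant Y.inv a b) b = compStab (cutOrbit_isInvariant Y'.inv a' b') b' ∧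
  (NonSep Γ Y.G a b ↔ NonSep Γ Y'.G a' b')

/-- If the count does not drop, the quotient map is injective on the edges over the given one. So
the image of the edge has a single preimage, and the complement of its orbit is unchanged. -/
theorem IsQuot.sameEdge (hW : IsFreeAction Γ W) {Y Y' : TreeOver Γ T} {q : Y.V → Y'.V}
    (hq : IsQuot Y Y' q) {p r : W} (hc : Y'.count p r = Y.count p r) {a b : Y.V}
    (hab : (a, b) ∈ Y.fibre p r) : SameEdge Y Y' a b (q a) (q b) := by
  have hinj : Set.InjOn (Prod.map q q) (Y.fibre p r) := by
    refine Set.injOn_of_ncard_image_eq ?_ (Y.fibre_finite hW p r)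
    rw [hq.image_fibre]
    exact hc
  have key : ∀ x y, Y.G.Adj x y → q x = q a → q y = q b → x = a ∧ y = b := by
    intro x y hxy h1 h2
    have hmem : (x, y) ∈ Y.fibre p r := ⟨hxy, by rw [← hq.map, h1, hq.map]; exact hab.2.1,
      by rw [← hq.map, h2, hq.map]; exact hab.2.2⟩
    exact Prod.mk.inj (hinj hmem hab (by simp [h1, h2]))
  have h := hq.isTreeMap.same_edge Y.isTree Y'.isTree Y.inv Y'.inv (p := a) (r := b)
    ((hq.adj _ _).2 ⟨a, b, rfl, rfl, hab.1⟩) (by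
      intro x y hxy he
      rcases Sym2.eq_iff.1 he with ⟨h1, h2⟩ | ⟨h1, h2⟩
      · obtain ⟨rfl, rfl⟩ := key x y hxy h1 h2
        rfl
      · obtain ⟨rfl, rfl⟩ := key y x hxy.symm h2 h1
        exact Sym2.eq_swap)
  exact ⟨h.1 a, h.1 b, h.2⟩

/-- Fold until the number of edges over the given edge is about to drop, or until the map to `T` is
injective. Up to that point the stabilizers attached to the chosen edge are carried along, however
many folds occur. The induction is on the number of vertex orbits. -/
theorem exists_last_equal (hΓ : IsLargeFree Γ) (hW : IsFreeAction Γ W) (hT : T.IsTree) {p r : W} :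
    ∀ (m : ℕ) (Y : TreeOver Γ T), Y.size ≤ m → Y.Leafless → ∀ a b, (a, b) ∈ Y.fibre p r →
    ∃ (Z : TreeOver Γ T) (a' b' : Z.V), SameEdge Y Z a b a' b' ∧ (a', b') ∈ Z.fibre p r ∧
      Z.Leafless ∧
      (Function.Injective Z.f ∨ ∃ Z' : TreeOver Γ T, Z'.Leafless ∧ Z'.count p r < Y.count p r ∧
        ∃ B B' : Set Γ, IsGeometric Z.G B ∧ IsGeometric Z'.G B' ∧ BNear 2 B B') := by
  intro m
  induction m with
  | zero =>
    intro Y hm _ a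
    exfalso
    have : Nonempty (MulAction.orbitRel.Quotient Γ Y.V) := ⟨Quotient.mk'' a⟩
    have h0 : 0 < Y.size := Nat.card_pos
    omega
  | succ m ih =>
    intro Y hm hY a b hab
    by_cases hinj : Function.Injective Y.f
    · exact ⟨Y, a, b, ⟨rfl, rfl, Iff.rfl⟩, hab, hY, Or.inl hinj⟩
    obtain ⟨Y', q, hq, hsize, hB⟩ := Y.exists_fold hΓ hW hT hinj
    rcases (hq.count_le hW p r).lt_or_eq with hlt | heq
    · exact ⟨Y, a, b, ⟨rfl, rfl, Iff.rfl⟩, hab, hY, Or.inr ⟨Y', hq.leafless hY, hlt, hB⟩⟩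
    · have hsame := hq.sameEdge hW heq hab
      have hab' : (q a, q b) ∈ Y'.fibre p r := by
        rw [← hq.image_fibre]
        exact ⟨(a, b), hab, rfl⟩
      obtain ⟨Z, a', b', h1, h2, h3, h4⟩ := ih Y' (by omega) (hq.leafless hY) (q a) (q b) hab'
      rw [heq] at h4
      exact ⟨Z, a', b', ⟨hsame.1.trans h1.1, hsame.2.1.trans h1.2.1, hsame.2.2.trans h1.2.2⟩,
        h2, h3, h4⟩

/-- Only the folds which decrease the number of edges over one fixed edge have a cost. Between two
of them the first and the last tree are compared directly, through the edge which has persisted. -/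
theorem exists_near_geometric (hΓ : IsLargeFree Γ) (hW : IsFreeAction Γ W) (hT : T.IsTree)
    (hmin : IsMinimalTree Γ T) {p r : W} (hpr : T.Adj p r) :
    ∀ (m : ℕ) (Y : TreeOver Γ T), Y.Leafless → Y.count p r ≤ m →
      ∃ B B' : Set Γ, IsGeometric Y.G B ∧ IsGeometric T B' ∧ BNear (8 * m) B B' := by
  intro m
  induction m with
  | zero =>
    intro Y _ hm
    exfalso
    obtain ⟨a, b, hab⟩ := Y.exists_edge hT hmin hpr
    have := (Set.ncard_pos (Y.fibre_finite hW p r)).2 ⟨(a, b), hab⟩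
    rw [count] at hm
    omega
  | succ m ih =>
    intro Y hY hm
    obtain ⟨a, b, hab⟩ := Y.exists_edge hT hmin hpr
    obtain ⟨Z, a', b', h1, h2, h3, h4⟩ :=
      exists_last_equal hΓ hW hT Y.size Y le_rfl hY a b (p := p) (r := r) hab
    have hleaf : ∀ v, ∃ a b, a ≠ b ∧ Y.G.Adj v a ∧ Y.G.Adj v b := fun v => by
      obtain ⟨a, b, ha, hb, hne⟩ := hY v
      exact ⟨a, b, fun h => hne (h ▸ rfl), ha, hb⟩
    obtain ⟨B₁, B₂, hB₁, hB₂, h12⟩ := exists_near_of_same_edge Y.isTree Z.isTree Y.inv Z.inv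
      (Y.free hW) (Z.free hW) hΓ.tf hab.1 h2.1 h1.1 h1.2.1 h1.2.2 (fun hns =>
        ⟨compStab_ne_bot Y.isTree Y.inv hleaf hns, compStab_ne_bot_right Y.isTree Y.inv hleaf hns⟩)
    rcases h4 with hinj | ⟨Z', hZ', hlt, B₃, B₄, hB₃, hB₄, h34⟩
    · exact ⟨B₁, B₂, hB₁, hB₂.of_bijective Z.equivariant ⟨hinj, Z.surjective hmin⟩
        (fun x y => ⟨adj_of_injective hT.isAcyclic Z.isTree.connected Z.toHom hinj, Z.hom x y⟩),
        h12.mono (by omega)⟩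
    · obtain ⟨B₅, B₆, hB₅, hB₆, h56⟩ := ih Z' hZ' (by omega)
      have hne : ∀ {V : Type} [MulAction Γ V] {G : SimpleGraph V} {B : Set Γ}, G.IsTree →
          IsInvariant Γ G → IsGeometric G B → B.Nontrivial := by
        intro V _ G B hG hinv hB
        obtain ⟨x, hx, y, hy, -, -, hxy, -⟩ := hΓ.three B (hB.isBasis hG hinv)
        exact ⟨x, hx, y, hy, hxy⟩
      have h23 := hB₂.near Z.isTree Z.inv hΓ.tf hB₃ (hne Z.isTree Z.inv hB₂).nonempty
        (hne Z.isTree Z.inv hB₃)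
      have h45 := hB₄.near Z'.isTree Z'.inv hΓ.tf hB₅ (hne Z'.isTree Z'.inv hB₄).nonempty
        (hne Z'.isTree Z'.inv hB₅)
      -- Four moves of length two for each drop of the count: along the persisting edge, within `Z`,
      -- across the fold, and within `Z'`.
      exact ⟨B₁, B₆, hB₁, hB₆, ((((h12.trans h23).trans h34).trans h45).trans h56).mono (by omega)⟩

end TreeOver

end Descent

end OuterSpace

end

noncomputable section

namespace OuterSpace

/-! ### Subgraphs which carry a free factor -/

section Marked

variable {Γ : Type} [Group Γ] {W : Type} [MulAction Γ W] {T : SimpleGraph W}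

theorem IsPartialTransversal.mono {V : Type*} [MulAction Γ V] {G H : SimpleGraph V} (h : H ≤ G)
    {X : Set V} (hX : IsPartialTransversal Γ H X) : IsPartialTransversal Γ G X :=
  ⟨hX.conn.mono h, hX.uniq⟩

theorem steps_mono {V : Type*} [MulAction Γ V] {G H : SimpleGraph V} (h : H ≤ G) {X X' : Set V}
    (hX : X ⊆ X') : steps Γ H X ⊆ steps Γ G X' := by
  rintro g ⟨h1, x, hx, y, hy, hxy⟩
  exact ⟨h1, x, hX hx, y, hX hy, h hxy⟩

theorem IsHalf.inter {B S S' : Set Γ} (hB : IsHalf B S) (hS : S' ⊆ S)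
    (hinv : ∀ s ∈ S', s⁻¹ ∈ S') : IsHalf (B ∩ S') S' :=
  ⟨Set.inter_subset_right, fun s hs => (hB.cover s (hS hs)).imp (fun h => ⟨h, hs⟩)
    (fun h => ⟨h, hinv s hs⟩), fun b hb hb' => hB.inv_notMem b hb.1 hb'.1⟩

/-- A subset of a basis contained in the stabilizer of a component of an invariant proper subgraph
extends to a basis adjacent to a geometric one. -/
theorem exists_bAdj_of_compStab {V : Type*} [MulAction Γ V] {G H : SimpleGraph V} (hG : G.IsTree)
    (hinv : IsInvariant Γ G) (hfree : IsFreeAction Γ V) (htf : ∀ g : Γ, g * g = 1 → g = 1)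
    (hHG : H ≤ G) (hH : IsInvariant Γ H) {y₀ : V} (hne : compStab hH y₀ ≠ ⊤) {B₀ C : Set Γ}
    (hB₀ : IsBasis B₀) (hC : C ⊆ B₀) (hCA : C ⊆ compStab hH y₀) :
    ∃ B' B : Set Γ, C ⊆ B' ∧ IsGeometric G B ∧ BAdj B' B := by
  obtain ⟨X₀, hP, hX₀, hcov⟩ := exists_partialTransversal_extending hH hfree
    (isPartialTransversal_singleton hfree y₀)
  have hy₀ : y₀ ∈ X₀ := hP rfl
  -- With a transversal adapted to the component, a part `S` of the geometric basis generates its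
  -- stabilizer. The part is replaced by another basis `D` of the stabilizer, one which contains
  -- `C`. As the stabilizer is proper, some element outside `S` is common to both bases and can be
  -- omitted from them.
  obtain ⟨X, hXX, hX⟩ := exists_transversal_extending hinv hfree hG.connected.preconnected
    (hX₀.mono hHG) ⟨y₀, hy₀⟩
  obtain ⟨B, hB⟩ := exists_geometric (G := G) htf (X := X)
  have hbasis := isBasis_of_isTransversal hG hinv hX hB
  set S : Set Γ := B ∩ steps Γ H X₀ with hS
  have hSB : S ⊆ B := Set.inter_subset_left
  have hcl : Subgroup.closure S = compStab hH y₀ := by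
    rw [(hB.inter (steps_mono hHG hXX) (fun s hs => inv_mem_steps hH hs)).closure_eq]
    exact closure_steps_eq_compStab hH hX₀ hy₀ (hcov y₀ rfl)
  obtain ⟨D, hCD, hD, hDcl⟩ := hB₀.exists_extend_to_subgroup hC htf hCA
  have hb : ∃ b ∈ B, b ∉ S := by
    by_contra hn
    push Not at hn
    exact hne (by rw [← hcl, Set.Subset.antisymm hSB hn, hbasis.closure_eq])
  obtain ⟨b, hb, hbS⟩ := hb
  have hdis : Disjoint S (B \ S) := Set.disjoint_sdiff_right
  have hBS : S ∪ (B \ S) = B := Set.union_sdiff_cancel hSB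
  have hbasis' : IsBasis (D ∪ (B \ S)) :=
    IsBasis.replace (B := S) (hBS.symm ▸ hbasis) hdis hD (hDcl.trans hcl.symm)
  have hbD : b ∉ D := by
    intro h
    refine hbasis.notMem_closure hb hSB hbS ?_
    rw [hcl, ← hDcl]
    exact Subgroup.subset_closure h
  refine ⟨D ∪ (B \ S), B, hCD.trans Set.subset_union_left, ⟨X, hX, hB⟩, hbasis', hbasis,
    b, Or.inr ⟨hb, hbS⟩, b, hb, 1, ?_⟩
  rw [conjSub_one]
  have h1 : (D ∪ (B \ S)) \ {b} = D ∪ ((B \ S) \ {b}) := by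
    rw [Set.union_sdiff_distrib, Set.sdiff_singleton_eq_self hbD]
  have h2 : B \ {b} = S ∪ ((B \ S) \ {b}) := by
    conv_lhs => rw [← hBS]
    rw [Set.union_sdiff_distrib, Set.sdiff_singleton_eq_self hbS]
  rw [h1, h2, Subgroup.closure_union, Subgroup.closure_union, hDcl, hcl]

/-- A tree over `T` with an invariant subgraph which crosses the edge from `p` to `r` few times, and
which contains paths from `y₀` to its translates by `C`. -/
structure IsMarked (C : Set Γ) (p r : W) (m : ℕ) (Y : TreeOver Γ T) (H : SimpleGraph Y.V)
    (y₀ : Y.V) : Prop where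
  le : H ≤ Y.G
  inv : IsInvariant Γ H
  mem : ∀ c ∈ C, H.Reachable y₀ (c • y₀)
  start : ∃ y, H.Adj y₀ y
  leafless : ∀ x y, H.Adj x y → ∃ a b, H.Adj x a ∧ H.Adj x b ∧ Y.f a ≠ Y.f b
  count : {z : Y.V × Y.V | H.Adj z.1 z.2 ∧ Y.f z.1 = p ∧ Y.f z.2 = r}.ncard ≤ m

namespace IsMarked

variable {C : Set Γ} {p r : W} {m : ℕ}

/-- Leaflessness is tested on images in `T`, and the count concerns edges over a fixed edge of `T`,
so both conditions survive folding. -/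
theorem quot (hW : IsFreeAction Γ W) {Y Y' : TreeOver Γ T} {q : Y.V → Y'.V}
    (hq : TreeOver.IsQuot Y Y' q) {H : SimpleGraph Y.V} {y₀ : Y.V}
    (h : IsMarked C p r m Y H y₀) : ∃ H' : SimpleGraph Y'.V, IsMarked C p r m Y' H' (q y₀) := by
  let H' : SimpleGraph Y'.V :=
    { Adj := fun a b => ∃ x y, q x = a ∧ q y = b ∧ H.Adj x y
      symm := ⟨fun a b ⟨x, y, h1, h2, h3⟩ => ⟨y, x, h2, h1, h3.symm⟩⟩
      loopless := ⟨fun a ⟨x, y, h1, h2, h3⟩ => (Y.hom x y (h.le h3)).ne (by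
        rw [← hq.map, ← hq.map, h1, h2])⟩ }
  have hadj : ∀ x y, H.Adj x y → H'.Adj (q x) (q y) := fun x y hxy => ⟨x, y, rfl, rfl, hxy⟩
  have hfin : {z : Y.V × Y.V | H.Adj z.1 z.2 ∧ Y.f z.1 = p ∧ Y.f z.2 = r}.Finite :=
    (Y.fibre_finite hW p r).subset fun z hz => ⟨h.le hz.1, hz.2⟩
  refine ⟨H', ?_, ?_, ?_, ?_, ?_, ?_⟩
  · rintro a b ⟨x, y, rfl, rfl, hxy⟩
    exact (hq.adj _ _).2 ⟨x, y, rfl, rfl, h.le hxy⟩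
  · rintro g a b ⟨x, y, rfl, rfl, hxy⟩
    rw [← hq.equivariant, ← hq.equivariant]
    exact hadj _ _ (h.inv g x y hxy)
  · intro c hc
    rw [← hq.equivariant]
    exact reachable_of_closed (P := fun v => H'.Reachable (q y₀) (q v))
      (fun u v huv hu => hu.trans (hadj u v huv).reachable) (h.mem c hc)
      (SimpleGraph.Reachable.refl _)
  · obtain ⟨y, hy⟩ := h.start
    exact ⟨q y, hadj _ _ hy⟩
  · rintro _ _ ⟨x, y, rfl, rfl, hxy⟩
    obtain ⟨a, b, ha, hb, hab⟩ := h.leafless x y hxy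
    exact ⟨q a, q b, hadj _ _ ha, hadj _ _ hb, by rwa [hq.map, hq.map]⟩
  · refine le_trans ?_ h.count
    refine le_trans (Set.ncard_le_ncard ?_ (hfin.image (Prod.map q q))) (Set.ncard_image_le hfin)
    rintro ⟨a, b⟩ ⟨⟨x, y, rfl, rfl, hxy⟩, h1, h2⟩
    exact ⟨(x, y), ⟨hxy, (hq.map x).symm.trans h1, (hq.map y).symm.trans h2⟩, rfl⟩

/-- The marked component, if it is invariant. -/
def component {Y : TreeOver Γ T} {H : SimpleGraph Y.V} {y₀ : Y.V} (h : IsMarked C p r m Y H y₀)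
    (hinv : ∀ g : Γ, H.Reachable y₀ (g • y₀)) : TreeOver Γ T where
  V := {x : Y.V // H.Reachable y₀ x}
  act :=
    { smul := fun g v => ⟨g • v.1, (hinv g).trans (h.inv.reachable g v.2)⟩
      one_smul := fun v => Subtype.ext (one_smul Γ v.1)
      mul_smul := fun g k v => Subtype.ext (mul_smul g k v.1) }
  G := H.comap Subtype.val
  isTree := by
    have hconn : (H.induce {x | H.Reachable y₀ x}).Connected :=
      (connectedOn_component y₀).induce_connected ⟨y₀, SimpleGraph.Reachable.refl _⟩
    refine ⟨hconn, ?_⟩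
    exact (Y.isTree.isAcyclic.anti h.le).comap ⟨Subtype.val, fun {_ _} h => h⟩
      Subtype.val_injective
  inv := fun g x y hxy => h.inv g x.1 y.1 hxy
  f := fun v => Y.f v.1
  equivariant := fun g v => Y.equivariant g v.1
  hom := fun x y hxy => Y.hom x.1 y.1 (h.le hxy)
  fin := by
    refine Finite.of_injective (β := MulAction.orbitRel.Quotient Γ Y.V)
      (Quotient.map' Subtype.val ?_) ?_
    · intro a b hab
      obtain ⟨g, hg⟩ := hab
      exact ⟨g, congrArg Subtype.val hg⟩
    · intro a b
      induction a using Quotient.inductionOn'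
      induction b using Quotient.inductionOn'
      intro hab
      obtain ⟨g, hg⟩ := MulAction.orbitRel_apply.1 (Quotient.exact' hab)
      exact Quotient.sound' ⟨g, Subtype.ext hg⟩

/-- The component is itself a leafless tree over `T`, with few edges over the fixed edge, so the
descent applies to it. A basis read off from it is also read off from `Y`: the transversal extends,
and a basis contained in another one is equal to it. -/
theorem exists_near_of_invariant (hΓ : IsLargeFree Γ) (hW : IsFreeAction Γ W) (hT : T.IsTree)
    (hmin : IsMinimalTree Γ T) (hpr : T.Adj p r) {Y : TreeOver Γ T} {H : SimpleGraph Y.V}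
    {y₀ : Y.V} (h : IsMarked C p r m Y H y₀) (hinv : ∀ g : Γ, H.Reachable y₀ (g • y₀)) :
    ∃ B B' : Set Γ, IsGeometric Y.G B ∧ IsGeometric T B' ∧ BNear (8 * m) B B' := by
  have hleaf : (h.component hinv).Leafless := by
    rintro ⟨x, hx⟩
    have hy : ∃ y, H.Adj x y := by
      by_cases hxy : x = y₀
      · rw [hxy]
        exact h.start
      · obtain ⟨w⟩ := hx.symm
        cases w with
        | nil => exact absurd rfl hxy
        | cons h' _ => exact ⟨_, h'⟩
    obtain ⟨y, hy⟩ := hy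
    obtain ⟨a, b, ha, hb, hab⟩ := h.leafless x y hy
    exact ⟨⟨a, hx.trans ha.reachable⟩, ⟨b, hx.trans hb.reachable⟩, ha, hb, hab⟩
  have hcount : (h.component hinv).count p r ≤ m := by
    refine le_trans ?_ h.count
    have hfin : {z : Y.V × Y.V | H.Adj z.1 z.2 ∧ Y.f z.1 = p ∧ Y.f z.2 = r}.Finite :=
      (Y.fibre_finite hW p r).subset fun z hz => ⟨h.le hz.1, hz.2⟩
    refine Set.ncard_le_ncard_of_injOn (Prod.map Subtype.val Subtype.val) ?_ ?_ hfin
    · rintro ⟨a, b⟩ hab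
      exact hab
    · exact (Subtype.val_injective.prodMap Subtype.val_injective).injOn
  obtain ⟨B, B', hB, hB', hn⟩ :=
    (h.component hinv).exists_near_geometric hΓ hW hT hmin hpr m hleaf hcount
  refine ⟨B, B', ?_, hB', hn⟩
  have hBbasis : IsBasis B := hB.isBasis (h.component hinv).isTree (h.component hinv).inv
  obtain ⟨X, hX, hBX⟩ := hB
  have hX₀ : IsPartialTransversal Γ H (Subtype.val '' X) := by
    constructor
    · rintro _ ⟨x, hx, rfl⟩ _ ⟨y, hy, rfl⟩
      refine reachable_of_closed
        (P := fun y : (h.component hinv).V => (within H (Subtype.val '' X)).Reachable x.1 y.1) ?_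
        (hX.conn x hx y hy) (SimpleGraph.Reachable.refl _)
      intro u v huv hu
      exact hu.trans (SimpleGraph.Adj.reachable
        ⟨huv.1, ⟨u, huv.2.1, rfl⟩, ⟨v, huv.2.2, rfl⟩⟩)
    · rintro _ ⟨x, hx, rfl⟩ g ⟨y, hy, hxy⟩
      have : y = (h.component hinv).act.smul g x := Subtype.ext hxy
      refine hX.uniq x hx g ?_
      change (h.component hinv).act.smul g x ∈ X
      rwa [← this]
  obtain ⟨x₁, hx₁⟩ := hX.nonempty ⟨y₀, SimpleGraph.Reachable.refl _⟩
  obtain ⟨X', hXX', hX'⟩ := exists_transversal_extending Y.inv (Y.free hW)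
    Y.isTree.connected.preconnected (hX₀.mono h.le) ⟨_, x₁, hx₁, rfl⟩
  have hsub : steps Γ (h.component hinv).G X ⊆ steps Γ Y.G X' := by
    rintro g ⟨h1, x, hx, y, hy, hxy⟩
    exact ⟨h1, x.1, hXX' ⟨x, hx, rfl⟩, y.1, hXX' ⟨y, hy, rfl⟩, h.le hxy⟩
  obtain ⟨B₁, hBB₁, hB₁⟩ := exists_isHalf_extending (steps_inv_ne (G := Y.G) hΓ.tf (X := X'))
    (hBX.sub.trans hsub) hBX.inv_notMem
  have := (isBasis_of_isTransversal Y.isTree Y.inv hX' hB₁).eq_of_subset hBB₁ hBbasis.closure_eq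
  rw [this]
  exact ⟨X', hX', hB₁⟩

/-- As long as the stabilizer of the marked component is proper, `C` extends to a basis adjacent to
one read off from the current tree, so folding can go on without accumulating any cost. The cost
arises at the fold after which the stabilizer is the whole group. If there is no such fold, the
sequence ends with `T` itself. -/
theorem exists_near (hΓ : IsLargeFree Γ) (hW : IsFreeAction Γ W) (hT : T.IsTree)
    (hmin : IsMinimalTree Γ T) (hpr : T.Adj p r) {B₀ : Set Γ} (hB₀ : IsBasis B₀) (hC : C ⊆ B₀) :
    ∀ (s : ℕ) (Y : TreeOver Γ T) (H : SimpleGraph Y.V) (y₀ : Y.V), Y.size ≤ s →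
      IsMarked C p r m Y H y₀ → (¬ ∀ g : Γ, H.Reachable y₀ (g • y₀)) →
      ∃ B' B : Set Γ, C ⊆ B' ∧ IsGeometric T B ∧ BNear (8 * m + 7) B' B := by
  intro s
  induction s with
  | zero =>
    intro Y H y₀ hs
    exfalso
    have : Nonempty (MulAction.orbitRel.Quotient Γ Y.V) := ⟨Quotient.mk'' y₀⟩
    have h0 : 0 < Y.size := Nat.card_pos
    omega
  | succ s ih =>
    intro Y H y₀ hs h hN
    obtain ⟨B', B, hCB, hB, hadj⟩ := exists_bAdj_of_compStab Y.isTree Y.inv (Y.free hW) hΓ.tf h.le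
      h.inv (y₀ := y₀) (fun htop => hN fun g => by
        rw [← mem_compStab h.inv, htop]
        exact Subgroup.mem_top g) hB₀ hC h.mem
    by_cases hinj : Function.Injective Y.f
    · exact ⟨B', B, hCB, hB.of_bijective Y.equivariant ⟨hinj, Y.surjective hmin⟩
        (fun x y => ⟨adj_of_injective hT.isAcyclic Y.isTree.connected Y.toHom hinj, Y.hom x y⟩),
        hadj.near.mono (by omega)⟩
    obtain ⟨Y', q, hq, hsize, B₁, B₂, hB₁, hB₂, h12⟩ := Y.exists_fold hΓ hW hT hinj
    obtain ⟨H', h'⟩ := h.quot hW hq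
    by_cases hN' : ∀ g : Γ, H'.Reachable (q y₀) (g • q y₀)
    · obtain ⟨B₃, B₄, hB₃, hB₄, h34⟩ := h'.exists_near_of_invariant hΓ hW hT hmin hpr hN'
      have hne : ∀ {V : Type} [MulAction Γ V] {G : SimpleGraph V} {B : Set Γ}, G.IsTree →
          IsInvariant Γ G → IsGeometric G B → B.Nontrivial := by
        intro V _ G B hG hinv hB
        obtain ⟨x, hx, y, hy, -, -, hxy, -⟩ := hΓ.three B (hB.isBasis hG hinv)
        exact ⟨x, hx, y, hy, hxy⟩
      have h01 := hB.near Y.isTree Y.inv hΓ.tf hB₁ (hne Y.isTree Y.inv hB).nonempty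
        (hne Y.isTree Y.inv hB₁)
      have h23 := hB₂.near Y'.isTree Y'.inv hΓ.tf hB₃ (hne Y'.isTree Y'.inv hB₂).nonempty
        (hne Y'.isTree Y'.inv hB₃)
      -- One adjacency, three moves of length two around the fold, and `8 * m` for the descent.
      exact ⟨B', B₄, hCB, hB₄,
        ((((hadj.near.trans h01).trans h12).trans h23).trans h34).mono (by omega)⟩
    · exact ih Y' H' (q y₀) (by omega) h' hN'

end IsMarked

end Marked

end OuterSpace

end

noncomputable section

namespace OuterSpace

/-! ### Subdivided Cayley trees -/

section Petals

variable {Γ : Type} [Group Γ] {W : Type} [MulAction Γ W] {T : SimpleGraph W} {B : Set Γ}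

/-- Edge paths in `T` from a vertex to its translates by the elements of `B`. -/
structure Petals (B : Set Γ) (T : SimpleGraph W) where
  v : W
  len : Γ → ℕ
  u : Γ → ℕ → W
  pos : ∀ b ∈ B, 0 < len b
  zero : ∀ b ∈ B, u b 0 = v
  last : ∀ b ∈ B, u b (len b) = b • v
  adj : ∀ b ∈ B, ∀ i < len b, T.Adj (u b i) (u b (i + 1))

namespace Petals

/-- The vertices of the subdivided Cayley tree. -/
structure Vert (π : Petals B T) : Type where
  fst : Γ
  snd : Option {z : Γ × ℕ // z.1 ∈ B ∧ 0 < z.2 ∧ z.2 < π.len z.1}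

instance (π : Petals B T) : MulAction Γ π.Vert where
  smul g x := ⟨g * x.1, x.2⟩
  one_smul x := by
    change Vert.mk (1 * x.1) x.2 = x
    rw [one_mul]
  mul_smul g k x := by
    change Vert.mk (g * k * x.1) x.2 = Vert.mk (g * (k * x.1)) x.2
    rw [mul_assoc]

/-- The vertices of the Cayley tree. -/
def base (π : Petals B T) (g : Γ) : π.Vert := ⟨g, none⟩

theorem smul_base (π : Petals B T) (k g : Γ) : k • π.base g = π.base (k * g) := rfl

open Classical in
/-- The vertices along the edge path labelled by `b`. -/
def node (π : Petals B T) (g b : Γ) (i : ℕ) : π.Vert :=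
  if h : b ∈ B ∧ 0 < i ∧ i < π.len b then ⟨g, some ⟨(b, i), h⟩⟩
  else if i = 0 then (π.base g) else (π.base (g * b))

/-- The map to `T`. -/
def toT (π : Petals B T) (x : π.Vert) : W :=
  match x.2 with
  | none => x.1 • π.v
  | some z => x.1 • π.u z.1.1 z.1.2

theorem node_zero (π : Petals B T) (g b : Γ) : π.node g b 0 = (π.base g) := by
  simp [node]

theorem node_len (π : Petals B T) (g : Γ) {b : Γ} (hb : b ∈ B) :
    π.node g b (π.len b) = (π.base (g * b)) := by
  simp [node, (π.pos b hb).ne']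

theorem node_mid (π : Petals B T) (g : Γ) {b : Γ} {i : ℕ} (h : b ∈ B ∧ 0 < i ∧ i < π.len b) :
    π.node g b i = ⟨g, some ⟨(b, i), h⟩⟩ := by
  rw [node, dif_pos h]

theorem smul_node (π : Petals B T) (k g b : Γ) (i : ℕ) :
    k • π.node g b i = π.node (k * g) b i := by
  by_cases h : b ∈ B ∧ 0 < i ∧ i < π.len b
  · rw [node, dif_pos h, node, dif_pos h]
    rfl
  · rw [node, dif_neg h, node, dif_neg h]
    split_ifs
    · rfl
    · rw [smul_base, mul_assoc]

theorem toT_smul (π : Petals B T) (k : Γ) (x : π.Vert) : π.toT (k • x) = k • π.toT x := by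
  obtain ⟨g, o⟩ := x
  cases o with
  | none => exact mul_smul k g _
  | some z => exact mul_smul k g _

theorem toT_node (π : Petals B T) (g : Γ) {b : Γ} (hb : b ∈ B) {i : ℕ} (hi : i ≤ π.len b) :
    π.toT (π.node g b i) = g • π.u b i := by
  rcases Nat.eq_zero_or_pos i with rfl | h0
  · rw [node_zero, π.zero b hb]
    rfl
  rcases hi.lt_or_eq with h1 | rfl
  · rw [π.node_mid g ⟨hb, h0, h1⟩]
    rfl
  · rw [π.node_len g hb, π.last b hb]
    exact mul_smul g b _

/-- The subgraph of edges with labels in `S`. -/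
def graph (π : Petals B T) (S : Set Γ) (hinv : IsInvariant Γ T) : SimpleGraph π.Vert where
  Adj x y := ∃ b ∈ B, b ∈ S ∧ ∃ (g : Γ) (i : ℕ), i < π.len b ∧
    s(x, y) = s(π.node g b i, π.node g b (i + 1))
  symm := ⟨fun x y ⟨b, hb, hS, g, i, hi, h⟩ => ⟨b, hb, hS, g, i, hi, by rw [← h, Sym2.eq_swap]⟩⟩
  loopless := ⟨fun x ⟨b, hb, hS, g, i, hi, h⟩ => by
    have h1 : π.node g b i = π.node g b (i + 1) := by
      rcases Sym2.eq_iff.1 h with ⟨h1, h2⟩ | ⟨h1, h2⟩ <;> rw [← h1, ← h2]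
    have h2 := congrArg π.toT h1
    rw [π.toT_node g hb hi.le, π.toT_node g hb hi] at h2
    exact (hinv g _ _ (π.adj b hb i hi)).ne h2⟩

variable (hinv : IsInvariant Γ T)

theorem graph_adj (π : Petals B T) {S : Set Γ} {b : Γ} (hb : b ∈ B) (hS : b ∈ S) (g : Γ) {i : ℕ}
    (hi : i < π.len b) : (π.graph S hinv).Adj (π.node g b i) (π.node g b (i + 1)) :=
  ⟨b, hb, hS, g, i, hi, rfl⟩

theorem graph_le (π : Petals B T) {S S' : Set Γ} (h : S ⊆ S') :
    π.graph S hinv ≤ π.graph S' hinv := by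
  rintro x y ⟨b, hb, hS, h'⟩
  exact ⟨b, hb, h hS, h'⟩

theorem graph_isInvariant (π : Petals B T) (S : Set Γ) : IsInvariant Γ (π.graph S hinv) := by
  rintro k x y ⟨b, hb, hS, g, i, hi, h⟩
  refine ⟨b, hb, hS, k * g, i, hi, ?_⟩
  have := congrArg (Sym2.map (fun z => k • z)) h
  simpa [smul_node] using this

theorem reachable_node (π : Petals B T) {S : Set Γ} {b : Γ} (hb : b ∈ B) (hS : b ∈ S) (g : Γ)
    {i : ℕ} (hi : i ≤ π.len b) : (π.graph S hinv).Reachable (π.base g) (π.node g b i) := by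
  induction i with
  | zero => rw [node_zero]
  | succ i ih => exact (ih (by omega)).trans (π.graph_adj hinv hb hS g hi).reachable

theorem reachable_base (π : Petals B T) {S : Set Γ} (hSB : S ⊆ B) {g : Γ}
    (hg : g ∈ Subgroup.closure S) : ∀ k : Γ, (π.graph S hinv).Reachable (π.base k) (π.base (k * g)) := by
  induction hg using Subgroup.closure_induction with
  | mem b hb =>
    intro k
    have := π.reachable_node hinv (hSB hb) hb k le_rfl
    rwa [π.node_len k (hSB hb)] at this
  | one => intro k; rw [mul_one]
  | mul x y _ _ hx hy => intro k; rw [← mul_assoc]; exact (hx k).trans (hy (k * x))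
  | inv x _ hx =>
    intro k
    have := (hx (k * x⁻¹)).symm
    rwa [inv_mul_cancel_right] at this

theorem graph_connected (π : Petals B T) (hB : IsBasis B) : (π.graph B hinv).Connected := by
  have key : ∀ x, (π.graph B hinv).Reachable (π.base 1) x := by
    rintro ⟨g, o⟩
    have h1 : (π.graph B hinv).Reachable (π.base 1) (π.base g) := by
      have := π.reachable_base hinv subset_rfl (g := g) (by rw [hB.closure_eq]; trivial) 1
      rwa [one_mul] at this
    cases o with
    | none => exact h1
    | some z =>
      have := π.reachable_node hinv z.2.1 z.2.1 g z.2.2.2.le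
      rw [π.node_mid g z.2] at this
      exact h1.trans this
  have : Nonempty π.Vert := ⟨(π.base 1)⟩
  exact ⟨fun x y => (key x).symm.trans (key y)⟩

/-- The parity of crossings of the Cayley edge which contains the given small edge is interpolated
along that Cayley edge, so that it jumps exactly at the small edge. -/
theorem graph_isTree (π : Petals B T) (hB : IsBasis B) : (π.graph B hinv).IsTree := by
  classical
  refine isTree_of_cut (π.graph_connected hinv hB) ?_
  rintro x y ⟨b, hb, -, h, j, hj, hxy⟩
  obtain ⟨χ, -, hχ⟩ := hB.exists_parity h b
  let ψ : π.Vert → ZMod 2 := fun x => match x.2 with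
    | none => χ x.1
    | some z => χ x.1 + if x.1 = h ∧ z.1.1 = b ∧ j < z.1.2 then 1 else 0
  have hψ : ∀ (g : Γ), ∀ c ∈ B, ∀ i ≤ π.len c,
      ψ (π.node g c i) = χ g + if g = h ∧ c = b ∧ j < i then 1 else 0 := by
    intro g c hc i hi
    rcases Nat.eq_zero_or_pos i with rfl | h0
    · rw [node_zero]
      simp [ψ, base]
    rcases hi.lt_or_eq with h1 | rfl
    · rw [π.node_mid g ⟨hc, h0, h1⟩]
    · rw [π.node_len g hc]
      change χ (g * c) = _
      by_cases hgc : g = h ∧ c = b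
      · rw [(hχ g c hc).1 hgc, if_pos ⟨hgc.1, hgc.2, by rw [hgc.2]; exact hj⟩]
      · rw [(hχ g c hc).2 hgc, if_neg fun h' => hgc ⟨h'.1, h'.2.1⟩, add_zero]
  have hne : ψ (π.node h b j) ≠ ψ (π.node h b (j + 1)) := by
    rw [hψ h b hb j hj.le, hψ h b hb (j + 1) hj]
    simp
  refine ⟨fun z => ψ z = ψ (π.node h b j), ?_, ?_⟩
  · rcases Sym2.eq_iff.1 hxy with ⟨rfl, rfl⟩ | ⟨rfl, rfl⟩
    · simpa using hne.symm
    · simpa using hne.symm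
  · rintro x' y' ⟨c, hc, -, g, i, hi, hxy'⟩ hne'
    have heq : ψ (π.node g c i) = ψ (π.node g c (i + 1)) := by
      rw [hψ g c hc i hi.le, hψ g c hc (i + 1) hi]
      congr 1
      have : ¬ (g = h ∧ c = b ∧ i = j) := by
        rintro ⟨rfl, rfl, rfl⟩
        exact hne' (hxy'.trans hxy.symm)
      refine if_congr ?_ rfl rfl
      constructor
      · rintro ⟨h1, h2, h3⟩
        exact ⟨h1, h2, by omega⟩
      · rintro ⟨h1, h2, h3⟩
        refine ⟨h1, h2, ?_⟩
        have : i ≠ j := fun h => this ⟨h1, h2, h⟩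
        omega
    rcases Sym2.eq_iff.1 hxy' with ⟨rfl, rfl⟩ | ⟨rfl, rfl⟩
    · simp only [heq]
    · simp only [heq]

/-- The subdivided Cayley tree. -/
def tree (π : Petals B T) (hB : IsBasis B) (hBfin : B.Finite) : TreeOver Γ T where
  V := π.Vert
  G := π.graph B hinv
  isTree := π.graph_isTree hinv hB
  inv := π.graph_isInvariant hinv B
  f := π.toT
  equivariant := π.toT_smul
  hom := by
    rintro x y ⟨b, hb, -, g, i, hi, h⟩
    have hadj : T.Adj (π.toT (π.node g b i)) (π.toT (π.node g b (i + 1))) := by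
      rw [π.toT_node g hb hi.le, π.toT_node g hb hi]
      exact hinv g _ _ (π.adj b hb i hi)
    rcases Sym2.eq_iff.1 h with ⟨rfl, rfl⟩ | ⟨rfl, rfl⟩
    · exact hadj
    · exact hadj.symm
  fin := by
    have hf : Finite {z : Γ × ℕ // z.1 ∈ B ∧ 0 < z.2 ∧ z.2 < π.len z.1} := by
      refine Set.Finite.subset (hBfin.biUnion (t := fun b => (fun i => (b, i)) '' Set.Iio (π.len b))
        fun b _ => (Set.finite_Iio _).image _) ?_
      rintro ⟨b, i⟩ ⟨h1, h2, h3⟩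
      exact Set.mem_biUnion h1 ⟨i, h3, rfl⟩
    refine Finite.of_surjective (α := Option {z : Γ × ℕ // z.1 ∈ B ∧ 0 < z.2 ∧ z.2 < π.len z.1})
      (fun o => Quotient.mk'' (Vert.mk 1 o : π.Vert)) ?_
    intro x
    induction x using Quotient.inductionOn' with
    | h x =>
      refine ⟨x.2, Quotient.sound' ?_⟩
      refine ⟨x.1⁻¹, ?_⟩
      change Vert.mk (x.1⁻¹ * x.1) x.2 = _
      rw [inv_mul_cancel]

/-- Inside a petal leaflessness means that there is no backtracking; at the base vertex it means
that the initial and final directions do not all agree. Edges over the fixed oriented edge are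
counted by label and index: two of them with the same data differ by an element which fixes or
inverts the edge of `T`. In the first case it is trivial because the action is free, and the second
is impossible without torsion. -/
theorem isMarked (π : Petals B T) (hB : IsBasis B) (hBfin : B.Finite) (hW : IsFreeAction Γ W)
    (htf : ∀ g : Γ, g * g = 1 → g = 1) {C : Set Γ} (hC : C ⊆ B) {p r : W} (hpr : T.Adj p r)
    {m : ℕ} (hpath : ∀ c ∈ C, ∀ i, i + 2 ≤ π.len c → π.u c i ≠ π.u c (i + 2))
    (hbase : ∀ w, ∃ c ∈ C, π.u c 1 ≠ w ∨ c⁻¹ • π.u c (π.len c - 1) ≠ w)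
    (hcount : {z : Γ × ℕ | z.1 ∈ C ∧ z.2 < π.len z.1 ∧
      ∃ g : Γ, s(g • π.u z.1 z.2, g • π.u z.1 (z.2 + 1)) = s(p, r)}.ncard ≤ m) :
    IsMarked C p r m (π.tree hinv hB hBfin) (π.graph C hinv) (π.base 1) := by
  have hfirst : ∀ c ∈ C, (π.graph C hinv).Adj (π.base 1) (π.node 1 c 1) := by
    intro c hc
    have := π.graph_adj hinv (hC hc) hc 1 (π.pos c (hC hc))
    rwa [node_zero] at this
  have hlast : ∀ c ∈ C, (π.graph C hinv).Adj (π.base 1) (π.node c⁻¹ c (π.len c - 1)) := by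
    intro c hc
    have h0 := π.pos c (hC hc)
    have := π.graph_adj hinv (hC hc) hc c⁻¹ (i := π.len c - 1) (by omega)
    rw [Nat.sub_add_cancel h0, π.node_len _ (hC hc), inv_mul_cancel] at this
    exact this.symm
  have hf1 : ∀ c ∈ C, π.toT (π.node 1 c 1) = π.u c 1 := fun c hc => by
    rw [π.toT_node 1 (hC hc) (π.pos c (hC hc)), one_smul]
  have hf2 : ∀ c ∈ C, π.toT (π.node c⁻¹ c (π.len c - 1)) = c⁻¹ • π.u c (π.len c - 1) :=
    fun c hc => by rw [π.toT_node _ (hC hc) (Nat.sub_le _ _)]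
  obtain ⟨c₀, hc₀, -⟩ := hbase π.v
  refine ⟨π.graph_le hinv hC, π.graph_isInvariant hinv C, ?_, ⟨_, hfirst c₀ hc₀⟩, ?_, ?_⟩
  · intro c hc
    have := π.reachable_base hinv hC (Subgroup.subset_closure hc) 1
    change (π.graph C hinv).Reachable (π.base 1) (c • π.base 1)
    rwa [smul_base, mul_one, ← one_mul c]
  · have hbase1 : ∃ a b, (π.graph C hinv).Adj (π.base 1) a ∧ (π.graph C hinv).Adj (π.base 1) b ∧
        π.toT a ≠ π.toT b := by
      obtain ⟨c, hc, h | h⟩ := hbase (π.u c₀ 1)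
      · exact ⟨_, _, hfirst c hc, hfirst c₀ hc₀, by rwa [hf1 c hc, hf1 c₀ hc₀]⟩
      · exact ⟨_, _, hlast c hc, hfirst c₀ hc₀, by rwa [hf2 c hc, hf1 c₀ hc₀]⟩
    have hnode : ∀ g, ∀ c ∈ C, ∀ i ≤ π.len c, ∃ a b, (π.graph C hinv).Adj (π.node g c i) a ∧
        (π.graph C hinv).Adj (π.node g c i) b ∧ π.toT a ≠ π.toT b := by
      have hb : ∀ g : Γ, ∃ a b, (π.graph C hinv).Adj (π.base g) a ∧
          (π.graph C hinv).Adj (π.base g) b ∧ π.toT a ≠ π.toT b := by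
        intro g
        obtain ⟨a, b, ha, hb, hab⟩ := hbase1
        have hg : g • (π.base 1) = (π.base g) := by rw [smul_base, mul_one]
        refine ⟨g • a, g • b, ?_, ?_, ?_⟩
        · rw [← hg]
          exact π.graph_isInvariant hinv C g _ _ ha
        · rw [← hg]
          exact π.graph_isInvariant hinv C g _ _ hb
        · rw [toT_smul, toT_smul]
          exact fun h => hab (MulAction.injective g h)
      intro g c hc i hi
      rcases Nat.eq_zero_or_pos i with rfl | h0
      · rw [node_zero]
        exact hb g
      rcases hi.lt_or_eq with h1 | rfl
      · refine ⟨π.node g c (i - 1), π.node g c (i + 1), ?_, π.graph_adj hinv (hC hc) hc g h1, ?_⟩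
        · have := π.graph_adj hinv (hC hc) hc g (i := i - 1) (by omega)
          rw [Nat.sub_add_cancel h0] at this
          exact this.symm
        · rw [π.toT_node g (hC hc) (by omega), π.toT_node g (hC hc) h1]
          intro h
          refine hpath c hc (i - 1) (by omega) ?_
          rw [show i - 1 + 2 = i + 1 by omega]
          exact MulAction.injective g h
      · rw [π.node_len g (hC hc)]
        exact hb _
    rintro x y ⟨c, -, hc, g, i, hi, hxy⟩
    rcases Sym2.eq_iff.1 hxy with ⟨rfl, -⟩ | ⟨rfl, -⟩
    · exact hnode g c hc i hi.le
    · exact hnode g c hc (i + 1) hi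
  · refine le_trans ?_ hcount
    set I := {z : Γ × ℕ | z.1 ∈ C ∧ z.2 < π.len z.1 ∧
      ∃ g : Γ, s(g • π.u z.1 z.2, g • π.u z.1 (z.2 + 1)) = s(p, r)} with hI
    have hIfin : I.Finite := by
      refine Set.Finite.subset (hBfin.biUnion (t := fun b => (fun i => (b, i)) '' Set.Iio (π.len b))
        fun b _ => (Set.finite_Iio _).image _) ?_
      rintro ⟨b, i⟩ ⟨h1, h2, h3⟩
      exact Set.mem_biUnion (hC h1) ⟨i, h2, rfl⟩
    have hex : ∀ z : π.Vert × π.Vert, ∃ w : Γ × ℕ, (π.graph C hinv).Adj z.1 z.2 ∧ π.toT z.1 = p ∧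
        π.toT z.2 = r → w ∈ I ∧ ∃ g, s(z.1, z.2) = s(π.node g w.1 w.2, π.node g w.1 (w.2 + 1)) := by
      intro z
      by_cases h : (π.graph C hinv).Adj z.1 z.2 ∧ π.toT z.1 = p ∧ π.toT z.2 = r
      · obtain ⟨⟨c, hcB, hc, g, i, hi, he⟩, h1, h2⟩ := h
        refine ⟨(c, i), fun _ => ⟨⟨hc, hi, g, ?_⟩, g, he⟩⟩
        have := congrArg (Sym2.map π.toT) he
        simp only [Sym2.map_mk, h1, h2] at this
        rw [this, π.toT_node g hcB hi.le, π.toT_node g hcB hi]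
      · exact ⟨(1, 0), fun h' => absurd h' h⟩
    choose φ hφ using hex
    refine Set.ncard_le_ncard_of_injOn φ (fun z hz => (hφ z hz).1) ?_ hIfin
    rintro ⟨(x : π.Vert), (y : π.Vert)⟩ hz ⟨(x' : π.Vert), (y' : π.Vert)⟩ hz' heq
    obtain ⟨g, hg⟩ := (hφ _ hz).2
    obtain ⟨g', hg'⟩ := (hφ _ hz').2
    rw [← heq] at hg'
    obtain ⟨-, h1, h2⟩ := hz
    obtain ⟨-, h1', h2'⟩ := hz'
    have h3 : s(x, y) = s((g * g'⁻¹) • x', (g * g'⁻¹) • y') := by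
      have := congrArg (Sym2.map (fun z => (g * g'⁻¹) • z)) hg'
      simp only [Sym2.map_mk, smul_node, inv_mul_cancel_right] at this
      exact hg.trans this.symm
    have h1 : π.toT x = p := h1
    have h2 : π.toT y = r := h2
    have h1' : π.toT x' = p := h1'
    have h2' : π.toT y' = r := h2'
    rcases Sym2.eq_iff.1 h3 with ⟨h4, h5⟩ | ⟨h4, h5⟩
    · have h6 := congrArg π.toT h4
      rw [toT_smul, h1, h1'] at h6
      rw [hW _ _ h6.symm, one_smul] at h4 h5
      rw [h4, h5]
    · exfalso
      have h6 := congrArg π.toT h4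
      have h7 := congrArg π.toT h5
      rw [toT_smul, h1, h2'] at h6
      rw [toT_smul, h2, h1'] at h7
      have h8 := htf _ (hW ((g * g'⁻¹) * (g * g'⁻¹)) p (by rw [mul_smul, ← h7, ← h6]))
      rw [h8, one_smul] at h6
      exact hpr.ne h6

/-- The coset of the group coordinate modulo the closure of `C` is constant on components of the
subgraph. -/
theorem not_invariant (π : Petals B T) (hB : IsBasis B) {C : Set Γ} (hC : C ⊆ B) (hne : C ≠ B) :
    ¬ ∀ g : Γ, (π.graph C hinv).Reachable (π.base 1) (g • (π.base 1)) := by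
  intro h
  refine hne (hB.eq_of_subset hC ((Subgroup.eq_top_iff' _).2 fun g => ?_))
  have h1 := reachable_invariant (χ := fun x : π.Vert => (x.1 : Γ ⧸ Subgroup.closure C)) (by
    have key : ∀ g, ∀ c ∈ C, ∀ i, ((π.node g c i).1 : Γ ⧸ Subgroup.closure C) = g := by
      intro g c hc i
      by_cases h : c ∈ B ∧ 0 < i ∧ i < π.len c
      · rw [node, dif_pos h]
      rw [node, dif_neg h]
      split_ifs
      · rfl
      · refine (QuotientGroup.eq.2 ?_).symm
        change g⁻¹ * (g * c) ∈ _
        rw [inv_mul_cancel_left]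
        exact Subgroup.subset_closure hc
    rintro x y ⟨c, -, hc, g, i, -, hxy⟩
    rcases Sym2.eq_iff.1 hxy with ⟨rfl, rfl⟩ | ⟨rfl, rfl⟩
    · exact (key g c hc _).trans (key g c hc _).symm
    · exact (key g c hc _).trans (key g c hc _).symm) (h g)
  have h2 := QuotientGroup.eq.1 h1
  change (1 : Γ)⁻¹ * (g * 1) ∈ _ at h2
  rwa [inv_one, one_mul, mul_one] at h2

end Petals

end Petals

end OuterSpace

end

noncomputable section

namespace OuterSpace

/-! ### Free factors and parts of bases -/

section Factors

variable {n : ℕ}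

theorem freeGroup_torsionFree {α : Type*} (g : FreeGroup α) (h : g * g = 1) : g = 1 := by
  have h' : g ^ 2 = 1 := by rw [pow_two, h]
  exact (pow_eq_one_iff_left (two_ne_zero)).1 h'

theorem isLargeFree (hn : 3 ≤ n) : IsLargeFree (F n) := by
  refine ⟨freeGroup_torsionFree, fun B hB => ?_⟩
  obtain ⟨h1, h2⟩ := hB.finite_and_ncard
  have : 2 < B.ncard := by omega
  rw [Set.two_lt_ncard_iff h1] at this
  obtain ⟨a, b, c, ha, hb, hc, hab, hac, hbc⟩ := this
  exact ⟨a, ha, b, hb, c, hc, hab, hac, hbc⟩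

theorem isBasis_of_coprod {Γ : Type*} [Group Γ] {A A' : Subgroup Γ}
    (h : Function.Bijective (Monoid.Coprod.lift A.subtype A'.subtype)) {C D : Set Γ}
    (hC : IsFreeSet C) (hCA : Subgroup.closure C = A) (hD : IsFreeSet D)
    (hDA : Subgroup.closure D = A') : IsBasis (C ∪ D) := by
  subst hCA hDA
  let e : Monoid.Coprod (Subgroup.closure C) (Subgroup.closure D) ≃* Γ :=
    MulEquiv.ofBijective _ h
  let ψ : Monoid.Coprod (Subgroup.closure C) (Subgroup.closure D) →* FreeGroup ↥(C ∪ D) :=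
    Monoid.Coprod.lift
      ((FreeGroup.map (Set.inclusion Set.subset_union_left)).comp hC.equiv.symm.toMonoidHom)
      ((FreeGroup.map (Set.inclusion Set.subset_union_right)).comp hD.equiv.symm.toMonoidHom)
  refine IsFreeSet.isBasis (isFreeSet_of_extend (ψ.comp e.symm.toMonoidHom) ?_) ?_
  · rintro ⟨b, hb | hb⟩
    · have h1 : e.symm b = Monoid.Coprod.inl (hC.equiv (FreeGroup.of ⟨b, hb⟩)) := by
        rw [MulEquiv.symm_apply_eq]
        exact (hC.equiv_of ⟨b, hb⟩).symm
      change ψ (e.symm b) = _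
      rw [h1]
      simp [ψ]
    · have h1 : e.symm b = Monoid.Coprod.inr (hD.equiv (FreeGroup.of ⟨b, hb⟩)) := by
        rw [MulEquiv.symm_apply_eq]
        exact (hD.equiv_of ⟨b, hb⟩).symm
      change ψ (e.symm b) = _
      rw [h1]
      simp [ψ]
  · rw [Subgroup.closure_union, eq_top_iff]
    intro g _
    obtain ⟨x, rfl⟩ := h.2 g
    induction x using Monoid.Coprod.induction_on with
    | inl m => exact Subgroup.mem_sup_left (by simp)
    | inr m => exact Subgroup.mem_sup_right (by simp)
    | mul x y hx hy => rw [map_mul]; exact mul_mem (hx trivial) (hy trivial)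

theorem coprod_bijective_of_isBasis {Γ : Type*} [Group Γ] {C D : Set Γ} (h : IsBasis (C ∪ D))
    (hd : Disjoint C D) : Function.Bijective
      (Monoid.Coprod.lift (Subgroup.closure C).subtype (Subgroup.closure D).subtype) := by
  classical
  constructor
  · obtain ⟨φ, hφ⟩ := h.exists_hom (fun b : Γ =>
      if hb : b ∈ C then (Monoid.Coprod.inl ⟨b, Subgroup.subset_closure hb⟩ :
        Monoid.Coprod (Subgroup.closure C) (Subgroup.closure D))
      else if hb : b ∈ D then Monoid.Coprod.inr ⟨b, Subgroup.subset_closure hb⟩ else 1)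
    have hid : φ.comp (Monoid.Coprod.lift (Subgroup.closure C).subtype
        (Subgroup.closure D).subtype) = MonoidHom.id _ := by
      refine Monoid.Coprod.hom_ext ?_ ?_
      · refine hom_eqOn_closure fun b hb => ?_
        have := hφ b (Or.inl hb)
        rw [dif_pos hb] at this
        simpa using this
      · refine hom_eqOn_closure fun b hb => ?_
        have := hφ b (Or.inr hb)
        rw [dif_neg (fun h' => Set.disjoint_left.1 hd h' hb), dif_pos hb] at this
        simpa using this
    exact Function.LeftInverse.injective (DFunLike.congr_fun hid)
  · rw [← MonoidHom.range_eq_top, eq_top_iff, ← h.closure_eq, Subgroup.closure_le]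
    rintro b (hb | hb)
    · exact ⟨Monoid.Coprod.inl ⟨b, Subgroup.subset_closure hb⟩, by simp⟩
    · exact ⟨Monoid.Coprod.inr ⟨b, Subgroup.subset_closure hb⟩, by simp⟩

theorem IsBasis.isFreeFactor {B C : Set (F n)} (hB : IsBasis B) (hC : C ⊆ B) :
    IsFreeFactor (Subgroup.closure C) :=
  ⟨Subgroup.closure (B \ C), coprod_bijective_of_isBasis (by rwa [Set.union_sdiff_cancel hC])
    Set.disjoint_sdiff_right⟩

theorem IsBasis.isFreeFactorOfRank {B C : Set (F n)} (hB : IsBasis B) (hC : C ⊆ B) :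
    IsFreeFactorOfRank C.ncard (Subgroup.closure C) := by
  refine ⟨hB.isFreeFactor hC, ?_⟩
  have hfin : C.Finite := hB.finite_and_ncard.1.subset hC
  have : Finite C := hfin
  have e : C ≃ Fin C.ncard := Finite.equivFinOfCardEq rfl
  exact ⟨(FreeGroup.freeGroupCongr e.symm).trans (hB.isFreeSet.mono hC).equiv⟩

/-- The Nielsen–Schreier theorem, through the action on the Cayley tree of the standard basis. -/
theorem exists_freeSet (A : Subgroup (F n)) : ∃ C : Set (F n), IsFreeSet C ∧
    Subgroup.closure C = A := by
  obtain ⟨D, -, h⟩ := (isBasis_range_of n).exists_extend_to_subgroup (Set.empty_subset _)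
    freeGroup_torsionFree (A := A) (Set.empty_subset _)
  exact ⟨D, h⟩

/-- A complement of the factor is free as well, and a basis of it completes the given one. -/
theorem IsFreeFactor.exists_basis {A : Subgroup (F n)} (hA : IsFreeFactor A) {C : Set (F n)}
    (hC : IsFreeSet C) (hCA : Subgroup.closure C = A) : ∃ B, IsBasis B ∧ C ⊆ B := by
  obtain ⟨A', hA'⟩ := hA
  obtain ⟨D, hD, hDA⟩ := exists_freeSet A'
  exact ⟨C ∪ D, isBasis_of_coprod hA' hC hCA hD hDA, Set.subset_union_left⟩

theorem freeSet_of_equiv {r : ℕ} {A : Subgroup (F n)} (φ : FreeGroup (Fin r) ≃* A) :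
    IsFreeSet (Set.range fun i => (φ (FreeGroup.of i) : F n)) ∧
      Subgroup.closure (Set.range fun i => (φ (FreeGroup.of i) : F n)) = A ∧
      (Set.range fun i => (φ (FreeGroup.of i) : F n)).ncard = r := by
  have hlift : FreeGroup.lift (fun i => (φ (FreeGroup.of i) : F n)) =
      A.subtype.comp φ.toMonoidHom := by
    ext i
    simp
  have hinj : Function.Injective (FreeGroup.lift (fun i => (φ (FreeGroup.of i) : F n))) := by
    rw [hlift]
    exact A.subtype_injective.comp φ.injective
  obtain ⟨h1, h2⟩ := isFreeSet_range hinj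
  refine ⟨h1, ?_, ?_⟩
  · rw [← FreeGroup.range_lift_eq_closure, hlift]
    ext x
    constructor
    · rintro ⟨y, rfl⟩
      exact (φ y).2
    · intro hx
      exact ⟨φ.symm ⟨x, hx⟩, by simp⟩
  · rw [← Set.image_univ, Set.ncard_image_of_injective _ h2, Set.ncard_univ, Nat.card_fin]

theorem IsFreeFactorOfRank.exists_basis {r : ℕ} {A : Subgroup (F n)}
    (hA : IsFreeFactorOfRank r A) :
    ∃ B C : Set (F n), IsBasis B ∧ C ⊆ B ∧ C.ncard = r ∧ Subgroup.closure C = A := by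
  obtain ⟨h, ⟨φ⟩⟩ := hA
  obtain ⟨h1, h2, h3⟩ := freeSet_of_equiv φ
  obtain ⟨B, hB, hC⟩ := h.exists_basis h1 h2
  exact ⟨B, _, hB, hC, h3, h2⟩

end Factors

end OuterSpace

end

noncomputable section

namespace OuterSpace

/-! ### Short free factors: base vertices and crossings -/

section Metric

variable {n : ℕ}

instance FreeSplitting.instAction (S : FreeSplitting n) : MulAction (F n) S.V where
  smul g v := S.ρ g v
  one_smul v := by
    change S.ρ 1 v = v
    rw [map_one]
    rfl
  mul_smul g h v := by
    change S.ρ (g * h) v = S.ρ g (S.ρ h v)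
    rw [map_mul]
    rfl

theorem FreeSplitting.isInvariant (S : FreeSplitting n) : IsInvariant (F n) S.graph :=
  fun g _ _ h => (S.ρ g).map_rel_iff.2 h

theorem FreeSplitting.isMinimalTree (S : FreeSplitting n) : IsMinimalTree (F n) S.graph :=
  fun A hA hinv hc => S.minimal A hA hinv (hc.induce_connected hA)

theorem MetricTree.isFreeAction (T : MetricTree n) : IsFreeAction (F n) T.V :=
  fun g v h => T.free g v h

namespace MetricTree

/-- The length of a list of edges. -/
def weight (T : MetricTree n) {v w : T.V} (p : T.graph.Walk v w) : ℝ := (p.edges.map T.len).sum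

theorem weight_nonneg (T : MetricTree n) {v w : T.V} (p : T.graph.Walk v w) : 0 ≤ T.weight p := by
  refine List.sum_nonneg ?_
  intro x hx
  obtain ⟨e, he, rfl⟩ := List.mem_map.1 hx
  exact (T.len_pos e (p.edges_subset_edgeSet he)).le

theorem weight_le_of_sublist (T : MetricTree n) {v w v' w' : T.V} {p : T.graph.Walk v w}
    {q : T.graph.Walk v' w'} (h : p.edges.Sublist q.edges) : T.weight p ≤ T.weight q := by
  refine (h.map T.len).sum_le_sum ?_
  intro x hx
  obtain ⟨e, he, rfl⟩ := List.mem_map.1 hx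
  exact (T.len_pos e (q.edges_subset_edgeSet he)).le

theorem dist_le_weight (T : MetricTree n) {v w : T.V} (p : T.graph.Walk v w) :
    T.dist v w ≤ T.weight p :=
  ciInf_le ⟨0, by rintro _ ⟨q, rfl⟩; exact T.weight_nonneg q⟩ p

theorem dist_eq_weight (T : MetricTree n) {v w : T.V} {p : T.graph.Walk v w} (hp : p.IsPath) :
    T.dist v w = T.weight p := by
  classical
  refine le_antisymm (T.dist_le_weight p) ?_
  have : Nonempty (T.graph.Walk v w) := ⟨p⟩
  refine le_ciInf fun q => ?_
  have h : q.bypass = p :=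
    (T.isTree.existsUnique_path v w).unique q.bypass_isPath hp
  exact T.weight_le_of_sublist (h ▸ q.edges_bypass_sublist_edges)

theorem weight_eq_sum (T : MetricTree n) {v w : T.V} (p : T.graph.Walk v w) :
    T.weight p = ∑ i ∈ Finset.range p.length, T.len s(p.getVert i, p.getVert (i + 1)) := by
  induction p with
  | nil => simp [weight]
  | cons h p ih =>
    rw [SimpleGraph.Walk.length_cons, Finset.sum_range_succ']
    simp only [SimpleGraph.Walk.getVert_cons_succ, SimpleGraph.Walk.getVert_zero]
    rw [← ih]
    simp [weight, add_comm]

end MetricTree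

theorem exists_inner_path {V : Type*} {G : SimpleGraph V} {a b : V} (P : G.Walk a b)
    (hP : P.IsPath) (h : 2 ≤ P.length) : ∃ Q : G.Walk (P.getVert 1) (P.getVert (P.length - 1)),
      Q.IsPath ∧ Q.length + 2 = P.length ∧ Q.edges.Sublist P.edges := by
  have he : (P.drop 1).getVert (P.length - 2) = P.getVert (P.length - 1) := by
    rw [SimpleGraph.Walk.drop_getVert]
    congr 1
    omega
  refine ⟨((P.drop 1).take (P.length - 2)).copy rfl he, ?_, ?_, ?_⟩
  · rw [SimpleGraph.Walk.isPath_copy]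
    exact (hP.drop 1).take _
  · rw [SimpleGraph.Walk.length_copy, SimpleGraph.Walk.take_length, SimpleGraph.Walk.drop_length]
    omega
  · rw [SimpleGraph.Walk.edges_copy]
    exact (((P.drop 1).isSubwalk_take _).trans (P.isSubwalk_drop 1)).edges_isInfix.sublist

/-- A displacement minimizing vertex for a set of group elements. -/
theorem MetricTree.exists_base (T : MetricTree n) {C : Set (F n)} (hCfin : C.Finite)
    (htf : ∀ c ∈ C, c ≠ 1) {k : ℝ} {v₀ : T.V} (h₀ : ∀ c ∈ C, T.dist v₀ (c • v₀) ≤ k)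
    (hne : C.Nonempty) (P : ∀ a b : T.V, T.graph.Walk a b) (hP : ∀ a b, (P a b).IsPath) :
    ∃ v : T.V, (∀ c ∈ C, T.dist v (c • v) ≤ k) ∧ ∀ w, ∃ c ∈ C, (P v (c • v)).getVert 1 ≠ w ∨
      c⁻¹ • (P v (c • v)).getVert ((P v (c • v)).length - 1) ≠ w := by
  classical
  -- Among the vertices displaced at most `k`, one is chosen for which the paths to its translates
  -- have the least total number of edges. Minimising the combinatorial rather than the metric
  -- length guarantees that a minimum exists.
  let N : T.V → ℕ := fun v => ∑ c ∈ hCfin.toFinset, (P v (c • v)).length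
  obtain ⟨v, hv, hmin⟩ : ∃ v, (∀ c ∈ C, T.dist v (c • v) ≤ k) ∧
      ∀ w, (∀ c ∈ C, T.dist w (c • w) ≤ k) → N v ≤ N w := by
    have hex : ∃ m, ∃ v, (∀ c ∈ C, T.dist v (c • v) ≤ k) ∧ N v = m := ⟨_, v₀, h₀, rfl⟩
    obtain ⟨v, hv, hm⟩ := Nat.find_spec hex
    exact ⟨v, hv, fun w hw => hm ▸ Nat.find_min' hex ⟨w, hw, rfl⟩⟩
  refine ⟨v, hv, ?_⟩
  by_contra hcon
  push Not at hcon
  obtain ⟨w, hw⟩ := hcon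
  -- If all paths leave `v` through `w` and arrive through the translates of `w`, then `w` is a
  -- better base vertex: each path loses its two end edges, and no displacement increases.
  have key : ∀ c ∈ C, (P w (c • w)).length < (P v (c • v)).length ∧
      T.dist w (c • w) ≤ T.dist v (c • v) := by
    intro c hc
    obtain ⟨h1, h2⟩ := hw c hc
    have h2' : (P v (c • v)).getVert ((P v (c • v)).length - 1) = c • w := by
      rw [← h2, smul_inv_smul]
    have h0 : (P v (c • v)).length ≠ 0 := by
      intro h
      exact htf c hc (T.isFreeAction c v (SimpleGraph.Walk.eq_of_length_eq_zero h).symm)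
    -- A path with a single edge would be inverted by `c`, so that `c * c` would fix `v`.
    have h3 : (P v (c • v)).length ≠ 1 := by
      intro h
      have h4 : c • v = w := by
        rw [← h1, ← h, SimpleGraph.Walk.getVert_length]
      have h5 : v = c • w := by
        rw [← h2', h]
        simp
      have h6 : (c * c) • v = v := by rw [mul_smul, h4, ← h5]
      exact htf c hc (freeGroup_torsionFree c (T.isFreeAction _ _ h6))
    obtain ⟨Q, hQ, hlen, hsub⟩ := exists_inner_path (P v (c • v)) (hP _ _) (by omega)
    have h7 := T.weight_le_of_sublist hsub
    rw [← T.dist_eq_weight hQ, ← T.dist_eq_weight (hP v (c • v)), h1, h2'] at h7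
    refine ⟨?_, h7⟩
    have h8 : Q.copy h1 h2' = P w (c • w) :=
      (T.isTree.existsUnique_path _ _).unique (by simpa using hQ) (hP _ _)
    rw [← h8, SimpleGraph.Walk.length_copy]
    omega
  have h1 : N w < N v := by
    refine Finset.sum_lt_sum_of_nonempty ?_ ?_
    · obtain ⟨c, hc⟩ := hne
      exact ⟨c, hCfin.mem_toFinset.2 hc⟩
    · intro c hc
      exact (key c (hCfin.mem_toFinset.1 hc)).1
  have h2 := hmin w fun c hc => (key c hc).2.trans (hv c hc)
  omega

/-- Averaging: the total length of the paths is at most `C.ncard * k`. It is also the sum of the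
lengths of the edges of the quotient, which add up to one, weighted by the numbers of crossings. So
some edge is crossed at most `C.ncard * k` times. -/
theorem MetricTree.exists_few_crossings (T : MetricTree n) {C : Set (F n)} (hCfin : C.Finite)
    {k : ℝ} {v : T.V} (hv : ∀ c ∈ C, T.dist v (c • v) ≤ k)
    (P : ∀ c : F n, T.graph.Walk v (c • v)) (hP : ∀ c, (P c).IsPath) :
    ∃ p r, T.graph.Adj p r ∧ ({z : F n × ℕ | z.1 ∈ C ∧ z.2 < (P z.1).length ∧
      ∃ g : F n, s(g • (P z.1).getVert z.2, g • (P z.1).getVert (z.2 + 1)) = s(p, r)}.ncard : ℝ) ≤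
        C.ncard * k := by
  classical
  obtain ⟨D, hD1, hD2, hD3⟩ := T.volume_one
  have hJfin : {z : F n × ℕ | z.1 ∈ C ∧ z.2 < (P z.1).length}.Finite := by
    refine Set.Finite.subset (hCfin.biUnion (t := fun b => (fun i => (b, i)) '' Set.Iio (P b).length)
      fun b _ => (Set.finite_Iio _).image _) ?_
    rintro ⟨b, i⟩ ⟨h1, h2⟩
    exact Set.mem_biUnion h1 ⟨i, h2, rfl⟩
  let E : F n × ℕ → Sym2 T.V := fun z => s((P z.1).getVert z.2, (P z.1).getVert (z.2 + 1))
  have hE : ∀ z ∈ hJfin.toFinset, E z ∈ T.graph.edgeSet := by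
    intro z hz
    exact (P z.1).adj_getVert_succ (hJfin.mem_toFinset.1 hz).2
  have hrep : ∀ z : F n × ℕ, ∃ d, z ∈ hJfin.toFinset → (d ∈ D ∧ (∃ g : F n, d.map (T.ρ g) = E z) ∧
      ∀ d' ∈ D, (∃ g : F n, d'.map (T.ρ g) = E z) → d' = d) := by
    intro z
    by_cases hz : z ∈ hJfin.toFinset
    · obtain ⟨d, ⟨h1, h2⟩, h3⟩ := hD2 _ (hE z hz)
      exact ⟨d, fun _ => ⟨h1, h2, fun d' h4 h5 => h3 d' ⟨h4, h5⟩⟩⟩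
    · exact ⟨E z, fun h => absurd h hz⟩
  choose rep hrep using hrep
  have hlen : ∀ z ∈ hJfin.toFinset, T.len (E z) = T.len (rep z) := by
    intro z hz
    obtain ⟨h1, ⟨g, hg⟩, -⟩ := hrep z hz
    rw [← hg, T.len_inv g _ (hD1 _ h1)]
  have htotal : ∑ z ∈ hJfin.toFinset, T.len (E z) ≤ C.ncard * k := by
    rw [Finset.sum_finset_product hJfin.toFinset hCfin.toFinset
      (fun c => Finset.range (P c).length) (by simp)]
    have h1 : ∀ c ∈ hCfin.toFinset, ∑ i ∈ Finset.range (P c).length, T.len (E (c, i)) ≤ k := by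
      intro c hc
      rw [← T.weight_eq_sum, ← T.dist_eq_weight (hP c)]
      exact hv c (hCfin.mem_toFinset.1 hc)
    refine (Finset.sum_le_card_nsmul _ _ _ h1).trans ?_
    rw [nsmul_eq_mul, Set.ncard_eq_toFinset_card C hCfin]
  have hfib : ∑ z ∈ hJfin.toFinset, T.len (E z) =
      ∑ d ∈ D, ((hJfin.toFinset.filter fun z => rep z = d).card : ℝ) * T.len d := by
    rw [← Finset.sum_fiberwise_of_maps_to (g := rep) (t := D) (fun z hz => (hrep z hz).1)]
    refine Finset.sum_congr rfl fun d _ => ?_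
    rw [← nsmul_eq_mul]
    refine Finset.sum_eq_card_nsmul fun z hz => ?_
    obtain ⟨h1, rfl⟩ := Finset.mem_filter.1 hz
    exact hlen z h1
  obtain ⟨d, hd, hle⟩ : ∃ d ∈ D, ((hJfin.toFinset.filter fun z => rep z = d).card : ℝ) ≤
      C.ncard * k := by
    by_contra hcon
    push Not at hcon
    have hne : D.Nonempty := by
      by_contra h
      rw [Finset.not_nonempty_iff_eq_empty] at h
      rw [h, Finset.sum_empty] at hD3
      exact zero_ne_one hD3
    have : ∑ d ∈ D, (C.ncard * k) * T.len d <
        ∑ d ∈ D, ((hJfin.toFinset.filter fun z => rep z = d).card : ℝ) * T.len d :=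
      Finset.sum_lt_sum_of_nonempty hne fun d hd =>
        mul_lt_mul_of_pos_right (hcon d hd) (T.len_pos d (hD1 d hd))
    rw [← Finset.mul_sum, hD3, mul_one, ← hfib] at this
    linarith
  have hdT := hD1 d hd
  induction d with
  | _ p r =>
    refine ⟨p, r, hdT, le_trans ?_ hle⟩
    rw [Nat.cast_le, ← Set.ncard_coe_finset]
    refine Set.ncard_le_ncard ?_ (Finset.finite_toSet _)
    rintro z ⟨h1, h2, g, hg⟩
    have hz : z ∈ hJfin.toFinset := hJfin.mem_toFinset.2 ⟨h1, h2⟩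
    rw [Finset.mem_coe, Finset.mem_filter]
    refine ⟨hz, ((hrep z hz).2.2 _ hd ⟨g⁻¹, ?_⟩).symm⟩
    rw [← hg]
    change s(g⁻¹ • g • (P z.1).getVert z.2, g⁻¹ • g • (P z.1).getVert (z.2 + 1)) = _
    rw [inv_smul_smul, inv_smul_smul]

/-- The bound on the number of steps from a short free factor to a basis read off from the tree. -/
def nearBound (n : ℕ) (k : ℝ) : ℕ := 8 * ⌊n * k⌋₊ + 7

/-- The petals are the paths from the optimal base vertex to its translates. Those labelled by `C`
cross a suitable edge at most `n * k` times. The petals of the other elements of `B₀` may be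
arbitrarily long and do not enter the bound. -/
theorem MetricTree.exists_near_of_short (hn : 3 ≤ n) (T : MetricTree n) {B₀ C : Set (F n)}
    (hB₀ : IsBasis B₀) (hC : C ⊆ B₀) (hCB : C ≠ B₀) (hne : C.Nonempty) {k : ℝ} (hk : 0 ≤ k)
    {v₀ : T.V} (h₀ : ∀ c ∈ C, T.dist v₀ (c • v₀) ≤ k) :
    ∃ B' B : Set (F n), C ⊆ B' ∧ IsGeometric T.graph B ∧ BNear (nearBound n k) B' B := by
  have hB₀fin := hB₀.finite_and_ncard.1
  have hCfin := hB₀fin.subset hC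
  have hex : ∀ a b, ∃ P : T.graph.Walk a b, P.IsPath := fun a b =>
    (T.isTree.existsUnique_path a b).exists
  choose P hP using hex
  obtain ⟨v, hv, hbase⟩ := T.exists_base hCfin (fun c hc => hB₀.ne_one (hC hc)) h₀ hne P hP
  obtain ⟨p, r, hpr, hcount⟩ := T.exists_few_crossings hCfin hv (fun c => P v (c • v))
    (fun c => hP v (c • v))
  let π : Petals B₀ T.graph :=
    { v := v
      len := fun b => (P v (b • v)).length
      u := fun b i => (P v (b • v)).getVert i
      pos := fun b hb => Nat.pos_of_ne_zero fun h => hB₀.ne_one hb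
        (T.isFreeAction b v (SimpleGraph.Walk.eq_of_length_eq_zero h).symm)
      zero := fun b _ => SimpleGraph.Walk.getVert_zero _
      last := fun b _ => SimpleGraph.Walk.getVert_length _
      adj := fun b _ i hi => SimpleGraph.Walk.adj_getVert_succ _ hi }
  have hm : C.ncard * k ≤ n * k := by
    refine mul_le_mul_of_nonneg_right ?_ hk
    exact_mod_cast (Set.ncard_le_ncard hC hB₀fin).trans_eq hB₀.finite_and_ncard.2
  have hmark := π.isMarked T.isInvariant hB₀ hB₀fin T.isFreeAction freeGroup_torsionFree hC hpr
    (m := ⌊n * k⌋₊) (fun c _ i hi h => by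
      have := (hP v (c • v)).getVert_injOn (show i ≤ _ by exact le_trans (by omega) hi) hi h
      omega) hbase (Nat.le_floor (hcount.trans hm))
  exact hmark.exists_near (isLargeFree hn) T.isFreeAction T.isTree T.isMinimalTree hpr hB₀ hC _ _ _ _
    le_rfl (π.not_invariant T.isInvariant hB₀ hC hCB)

end Metric

end OuterSpace

end

noncomputable section

namespace OuterSpace

/-! ### Displacements of bases and short free factors -/

section Short

variable {n : ℕ}

namespace MetricTree

theorem exists_path (T : MetricTree n) (v w : T.V) : ∃ p : T.graph.Walk v w, p.IsPath :=
  (T.isTree.existsUnique_path v w).exists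

theorem dist_nonneg (T : MetricTree n) (v w : T.V) : 0 ≤ T.dist v w := by
  obtain ⟨p, hp⟩ := T.exists_path v w
  rw [T.dist_eq_weight hp]
  exact T.weight_nonneg p

theorem dist_self (T : MetricTree n) (v : T.V) : T.dist v v = 0 := by
  refine le_antisymm ((T.dist_le_weight SimpleGraph.Walk.nil).trans ?_) (T.dist_nonneg v v)
  simp [weight]

theorem dist_triangle (T : MetricTree n) (u v w : T.V) : T.dist u w ≤ T.dist u v + T.dist v w := by
  obtain ⟨p, hp⟩ := T.exists_path u v
  obtain ⟨q, hq⟩ := T.exists_path v w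
  rw [T.dist_eq_weight hp, T.dist_eq_weight hq]
  refine (T.dist_le_weight (p.append q)).trans ?_
  simp [weight]

theorem dist_comm (T : MetricTree n) (u v : T.V) : T.dist u v = T.dist v u := by
  have key : ∀ u v, T.dist u v ≤ T.dist v u := by
    intro u v
    obtain ⟨p, hp⟩ := T.exists_path v u
    rw [T.dist_eq_weight hp]
    refine (T.dist_le_weight p.reverse).trans ?_
    simp [weight]
  exact le_antisymm (key u v) (key v u)

theorem dist_adj_le (T : MetricTree n) {v w : T.V} (h : T.graph.Adj v w) :
    T.dist v w ≤ T.len s(v, w) := by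
  refine (T.dist_le_weight (SimpleGraph.Walk.cons h SimpleGraph.Walk.nil)).trans ?_
  simp [weight]

theorem dist_map_le {T T' : MetricTree n} (f : T.graph →g T'.graph)
    (hf : ∀ e ∈ T.graph.edgeSet, T'.len (e.map f) = T.len e) (v w : T.V) :
    T'.dist (f v) (f w) ≤ T.dist v w := by
  obtain ⟨p, hp⟩ := T.exists_path v w
  rw [T.dist_eq_weight hp]
  refine (T'.dist_le_weight (p.map f)).trans (le_of_eq ?_)
  rw [weight, weight, SimpleGraph.Walk.edges_map, List.map_map]
  congr 1
  refine List.map_congr_left fun e he => ?_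
  exact hf e (p.edges_subset_edgeSet he)

theorem dist_smul (T : MetricTree n) (g : F n) (v w : T.V) : T.dist (g • v) (g • w) = T.dist v w := by
  have key : ∀ (g : F n) (v w : T.V), T.dist (g • v) (g • w) ≤ T.dist v w := fun g v w =>
    dist_map_le (T.ρ g).toHom (T.len_inv g) v w
  refine le_antisymm (key g v w) ?_
  have := key g⁻¹ (g • v) (g • w)
  rwa [inv_smul_smul, inv_smul_smul] at this

end MetricTree

/-- The elements of `C` move the vertex `v` at most `k`. -/
def Displaces (T : MetricTree n) (k : ℝ) (v : T.V) (C : Set (F n)) : Prop :=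
  ∀ c ∈ C, T.dist v (c • v) ≤ k

/-- Equivariance makes the map the orbit map of the image of `1`, and the Lipschitz condition is
read off at the neighbours of `1`. -/
theorem IsShort.exists_displaces {k : ℝ} {r : ℕ} {A : Subgroup (F n)} {T : MetricTree n}
    (h : IsShort k r A T) : ∃ (C : Set (F n)) (v : T.V), IsFreeSet C ∧ Subgroup.closure C = A ∧
      C.ncard = r ∧ Displaces T k v C := by
  obtain ⟨φ, f, hf, hd⟩ := h
  obtain ⟨h1, h2, h3⟩ := freeSet_of_equiv φ
  refine ⟨_, f 1, h1, h2, h3, ?_⟩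
  rintro _ ⟨i, rfl⟩
  have h4 := hd 1 (FreeGroup.of i)
  have h5 := hf (FreeGroup.of i) 1
  rw [mul_one] at h5
  rw [inv_one, one_mul, FreeGroup.norm_of, h5] at h4
  rw [Nat.cast_one, mul_one] at h4
  exact h4

theorem Displaces.dist_le {T : MetricTree n} {r : ℕ} {c : Fin r → F n} {k : ℝ} {v : T.V}
    (h : ∀ i, T.dist v (c i • v) ≤ k) (x : FreeGroup (Fin r)) :
    T.dist v (FreeGroup.lift c x • v) ≤ k * x.norm := by
  have key : ∀ L : List (Fin r × Bool),
      T.dist v (FreeGroup.lift c (FreeGroup.mk L) • v) ≤ k * L.length := by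
    intro L
    induction L with
    | nil => simp [T.dist_self, FreeGroup.one_eq_mk.symm]
    | cons a L ih =>
      obtain ⟨i, b⟩ := a
      have h1 : (FreeGroup.mk ((i, b) :: L)) = FreeGroup.mk [(i, b)] * FreeGroup.mk L := by
        rw [FreeGroup.mul_mk]
        rfl
      rw [h1, map_mul, mul_smul]
      have h2 : T.dist v (FreeGroup.lift c (FreeGroup.mk [(i, b)]) • v) ≤ k := by
        cases b with
        | true => simpa using h i
        | false =>
          have h3 := T.dist_smul (c i)⁻¹ v (c i • v)
          rw [inv_smul_smul, T.dist_comm] at h3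
          simpa [h3] using h i
      have h4 := T.dist_triangle v (FreeGroup.lift c (FreeGroup.mk [(i, b)]) • v)
        (FreeGroup.lift c (FreeGroup.mk [(i, b)]) • FreeGroup.lift c (FreeGroup.mk L) • v)
      rw [T.dist_smul] at h4
      push_cast [List.length_cons]
      linarith
  have := key x.toWord
  rwa [FreeGroup.mk_toWord] at this

theorem Displaces.isShort {T : MetricTree n} {k : ℝ} {v : T.V} {C : Set (F n)}
    (h : Displaces T k v C) (hC : IsFreeSet C) (hfin : C.Finite) :
    IsShort k C.ncard (Subgroup.closure C) T := by
  have : Finite C := hfin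
  let e : Fin C.ncard ≃ C := (Finite.equivFinOfCardEq rfl).symm
  let φ : FreeGroup (Fin C.ncard) ≃* Subgroup.closure C :=
    (FreeGroup.freeGroupCongr e).trans hC.equiv
  have hφ : (Subgroup.closure C).subtype.comp φ.toMonoidHom =
      FreeGroup.lift (fun i => (e i : F n)) := by
    ext i
    simp [φ, hC.equiv_of]
  have hφ' : ∀ x, (φ x : F n) = FreeGroup.lift (fun i => (e i : F n)) x :=
    DFunLike.congr_fun hφ
  refine ⟨φ, fun g => (φ g : F n) • v, fun g g' => ?_, fun g g' => ?_⟩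
  · change (φ (g * g') : F n) • v = (φ g : F n) • (φ g' : F n) • v
    rw [map_mul, Subgroup.coe_mul, mul_smul]
  · have h1 := Displaces.dist_le (T := T) (c := fun i => (e i : F n)) (v := v)
      (fun i => h _ (e i).2) (g⁻¹ * g')
    rw [← hφ', ← T.dist_smul (φ g : F n), ← mul_smul] at h1
    convert h1 using 3
    rw [map_mul, map_inv, Subgroup.coe_mul, Subgroup.coe_inv, mul_inv_cancel_left]

/-- A set of edges which meets each orbit at most once has length at most one. -/
theorem MetricTree.sum_len_le_one (T : MetricTree n) (E : Finset (Sym2 T.V))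
    (hE : ∀ e ∈ E, e ∈ T.graph.edgeSet)
    (hinj : ∀ e ∈ E, ∀ e' ∈ E, ∀ g : F n, e.map (T.ρ g) = e' → e = e') :
    ∑ e ∈ E, T.len e ≤ 1 := by
  classical
  obtain ⟨D, hD1, hD2, hD3⟩ := T.volume_one
  have hrep : ∀ e, ∃ d, e ∈ E → d ∈ D ∧ ∃ g : F n, d.map (T.ρ g) = e := by
    intro e
    by_cases he : e ∈ E
    · obtain ⟨d, hd, -⟩ := hD2 e (hE e he)
      exact ⟨d, fun _ => hd⟩
    · exact ⟨e, fun h => absurd h he⟩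
  choose rep hrep using hrep
  have hlen : ∀ e ∈ E, T.len e = T.len (rep e) := by
    intro e he
    obtain ⟨h1, g, hg⟩ := hrep e he
    rw [← T.len_inv g _ (hD1 _ h1), hg]
  have hinj' : Set.InjOn rep E := by
    intro e he e' he' h
    obtain ⟨-, g, hg⟩ := hrep e he
    obtain ⟨-, g', hg'⟩ := hrep e' he'
    refine hinj e he e' he' (g' * g⁻¹) ?_
    rw [← hg', ← hg, h, Sym2.map_map]
    congr 1
    funext v
    change (g' * g⁻¹) • g • v = g' • v
    rw [mul_smul, inv_smul_smul]
  rw [Finset.sum_congr rfl hlen, ← Finset.sum_image (f := T.len) hinj', ← hD3]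
  refine Finset.sum_le_sum_of_subset_of_nonneg ?_ fun d hd _ => (T.len_pos d (hD1 d hd)).le
  intro d hd
  obtain ⟨e, he, rfl⟩ := Finset.mem_image.1 hd
  exact (hrep e he).1

/-- A path inside a transversal uses at most one edge of each orbit, so the transversal has diameter
at most one, the volume; a single edge has length at most one too. From `v` to `b • v` one crosses
`X`, one edge, and `b • X`, whence the constant three. -/
theorem IsGeometric.exists_displaces {T : MetricTree n} {B : Set (F n)}
    (hB : IsGeometric T.graph B) : ∃ v, Displaces T 3 v B := by
  classical
  obtain ⟨X, hX, hB⟩ := hB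
  obtain ⟨v₀⟩ := T.isTree.connected.nonempty
  obtain ⟨v, hv⟩ := hX.nonempty v₀
  have hdist : ∀ x ∈ X, ∀ y ∈ X, T.dist x y ≤ 1 := by
    intro x hx y hy
    obtain ⟨p, hp⟩ := (hX.conn x hx y hy).exists_isPath
    have hp' : (p.mapLe (within_le X)).IsPath := by simpa using hp
    rw [T.dist_eq_weight hp', MetricTree.weight, SimpleGraph.Walk.edges_mapLe_eq_edges]
    have hnd := hp.isTrail.edges_nodup
    rw [← List.sum_toFinset _ hnd]
    have hmem : ∀ e ∈ p.edges, ∀ z ∈ e, z ∈ X := by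
      intro e he z hz
      have h1 := p.edges_subset_edgeSet he
      induction e with
      | _ a b =>
        rcases Sym2.mem_iff.1 hz with rfl | rfl
        · exact h1.2.1
        · exact h1.2.2
    refine T.sum_len_le_one _ ?_ ?_
    · intro e he
      have h1 := p.edges_subset_edgeSet (List.mem_toFinset.1 he)
      induction e with
      | _ a b => exact h1.1
    · intro e he e' he' g hg
      have h1 : g = 1 := by
        induction e with
        | _ a b =>
          have ha := hmem _ (List.mem_toFinset.1 he) a (Sym2.mem_mk_left a b)
          refine hX.uniq a ha g (hmem e' (List.mem_toFinset.1 he') _ ?_)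
          rw [← hg]
          exact Sym2.mem_mk_left _ _
      rw [← hg, h1, map_one]
      induction e with
      | _ a b => rfl
  have hedge : ∀ e ∈ T.graph.edgeSet, T.len e ≤ 1 := by
    intro e he
    have := T.sum_len_le_one {e} (by simpa using he) (by
      intro e1 h1 e2 h2 _ _
      rw [Finset.mem_singleton] at h1 h2
      rw [h1, h2])
    simpa using this
  refine ⟨v, fun b hb => ?_⟩
  obtain ⟨-, x, hx, y, hy, hxy⟩ := hB.sub hb
  have h1 := T.dist_triangle v x (b • v)
  have h2 := T.dist_triangle x (b • y) (b • v)
  have h3 := hdist v hv x hx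
  have h4 := hdist y hy v hv
  rw [← T.dist_smul b] at h4
  have h5 := (T.dist_adj_le hxy).trans (hedge _ hxy)
  linarith

/-! ### Equivariant isometries -/

theorem MetricTree.Iso.isGeometric {T T' : MetricTree n} (h : T.Iso T') {B : Set (F n)}
    (hB : IsGeometric T.graph B) : IsGeometric T'.graph B := by
  obtain ⟨f, hf, -⟩ := h
  exact hB.of_bijective hf f.bijective fun _ _ => f.map_rel_iff

end Short

end OuterSpace

end

noncomputable section

namespace OuterSpace

/-! ### Roses with prescribed petal lengths -/

section Rose

variable {n : ℕ}

theorem three_le_encard {α : Type*} {s : Set α} {a b c : α} (ha : a ∈ s) (hb : b ∈ s) (hc : c ∈ s)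
    (hab : a ≠ b) (hac : a ≠ c) (hbc : b ≠ c) : 3 ≤ s.encard := by
  have h : ({a, b, c} : Set α).encard = 3 := Set.encard_eq_three.2 ⟨a, b, c, hab, hac, hbc, rfl⟩
  rw [← h]
  refine Set.encard_le_encard ?_
  rintro x (rfl | rfl | rfl) <;> assumption

/-- Left translations of a Cayley graph. -/
def cayleyAction {Γ : Type*} [Group Γ] (B : Set Γ) : Γ →* (cayley B ≃g cayley B) where
  toFun g := ⟨Equiv.mulLeft g, fun {x y} => (cayley_isInvariant B).adj_iff g x y⟩
  map_one' := by
    ext x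
    exact one_mul x
  map_mul' g h := by
    ext x
    exact mul_assoc g h x

/-- The universal covering of the rose defined by a basis. -/
def roseSplitting (hn : 3 ≤ n) {B : Set (F n)} (hB : IsBasis B) : FreeSplitting n where
  V := F n
  graph := cayley B
  isTree := hB.cayley_isTree
  ρ := cayleyAction B
  edge_stab g v w _ hv _ := by
    have : g * v = v := hv
    simpa using this
  minimal S hS hinv _ := by
    obtain ⟨s, hs⟩ := hS
    refine Set.eq_univ_of_forall fun v => ?_
    have h : (v * s⁻¹) * s ∈ S := hinv (v * s⁻¹) s hs
    rwa [inv_mul_cancel_right] at h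
  valence v := by
    obtain ⟨a, ha, b, hb, -, -, hab, -⟩ := (isLargeFree hn).three B hB
    have h1 : ∀ x ∈ B, v * x ∈ (cayley B).neighborSet v := fun x hx =>
      cayley_adj_mul v hx (hB.ne_one hx)
    have h2 : v * a⁻¹ ∈ (cayley B).neighborSet v := by
      have := (cayley_adj_mul (v * a⁻¹) ha (hB.ne_one ha)).symm
      rwa [inv_mul_cancel_right] at this
    refine three_le_encard (h1 a ha) (h1 b hb) h2 (fun h => hab (mul_left_cancel h)) ?_ ?_
    · intro h
      refine hB.inv_notMem ha ?_
      rw [← mul_left_cancel h]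
      exact ha
    · intro h
      refine hB.inv_notMem ha ?_
      rw [← mul_left_cancel h]
      exact hb

/-- The length function on the edges of a Cayley tree defined by a weight on the basis. -/
def roseLen (B : Set (F n)) (w : F n → ℝ) : Sym2 (F n) → ℝ :=
  Sym2.lift ⟨fun x y : F n => B.indicator w (x⁻¹ * y) + B.indicator w (y⁻¹ * x),
    fun _ _ => add_comm _ _⟩

theorem roseLen_mk (B : Set (F n)) (w : F n → ℝ) (x y : F n) :
    roseLen B w s(x, y) = B.indicator w (x⁻¹ * y) + B.indicator w (y⁻¹ * x) := rfl

theorem roseLen_mul {B : Set (F n)} (hB : IsBasis B) (w : F n → ℝ) (v : F n) {b : F n}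
    (hb : b ∈ B) : roseLen B w s(v, v * b) = w b := by
  rw [roseLen_mk]
  simp [Set.indicator_of_mem hb, Set.indicator_of_notMem (hB.inv_notMem hb)]

theorem roseLen_pos {B : Set (F n)} {w : F n → ℝ} (hw : ∀ b ∈ B, 0 < w b) {e : Sym2 (F n)}
    (he : e ∈ (cayley B).edgeSet) : 0 < roseLen B w e := by
  have hnn : ∀ z, 0 ≤ B.indicator w z := fun z => Set.indicator_nonneg (fun b hb => (hw b hb).le) z
  induction e with
  | _ x y =>
    rw [roseLen_mk]
    have he' : (cayley B).Adj x y := he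
    rcases he'.2 with h | h
    · refine add_pos_of_pos_of_nonneg ?_ (hnn _)
      rw [Set.indicator_of_mem h]
      exact hw _ h
    · refine add_pos_of_nonneg_of_pos (hnn _) ?_
      rw [Set.indicator_of_mem h]
      exact hw _ h

theorem roseLen_map (B : Set (F n)) (w : F n → ℝ) (g : F n) (e : Sym2 (F n)) :
    roseLen B w (e.map fun z => g * z) = roseLen B w e := by
  induction e with
  | _ x y =>
    rw [Sym2.map_mk, roseLen_mk, roseLen_mk]
    simp [mul_assoc]

theorem roseLen_volume {B : Set (F n)} (hB : IsBasis B) {w : F n → ℝ}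
    (hsum : ∑ b ∈ hB.finite_and_ncard.1.toFinset, w b = 1) :
    ∃ D : Finset (Sym2 (F n)), (∀ e ∈ D, e ∈ (cayley B).edgeSet) ∧
      (∀ e ∈ (cayley B).edgeSet, ∃! d, d ∈ D ∧ ∃ g : F n, d.map (fun z => g * z) = e) ∧
      ∑ e ∈ D, roseLen B w e = 1 := by
  classical
  have hfin := hB.finite_and_ncard.1
  let D : Finset (Sym2 (F n)) := hfin.toFinset.image fun b => s(1, b)
  have hmemD : ∀ {d}, d ∈ D ↔ ∃ b ∈ B, s(1, b) = d := by
    intro d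
    simp [D]
  have hinj : Set.InjOn (fun b : F n => s(1, b)) hfin.toFinset := by
    intro b hb b' hb' h
    rcases Sym2.eq_iff.1 h with ⟨-, h⟩ | ⟨h1, h2⟩
    · exact h
    · exact h2.trans h1
  have hex : ∀ x : F n, ∀ b ∈ B, ∃! d, d ∈ D ∧ ∃ g : F n,
      d.map (fun z => g * z) = s(x, x * b) := by
    intro x b hb
    refine ⟨s(1, b), ⟨hmemD.2 ⟨b, hb, rfl⟩, x, by simp⟩, ?_⟩
    rintro d ⟨hd, g, hg⟩
    obtain ⟨b', hb', rfl⟩ := hmemD.1 hd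
    rw [Sym2.map_mk] at hg
    rcases Sym2.eq_iff.1 hg with ⟨h1, h2⟩ | ⟨h1, h2⟩
    · rw [mul_one] at h1
      rw [h1] at h2
      rw [mul_left_cancel h2]
    · rw [mul_one] at h1
      rw [h1, mul_assoc] at h2
      have h3 : b * b' = 1 := by simpa using h2
      exact absurd (eq_inv_of_mul_eq_one_right h3 ▸ hb') (hB.inv_notMem hb)
  refine ⟨D, ?_, ?_, ?_⟩
  · intro d hd
    obtain ⟨b, hb, rfl⟩ := hmemD.1 hd
    have := cayley_adj_mul 1 hb (hB.ne_one hb)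
    rwa [one_mul] at this
  · intro e he
    induction e with
    | _ x y =>
      have he' : (cayley B).Adj x y := he
      rcases he'.2 with h | h
      · have := hex x _ h
        rwa [mul_inv_cancel_left] at this
      · have := hex y _ h
        rw [mul_inv_cancel_left, Sym2.eq_swap] at this
        exact this
  · rw [Finset.sum_image hinj, ← hsum]
    refine Finset.sum_congr rfl fun b hb => ?_
    have hb' : b ∈ B := by simpa using hb
    have := roseLen_mul hB w 1 hb'
    rwa [one_mul] at this

/-- The tree with edge lengths prescribed by a weight on the basis. -/
def roseTree (hn : 3 ≤ n) {B : Set (F n)} (hB : IsBasis B) (w : F n → ℝ) (hw : ∀ b ∈ B, 0 < w b)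
    (hsum : ∑ b ∈ hB.finite_and_ncard.1.toFinset, w b = 1) : MetricTree n where
  toFreeSplitting := roseSplitting hn hB
  free g v hv := mul_eq_right.1 (show g * (id v : F n) = (id v : F n) from hv)
  len := roseLen B w
  len_pos _ he := roseLen_pos hw he
  len_inv g e _ := roseLen_map B w g e
  volume_one := roseLen_volume hB hsum

/-- In a Cayley tree a single vertex is a transversal, and its steps are the basis elements and
their inverses. -/
theorem cayley_isGeometric {B : Set (F n)} (hB : IsBasis B) : IsGeometric (cayley B) B := by
  refine ⟨{1}, ⟨isPartialTransversal_singleton isFreeAction_self 1,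
    fun v => ⟨v⁻¹, inv_mul_cancel v⟩⟩, ?_, ?_, fun b hb => hB.inv_notMem hb⟩
  · intro b hb
    refine ⟨hB.ne_one hb, 1, rfl, 1, rfl, ?_⟩
    have := cayley_adj_mul 1 hb (hB.ne_one hb)
    rwa [one_mul, ← mul_one b] at this
  · rintro s ⟨-, _, rfl, _, rfl, h⟩
    have h' : (cayley B).Adj 1 (s * 1) := h
    rw [mul_one] at h'
    simpa using h'.2

theorem roseSplitting_isGeometric (hn : 3 ≤ n) {B : Set (F n)} (hB : IsBasis B) :
    IsGeometric (roseSplitting hn hB).graph B := cayley_isGeometric hB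

theorem roseTree_displaces (hn : 3 ≤ n) {B : Set (F n)} (hB : IsBasis B) {w : F n → ℝ}
    (hw : ∀ b ∈ B, 0 < w b) (hsum : ∑ b ∈ hB.finite_and_ncard.1.toFinset, w b = 1) {C : Set (F n)}
    (hC : C ⊆ B) {k : ℝ} (hk : ∀ c ∈ C, w c ≤ k) (g : F n) :
    Displaces (roseTree hn hB w hw hsum) k g ((fun c => g * c * g⁻¹) '' C) := by
  rintro _ ⟨c, hc, rfl⟩
  have h1 : (g * c * g⁻¹) * g = g * c := by rw [inv_mul_cancel_right]
  have h2 := (roseTree hn hB w hw hsum).dist_adj_le (cayley_adj_mul g (hC hc) (hB.ne_one (hC hc)))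
  have h3 : (roseTree hn hB w hw hsum).len s(g, g * c) = w c := roseLen_mul hB w g (hC hc)
  change (roseTree hn hB w hw hsum).dist g ((g * c * g⁻¹) * g) ≤ k
  rw [h1]
  exact (h2.trans_eq h3).trans (hk c hc)

theorem weight_le_one {B : Set (F n)} (hfin : B.Finite) {w : F n → ℝ} (hw : ∀ b ∈ B, 0 < w b)
    (hsum : ∑ b ∈ hfin.toFinset, w b = 1) {b : F n} (hb : b ∈ B) : w b ≤ 1 := by
  rw [← hsum]
  exact Finset.single_le_sum (f := w) (fun c hc => (hw c (by simpa using hc)).le)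
    (by simpa using hb)

end Rose

end OuterSpace

end

noncomputable section

namespace OuterSpace

section Ties

variable {n : ℕ}

/-! ### Bases read off from points of outer space -/

theorem Cv0.exists_rep (x : Cv0 n) : ∃ T : MetricTree n, Cv0.mk T = x := Quotient.exists_rep x

theorem Cv0.iso_of_eq {T T' : MetricTree n} (h : Cv0.mk T = Cv0.mk T') : T.Iso T' :=
  Quotient.exact h

/-- The basis `B` can be read off from the point `x`. -/
def Geo (x : Cv0 n) (B : Set (F n)) : Prop :=
  ∃ T : MetricTree n, Cv0.mk T = x ∧ IsGeometric T.graph B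

theorem Geo.isBasis {x : Cv0 n} {B : Set (F n)} (h : Geo x B) : IsBasis B := by
  obtain ⟨T, -, hB⟩ := h
  exact hB.isBasis T.isTree T.isInvariant

theorem Geo.isGeometric {T : MetricTree n} {B : Set (F n)} (h : Geo (Cv0.mk T) B) :
    IsGeometric T.graph B := by
  obtain ⟨T', hT', hB⟩ := h
  exact (Cv0.iso_of_eq hT').isGeometric hB

theorem IsBasis.nontrivial (hn : 3 ≤ n) {B : Set (F n)} (hB : IsBasis B) : B.Nontrivial := by
  obtain ⟨x, hx, y, hy, -, -, hxy, -⟩ := (isLargeFree hn).three B hB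
  exact ⟨x, hx, y, hy, hxy⟩

theorem Geo.near (hn : 3 ≤ n) {x : Cv0 n} {B B' : Set (F n)} (h : Geo x B) (h' : Geo x B') :
    BNear 2 B B' := by
  obtain ⟨T, rfl⟩ := x.exists_rep
  exact h.isGeometric.near T.isTree T.isInvariant freeGroup_torsionFree h'.isGeometric
    (h.isBasis.nontrivial hn).nonempty (h'.isBasis.nontrivial hn)

theorem exists_isGeometric {V : Type*} [MulAction (F n) V] {G : SimpleGraph V} (hG : G.IsTree)
    (hinv : IsInvariant (F n) G) (hfree : IsFreeAction (F n) V) :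
    ∃ B : Set (F n), IsGeometric G B := by
  obtain ⟨X, hX⟩ := exists_transversal hinv hfree hG.connected
  obtain ⟨B, hB⟩ := exists_geometric (Γ := F n) (G := G) freeGroup_torsionFree (X := X)
  exact ⟨B, X, hX, hB⟩

theorem exists_geo (x : Cv0 n) : ∃ B, Geo x B := by
  obtain ⟨T, rfl⟩ := x.exists_rep
  obtain ⟨B, hB⟩ := exists_isGeometric T.isTree T.isInvariant T.isFreeAction
  exact ⟨B, T, rfl, hB⟩

theorem BNear.isBasis {s : ℕ} {B B' : Set (F n)} (h : BNear s B B') (hB : IsBasis B) :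
    IsBasis B' := by
  induction h with
  | refl => exact hB
  | step _ hadj _ => exact hadj.2.1

theorem IsBasis.exists_subset {B : Set (F n)} (hB : IsBasis B) {ℓ : ℕ} (hℓ : ℓ ≤ n) :
    ∃ C ⊆ B, C.ncard = ℓ :=
  Set.exists_subset_card_eq (hℓ.trans_eq hB.finite_and_ncard.2.symm)

theorem IsBasis.exists_sdiff_eq {B C : Set (F n)} (hB : IsBasis B) (hn : 1 ≤ n) (hC : C ⊆ B)
    (hcard : C.ncard = n - 1) : ∃ b ∈ B, B \ {b} = C := by
  obtain ⟨hfin, h⟩ := hB.finite_and_ncard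
  have h1 : (B \ C).ncard = 1 := by
    rw [Set.ncard_sdiff hC (hfin.subset hC), h, hcard]
    omega
  obtain ⟨b, hb⟩ := Set.ncard_eq_one.1 h1
  have hbB : b ∈ B \ C := hb ▸ rfl
  exact ⟨b, hbB.1, by rw [← hb, Set.sdiff_sdiff_cancel_left hC]⟩

theorem bAdj_of_closure_eq (hn : 1 ≤ n) {B B' C C' : Set (F n)} (hB : IsBasis B) (hB' : IsBasis B')
    (hC : C ⊆ B) (hC' : C' ⊆ B') (hcard : C.ncard = n - 1) (hcard' : C'.ncard = n - 1) (g : F n)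
    (h : conjSub g (Subgroup.closure C) = Subgroup.closure C') : BAdj B B' := by
  obtain ⟨b, hb, rfl⟩ := hB.exists_sdiff_eq hn hC hcard
  obtain ⟨b', hb', rfl⟩ := hB'.exists_sdiff_eq hn hC' hcard'
  exact ⟨hB, hB', b, hb, b', hb', g, h⟩

/-- The main estimate for points of outer space. Two more steps lead from one basis read off from
the tree to any other one. -/
theorem IsShortFactor.exists_near (hn : 3 ≤ n) {k : ℝ} (hk : 0 ≤ k) {r : ℕ} (hr : 1 ≤ r)
    (hrn : r ≤ n - 1) {A : Subgroup (F n)} {x : Cv0 n} (h : IsShortFactor k r A x) :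
    ∃ C B' : Set (F n), Subgroup.closure C = A ∧ C.ncard = r ∧ C ⊆ B' ∧ IsBasis B' ∧
      ∀ B, Geo x B → BNear (nearBound n k + 2) B' B := by
  obtain ⟨hA, T, rfl, hT⟩ := h
  obtain ⟨C, v, hC, hCA, hcard, hd⟩ := hT.exists_displaces
  obtain ⟨B₀, hB₀, hCB₀⟩ := hA.1.exists_basis hC hCA
  have hne : C.Nonempty := Set.nonempty_of_ncard_ne_zero (by omega)
  have hCB : C ≠ B₀ := by
    rintro rfl
    have := hB₀.finite_and_ncard.2
    omega
  obtain ⟨B', B, h1, h2, h3⟩ := T.exists_near_of_short hn hB₀ hCB₀ hCB hne hk hd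
  have hB : Geo (Cv0.mk T) B := ⟨T, rfl, h2⟩
  exact ⟨C, B', hCA, hcard, h1, h3.symm.isBasis hB.isBasis, fun B₁ hB₁ => h3.trans (hB.near hn hB₁)⟩

/-- Some vertex is moved by at most three by all basis elements. -/
theorem Geo.isShortFactor {k : ℝ} (hk : 3 ≤ k) {x : Cv0 n} {B C : Set (F n)} (h : Geo x B)
    (hC : C ⊆ B) : IsShortFactor k C.ncard (Subgroup.closure C) x := by
  have hB := h.isBasis
  refine ⟨hB.isFreeFactorOfRank hC, ?_⟩
  obtain ⟨T, rfl, hT⟩ := h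
  obtain ⟨v, hv⟩ := hT.exists_displaces
  exact ⟨T, rfl, Displaces.isShort (fun c hc => (hv c (hC hc)).trans hk) (hB.isFreeSet.mono hC)
    (hB.finite_and_ncard.1.subset hC)⟩

/-! ### Chains of tied trees -/

theorem Tied.symm {k : ℝ} {ℓ : ℕ} {x y : Cv0 n} (h : Tied k ℓ x y) : Tied k ℓ y x := by
  obtain ⟨A, h1, h2⟩ := h
  exact ⟨A, h2, h1⟩

theorem exists_isShortFactor {k : ℝ} (hk : 3 ≤ k) {ℓ : ℕ} (hℓ : ℓ ≤ n) (x : Cv0 n) :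
    ∃ A, IsShortFactor k ℓ A x := by
  obtain ⟨B, hB⟩ := exists_geo x
  obtain ⟨C, hC, rfl⟩ := hB.isBasis.exists_subset hℓ
  exact ⟨_, hB.isShortFactor hk hC⟩

theorem IsTiedChain.refl (k : ℝ) (ℓ : ℕ) (x : Cv0 n) : IsTiedChain k ℓ x x 0 :=
  ⟨fun _ => x, rfl, rfl, fun i hi => absurd hi (by omega)⟩

theorem IsTiedChain.step {k : ℝ} {ℓ s : ℕ} {x y z : Cv0 n} (h : IsTiedChain k ℓ x y s)
    (hyz : Tied k ℓ y z) : IsTiedChain k ℓ x z (s + 1) := by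
  obtain ⟨u, h0, hs, hu⟩ := h
  refine ⟨fun i => if i ≤ s then u i else z, by simpa using h0, by simp, fun i hi => ?_⟩
  rcases Nat.lt_or_ge i s with h | h
  · simp only [if_pos h.le, if_pos (show i + 1 ≤ s from h)]
    exact hu i h
  · have : i = s := by omega
    subst this
    simpa [hs] using hyz

theorem IsTiedChain.induction {k : ℝ} {ℓ : ℕ} {x : Cv0 n} {P : ℕ → Cv0 n → Prop} (h0 : P 0 x)
    (hstep : ∀ s y z, IsTiedChain k ℓ x y s → P s y → Tied k ℓ y z → P (s + 1) z) :
    ∀ {s : ℕ} {y : Cv0 n}, IsTiedChain k ℓ x y s → P s y := by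
  intro s
  induction s with
  | zero =>
    rintro y ⟨u, h1, h2, -⟩
    rw [← h2, h1]
    exact h0
  | succ s ih =>
    rintro y ⟨u, h1, h2, h3⟩
    have hc : IsTiedChain k ℓ x (u s) s := ⟨u, h1, rfl, fun i hi => h3 i (by omega)⟩
    rw [← h2]
    exact hstep s (u s) (u (s + 1)) hc (ih hc) (h3 s (by omega))

theorem Tied.chain {k : ℝ} {ℓ : ℕ} {x y : Cv0 n} (h : Tied k ℓ x y) : IsTiedChain k ℓ x y 1 :=
  (IsTiedChain.refl k ℓ x).step h

theorem IsTiedChain.trans {k : ℝ} {ℓ s t : ℕ} {x y z : Cv0 n} (h : IsTiedChain k ℓ x y s)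
    (h' : IsTiedChain k ℓ y z t) : IsTiedChain k ℓ x z (s + t) :=
  IsTiedChain.induction (P := fun t z => IsTiedChain k ℓ x z (s + t)) h
    (fun _ _ _ _ ih htied => ih.step htied) h'

theorem IsTiedChain.symm {k : ℝ} {ℓ s : ℕ} {x y : Cv0 n} (h : IsTiedChain k ℓ x y s) :
    IsTiedChain k ℓ y x s :=
  IsTiedChain.induction (P := fun t z => IsTiedChain k ℓ z x t) (IsTiedChain.refl k ℓ x)
    (fun s _ _ _ ih htied => by simpa only [Nat.add_comm] using htied.symm.chain.trans ih) h

/-- Every tree has a short factor, so it is tied to itself and chains can be prolonged. -/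
theorem IsTiedChain.mono {k : ℝ} (hk : 3 ≤ k) {ℓ : ℕ} (hℓ : ℓ ≤ n) {s t : ℕ} (hst : s ≤ t)
    {x y : Cv0 n} (h : IsTiedChain k ℓ x y s) : IsTiedChain k ℓ x y t := by
  induction t, hst using Nat.le_induction with
  | base => exact h
  | succ t _ ih =>
    obtain ⟨A, hA⟩ := exists_isShortFactor hk hℓ y
    exact ih.step ⟨A, hA, hA⟩

theorem ngDist_le {k : ℝ} {ℓ s : ℕ} {x y : Cv0 n} (h : IsTiedChain k ℓ x y s) :
    ngDist k ℓ x y ≤ s := by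
  unfold ngDist
  split_ifs with hxy
  · exact Nat.zero_le _
  · refine Nat.sInf_le ⟨?_, h⟩
    by_contra h0
    have : s = 0 := by omega
    subst this
    obtain ⟨u, h1, h2, -⟩ := h
    exact hxy (h1.symm.trans h2)

theorem isTiedChain_ngDist {k : ℝ} {ℓ : ℕ} {x y : Cv0 n} (h : ∃ s, 1 ≤ s ∧ IsTiedChain k ℓ x y s) :
    IsTiedChain k ℓ x y (ngDist k ℓ x y) := by
  unfold ngDist
  split_ifs with hxy
  · rw [hxy]
    exact IsTiedChain.refl k ℓ y
  · exact (Nat.sInf_mem (s := {s : ℕ | 1 ≤ s ∧ IsTiedChain k ℓ x y s}) h).2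

theorem isDistance_ngDist {k : ℝ} {ℓ : ℕ}
    (h : ∀ x y : Cv0 n, ∃ s, 1 ≤ s ∧ IsTiedChain k ℓ x y s) : IsDistance (ngDist (n := n) k ℓ) := by
  refine ⟨fun x y => ⟨fun h0 => ?_, fun hxy => by simp [ngDist, hxy]⟩, fun x y => ?_,
    fun x y z => ngDist_le ((isTiedChain_ngDist (h x y)).trans (isTiedChain_ngDist (h y z)))⟩
  · have := isTiedChain_ngDist (h x y)
    rw [h0] at this
    obtain ⟨u, h1, h2, -⟩ := this
    exact h1.symm.trans h2
  · exact le_antisymm (ngDist_le (isTiedChain_ngDist (h y x)).symm)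
      (ngDist_le (isTiedChain_ngDist (h x y)).symm)

/-! ### Roses -/

/-- The point of outer space defined by a rose. -/
def rosePt (hn : 3 ≤ n) {B : Set (F n)} (hB : IsBasis B) (w : F n → ℝ) (hw : ∀ b ∈ B, 0 < w b)
    (hsum : ∑ b ∈ hB.finite_and_ncard.1.toFinset, w b = 1) : Cv0 n :=
  Cv0.mk (roseTree hn hB w hw hsum)

theorem geo_rosePt (hn : 3 ≤ n) {B : Set (F n)} (hB : IsBasis B) {w : F n → ℝ}
    (hw : ∀ b ∈ B, 0 < w b) (hsum : ∑ b ∈ hB.finite_and_ncard.1.toFinset, w b = 1) :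
    Geo (rosePt hn hB w hw hsum) B :=
  ⟨_, rfl, roseSplitting_isGeometric hn hB⟩

theorem conjSub_closure {Γ : Type*} [Group Γ] (g : Γ) (C : Set Γ) :
    conjSub g (Subgroup.closure C) = Subgroup.closure ((fun c => g * c * g⁻¹) '' C) := by
  rw [conjSub, MonoidHom.map_closure]
  rfl

theorem IsBasis.conj {B : Set (F n)} (hB : IsBasis B) (g : F n) :
    IsBasis ((fun c => g * c * g⁻¹) '' B) := hB.image (MulAut.conj g)

theorem ncard_conj (g : F n) (C : Set (F n)) : ((fun c => g * c * g⁻¹) '' C).ncard = C.ncard :=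
  Set.ncard_image_of_injective _ (MulAut.conj g).injective

theorem isShortFactor_rosePt (hn : 3 ≤ n) {B : Set (F n)} (hB : IsBasis B) {w : F n → ℝ}
    (hw : ∀ b ∈ B, 0 < w b) (hsum : ∑ b ∈ hB.finite_and_ncard.1.toFinset, w b = 1) {k : ℝ}
    (hk : 1 ≤ k) {C : Set (F n)} (hC : C ⊆ B) (g : F n) :
    IsShortFactor k C.ncard (conjSub g (Subgroup.closure C)) (rosePt hn hB w hw hsum) := by
  have hBg := hB.conj g
  have hCg : (fun c => g * c * g⁻¹) '' C ⊆ (fun c => g * c * g⁻¹) '' B := Set.image_mono hC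
  rw [conjSub_closure, ← ncard_conj g C]
  refine ⟨hBg.isFreeFactorOfRank hCg, _, rfl, ?_⟩
  exact (roseTree_displaces hn hB hw hsum hC (fun c hc => (weight_le_one _ hw hsum (hC hc)).trans hk)
    g).isShort (hBg.isFreeSet.mono hCg) (hBg.finite_and_ncard.1.subset hCg)

/-- A factor spanned by a part of the basis is short for both trees, whatever the petal lengths. -/
theorem Geo.tied_rosePt (hn : 3 ≤ n) {k : ℝ} (hk : 3 ≤ k) {ℓ : ℕ} (hℓ : ℓ ≤ n) {x : Cv0 n}
    {B : Set (F n)} (h : Geo x B) {w : F n → ℝ} (hw : ∀ b ∈ B, 0 < w b)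
    (hsum : ∑ b ∈ h.isBasis.finite_and_ncard.1.toFinset, w b = 1) :
    Tied k ℓ x (rosePt hn h.isBasis w hw hsum) := by
  obtain ⟨C, hC, rfl⟩ := h.isBasis.exists_subset hℓ
  refine ⟨_, h.isShortFactor hk hC, ?_⟩
  have := isShortFactor_rosePt hn h.isBasis hw hsum (by linarith : 1 ≤ k) hC 1
  rwa [conjSub_one] at this

/-- `M` is the length of a word in `S` for `c`. It does not depend on the petal lengths, so these
can be chosen afterwards. -/
theorem rose_dist_bound (hn : 3 ≤ n) {B S : Set (F n)} (hB : IsBasis B) (hS : S ⊆ B) {c : F n}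
    (hc : c ∈ Subgroup.closure S) : ∃ M : ℕ, ∀ (w : F n → ℝ) (hw : ∀ b ∈ B, 0 < w b)
      (hsum : ∑ b ∈ hB.finite_and_ncard.1.toFinset, w b = 1) (ε : ℝ), (∀ b ∈ S, w b ≤ ε) →
      (roseTree hn hB w hw hsum).dist (1 : F n) c ≤ M * ε := by
  induction hc using Subgroup.closure_induction with
  | mem b hb =>
    refine ⟨1, fun w hw hsum ε hε => ?_⟩
    have h := roseTree_displaces hn hB hw hsum hS hε 1 (1 * b * 1⁻¹) ⟨b, hb, rfl⟩
    have h2 : (1 * b * 1⁻¹ : F n) * 1 = b := by simp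
    rw [Nat.cast_one, one_mul]
    exact (congrArg (fun z : F n => (roseTree hn hB w hw hsum).dist (1 : F n) z) h2).symm.trans_le h
  | one => exact ⟨0, fun w hw hsum ε _ => by
      simp [(roseTree hn hB w hw hsum).dist_self (1 : F n)]⟩
  | mul x y _ _ hx hy =>
    obtain ⟨M, hM⟩ := hx
    obtain ⟨N, hN⟩ := hy
    refine ⟨M + N, fun w hw hsum ε hε => ?_⟩
    have h1 := (roseTree hn hB w hw hsum).dist_triangle (1 : F n) x (x * y : F n)
    have h2 : (roseTree hn hB w hw hsum).dist (x * 1 : F n) (x * y : F n) = _ :=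
      (roseTree hn hB w hw hsum).dist_smul x (1 : F n) y
    rw [mul_one] at h2
    have h3 := hM w hw hsum ε hε
    have h4 := hN w hw hsum ε hε
    push_cast
    linarith
  | inv x _ hx =>
    obtain ⟨M, hM⟩ := hx
    refine ⟨M, fun w hw hsum ε hε => ?_⟩
    have h2 : (roseTree hn hB w hw hsum).dist (x * 1 : F n) (x * x⁻¹ : F n) = _ :=
      (roseTree hn hB w hw hsum).dist_smul x (1 : F n) (x⁻¹ : F n)
    rw [mul_one, mul_inv_cancel] at h2
    have h3 := (roseTree hn hB w hw hsum).dist_comm (1 : F n) x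
    exact (h2.symm.trans h3.symm).trans_le (hM w hw hsum ε hε)

theorem exists_weight {B : Set (F n)} (hB : IsBasis B) {b : F n} (hb : b ∈ B) {ε : ℝ} (hε : 0 < ε)
    (hεn : n * ε ≤ 1) : ∃ w : F n → ℝ, (∀ c ∈ B, 0 < w c) ∧
      ∑ c ∈ hB.finite_and_ncard.1.toFinset, w c = 1 ∧ ∀ c ∈ B \ {b}, w c ≤ ε := by
  classical
  obtain ⟨hfin, hcard⟩ := hB.finite_and_ncard
  refine ⟨fun c => if c = b then 1 - (n - 1) * ε else ε, fun c _ => ?_, ?_, fun c hc => ?_⟩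
  · dsimp only
    split_ifs
    · linarith
    · exact hε
  · have hb' : b ∈ hfin.toFinset := by simpa using hb
    rw [← Finset.add_sum_erase _ _ hb', if_pos rfl]
    have h1 : ∑ c ∈ hfin.toFinset.erase b, (if c = b then 1 - ((n : ℝ) - 1) * ε else ε) =
        ∑ c ∈ hfin.toFinset.erase b, ε :=
      Finset.sum_congr rfl fun c hc => if_neg (Finset.ne_of_mem_erase hc)
    have h2 : hfin.toFinset.card = n := by rw [← Set.ncard_eq_toFinset_card B hfin, hcard]
    have h3 : 1 ≤ n := by
      rw [← h2]
      exact Finset.card_pos.2 ⟨b, hb'⟩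
    rw [h1, Finset.sum_const, Finset.card_erase_of_mem hb', h2, nsmul_eq_mul, Nat.cast_sub h3]
    push_cast
    ring
  · have : c ≠ b := hc.2
    simp [this]

/-- The common corank one factor need not be short for both roses. In the rose of `B` it does not
involve the petal `b`, up to conjugation, so it becomes short when all other petals shrink. The rose
with the new lengths is tied to the original one through a part of `B`, and to the rose of `B'`
through a part of the common factor. -/
theorem BAdj.chain (hn : 3 ≤ n) {k : ℝ} (hk : 3 ≤ k) {ℓ : ℕ} (hℓ : ℓ ≤ n - 1) {B B' : Set (F n)}
    (hB : IsBasis B) (hB' : IsBasis B') (h : BAdj B B') {w w' : F n → ℝ} (hw : ∀ b ∈ B, 0 < w b)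
    (hsum : ∑ b ∈ hB.finite_and_ncard.1.toFinset, w b = 1) (hw' : ∀ b ∈ B', 0 < w' b)
    (hsum' : ∑ b ∈ hB'.finite_and_ncard.1.toFinset, w' b = 1) :
    IsTiedChain k ℓ (rosePt hn hB w hw hsum) (rosePt hn hB' w' hw' hsum') 2 := by
  obtain ⟨-, -, b', hb', b, hb, g, hg⟩ := h.symm
  have hcard : (B' \ {b'}).ncard = n - 1 := by
    rw [Set.ncard_sdiff_singleton_of_mem hb', hB'.finite_and_ncard.2]
  obtain ⟨C, hC, hCℓ⟩ := Set.exists_subset_card_eq (hℓ.trans_eq hcard.symm)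
  have hCB' : C ⊆ B' := hC.trans Set.sdiff_subset
  have hBg := hB'.conj g
  have hCg : (fun c => g * c * g⁻¹) '' C ⊆ (fun c => g * c * g⁻¹) '' B' := Set.image_mono hCB'
  have hfin := hBg.finite_and_ncard.1.subset hCg
  have hmem : ∀ c ∈ (fun c => g * c * g⁻¹) '' C, c ∈ Subgroup.closure (B \ {b}) := by
    rintro _ ⟨c, hc, rfl⟩
    rw [← hg, mem_conjSub]
    have : g⁻¹ * (g * c * g⁻¹) * g = c := by group
    rw [this]
    exact Subgroup.subset_closure (hC hc)
  have hex : ∀ c, ∃ M : ℕ, c ∈ (fun c => g * c * g⁻¹) '' C → ∀ (w : F n → ℝ)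
      (hw : ∀ b ∈ B, 0 < w b) (hsum : ∑ b ∈ hB.finite_and_ncard.1.toFinset, w b = 1) (ε : ℝ),
      (∀ a ∈ B \ {b}, w a ≤ ε) → (roseTree hn hB w hw hsum).dist (1 : F n) c ≤ M * ε := by
    intro c
    by_cases hc : c ∈ (fun c => g * c * g⁻¹) '' C
    · obtain ⟨M, hM⟩ := rose_dist_bound hn hB Set.sdiff_subset (hmem c hc)
      exact ⟨M, fun _ => hM⟩
    · exact ⟨0, fun h => absurd h hc⟩
  choose M hM using hex
  set N : ℕ := ∑ c ∈ hfin.toFinset, M c with hN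
  have hn0 : (0 : ℝ) < n := by
    exact_mod_cast (by omega : 0 < n)
  have hN0 : (0 : ℝ) < N + 1 := by positivity
  -- So small that `n` petals of this length fit into volume one, and that the words which occur, of
  -- length at most `N`, have total length at most one.
  have hε : (0 : ℝ) < 1 / (n * (N + 1)) := by positivity
  have hn1 : (1 : ℝ) ≤ n := by exact_mod_cast (by omega : 1 ≤ n)
  have hNnn : (0 : ℝ) ≤ N := Nat.cast_nonneg N
  obtain ⟨v, hv, hvsum, hvε⟩ := exists_weight hB hb hε (by
    rw [mul_one_div, div_le_one (by positivity)]
    nlinarith)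
  have htie1 : Tied k ℓ (rosePt hn hB w hw hsum) (rosePt hn hB v hv hvsum) :=
    (geo_rosePt hn hB hw hsum).tied_rosePt hn hk (hℓ.trans (Nat.sub_le _ _)) hv hvsum
  have htie2 : Tied k ℓ (rosePt hn hB v hv hvsum) (rosePt hn hB' w' hw' hsum') := by
    refine ⟨conjSub g (Subgroup.closure C), ?_, ?_⟩
    · rw [conjSub_closure, ← hCℓ, ← ncard_conj g C]
      refine ⟨hBg.isFreeFactorOfRank hCg, _, rfl, ?_⟩
      refine Displaces.isShort (v := (1 : F n)) ?_ (hBg.isFreeSet.mono hCg) hfin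
      intro c hc
      have h1 := hM c hc v hv hvsum _ hvε
      have h2 : M c ≤ N := Finset.single_le_sum (f := M) (fun _ _ => Nat.zero_le _)
        (by simpa using hc)
      have h3 : (M c : ℝ) * (1 / (n * (N + 1))) ≤ 1 := by
        rw [mul_one_div, div_le_one (by positivity)]
        have : (M c : ℝ) ≤ N := by exact_mod_cast h2
        nlinarith
      change (roseTree hn hB v hv hvsum).dist (1 : F n) (c * 1 : F n) ≤ k
      rw [mul_one]
      linarith
    · rw [← hCℓ]
      exact isShortFactor_rosePt hn hB' hw' hsum' (by linarith) hCB' g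
  exact htie1.chain.step htie2

/-- The rose with petals of the same length. -/
def stdRose (hn : 3 ≤ n) {B : Set (F n)} (hB : IsBasis B) : Cv0 n :=
  rosePt hn hB (fun _ => 1 / (n : ℝ)) (fun _ _ => by
    have : (0 : ℝ) < n := by exact_mod_cast (by omega : 0 < n)
    positivity) (by
    have h0 : (n : ℝ) ≠ 0 := by exact_mod_cast (by omega : n ≠ 0)
    obtain ⟨hfin, hcard⟩ := hB.finite_and_ncard
    rw [Finset.sum_const, ← Set.ncard_eq_toFinset_card B hfin, hcard, nsmul_eq_mul, mul_one_div,
      div_self h0])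

theorem geo_stdRose (hn : 3 ≤ n) {B : Set (F n)} (hB : IsBasis B) : Geo (stdRose hn hB) B :=
  geo_rosePt hn hB _ _

theorem BNear.chain (hn : 3 ≤ n) {k : ℝ} (hk : 3 ≤ k) {ℓ : ℕ} (hℓ : ℓ ≤ n - 1) {s : ℕ}
    {B B' : Set (F n)} (h : BNear s B B') (hB : IsBasis B) (hB' : IsBasis B') :
    IsTiedChain k ℓ (stdRose hn hB) (stdRose hn hB') (2 * s) := by
  induction h with
  | refl s => exact (IsTiedChain.refl k ℓ _).mono hk (by omega) (Nat.zero_le _)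
  | step h hadj ih => exact (ih hB hadj.1).trans (hadj.chain hn hk hℓ hadj.1 hB' _ _ _ _)

/-- Each adjacency costs two ties between standard roses. One tie at each end leads to the given
trees. -/
theorem Geo.chain (hn : 3 ≤ n) {k : ℝ} (hk : 3 ≤ k) {ℓ : ℕ} (hℓ : ℓ ≤ n - 1) {s : ℕ} {x y : Cv0 n}
    {B B' : Set (F n)} (h : BNear s B B') (hx : Geo x B) (hy : Geo y B') :
    IsTiedChain k ℓ x y (2 * s + 2) := by
  have h1 : Tied k ℓ x (stdRose hn hx.isBasis) := hx.tied_rosePt hn hk (by omega) _ _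
  have h2 : Tied k ℓ y (stdRose hn hy.isBasis) := hy.tied_rosePt hn hk (by omega) _ _
  have := (h1.chain.trans (h.chain hn hk hℓ hx.isBasis hy.isBasis)).step h2.symm
  exact this.mono hk (by omega) (by omega)

/-- The main estimate for the rose of `B'`, with no control on the constant: every finite set has
displacement bounded by something. All the connectedness assertions follow from this. -/
theorem exists_bNear (hn : 3 ≤ n) {B B' : Set (F n)} (hB : IsBasis B) (hB' : IsBasis B') :
    ∃ s, BNear s B B' := by
  obtain ⟨C, hC, hcard⟩ := hB.exists_subset (Nat.sub_le n 1)
  have hfin := hB.finite_and_ncard.1.subset hC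
  obtain ⟨T, hT⟩ := (stdRose hn hB').exists_rep
  obtain ⟨v⟩ := T.isTree.connected.nonempty
  have hd : Displaces T (∑ c ∈ hfin.toFinset, T.dist v (c • v)) v C := fun c hc =>
    Finset.single_le_sum (f := fun c => T.dist v (c • v)) (fun c _ => T.dist_nonneg _ _)
      (by simpa using hc)
  have hCB : C ≠ B := by
    rintro rfl
    have := hB.finite_and_ncard.2
    omega
  obtain ⟨B₁, B₂, h1, h2, h3⟩ := T.exists_near_of_short hn hB hC hCB
    (Set.nonempty_of_ncard_ne_zero (by omega)) (Finset.sum_nonneg fun c _ => T.dist_nonneg _ _) hd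
  have hB₂ : Geo (stdRose hn hB') B₂ := ⟨T, hT, h2⟩
  have h4 := hB₂.near hn (geo_stdRose hn hB')
  have h5 : BAdj B B₁ := bAdj_of_closure_eq (by omega) hB (h3.symm.isBasis hB₂.isBasis) hC h1 hcard
    hcard 1 (by rw [conjSub_one])
  exact ⟨_, (h5.near.trans h3).trans h4⟩

theorem exists_chain (hn : 3 ≤ n) {k : ℝ} (hk : 3 ≤ k) {ℓ : ℕ} (hℓ : ℓ ≤ n - 1) (x y : Cv0 n) :
    ∃ s, 1 ≤ s ∧ IsTiedChain k ℓ x y s := by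
  obtain ⟨B, hB⟩ := exists_geo x
  obtain ⟨B', hB'⟩ := exists_geo y
  obtain ⟨s, hs⟩ := exists_bNear hn hB.isBasis hB'.isBasis
  exact ⟨2 * s + 2, by omega, hB.chain hn hk hℓ hs hB'⟩

end Ties

end OuterSpace

end

noncomputable section

namespace OuterSpace

section Walks

/-! ### Walks of bounded length -/

variable {V : Type*} {G : SimpleGraph V}

/-- There is a walk of length at most `s` from `x` to `y`. -/
def GNear (G : SimpleGraph V) (s : ℕ) (x y : V) : Prop := ∃ p : G.Walk x y, p.length ≤ s

theorem GNear.refl (s : ℕ) (x : V) : GNear G s x x := ⟨.nil, Nat.zero_le _⟩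

theorem GNear.trans {s t : ℕ} {x y z : V} (h : GNear G s x y) (h' : GNear G t y z) :
    GNear G (s + t) x z := by
  obtain ⟨p, hp⟩ := h
  obtain ⟨q, hq⟩ := h'
  exact ⟨p.append q, by rw [SimpleGraph.Walk.length_append]; omega⟩

theorem GNear.symm {s : ℕ} {x y : V} (h : GNear G s x y) : GNear G s y x := by
  obtain ⟨p, hp⟩ := h
  exact ⟨p.reverse, by rwa [SimpleGraph.Walk.length_reverse]⟩

theorem GNear.mono {s t : ℕ} (hst : s ≤ t) {x y : V} (h : GNear G s x y) : GNear G t x y := by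
  obtain ⟨p, hp⟩ := h
  exact ⟨p, hp.trans hst⟩

theorem GNear.dist_le {s : ℕ} {x y : V} (h : GNear G s x y) : G.dist x y ≤ s := by
  obtain ⟨p, hp⟩ := h
  exact (SimpleGraph.dist_le p).trans hp

theorem GNear.reachable {s : ℕ} {x y : V} (h : GNear G s x y) : G.Reachable x y := ⟨h.choose⟩

theorem gNear_dist (hG : G.Connected) (x y : V) :
    GNear G (G.dist x y) x y := by
  obtain ⟨p, hp⟩ := hG.exists_walk_length_eq_dist x y
  exact ⟨p, hp.le⟩

theorem gNear_of_fromRel {r : V → V → Prop} {x y : V} (h : r x y) :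
    GNear (SimpleGraph.fromRel r) 1 x y := by
  by_cases hxy : x = y
  · exact hxy ▸ GNear.refl _ _
  · exact ⟨.cons ((SimpleGraph.fromRel_adj r x y).2 ⟨hxy, Or.inl h⟩) .nil, le_rfl⟩

/-- If each edge can be traversed at a bounded cost, then so can each walk. -/
theorem GNear.induction {X : Type*} {near : ℕ → X → X → Prop} (R : V → X → Prop) {a b : ℕ}
    (htrans : ∀ {s t : ℕ} {x y z : X}, near s x y → near t y z → near (s + t) x z)
    (hmono : ∀ {s t : ℕ} {x y : X}, s ≤ t → near s x y → near t x y)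
    (hR : ∀ v x y, R v x → R v y → near a x y)
    (hadj : ∀ v w, G.Adj v w → ∃ x y, R v x ∧ R w y ∧ near b x y)
    {s : ℕ} {v w : V} (h : GNear G s v w) {x y : X} (hx : R v x) (hy : R w y) :
    near ((a + b) * s + a) x y := by
  obtain ⟨p, hp⟩ := h
  refine hmono (Nat.add_le_add_right (Nat.mul_le_mul_left _ hp) _) ?_
  clear hp
  induction p generalizing x with
  | nil => simpa using hR _ _ _ hx hy
  | cons h p ih =>
    obtain ⟨x', y', hx', hy', hxy⟩ := hadj _ _ h
    refine hmono (le_of_eq ?_) (htrans (htrans (hR _ _ _ hx hx') hxy) (ih hy' hy))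
    rw [SimpleGraph.Walk.length_cons]
    ring

end Walks

section CorankOne

variable {n : ℕ}

/-! ### Corank one free factors -/

/-- The vertex of `FF_ℓ` defined by a corank one free factor. -/
def corankMk (A : Subgroup (F n)) (hA : IsFreeFactorOfRank (n - 1) A) : CorankOne n :=
  ⟨SubgroupConj.mk A, A, hA, rfl⟩

theorem conj_mk (g : F n) (A : Subgroup (F n)) : SubgroupConj.mk (conjSub g A) = SubgroupConj.mk A :=
  (Quotient.sound (s := conjSetoid n) ⟨g, rfl⟩ : SubgroupConj.mk A = SubgroupConj.mk _).symm

theorem exists_conj {A A' : Subgroup (F n)} (h : SubgroupConj.mk A = SubgroupConj.mk A') :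
    ∃ g, conjSub g A = A' := Quotient.exact (s := conjSetoid n) h

theorem gNear_of_le {ℓ : ℕ} {A A' D : Subgroup (F n)} {c c' : CorankOne n}
    (hc : SubgroupConj.mk A = (c : SubgroupConj n)) (hc' : SubgroupConj.mk A' = (c' : SubgroupConj n))
    (hD : IsFreeFactorOfRank ℓ D) (hDA : D ≤ A) (hDB : D ≤ A') : GNear (FFl n ℓ) 1 c c' :=
  gNear_of_fromRel ⟨A, A', D, hc, hc', hD, le_inf hDA hDB⟩

/-- The class `c` is represented by the subgroup generated by the subset `C` of the basis `B`. -/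
structure Spans (B C : Set (F n)) (c : CorankOne n) : Prop where
  isBasis : IsBasis B
  subset : C ⊆ B
  ncard : C.ncard = n - 1
  mk_eq : SubgroupConj.mk (Subgroup.closure C) = (c : SubgroupConj n)

theorem exists_spans (c : CorankOne n) : ∃ B C, Spans B C c := by
  obtain ⟨A, hA, h⟩ := c.2
  obtain ⟨B, C, h1, h2, h3, rfl⟩ := hA.exists_basis
  exact ⟨B, C, h1, h2, h3, h⟩

theorem IsBasis.exists_spans {B C : Set (F n)} (hB : IsBasis B) (hC : C ⊆ B)
    (hcard : C.ncard = n - 1) : ∃ c, Spans B C c :=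
  ⟨⟨_, _, hcard ▸ hB.isFreeFactorOfRank hC, rfl⟩, hB, hC, hcard, rfl⟩

/-- Two subsets of a basis with `n - 1` elements have at least `n - 2` elements in common. -/
theorem Spans.gNear_same {ℓ : ℕ} (hn : 3 ≤ n) (hℓ : ℓ ≤ n - 2) {B C C' : Set (F n)}
    {c c' : CorankOne n} (h : Spans B C c) (h' : Spans B C' c') : GNear (FFl n ℓ) 1 c c' := by
  obtain ⟨hfin, hcard⟩ := h.isBasis.finite_and_ncard
  have h1 : ℓ ≤ (C ∩ C').ncard := by
    have h2 := Set.ncard_union_add_ncard_inter C C' (hfin.subset h.subset) (hfin.subset h'.subset)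
    have h3 := Set.ncard_le_ncard (Set.union_subset h.subset h'.subset) hfin
    have h4 := h.ncard
    have h5 := h'.ncard
    omega
  obtain ⟨D, hD, rfl⟩ := Set.exists_subset_card_eq h1
  exact gNear_of_le h.mk_eq h'.mk_eq
    (h.isBasis.isFreeFactorOfRank ((hD.trans Set.inter_subset_left).trans h.subset))
    (Subgroup.closure_mono (hD.trans Set.inter_subset_left))
    (Subgroup.closure_mono (hD.trans Set.inter_subset_right))

/-- Adjacent bases span a common vertex of the graph, and vertices spanned by one basis are adjacent
or equal. -/
theorem Spans.gNear {ℓ : ℕ} (hn : 3 ≤ n) (hℓ : ℓ ≤ n - 2) {s : ℕ} {B B' C C' : Set (F n)}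
    {c c' : CorankOne n} (hBB' : BNear s B B') (h : Spans B C c) (h' : Spans B' C' c') :
    GNear (FFl n ℓ) (s + 1) c c' := by
  induction hBB' generalizing C' c' with
  | refl s B => exact (h.gNear_same hn hℓ h').mono (by omega)
  | @step s _ B' B'' _ hadj ih =>
    obtain ⟨h1, h2, b, hb, b', hb', g, hg⟩ := hadj
    obtain ⟨d, hd⟩ := h1.exists_spans (C := B' \ {b}) Set.sdiff_subset (by
      rw [Set.ncard_sdiff_singleton_of_mem hb, h1.finite_and_ncard.2])
    have hd' : Spans B'' (B'' \ {b'}) d := ⟨h2, Set.sdiff_subset, by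
      rw [Set.ncard_sdiff_singleton_of_mem hb', h2.finite_and_ncard.2], by
      rw [← hg, conj_mk, hd.mk_eq]⟩
    exact (ih h hd).trans (hd'.gNear_same hn hℓ h')

theorem FFl_connected {ℓ : ℕ} (hn : 3 ≤ n) (hℓ : ℓ ≤ n - 2) : (FFl n ℓ).Connected := by
  obtain ⟨C, hC, hcard⟩ := (isBasis_range_of n).exists_subset (Nat.sub_le n 1)
  obtain ⟨c, -⟩ := (isBasis_range_of n).exists_spans hC hcard
  have : Nonempty (CorankOne n) := ⟨c⟩
  refine ⟨fun c c' => ?_⟩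
  obtain ⟨B, C, h⟩ := exists_spans c
  obtain ⟨B', C', h'⟩ := exists_spans c'
  obtain ⟨s, hs⟩ := exists_bNear hn h.isBasis h'.isBasis
  exact (Spans.gNear hn hℓ hs h h').reachable

theorem IsShortFactor.exists_spans (hn : 3 ≤ n) {k : ℝ} (hk : 0 ≤ k) {A : Subgroup (F n)}
    {x : Cv0 n} (h : IsShortFactor k (n - 1) A x) {c : CorankOne n}
    (hc : SubgroupConj.mk A = (c : SubgroupConj n)) :
    ∃ B C, Spans B C c ∧ ∀ B', Geo x B' → BNear (nearBound n k + 2) B B' := by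
  obtain ⟨C, B, rfl, h2, h3, h4, h5⟩ := h.exists_near hn hk (by omega) le_rfl
  exact ⟨B, C, ⟨h4, h3, h2, hc⟩, h5⟩

/-- Corank one free factors which are short for the same tree are close to each other. -/
theorem IsShortFactor.gNear {ℓ : ℕ} (hn : 3 ≤ n) (hℓ : ℓ ≤ n - 2) {k : ℝ} (hk : 0 ≤ k)
    {A A' : Subgroup (F n)} {x : Cv0 n} (h : IsShortFactor k (n - 1) A x)
    (h' : IsShortFactor k (n - 1) A' x) {c c' : CorankOne n}
    (hc : SubgroupConj.mk A = (c : SubgroupConj n)) (hc' : SubgroupConj.mk A' = (c' : SubgroupConj n)) :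
    GNear (FFl n ℓ) (2 * nearBound n k + 5) c c' := by
  obtain ⟨B, C, h1, h2⟩ := h.exists_spans hn hk hc
  obtain ⟨B', C', h1', h2'⟩ := h'.exists_spans hn hk hc'
  obtain ⟨B₀, hB₀⟩ := exists_geo x
  exact (Spans.gNear hn hℓ ((h2 _ hB₀).trans (h2' _ hB₀).symm) h1 h1').mono (by omega)

/-- Trees which are tied have close short corank one free factors. -/
theorem Tied.gNear {ℓ : ℕ} (hn : 3 ≤ n) (h1 : 1 ≤ ℓ) (hℓ : ℓ ≤ n - 2) {k : ℝ} (hk : 0 ≤ k)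
    {x y : Cv0 n} (h : Tied k ℓ x y) {A A' : Subgroup (F n)} (hA : IsShortFactor k (n - 1) A x)
    (hA' : IsShortFactor k (n - 1) A' y) {c c' : CorankOne n}
    (hc : SubgroupConj.mk A = (c : SubgroupConj n)) (hc' : SubgroupConj.mk A' = (c' : SubgroupConj n)) :
    GNear (FFl n ℓ) (4 * nearBound n k + 11) c c' := by
  -- The rank `ℓ` factor is spanned by part of a basis close to the tree. Further elements of this
  -- basis enlarge it to a corank one factor, which is close to the given short one. Doing this for
  -- both trees gives corank one factors with the rank `ℓ` factor in common.
  have key : ∀ {D A : Subgroup (F n)} {x : Cv0 n} {c : CorankOne n}, IsShortFactor k ℓ D x →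
      IsShortFactor k (n - 1) A x → SubgroupConj.mk A = (c : SubgroupConj n) →
      ∃ (d : CorankOne n) (A' : Subgroup (F n)), SubgroupConj.mk A' = (d : SubgroupConj n) ∧
        D ≤ A' ∧ GNear (FFl n ℓ) (2 * nearBound n k + 5) c d := by
    intro D A x c hD hA hc
    obtain ⟨C, B, rfl, h2, h3, h4, h5⟩ := hD.exists_near hn hk h1 (by omega)
    obtain ⟨hfin, hcard⟩ := h4.finite_and_ncard
    obtain ⟨E, hCE, hEB, hE⟩ := Set.exists_subsuperset_card_eq h3 (by omega : C.ncard ≤ n - 1)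
      (by omega : n - 1 ≤ B.ncard)
    obtain ⟨d, hd⟩ := h4.exists_spans hEB hE
    obtain ⟨B', C', h1', h2'⟩ := hA.exists_spans hn hk hc
    obtain ⟨B₀, hB₀⟩ := exists_geo x
    exact ⟨d, _, hd.mk_eq, Subgroup.closure_mono hCE,
      (Spans.gNear hn hℓ ((h2' _ hB₀).trans (h5 _ hB₀).symm) h1' hd).mono (by omega)⟩
  obtain ⟨D, hx, hy⟩ := h
  obtain ⟨d, E, hd, hDE, hcd⟩ := key hx hA hc
  obtain ⟨d', E', hd', hDE', hcd'⟩ := key hy hA' hc'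
  exact ((hcd.trans (gNear_of_le hd hd' hx.1 hDE hDE')).trans hcd'.symm).mono (by omega)

/-- For the cardinalities: both bases of the whole group have `n` elements, and `E` does not meet
the unchanged part. -/
theorem IsBasis.exchange {B C E : Set (F n)} (hB : IsBasis B) (hC : C ⊆ B) (hE : IsFreeSet E)
    (h : Subgroup.closure E = Subgroup.closure C) :
    IsBasis (E ∪ B \ C) ∧ E.ncard = C.ncard := by
  have h1 : IsBasis (E ∪ B \ C) :=
    IsBasis.replace (by rwa [Set.union_sdiff_cancel hC]) Set.disjoint_sdiff_right hE h
  refine ⟨h1, ?_⟩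
  obtain ⟨hfin, hcard⟩ := hB.finite_and_ncard
  obtain ⟨hfin', hcard'⟩ := h1.finite_and_ncard
  have hd : Disjoint E (B \ C) := by
    rw [Set.disjoint_left]
    intro e he heB
    exact hB.notMem_closure heB.1 hC heB.2 (h ▸ Subgroup.subset_closure he)
  rw [Set.ncard_union_eq hd (hfin'.subset Set.subset_union_left) (hfin.subset Set.sdiff_subset),
    Set.ncard_sdiff hC (hfin.subset hC), hcard] at hcard'
  have := Set.ncard_le_ncard hC hfin
  omega

/-- A basis of the rank `ℓ` factor extends to a basis of each of the two corank one factors, and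
then to bases of the whole group. The rank `ℓ` factor is short for the roses of both. -/
theorem exists_tied_of_adj {ℓ : ℕ} (hn : 3 ≤ n) {k : ℝ} (hk : 3 ≤ k) {c d : CorankOne n}
    (h : ∃ A B C : Subgroup (F n), SubgroupConj.mk A = (c : SubgroupConj n) ∧
      SubgroupConj.mk B = (d : SubgroupConj n) ∧ IsFreeFactorOfRank ℓ C ∧ C ≤ A ⊓ B) :
    ∃ x y : Cv0 n, (∃ B C, Geo x B ∧ Spans B C c) ∧ (∃ B C, Geo y B ∧ Spans B C d) ∧
      Tied k ℓ x y := by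
  obtain ⟨A, A', D, hc, hd, hD, hle⟩ := h
  obtain ⟨B, C, hB, hCB, hcard, rfl⟩ := hD.exists_basis
  have key : ∀ {A : Subgroup (F n)} {c : CorankOne n}, SubgroupConj.mk A = (c : SubgroupConj n) →
      Subgroup.closure C ≤ A → ∃ x : Cv0 n, (∃ B C, Geo x B ∧ Spans B C c) ∧
        IsShortFactor k ℓ (Subgroup.closure C) x := by
    intro A c hc hle
    obtain ⟨B₁, C₁, h₁⟩ := exists_spans c
    obtain ⟨g, rfl⟩ := exists_conj (h₁.mk_eq.trans hc.symm)
    obtain ⟨E, hCE, hE, hEA⟩ := hB.exists_extend_to_subgroup hCB freeGroup_torsionFree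
      (fun x hx => hle (Subgroup.subset_closure hx))
    rw [conjSub_closure] at hEA
    obtain ⟨h2, h3⟩ := (h₁.isBasis.conj g).exchange (Set.image_mono h₁.subset) hE hEA
    have hgeo := geo_stdRose hn h2
    refine ⟨_, ⟨_, E, hgeo, h2, Set.subset_union_left, ?_, ?_⟩, ?_⟩
    · rw [h3, ncard_conj, h₁.ncard]
    · rw [hEA, ← conjSub_closure, hc]
    · rw [← hcard]
      exact hgeo.isShortFactor hk (hCE.trans Set.subset_union_left)
  obtain ⟨x, hx, hx'⟩ := key hc (hle.trans inf_le_left)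
  obtain ⟨y, hy, hy'⟩ := key hd (hle.trans inf_le_right)
  exact ⟨x, y, hx, hy, _, hx', hy'⟩

theorem Spans.bAdj (hn : 3 ≤ n) {B B' C C' : Set (F n)} {c : CorankOne n} (h : Spans B C c)
    (h' : Spans B' C' c) : BAdj B B' := by
  obtain ⟨g, hg⟩ := exists_conj (h.mk_eq.trans h'.mk_eq.symm)
  exact bAdj_of_closure_eq (by omega) h.isBasis h'.isBasis h.subset h'.subset h.ncard h'.ncard g hg

/-- Bases which span the same vertex are adjacent, so the corresponding trees are joined by four
ties. Each edge of the graph costs one tie more. -/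
theorem exists_chain_of_gNear {ℓ : ℕ} (hn : 3 ≤ n) (hℓ : ℓ ≤ n - 1) {k : ℝ} (hk : 3 ≤ k) {s : ℕ}
    {c d : CorankOne n} (h : GNear (FFl n ℓ) s c d) {x y : Cv0 n}
    (hx : ∃ B C, Geo x B ∧ Spans B C c) (hy : ∃ B C, Geo y B ∧ Spans B C d) :
    IsTiedChain k ℓ x y (5 * s + 4) := by
  refine GNear.induction (near := fun s x y => IsTiedChain k ℓ x y s) (a := 4) (b := 1)
    (fun c x => ∃ B C, Geo x B ∧ Spans B C c) IsTiedChain.trans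
    (fun hst h => h.mono hk (by omega) hst) ?_ ?_ h hx hy
  · rintro c x y ⟨B, C, h1, h2⟩ ⟨B', C', h1', h2'⟩
    exact h1.chain hn hk hℓ (h2.bAdj hn h2').near h1'
  · intro c d h
    rcases ((SimpleGraph.fromRel_adj _ _ _).1 h).2 with h | h
    · obtain ⟨x, y, hx, hy, hxy⟩ := exists_tied_of_adj hn hk h
      exact ⟨x, y, hx, hy, hxy.chain⟩
    · obtain ⟨x, y, hx, hy, hxy⟩ := exists_tied_of_adj hn hk h
      exact ⟨y, x, hy, hx, hxy.symm.chain⟩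

/-! ### The maps `Υ` -/

theorem exists_isShortFactorMap {k : ℝ} (hk : 3 ≤ k) :
    ∃ Υ : Cv0 n → CorankOne n, IsShortFactorMap k Υ := by
  choose A hA using fun x : Cv0 n => exists_isShortFactor hk (Nat.sub_le n 1) x
  exact ⟨fun x => corankMk (A x) (hA x).1, fun x => ⟨A x, hA x, rfl⟩⟩

theorem IsShort.twist {k : ℝ} {r : ℕ} {A : Subgroup (F n)} {T : MetricTree n} (h : IsShort k r A T)
    (φ : MulAut (F n)) : IsShort k r (A.map φ.toMonoidHom) (T.twist φ) := by
  obtain ⟨ψ, f, h1, h2⟩ := h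
  refine ⟨ψ.trans (φ.subgroupMap A), f, fun g h => ?_, h2⟩
  rw [h1 g h]
  change _ = T.ρ (φ⁻¹ (φ (ψ g : F n))) (f h)
  simp

theorem IsShortFactor.twist {k : ℝ} {r : ℕ} {A : Subgroup (F n)} {x : Cv0 n}
    (h : IsShortFactor k r A x) (φ : MulAut (F n)) :
    IsShortFactor k r (A.map φ.toMonoidHom) ((QuotientGroup.mk φ : Out n) • x) := by
  obtain ⟨h1, T, rfl, h2⟩ := h
  exact ⟨h1.map φ, T.twist φ, rfl, h2.twist φ⟩

theorem isEquivariantQI_FFl {ℓ : ℕ} (hn : 3 ≤ n) (h1 : 1 ≤ ℓ) (hℓ : ℓ ≤ n - 2) {k : ℝ}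
    (hk : 3 ≤ k) : ∃ L : ℝ, 0 ≤ L ∧ ∀ Υ : Cv0 n → CorankOne n, IsShortFactorMap k Υ →
      IsEquivariantQI (Out n) L (ngDist k ℓ) (FFl n ℓ).dist Υ := by
  have hk0 : 0 ≤ k := by linarith
  have hconn := FFl_connected hn hℓ
  set N := nearBound n k
  -- A tie moves the image by at most `4 * N + 11`, and a path of length `d` in the graph gives a
  -- chain of `5 * d + 4 * N + 16` ties. The constant dominates both, as well as the bound `2 * N +
  -- 5` for two short factors of one tree.
  refine ⟨((4 * N + 20 : ℕ) : ℝ), Nat.cast_nonneg _, fun Υ hΥ =>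
    ⟨fun x y => ?_, fun x y => ?_, fun c => ?_, ?_⟩⟩
  · have hch := isTiedChain_ngDist (exists_chain hn hk (by omega : ℓ ≤ n - 1) x y)
    have h2 : GNear (FFl n ℓ) ((4 * N + 11) * ngDist k ℓ x y) (Υ x) (Υ y) := by
      refine IsTiedChain.induction (P := fun s y => GNear (FFl n ℓ) ((4 * N + 11) * s) (Υ x) (Υ y))
        (GNear.refl _ _) ?_ hch
      intro s y z _ ih hyz
      obtain ⟨A, hA, hc⟩ := hΥ y
      obtain ⟨A', hA', hc'⟩ := hΥ z
      exact ih.trans (hyz.gNear hn h1 hℓ hk0 hA hA' hc hc')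
    have h3 := h2.dist_le
    have h4 : (FFl n ℓ).dist (Υ x) (Υ y) ≤ (4 * N + 20) * ngDist k ℓ x y + (4 * N + 20) := by
      nlinarith
    exact_mod_cast h4
  · obtain ⟨A, hA, hc⟩ := hΥ x
    obtain ⟨A', hA', hc'⟩ := hΥ y
    obtain ⟨B, C, hs, hB⟩ := hA.exists_spans hn hk0 hc
    obtain ⟨B', C', hs', hB'⟩ := hA'.exists_spans hn hk0 hc'
    obtain ⟨D, hD⟩ := exists_geo x
    obtain ⟨D', hD'⟩ := exists_geo y
    have h2 := hD.chain hn hk (by omega : ℓ ≤ n - 1) (hB _ hD).symm (geo_stdRose hn hs.isBasis)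
    have h3 := (geo_stdRose hn hs'.isBasis).chain hn hk (by omega : ℓ ≤ n - 1) (hB' _ hD') hD'
    have h4 := exists_chain_of_gNear hn (by omega) hk (gNear_dist hconn (Υ x) (Υ y))
      ⟨B, C, geo_stdRose hn hs.isBasis, hs⟩ ⟨B', C', geo_stdRose hn hs'.isBasis, hs'⟩
    have h5 := ngDist_le ((h2.trans h4).trans h3)
    have h6 : ngDist k ℓ x y ≤ (4 * N + 20) * (FFl n ℓ).dist (Υ x) (Υ y) + (4 * N + 20) := by
      nlinarith
    exact_mod_cast h6
  · obtain ⟨B, C, h⟩ := exists_spans c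
    have hgeo := geo_stdRose hn h.isBasis
    have hC := hgeo.isShortFactor hk h.subset
    rw [h.ncard] at hC
    obtain ⟨A, hA, hc⟩ := hΥ (stdRose hn h.isBasis)
    refine ⟨stdRose hn h.isBasis, ?_⟩
    have := (hA.gNear hn hℓ hk0 hC hc h.mk_eq).dist_le
    exact_mod_cast this.trans (by omega)
  · rintro ⟨φ⟩ x
    obtain ⟨A, hA, hc⟩ := hΥ x
    obtain ⟨A', hA', hc'⟩ := hΥ ((QuotientGroup.mk φ : Out n) • x)
    have h2 : SubgroupConj.mk (A.map φ.toMonoidHom) =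
        (((QuotientGroup.mk φ : Out n) • Υ x : CorankOne n) : SubgroupConj n) := by
      rw [SubMulAction.val_smul, ← hc]
      rfl
    have := ((hA.twist φ).gNear hn hℓ hk0 hA' h2 hc').dist_le
    exact_mod_cast this.trans (by omega)

end CorankOne

end OuterSpace

end

noncomputable section

namespace OuterSpace

/-! ### Composition of quasi-isometries -/

section QuasiIsometry

variable {Γ X Y Z : Type*} [Group Γ] [MulAction Γ X] [MulAction Γ Y] [MulAction Γ Z]

theorem IsEquivariantQI.mono {L L' : ℝ} (hL : L ≤ L') {dX : X → X → ℕ} {dY : Y → Y → ℕ} {f : X → Y}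
    (h : IsEquivariantQI Γ L dX dY f) : IsEquivariantQI Γ L' dX dY f := by
  obtain ⟨h1, h2, h3, h4⟩ := h
  have key : ∀ m : ℕ, L * m + L ≤ L' * m + L' := fun m => by
    have := mul_le_mul_of_nonneg_right hL (Nat.cast_nonneg (α := ℝ) m)
    linarith
  refine ⟨fun x y => (h1 x y).trans (key _), fun x y => (h2 x y).trans (key _), fun y => ?_,
    fun g x => (h4 g x).trans hL⟩
  obtain ⟨x, hx⟩ := h3 y
  exact ⟨x, hx.trans hL⟩

/-- The constant dominates the bounds of the four estimates, whose additive terms are `L * M + M`,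
`L * M + L` and, for density and equivariance, `L * M + 2 * M`. -/
theorem IsEquivariantQI.comp {L M : ℝ} (hL : 0 ≤ L) (hM : 0 ≤ M) {dX : X → X → ℕ} {dY : Y → Y → ℕ}
    {dZ : Z → Z → ℕ} (htri : ∀ x y z, dZ x z ≤ dZ x y + dZ y z) {f : X → Y} {g : Y → Z}
    (hg : IsEquivariantQI Γ M dY dZ g) (hf : IsEquivariantQI Γ L dX dY f) :
    IsEquivariantQI Γ (L * M + L + 2 * M) dX dZ (fun x => g (f x)) := by
  obtain ⟨f1, f2, f3, f4⟩ := hf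
  obtain ⟨g1, g2, g3, g4⟩ := hg
  have htri' : ∀ x y z, (dZ x z : ℝ) ≤ dZ x y + dZ y z := fun x y z => by exact_mod_cast htri x y z
  have hLM := mul_nonneg hL hM
  refine ⟨fun x y => ?_, fun x y => ?_, fun z => ?_, fun γ x => ?_⟩
  · have h1 := g1 (f x) (f y)
    have h2 := mul_le_mul_of_nonneg_left (f1 x y) hM
    have h3 := mul_nonneg hL (Nat.cast_nonneg (α := ℝ) (dX x y))
    have h4 := mul_nonneg hM (Nat.cast_nonneg (α := ℝ) (dX x y))
    nlinarith
  · have h1 := f2 x y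
    have h2 := mul_le_mul_of_nonneg_left (g2 (f x) (f y)) hL
    have h3 := mul_nonneg hL (Nat.cast_nonneg (α := ℝ) (dZ (g (f x)) (g (f y))))
    have h4 := mul_nonneg hM (Nat.cast_nonneg (α := ℝ) (dZ (g (f x)) (g (f y))))
    nlinarith
  · obtain ⟨y, hy⟩ := g3 z
    obtain ⟨x, hx⟩ := f3 y
    refine ⟨x, ?_⟩
    have h1 := htri' (g (f x)) (g y) z
    have h2 := g1 (f x) y
    have h3 := mul_le_mul_of_nonneg_left hx hM
    nlinarith
  · have h1 := htri' (γ • g (f x)) (g (γ • f x)) (g (f (γ • x)))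
    have h2 := g1 (γ • f x) (f (γ • x))
    have h3 := mul_le_mul_of_nonneg_left (f4 γ x) hM
    have h4 := g4 γ (f x)
    nlinarith

end QuasiIsometry

section FreeFactorGraph

variable {n : ℕ}

/-! ### The free factor graph -/

theorem IsBasis.closure_ne_top {B C : Set (F n)} (hB : IsBasis B) (hC : C ⊆ B) (hne : C ≠ B) :
    Subgroup.closure C ≠ ⊤ := fun h => hne (hB.eq_of_subset hC h)

theorem IsBasis.closure_ne_bot {B C : Set (F n)} (hB : IsBasis B) (hC : C ⊆ B) (hne : C.Nonempty) :
    Subgroup.closure C ≠ ⊥ := by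
  obtain ⟨c, hc⟩ := hne
  intro h
  exact hB.ne_one (hC hc) (Subgroup.mem_bot.1 (h ▸ Subgroup.subset_closure hc))

theorem IsFreeFactorOfRank.ne_bot_and_ne_top {r : ℕ} {A : Subgroup (F n)}
    (hA : IsFreeFactorOfRank r A) (h1 : 1 ≤ r) (hr : r < n) : A ≠ ⊥ ∧ A ≠ ⊤ := by
  obtain ⟨B, C, hB, hC, rfl, rfl⟩ := hA.exists_basis
  refine ⟨hB.closure_ne_bot hC (Set.nonempty_of_ncard_ne_zero (by omega)), hB.closure_ne_top hC ?_⟩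
  rintro rfl
  have := hB.finite_and_ncard.2
  omega

/-- The inclusion of the vertices of `FF_ℓ` into those of the free factor graph. -/
def corankIncl (hn : 3 ≤ n) (c : CorankOne n) : ProperFactor n :=
  ⟨c, by
    obtain ⟨A, hA, h⟩ := c.2
    obtain ⟨h1, h2⟩ := hA.ne_bot_and_ne_top (by omega) (by omega)
    exact ⟨A, hA.1, h1, h2, h⟩⟩

/-- The class `p` has a representative contained in a representative of the class `c`. -/
def Below (p : ProperFactor n) (c : CorankOne n) : Prop :=
  ∃ P A : Subgroup (F n), SubgroupConj.mk P = (p : SubgroupConj n) ∧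
    SubgroupConj.mk A = (c : SubgroupConj n) ∧ P ≤ A

theorem gNear_FF_of_le {P Q : Subgroup (F n)} {p q : ProperFactor n}
    (hp : SubgroupConj.mk P = (p : SubgroupConj n)) (hq : SubgroupConj.mk Q = (q : SubgroupConj n))
    (h : P ≤ Q) : GNear (FF n) 1 p q := by
  rcases h.eq_or_lt with rfl | h
  · have : p = q := Subtype.ext (hp.symm.trans hq)
    exact this ▸ GNear.refl _ _
  · exact gNear_of_fromRel ⟨P, Q, hp, hq, h⟩

theorem Below.gNear (hn : 3 ≤ n) {p : ProperFactor n} {c : CorankOne n} (h : Below p c) :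
    GNear (FF n) 1 p (corankIncl hn c) := by
  obtain ⟨P, A, hp, hc, h⟩ := h
  exact gNear_FF_of_le hp hc h

theorem isFreeFactor_of_mk_eq {P : Subgroup (F n)} {p : ProperFactor n}
    (hp : SubgroupConj.mk P = (p : SubgroupConj n)) : IsFreeFactor P ∧ P ≠ ⊥ ∧ P ≠ ⊤ := by
  obtain ⟨Q, h1, h2, h3, hQ⟩ := p.2
  obtain ⟨g, rfl⟩ := exists_conj (hQ.trans hp.symm)
  refine ⟨h1.map (MulAut.conj g), fun h => h2 ?_, fun h => h3 ?_⟩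
  · rw [conjSub_eq_iff] at h
    rw [h, conjSub, Subgroup.map_bot]
  · rw [conjSub_eq_iff] at h
    rw [h, conjSub]
    exact Subgroup.map_top_of_surjective _ (MulAut.conj g⁻¹).surjective

/-- A basis of a proper factor is a proper part of a basis of the group; an element outside it is
omitted. -/
theorem exists_below {Q : Subgroup (F n)} {q : ProperFactor n}
    (hq : SubgroupConj.mk Q = (q : SubgroupConj n)) :
    ∃ (c : CorankOne n) (A : Subgroup (F n)), SubgroupConj.mk A = (c : SubgroupConj n) ∧ Q ≤ A := by
  obtain ⟨hQ, -, h⟩ := isFreeFactor_of_mk_eq hq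
  obtain ⟨C, hC, rfl⟩ := exists_freeSet Q
  obtain ⟨B, hB, hCB⟩ := hQ.exists_basis hC rfl
  have hne : C ≠ B := by
    rintro rfl
    exact h hB.closure_eq
  obtain ⟨b, hb, hbC⟩ := Set.exists_of_ssubset (hCB.ssubset_of_ne hne)
  obtain ⟨c, hc⟩ := hB.exists_spans (C := B \ {b}) Set.sdiff_subset (by
    rw [Set.ncard_sdiff_singleton_of_mem hb, hB.finite_and_ncard.2])
  exact ⟨c, _, hc.mk_eq, Subgroup.closure_mono (Set.subset_sdiff_singleton hCB hbC)⟩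

/-- Any basis element of the common subfactor spans a free factor of rank one, contained in
representatives of both classes. -/
theorem Below.gNear_FFl {p : ProperFactor n} {c d : CorankOne n} (h : Below p c) (h' : Below p d) :
    GNear (FFl n 1) 1 c d := by
  obtain ⟨P, A, hp, hc, h⟩ := h
  obtain ⟨P', A', hp', hd, h'⟩ := h'
  obtain ⟨g, rfl⟩ := exists_conj (hp.trans hp'.symm)
  obtain ⟨hP, hbot, -⟩ := isFreeFactor_of_mk_eq hp
  obtain ⟨C, hC, rfl⟩ := exists_freeSet P
  obtain ⟨B, hB, hCB⟩ := hP.exists_basis hC rfl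
  have hne : C.Nonempty := by
    rw [Set.nonempty_iff_ne_empty]
    rintro rfl
    exact hbot Subgroup.closure_empty
  obtain ⟨x, hx⟩ := hne
  have hD := hB.isFreeFactorOfRank (Set.singleton_subset_iff.2 (hCB hx))
  rw [Set.ncard_singleton] at hD
  have hle : Subgroup.closure {x} ≤ Subgroup.closure C :=
    Subgroup.closure_mono (Set.singleton_subset_iff.2 hx)
  refine gNear_of_le (A := conjSub g A) (D := conjSub g (Subgroup.closure {x})) ?_ hd
    (hD.map (MulAut.conj g)) (Subgroup.map_mono (hle.trans h)) ((Subgroup.map_mono hle).trans h')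
  rw [conj_mk, hc]

theorem exists_below_of_adj {p q : ProperFactor n} (h : (FF n).Adj p q) :
    ∃ c, Below p c ∧ Below q c := by
  have key : ∀ {p q : ProperFactor n}, (∃ A B : Subgroup (F n),
      SubgroupConj.mk A = (p : SubgroupConj n) ∧ SubgroupConj.mk B = (q : SubgroupConj n) ∧ A < B) →
      ∃ c, Below p c ∧ Below q c := by
    rintro p q ⟨P, Q, hp, hq, h⟩
    obtain ⟨c, A, hc, hA⟩ := exists_below hq
    exact ⟨c, ⟨P, A, hp, hc, h.le.trans hA⟩, ⟨Q, A, hq, hc, hA⟩⟩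
  rcases ((SimpleGraph.fromRel_adj _ _ _).1 h).2 with h | h
  · exact key h
  · obtain ⟨c, h1, h2⟩ := key h
    exact ⟨c, h2, h1⟩

theorem below_corankIncl (hn : 3 ≤ n) (c : CorankOne n) : Below (corankIncl hn c) c := by
  obtain ⟨A, -, h⟩ := c.2
  exact ⟨A, A, h, h, le_rfl⟩

/-- Consecutive vertices of a path lie below one corank one class, and two corank one classes above
the same vertex are adjacent or equal. -/
theorem GNear.of_FF {s : ℕ} {p q : ProperFactor n} (h : GNear (FF n) s p q) {c d : CorankOne n}
    (hc : Below p c) (hd : Below q d) : GNear (FFl n 1) (s + 1) c d := by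
  have := GNear.induction (near := fun s x y => GNear (FFl n 1) s x y) (a := 1) (b := 0) Below
    GNear.trans (fun h h' => GNear.mono h h') (fun p c d => Below.gNear_FFl) (fun p q hpq => by
      obtain ⟨c, h1, h2⟩ := exists_below_of_adj hpq
      exact ⟨c, c, h1, h2, GNear.refl _ _⟩) h hc hd
  exact this.mono (by omega)

/-- Each edge is replaced by two edges through the common factor of rank one. -/
theorem GNear.corankIncl (hn : 3 ≤ n) {s : ℕ} {c d : CorankOne n} (h : GNear (FFl n 1) s c d) :
    GNear (FF n) (2 * s) (corankIncl hn c) (corankIncl hn d) := by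
  have key : ∀ {c d : CorankOne n}, (∃ A B C : Subgroup (F n),
      SubgroupConj.mk A = (c : SubgroupConj n) ∧ SubgroupConj.mk B = (d : SubgroupConj n) ∧
        IsFreeFactorOfRank 1 C ∧ C ≤ A ⊓ B) →
      GNear (FF n) 2 (OuterSpace.corankIncl hn c) (OuterSpace.corankIncl hn d) := by
    rintro c d ⟨A, B, C, hc, hd, hC, hle⟩
    obtain ⟨h1, h2⟩ := hC.ne_bot_and_ne_top le_rfl (by omega)
    let p : ProperFactor n := ⟨SubgroupConj.mk C, C, hC.1, h1, h2, rfl⟩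
    have hpc : GNear (FF n) 1 p (OuterSpace.corankIncl hn c) :=
      gNear_FF_of_le rfl hc (hle.trans inf_le_left)
    have hpd : GNear (FF n) 1 p (OuterSpace.corankIncl hn d) :=
      gNear_FF_of_le rfl hd (hle.trans inf_le_right)
    exact hpc.symm.trans hpd
  have := GNear.induction (near := fun s x y => GNear (FF n) s x y) (a := 0) (b := 2)
    (fun c p => p = OuterSpace.corankIncl hn c) GNear.trans (fun h h' => GNear.mono h h')
    (fun c p q hp hq => by rw [hp, hq]; exact GNear.refl _ _) (fun c d hcd => by
      refine ⟨_, _, rfl, rfl, ?_⟩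
      rcases ((SimpleGraph.fromRel_adj _ _ _).1 hcd).2 with h | h
      · exact key h
      · exact (key h).symm) h rfl rfl
  exact this.mono (by omega)

theorem FF_connected (hn : 3 ≤ n) : (FF n).Connected := by
  have hconn : (FFl n 1).Connected := FFl_connected hn (by omega)
  have hne : Nonempty (ProperFactor n) := hconn.nonempty.map (corankIncl hn)
  refine ⟨fun p q => ?_⟩
  obtain ⟨P, -, -, -, hp⟩ := p.2
  obtain ⟨Q, -, -, -, hq⟩ := q.2
  obtain ⟨c, A, hc, hPA⟩ := exists_below hp
  obtain ⟨d, A', hd, hQA⟩ := exists_below hq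
  have h1 := Below.gNear hn ⟨P, A, hp, hc, hPA⟩
  have h2 := Below.gNear hn ⟨Q, A', hq, hd, hQA⟩
  exact ((h1.trans ((gNear_dist hconn c d).corankIncl hn)).trans h2.symm).reachable

theorem isEquivariantQI_corankIncl (hn : 3 ≤ n) :
    IsEquivariantQI (Out n) 2 (FFl n 1).dist (FF n).dist (corankIncl hn) := by
  have hconn : (FFl n 1).Connected := FFl_connected hn (by omega)
  refine ⟨fun c d => ?_, fun c d => ?_, fun p => ?_, fun g c => ?_⟩
  · have := ((gNear_dist hconn c d).corankIncl hn).dist_le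
    exact_mod_cast this.trans (by omega)
  · have := ((gNear_dist (FF_connected hn) _ _).of_FF (below_corankIncl hn c)
      (below_corankIncl hn d)).dist_le
    exact_mod_cast this.trans (by omega)
  · obtain ⟨P, -, -, -, hp⟩ := p.2
    obtain ⟨c, A, hc, hPA⟩ := exists_below hp
    refine ⟨c, ?_⟩
    have := (Below.gNear hn ⟨P, A, hp, hc, hPA⟩).symm.dist_le
    exact_mod_cast this.trans (by omega)
  · have : g • corankIncl hn c = corankIncl hn (g • c) := rfl
    rw [this, SimpleGraph.dist_self]
    norm_num

theorem isEquivariantQI_FF (hn : 3 ≤ n) {k : ℝ} (hk : 3 ≤ k) :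
    ∃ L : ℝ, IsEquivariantQI (Out n) L (FFl n 1).dist (FF n).dist (corankIncl hn) ∧
      ∀ Υ : Cv0 n → CorankOne n, IsShortFactorMap k Υ →
        IsEquivariantQI (Out n) L (ngDist k 1) (FF n).dist (fun x => corankIncl hn (Υ x)) := by
  obtain ⟨L, hL, h⟩ := isEquivariantQI_FFl hn le_rfl (by omega : 1 ≤ n - 2) hk
  refine ⟨L * 2 + L + 2 * 2, (isEquivariantQI_corankIncl hn).mono (by linarith), fun Υ hΥ => ?_⟩
  have htri : ∀ p q r : ProperFactor n, (FF n).dist p r ≤ (FF n).dist p q + (FF n).dist q r :=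
    fun p q r => (FF_connected hn).dist_triangle
  exact (isEquivariantQI_corankIncl hn).comp (f := Υ) hL (zero_le_two (α := ℝ)) htri (h Υ hΥ)

end FreeFactorGraph

end OuterSpace

end

noncomputable section

namespace OuterSpace

section UniqueProducts

variable {n : ℕ}

/-! ### Unique products in free groups -/

/-- A nontrivial subgroup is free on a nonempty set, so it has a nontrivial homomorphism to the
integers, which cannot kill all generators. -/
theorem exists_hom_ne_zero {S : Set (F n)} {s : F n} (hs : s ∈ S) (h1 : s ≠ 1) :
    ∃ φ : Subgroup.closure S →* Multiplicative ℤ, ∃ x, ∃ hx : x ∈ S,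
      φ ⟨x, Subgroup.subset_closure hx⟩ ≠ 1 := by
  obtain ⟨C, hC, hCS⟩ := exists_freeSet (Subgroup.closure S)
  have hne : C.Nonempty := by
    rw [Set.nonempty_iff_ne_empty]
    rintro rfl
    rw [Subgroup.closure_empty] at hCS
    exact h1 (Subgroup.mem_bot.1 (hCS ▸ Subgroup.subset_closure hs))
  obtain ⟨c, hc⟩ := hne
  let e : FreeGroup C ≃* Subgroup.closure S := hC.equiv.trans (MulEquiv.subgroupCongr hCS)
  let φ : Subgroup.closure S →* Multiplicative ℤ :=
    (FreeGroup.lift fun _ : C => Multiplicative.ofAdd (1 : ℤ)).comp e.symm.toMonoidHom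
  refine ⟨φ, ?_⟩
  by_contra! hall
  have h : φ = 1 := hom_eqOn_closure fun x hx => hall x hx
  have h2 : φ (e (FreeGroup.of ⟨c, hc⟩)) = Multiplicative.ofAdd (1 : ℤ) := by
    simp [φ]
  rw [h, MonoidHom.one_apply] at h2
  exact absurd h2 (by decide)

/-- Free groups are locally indicable. After translation both sets lie in the subgroup generated by
`S`, and a homomorphism to the integers is not constant on at least one of them. It selects the
layers on which it is maximal, which together have fewer elements; a product unique for these layers
is unique for the whole sets. -/
theorem exists_uniqueMul (m : ℕ) : ∀ A B : Finset (F n), A.card + B.card ≤ m → A.Nonempty →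
    B.Nonempty → ∃ a ∈ A, ∃ b ∈ B, UniqueMul A B a b := by
  classical
  induction m with
  | zero =>
    intro A B h hA
    have := hA.card_pos
    omega
  | succ m ih =>
    intro A B hm hA hB
    obtain ⟨a₀, ha₀⟩ := hA
    obtain ⟨b₀, hb₀⟩ := hB
    let S : Set (F n) := (fun a => a₀⁻¹ * a) '' A ∪ (fun b => b * b₀⁻¹) '' B
    by_cases htriv : ∀ s ∈ S, s = 1
    · refine ⟨a₀, ha₀, b₀, hb₀, fun a b ha hb _ => ⟨?_, ?_⟩⟩
      · exact (inv_mul_eq_one.1 (htriv _ (Or.inl ⟨a, ha, rfl⟩))).symm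
      · exact mul_inv_eq_one.1 (htriv _ (Or.inr ⟨b, hb, rfl⟩))
    · push Not at htriv
      obtain ⟨s, hs, hs1⟩ := htriv
      obtain ⟨φ, x, hx, hφ⟩ := exists_hom_ne_zero hs hs1
      have hAS : ∀ a ∈ A, a₀⁻¹ * a ∈ Subgroup.closure S := fun a ha =>
        Subgroup.subset_closure (Or.inl ⟨a, ha, rfl⟩)
      have hBS : ∀ b ∈ B, b * b₀⁻¹ ∈ Subgroup.closure S := fun b hb =>
        Subgroup.subset_closure (Or.inr ⟨b, hb, rfl⟩)
      let ψ : F n → ℤ := fun y =>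
        if hy : y ∈ Subgroup.closure S then Multiplicative.toAdd (φ ⟨y, hy⟩) else 0
      have hψ1 : ψ 1 = 0 := by
        have : φ ⟨1, one_mem _⟩ = 1 := map_one φ
        simp [ψ, this]
      have hψmul : ∀ y z, y ∈ Subgroup.closure S → z ∈ Subgroup.closure S →
          ψ (y * z) = ψ y + ψ z := by
        intro y z hy hz
        have : φ ⟨y * z, mul_mem hy hz⟩ = φ ⟨y, hy⟩ * φ ⟨z, hz⟩ := map_mul φ ⟨y, hy⟩ ⟨z, hz⟩
        simp [ψ, hy, hz, mul_mem hy hz, this]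
      have hψx : ψ x ≠ 0 := by
        have : ψ x = Multiplicative.toAdd (φ ⟨x, Subgroup.subset_closure hx⟩) := dif_pos _
        rw [this]
        exact fun h => hφ (toAdd_eq_zero.1 h)
      obtain ⟨a₁, ha₁, hamax⟩ := A.exists_max_image (fun a => ψ (a₀⁻¹ * a)) ⟨a₀, ha₀⟩
      obtain ⟨b₁, hb₁, hbmax⟩ := B.exists_max_image (fun b => ψ (b * b₀⁻¹)) ⟨b₀, hb₀⟩
      let A' := A.filter fun a => ψ (a₀⁻¹ * a) = ψ (a₀⁻¹ * a₁)
      let B' := B.filter fun b => ψ (b * b₀⁻¹) = ψ (b₁ * b₀⁻¹)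
      have hcard : A'.card + B'.card < A.card + B.card := by
        have hA' : A'.card ≤ A.card := Finset.card_filter_le _ _
        have hB' : B'.card ≤ B.card := Finset.card_filter_le _ _
        by_contra hge
        have hAeq : A' = A := Finset.eq_of_subset_of_card_le (Finset.filter_subset _ _) (by omega)
        have hBeq : B' = B := Finset.eq_of_subset_of_card_le (Finset.filter_subset _ _) (by omega)
        apply hψx
        rcases hx with ⟨a, ha, rfl⟩ | ⟨b, hb, rfl⟩
        · have h1 := Finset.filter_eq_self.1 hAeq a ha
          have h2 := Finset.filter_eq_self.1 hAeq a₀ ha₀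
          rw [inv_mul_cancel, hψ1] at h2
          exact h1.trans h2.symm
        · have h1 := Finset.filter_eq_self.1 hBeq b hb
          have h2 := Finset.filter_eq_self.1 hBeq b₀ hb₀
          rw [mul_inv_cancel, hψ1] at h2
          exact h1.trans h2.symm
      obtain ⟨a, ha, b, hb, hu⟩ := ih A' B' (by omega) ⟨a₁, by simp [A', ha₁]⟩ ⟨b₁, by simp [B', hb₁]⟩
      obtain ⟨haA, haψ⟩ := Finset.mem_filter.1 ha
      obtain ⟨hbB, hbψ⟩ := Finset.mem_filter.1 hb
      refine ⟨a, haA, b, hbB, fun a' b' ha' hb' he => ?_⟩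
      have h1 : ψ (a₀⁻¹ * a' * (b' * b₀⁻¹)) = ψ (a₀⁻¹ * a * (b * b₀⁻¹)) := by
        have h3 : ∀ c d : F n, a₀⁻¹ * c * (d * b₀⁻¹) = a₀⁻¹ * (c * d) * b₀⁻¹ := fun c d => by group
        rw [h3, h3, he]
      rw [hψmul _ _ (hAS a' ha') (hBS b' hb'), hψmul _ _ (hAS a haA) (hBS b hbB)] at h1
      have h2 := hamax a' ha'
      have h3 := hbmax b' hb'
      exact hu (Finset.mem_filter.2 ⟨ha', by omega⟩) (Finset.mem_filter.2 ⟨hb', by omega⟩) he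

instance freeGroup_uniqueProds : UniqueProds (F n) :=
  ⟨fun {A B} hA hB => exists_uniqueMul _ A B le_rfl hA hB⟩

/-- For groups the unique product property improves to two unique products as soon as one of the
factors has several terms. These would be two group elements with nonzero coefficient in the
product, while `1` has only one. So `g` has a single term, whose coefficient is one modulo two. -/
theorem exists_eq_of_mul_eq_one {f g : MonoidAlgebra (ZMod 2) (F n)} (h : f * g = 1) :
    ∃ m, g = MonoidAlgebra.of (ZMod 2) (F n) m := by
  classical
  have := UniqueProds.toTwoUniqueProds_of_group (G := F n)
  have hf : f.coeff.support.Nonempty := by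
    rw [Finsupp.support_nonempty_iff, Ne, MonoidAlgebra.coeff_eq_zero]
    rintro rfl
    simp at h
  have hg : g.coeff.support.Nonempty := by
    rw [Finsupp.support_nonempty_iff, Ne, MonoidAlgebra.coeff_eq_zero]
    rintro rfl
    simp at h
  have key : ∀ a b, a ∈ f.coeff.support → b ∈ g.coeff.support →
      UniqueMul f.coeff.support g.coeff.support a b → a * b = 1 := by
    intro a b ha hb hu
    have h1 := MonoidAlgebra.coeff_mul_mul_of_uniqueMul hu
    rw [h, MonoidAlgebra.one_def, MonoidAlgebra.coeff_single, Finsupp.single_apply] at h1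
    by_contra hne
    rw [if_neg (fun h => hne h.symm)] at h1
    exact mul_ne_zero (Finsupp.mem_support_iff.1 ha) (Finsupp.mem_support_iff.1 hb) h1.symm
  have hcard : ¬ 1 < f.coeff.support.card * g.coeff.support.card := by
    intro hc
    obtain ⟨p, hp, q, hq, hpq, hup, huq⟩ := TwoUniqueProds.uniqueMul_of_one_lt_card hc
    rw [Finset.mem_product] at hp hq
    have h1 := key _ _ hp.1 hp.2 hup
    have h2 := key _ _ hq.1 hq.2 huq
    have := hup hq.1 hq.2 (h2.trans h1.symm)
    exact hpq (Prod.ext this.1.symm this.2.symm)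
  have hg1 : g.coeff.support.card = 1 := by
    have h1 := hf.card_pos
    have h2 := hg.card_pos
    nlinarith
  obtain ⟨m, hm⟩ := Finset.card_eq_one.1 hg1
  have hcoeff : g.coeff m = 1 := by
    have h1 : g.coeff m ≠ 0 := by
      rw [← Finsupp.mem_support_iff, hm]
      exact Finset.mem_singleton_self m
    generalize g.coeff m = z at h1
    revert h1
    revert z
    decide
  refine ⟨m, ?_⟩
  rw [MonoidAlgebra.of_apply, ← MonoidAlgebra.coeff_inj, MonoidAlgebra.coeff_single, ← hcoeff]
  exact (Finsupp.support_subset_singleton.1 hm.le)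

end UniqueProducts

/-! ### Fox derivatives modulo two -/

section Fox

variable {Γ : Type*} [Group Γ]

theorem crossed_unique {M : Type*} [AddCommGroup M] {a : Γ → M → M}
    (ha : ∀ x, Function.Injective (a x)) {D D' : Γ → M}
    (hD : ∀ x y, D (x * y) = D x + a x (D y)) (hD' : ∀ x y, D' (x * y) = D' x + a x (D' y))
    {S : Set Γ} (hS : Subgroup.closure S = ⊤) (h : ∀ s ∈ S, D s = D' s) (x : Γ) : D x = D' x := by
  have h1 : D 1 = D' 1 := by
    have e1 := hD 1 1
    have e2 := hD' 1 1
    rw [mul_one, left_eq_add] at e1 e2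
    exact ha 1 (e1.trans e2.symm)
  have hx : x ∈ Subgroup.closure S := hS ▸ Subgroup.mem_top x
  induction hx using Subgroup.closure_induction with
  | mem s hs => exact h s hs
  | one => exact h1
  | mul x y _ _ hx hy => rw [hD, hD', hx, hy]
  | inv x _ hx =>
    have e1 := hD x x⁻¹
    have e2 := hD' x x⁻¹
    rw [mul_inv_cancel] at e1 e2
    rw [h1, hx] at e1
    exact ha x (add_left_cancel (e1.symm.trans e2))

/-- The Fox derivative, modulo two, with respect to an element of a basis. -/
theorem IsBasis.exists_fox {B : Set Γ} (hB : IsBasis B) (t : Γ) :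
    ∃ D : Γ → MonoidAlgebra (ZMod 2) Γ,
      (t ∈ B → D t = 1) ∧ (∀ c ∈ B, c ≠ t → D c = 0) ∧
      ∀ x y, D (x * y) = D x + MonoidAlgebra.of (ZMod 2) Γ x * D y := by
  classical
  let e := MonoidAlgebra.of (ZMod 2) Γ
  have he : ∀ x, e x * e x⁻¹ = 1 := fun x => by rw [← map_mul, mul_inv_cancel, map_one]
  have he' : ∀ x, e x⁻¹ * e x = 1 := fun x => by rw [← map_mul, inv_mul_cancel, map_one]
  let δ : Γ → MonoidAlgebra (ZMod 2) Γ := fun c => if c = t then 1 else 0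
  -- Affine permutations of the group ring. Prescribing them on the basis gives an action by affine
  -- maps, and its translation part is a crossed homomorphism.
  let σ : Γ → Equiv.Perm (MonoidAlgebra (ZMod 2) Γ) := fun c =>
    { toFun := fun r => e c * r + δ c
      invFun := fun r => e c⁻¹ * (r - δ c)
      left_inv := fun r => by simp only [add_sub_cancel_right, ← mul_assoc, he', one_mul]
      right_inv := fun r => by simp only [← mul_assoc, he, one_mul, sub_add_cancel] }
  obtain ⟨φ, hφ⟩ := hB.exists_hom σ
  have key : ∀ x r, φ x r = e x * r + φ x 0 := by
    intro x
    have hx : x ∈ Subgroup.closure B := hB.closure_eq ▸ Subgroup.mem_top x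
    induction hx using Subgroup.closure_induction with
    | mem s hs =>
      intro r
      rw [hφ s hs]
      simp [σ]
    | one =>
      intro r
      simp
    | mul x y _ _ hx hy =>
      intro r
      rw [map_mul, Equiv.Perm.mul_apply, Equiv.Perm.mul_apply, hy r, hx, hx (φ y 0), map_mul]
      noncomm_ring
    | inv x _ hx =>
      intro r
      apply (φ x).injective
      rw [hx (_ + _), mul_add, ← mul_assoc, he, one_mul, add_assoc, ← hx, map_inv,
        ← Equiv.Perm.mul_apply, ← Equiv.Perm.mul_apply, mul_inv_cancel, Equiv.Perm.one_apply,
        Equiv.Perm.one_apply, add_zero]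
  refine ⟨fun x => φ x 0, fun ht => ?_, fun c hc hct => ?_, fun x y => ?_⟩
  · change φ t 0 = 1
    rw [hφ t ht]
    simp [σ, δ]
  · change φ c 0 = 0
    rw [hφ c hc]
    simp [σ, δ, hct]
  · change φ (x * y) 0 = φ x 0 + e x * φ y 0
    rw [map_mul, Equiv.Perm.mul_apply, key x, add_comm]

end Fox

/-! ### Uniqueness of the stable letter -/

section StableLetter

variable {n : ℕ}

/-- The stable letter of a corank one free factor is unique up to inversion and multiplication by
elements of the factor. -/
theorem stable_letter_unique {B B' : Set (F n)} (hB : IsBasis B) (hB' : IsBasis B') {t t' : F n}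
    (ht : t ∈ B) (ht' : t' ∈ B') {A : Subgroup (F n)} (hA : Subgroup.closure (B \ {t}) = A)
    (hA' : Subgroup.closure (B' \ {t'}) = A) :
    ∃ a ∈ A, ∃ b ∈ A, t' = a * t * b ∨ t' = a * t⁻¹ * b := by
  classical
  let e := MonoidAlgebra.of (ZMod 2) (F n)
  have he : ∀ x, e x⁻¹ * e x = 1 := fun x => by rw [← map_mul, inv_mul_cancel, map_one]
  have hinj : ∀ x, Function.Injective fun r => e x * r := fun x r s h => by
    have := congrArg (fun z => e x⁻¹ * z) h
    simpa only [← mul_assoc, he, one_mul] using this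
  obtain ⟨D, hDt, hD0, hD⟩ := hB.exists_fox t
  obtain ⟨D', hDt', hD0', hD'⟩ := hB'.exists_fox t'
  have hDA : ∀ x ∈ A, D x = 0 := by
    intro x hx
    rw [← hA] at hx
    have h1 : D 1 = 0 := by
      have := hD 1 1
      rw [mul_one, left_eq_add, map_one, one_mul] at this
      exact this
    induction hx using Subgroup.closure_induction with
    | mem s hs => exact hD0 s hs.1 hs.2
    | one => exact h1
    | mul x y _ _ hx hy => rw [hD, hx, hy, mul_zero, add_zero]
    | inv x _ hx =>
      have := hD x x⁻¹
      rw [mul_inv_cancel, h1, hx, zero_add] at this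
      exact hinj x (this.symm.trans (mul_zero _).symm)
  -- A chain rule: both sides are crossed homomorphisms, and they agree on `B'` because `D` vanishes
  -- on `A`. At `t` it says that `D' t * D t' = 1`, so `D t'` is a trivial unit, a group element
  -- `m`.
  have hfox : ∀ x, D x = D' x * D t' := by
    refine crossed_unique hinj hD (fun x y => ?_) hB'.closure_eq fun s hs => ?_
    · rw [hD', add_mul, mul_assoc]
    · by_cases hst : s = t'
      · rw [hst, hDt' ht', one_mul]
      · rw [hD0' s hs hst, zero_mul, hDA s (hA' ▸ Subgroup.subset_closure ⟨hs, hst⟩)]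
  obtain ⟨m, hm⟩ := exists_eq_of_mul_eq_one ((hfox t).symm.trans (hDt ht))
  let ρ := Representation.ofMulAction (ZMod 2) (F n) (F n ⧸ A)
  let ψ := MonoidAlgebra.lift (ZMod 2) (Module.End (ZMod 2) (MonoidAlgebra (ZMod 2) (F n ⧸ A))) (F n) ρ
  let o : MonoidAlgebra (ZMod 2) (F n ⧸ A) := MonoidAlgebra.single (QuotientGroup.mk 1) 1
  have hψ : ∀ x, ψ (e x) = ρ x := fun x => MonoidAlgebra.lift_of _ _
  have hρ : ∀ x, ρ x o = MonoidAlgebra.single (QuotientGroup.mk x) 1 := by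
    intro x
    simp only [ρ, o, Representation.ofMulAction_single]
    congr 1
    change (QuotientGroup.mk (x * 1) : F n ⧸ A) = _
    rw [mul_one]
  have hρinj : ∀ x, Function.Injective fun v => ρ x v := fun x v w h => by
    have h2 : ρ x⁻¹ (ρ x v) = ρ x⁻¹ (ρ x w) := congrArg (ρ x⁻¹) h
    simpa only [← Module.End.mul_apply, ← map_mul, inv_mul_cancel, map_one,
      Module.End.one_apply] using h2
  -- The fundamental formula of Fox calculus in the permutation module on the cosets of `A`. Basis
  -- elements in `A` fix the base coset, so only `t` contributes.
  have hformula : ∀ x, ρ x o - o = ψ (D x) (ρ t o - o) := by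
    refine crossed_unique hρinj (fun x y => ?_) (fun x y => ?_) hB.closure_eq fun s hs => ?_
    · rw [map_mul, Module.End.mul_apply, map_sub]
      abel
    · rw [hD, map_add, map_mul, LinearMap.add_apply, Module.End.mul_apply]
      rw [hψ]
    · by_cases hst : s = t
      · rw [hst, hDt ht, map_one, Module.End.one_apply]
      · have hsA : s ∈ A := hA ▸ Subgroup.subset_closure ⟨hs, hst⟩
        rw [hD0 s hs hst, map_zero, LinearMap.zero_apply, sub_eq_zero, hρ]
        congr 1
        rw [QuotientGroup.eq]
        simpa using hsA
  have hmain := hformula t'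
  rw [hm, hψ, map_sub, ← Module.End.mul_apply, ← map_mul, hρ, hρ, hρ] at hmain
  have ht'A : t' ∉ A := hA' ▸ hB'.notMem_closure ht' Set.sdiff_subset (by simp)
  have hne : (QuotientGroup.mk t' : F n ⧸ A) ≠ QuotientGroup.mk 1 := by
    intro h
    rw [QuotientGroup.eq] at h
    exact ht'A (by simpa using h)
  have e1 := congrArg (fun f => f.coeff (QuotientGroup.mk 1)) hmain
  have e2 := congrArg (fun f => f.coeff (QuotientGroup.mk t')) hmain
  simp only [o, MonoidAlgebra.coeff_sub, MonoidAlgebra.coeff_single, Finsupp.sub_apply,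
    Finsupp.single_apply, if_neg hne, if_neg hne.symm, if_true,
    zero_sub, sub_zero] at e1 e2
  -- At `t'` the formula says that the cosets of `t'` and `1` have the same difference as those of
  -- `m * t` and `m`. Modulo two the pairs agree in one of the two orders, one giving `t` and the
  -- other its inverse.
  by_cases h1 : (QuotientGroup.mk m : F n ⧸ A) = QuotientGroup.mk 1
  · have h2 : (QuotientGroup.mk (m * t) : F n ⧸ A) = QuotientGroup.mk t' := by
      by_contra h2
      rw [if_neg h2, if_neg (fun h => hne (h.symm.trans h1))] at e2
      exact absurd e2 (by decide)
    rw [QuotientGroup.eq] at h1 h2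
    refine ⟨m, by simpa using h1, _, h2, Or.inl ?_⟩
    group
  · have h2 : (QuotientGroup.mk (m * t) : F n ⧸ A) = QuotientGroup.mk 1 := by
      by_contra h2
      rw [if_neg h2, if_neg h1] at e1
      exact absurd e1 (by decide)
    have h3 : (QuotientGroup.mk m : F n ⧸ A) = QuotientGroup.mk t' := by
      by_contra h3
      rw [if_neg h3, if_neg (fun h => hne (h.symm.trans h2))] at e2
      exact absurd e2 (by decide)
    rw [QuotientGroup.eq] at h2 h3
    have h4 : m * t ∈ A := by simpa using inv_mem h2
    refine ⟨m * t, h4, _, h3, Or.inr ?_⟩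
    group

end StableLetter

end OuterSpace

end

noncomputable section

namespace OuterSpace

section HNN

variable {n : ℕ}

/-! ### The splitting defined by a corank one free factor -/

/-- The homomorphism defined by an action on a graph. -/
def actionHom {Γ V : Type*} [Group Γ] [MulAction Γ V] {G : SimpleGraph V} (hG : IsInvariant Γ G) :
    Γ →* (G ≃g G) where
  toFun g := ⟨MulAction.toPerm g, fun {x y} => hG.adj_iff g x y⟩
  map_one' := by
    ext x
    exact one_smul Γ x
  map_mul' g h := by
    ext x
    exact mul_smul g h x

/-- The graph on the cosets of `A` whose edges join `gA` to `gtA`. -/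
def hnnGraph {Γ : Type*} [Group Γ] (A : Subgroup Γ) (t : Γ) : SimpleGraph (Γ ⧸ A) :=
  SimpleGraph.fromRel fun x y => ∃ g : Γ, x = QuotientGroup.mk g ∧ y = QuotientGroup.mk (g * t)

theorem hnnGraph_adj {Γ : Type*} [Group Γ] {A : Subgroup Γ} {t : Γ} (ht : t ∉ A) (g : Γ) :
    (hnnGraph A t).Adj (QuotientGroup.mk g) (QuotientGroup.mk (g * t)) := by
  refine (SimpleGraph.fromRel_adj _ _ _).2 ⟨fun h => ht ?_, Or.inl ⟨g, rfl, rfl⟩⟩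
  rw [QuotientGroup.eq] at h
  simpa using h

theorem hnnGraph_adj_cases {Γ : Type*} [Group Γ] {A : Subgroup Γ} {t : Γ} {x y : Γ ⧸ A}
    (h : (hnnGraph A t).Adj x y) :
    ∃ g : Γ, s(x, y) = s((QuotientGroup.mk g : Γ ⧸ A), QuotientGroup.mk (g * t)) := by
  rcases ((SimpleGraph.fromRel_adj _ _ _).1 h).2 with ⟨g, rfl, rfl⟩ | ⟨g, rfl, rfl⟩
  · exact ⟨g, rfl⟩
  · exact ⟨g, Sym2.eq_swap⟩

theorem hnnGraph_isInvariant {Γ : Type*} [Group Γ] (A : Subgroup Γ) (t : Γ) :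
    IsInvariant Γ (hnnGraph A t) := by
  intro g x y h
  have key : ∀ {x y : Γ ⧸ A}, (∃ k : Γ, x = QuotientGroup.mk k ∧ y = QuotientGroup.mk (k * t)) →
      ∃ k : Γ, g • x = QuotientGroup.mk k ∧ g • y = QuotientGroup.mk (k * t) := by
    rintro x y ⟨k, rfl, rfl⟩
    refine ⟨g * k, rfl, ?_⟩
    rw [mul_assoc]
    rfl
  obtain ⟨hne, h⟩ := (SimpleGraph.fromRel_adj _ _ _).1 h
  exact (SimpleGraph.fromRel_adj _ _ _).2
    ⟨fun h' => hne (MulAction.injective g h'), h.imp key key⟩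

/-- Cosets absorb right factors from `A`, and inverting the letter reverses the edges. -/
theorem hnnGraph_le {Γ : Type*} [Group Γ] {A : Subgroup Γ} {t t' a b : Γ} (ha : a ∈ A) (hb : b ∈ A)
    (h : t' = a * t * b ∨ t' = a * t⁻¹ * b) : hnnGraph A t' ≤ hnnGraph A t := by
  have hmk : ∀ g c : Γ, c ∈ A → (QuotientGroup.mk (g * c) : Γ ⧸ A) = QuotientGroup.mk g :=
    fun g c hc => QuotientGroup.mk_mul_of_mem g hc
  have key : ∀ {x y : Γ ⧸ A}, (∃ g : Γ, x = QuotientGroup.mk g ∧ y = QuotientGroup.mk (g * t')) →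
      (∃ g : Γ, x = QuotientGroup.mk g ∧ y = QuotientGroup.mk (g * t)) ∨
        ∃ g : Γ, y = QuotientGroup.mk g ∧ x = QuotientGroup.mk (g * t) := by
    rintro x y ⟨g, rfl, rfl⟩
    rcases h with rfl | rfl
    · refine Or.inl ⟨g * a, (hmk _ _ ha).symm, ?_⟩
      rw [show g * (a * t * b) = g * a * t * b by group, hmk _ _ hb]
    · refine Or.inr ⟨g * a * t⁻¹, ?_, ?_⟩
      · rw [show g * (a * t⁻¹ * b) = g * a * t⁻¹ * b by group, hmk _ _ hb]
      · rw [inv_mul_cancel_right, hmk _ _ ha]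
  intro x y hxy
  obtain ⟨hne, h⟩ := (SimpleGraph.fromRel_adj _ _ _).1 hxy
  refine (SimpleGraph.fromRel_adj _ _ _).2 ⟨hne, ?_⟩
  rcases h with h | h
  · exact key h
  · exact (key h).symm

/-- Basis elements other than `t` do not change the parity of crossings of an edge labelled `t`, so
this parity descends to the cosets of `A`. -/
theorem IsBasis.exists_cosetParity {Γ : Type*} [Group Γ] {B : Set Γ} (hB : IsBasis B) {t : Γ}
    (ht : t ∈ B) {A : Subgroup Γ} (hA : Subgroup.closure (B \ {t}) = A) (h : Γ) :
    ∃ χ : Γ ⧸ A → ZMod 2, χ (QuotientGroup.mk (h * t)) = χ (QuotientGroup.mk h) + 1 ∧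
      ∀ g, g ≠ h → χ (QuotientGroup.mk (g * t)) = χ (QuotientGroup.mk g) := by
  obtain ⟨χ, -, hχ⟩ := hB.exists_parity h t
  have hinv : ∀ a ∈ A, ∀ g, χ (g * a) = χ g := by
    intro a ha
    rw [← hA] at ha
    induction ha using Subgroup.closure_induction with
    | mem c hc => exact fun g => (hχ g c hc.1).2 fun h' => hc.2 h'.2
    | one => simp
    | mul a b _ _ ha hb =>
      intro g
      rw [← mul_assoc, hb, ha]
    | inv a _ ha =>
      intro g
      rw [← ha, inv_mul_cancel_right]
  refine ⟨Quotient.lift χ fun x y hxy => ?_, (hχ h t ht).1 ⟨rfl, rfl⟩,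
    fun g hg => (hχ g t ht).2 fun h' => hg h'.1⟩
  have h1 : x⁻¹ * y ∈ A := QuotientGroup.leftRel_apply.1 hxy
  rw [← hinv _ h1 x, mul_inv_cancel_left]

theorem hnnGraph_isTree {Γ : Type*} [Group Γ] {B : Set Γ} (hB : IsBasis B) {t : Γ} (ht : t ∈ B)
    {A : Subgroup Γ} (hA : Subgroup.closure (B \ {t}) = A) : (hnnGraph A t).IsTree := by
  have htA : t ∉ A := hA ▸ hB.notMem_closure ht Set.sdiff_subset (by simp)
  have hreach : ∀ x ∈ Subgroup.closure B, ∀ g : Γ,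
      (hnnGraph A t).Reachable (QuotientGroup.mk g) (QuotientGroup.mk (g * x)) := by
    intro x hx
    induction hx using Subgroup.closure_induction with
    | mem c hc =>
      intro g
      by_cases hct : c = t
      · exact hct ▸ (hnnGraph_adj htA g).reachable
      · rw [QuotientGroup.mk_mul_of_mem g (hA ▸ Subgroup.subset_closure ⟨hc, hct⟩)]
    | one => simp
    | mul x y _ _ hx hy =>
      intro g
      rw [← mul_assoc]
      exact (hx g).trans (hy _)
    | inv x _ hx =>
      intro g
      have := hx (g * x⁻¹)
      rw [inv_mul_cancel_right] at this
      exact this.symm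
  have hconn : (hnnGraph A t).Connected := by
    have : Nonempty (Γ ⧸ A) := ⟨QuotientGroup.mk 1⟩
    refine ⟨fun x y => ?_⟩
    induction x using QuotientGroup.induction_on with | _ g
    induction y using QuotientGroup.induction_on with | _ h
    have := hreach (g⁻¹ * h) (hB.closure_eq ▸ Subgroup.mem_top _) g
    rwa [mul_inv_cancel_left] at this
  refine isTree_of_cut hconn fun a b hab => ?_
  obtain ⟨h, hh⟩ := hnnGraph_adj_cases hab
  obtain ⟨χ, hχ1, hχ2⟩ := hB.exists_cosetParity ht hA h
  refine ⟨fun x => χ x = 0, ?_, fun x y hxy hne => ?_⟩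
  · have h1 : χ (QuotientGroup.mk h) ≠ χ (QuotientGroup.mk (h * t)) := by
      rw [hχ1]
      generalize χ (QuotientGroup.mk h) = z
      revert z
      decide
    have h2 : ∀ z w : ZMod 2, z ≠ w → ((z = 0) ≠ (w = 0)) := by decide
    rcases Sym2.eq_iff.1 hh with ⟨rfl, rfl⟩ | ⟨rfl, rfl⟩
    · exact h2 _ _ h1
    · exact h2 _ _ h1.symm
  · obtain ⟨g, hg⟩ := hnnGraph_adj_cases hxy
    have hgh : g ≠ h := by
      rintro rfl
      exact hne (hg.trans hh.symm)
    have h1 := hχ2 g hgh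
    rcases Sym2.eq_iff.1 hg with ⟨rfl, rfl⟩ | ⟨rfl, rfl⟩
    · exact congrArg (· = 0) h1.symm
    · exact congrArg (· = 0) h1

/-- The parity which jumps at the edge given by `h` has no jump at that of `g ≠ h`. Triviality of
the edge stabilizers of the HNN tree follows from this. -/
theorem hnn_mk_eq_iff {Γ : Type*} [Group Γ] {B : Set Γ} (hB : IsBasis B) {t : Γ} (ht : t ∈ B)
    {A : Subgroup Γ} (hA : Subgroup.closure (B \ {t}) = A) {g h : Γ}
    (h1 : (QuotientGroup.mk g : Γ ⧸ A) = QuotientGroup.mk h)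
    (h2 : (QuotientGroup.mk (g * t) : Γ ⧸ A) = QuotientGroup.mk (h * t)) : g = h := by
  by_contra hne
  obtain ⟨χ, hχ1, hχ2⟩ := hB.exists_cosetParity ht hA h
  have := hχ2 g hne
  rw [h1, h2, hχ1] at this
  revert this
  generalize χ (QuotientGroup.mk h) = z
  revert z
  decide

/-- The splitting of `F_n` as an HNN extension of a corank one free factor. -/
def hnnSplitting (hn : 3 ≤ n) {B : Set (F n)} (hB : IsBasis B) {t : F n} (ht : t ∈ B)
    {A : Subgroup (F n)} (hA : Subgroup.closure (B \ {t}) = A) : FreeSplitting n where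
  V := F n ⧸ A
  graph := hnnGraph A t
  isTree := hnnGraph_isTree hB ht hA
  ρ := actionHom (hnnGraph_isInvariant A t)
  edge_stab g v w h hv hw := by
    obtain ⟨k, hk⟩ := hnnGraph_adj_cases h
    have key : g • (QuotientGroup.mk k : F n ⧸ A) = QuotientGroup.mk k →
        g • (QuotientGroup.mk (k * t) : F n ⧸ A) = QuotientGroup.mk (k * t) → g = 1 := by
      intro h1 h2
      have h2' : (QuotientGroup.mk (g * k * t) : F n ⧸ A) = QuotientGroup.mk (k * t) := by
        rw [mul_assoc]
        exact h2
      have := hnn_mk_eq_iff hB ht hA (g := g * k) h1 h2'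
      simpa using this
    rcases Sym2.eq_iff.1 hk with ⟨rfl, rfl⟩ | ⟨rfl, rfl⟩
    · exact key hv hw
    · exact key hw hv
  minimal S hS hinv _ := by
    obtain ⟨s, hs⟩ := hS
    refine Set.eq_univ_of_forall fun v => ?_
    obtain ⟨x, rfl⟩ := QuotientGroup.mk_surjective s
    obtain ⟨y, rfl⟩ := QuotientGroup.mk_surjective v
    have h : (QuotientGroup.mk ((y * x⁻¹) * x) : F n ⧸ A) ∈ S := hinv (y * x⁻¹) _ hs
    rwa [inv_mul_cancel_right] at h
  valence v := by
    obtain ⟨g, rfl⟩ := QuotientGroup.mk_surjective v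
    have htA : t ∉ A := hA ▸ hB.notMem_closure ht Set.sdiff_subset (by simp)
    obtain ⟨c, hc, hct⟩ := (hB.nontrivial hn).exists_ne t
    have hcA : c ∈ A := hA ▸ Subgroup.subset_closure ⟨hc, hct⟩
    have hc1 := hB.ne_one hc
    have hmk : ∀ a ∈ A, (QuotientGroup.mk (g * a) : F n ⧸ A) = QuotientGroup.mk g := fun a ha =>
      QuotientGroup.mk_mul_of_mem g ha
    have hadj : ∀ a ∈ A, (QuotientGroup.mk (g * a * t) : F n ⧸ A) ∈
        (hnnGraph A t).neighborSet (QuotientGroup.mk g) := fun a ha => by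
      have := hnnGraph_adj htA (g * a)
      rwa [hmk a ha] at this
    have hne : ∀ a ∈ A, ∀ b ∈ A, a ≠ b → (QuotientGroup.mk (g * a * t) : F n ⧸ A) ≠
        QuotientGroup.mk (g * b * t) := fun a ha b hb hab h =>
      hab (mul_left_cancel (hnn_mk_eq_iff hB ht hA ((hmk a ha).trans (hmk b hb).symm) h))
    refine three_le_encard (hadj 1 (one_mem A)) (hadj c hcA) (hadj (c * c) (mul_mem hcA hcA))
      (hne _ (one_mem A) _ hcA hc1.symm) (hne _ (one_mem A) _ (mul_mem hcA hcA) ?_)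
      (hne _ hcA _ (mul_mem hcA hcA) ?_)
    · exact fun h => hc1 (freeGroup_torsionFree c h.symm)
    · intro h
      rw [left_eq_mul] at h
      exact hc1 h

/-- All petals except `t` are collapsed. The fibres are the cosets of `A`, which are connected
because the collapsed petals generate `A`. -/
theorem roseSplitting_isCollapse_hnn (hn : 3 ≤ n) {B : Set (F n)} (hB : IsBasis B) {t : F n}
    (ht : t ∈ B) {A : Subgroup (F n)} (hA : Subgroup.closure (B \ {t}) = A) :
    (roseSplitting hn hB).IsCollapse (hnnSplitting hn hB ht hA) := by
  have htA : t ∉ A := hA ▸ hB.notMem_closure ht Set.sdiff_subset (by simp)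
  refine ⟨fun x : F n => (QuotientGroup.mk x : F n ⧸ A), fun _ _ => rfl, fun w => ?_, fun w w' => ?_⟩
  · obtain ⟨g, rfl⟩ := QuotientGroup.mk_surjective w
    set X : Set (F n) := (fun x : F n => (QuotientGroup.mk x : F n ⧸ A)) ⁻¹' {QuotientGroup.mk g}
    have hmem : ∀ x ∈ X, ∀ a ∈ A, x * a ∈ X := fun x hx a ha =>
      (QuotientGroup.mk_mul_of_mem x ha).trans hx
    have hX : ConnectedOn (cayley B) X := by
      have key : ∀ a ∈ Subgroup.closure (B \ {t}), ∀ x ∈ X,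
          (within (cayley B) X).Reachable x (x * a) := by
        intro a ha
        induction ha using Subgroup.closure_induction with
        | mem c hc =>
          intro x hx
          exact SimpleGraph.Adj.reachable ⟨cayley_adj_mul x hc.1 (hB.ne_one hc.1), hx,
            hmem x hx c (hA ▸ Subgroup.subset_closure hc)⟩
        | one => simp
        | mul a b ha _ iha ihb =>
          intro x hx
          rw [← mul_assoc]
          exact (iha x hx).trans (ihb _ (hmem x hx a (hA ▸ ha)))
        | inv a ha iha =>
          intro x hx
          have := iha _ (hmem x hx a⁻¹ (inv_mem (hA ▸ ha)))
          rw [inv_mul_cancel_right] at this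
          exact this.symm
      intro x hx y hy
      have hxy : x⁻¹ * y ∈ A := QuotientGroup.eq.1 (Eq.trans hx (Eq.symm hy))
      have := key _ (hA ▸ hxy) x hx
      rwa [mul_inv_cancel_left] at this
    exact hX.induce_connected ⟨g, rfl⟩
  · constructor
    · intro h
      refine ⟨h.ne, ?_⟩
      obtain ⟨g, hg⟩ := hnnGraph_adj_cases h
      have hadj := cayley_adj_mul g ht (hB.ne_one ht)
      rcases Sym2.eq_iff.1 hg with ⟨rfl, rfl⟩ | ⟨rfl, rfl⟩
      · exact ⟨g, g * t, rfl, rfl, hadj⟩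
      · exact ⟨g * t, g, rfl, rfl, hadj.symm⟩
    · rintro ⟨hne, v, v', rfl, rfl, hvv'⟩
      have key : ∀ x y : F n, x⁻¹ * y ∈ B →
          (QuotientGroup.mk x : F n ⧸ A) ≠ QuotientGroup.mk y →
          (hnnGraph A t).Adj (QuotientGroup.mk x) (QuotientGroup.mk y) := by
        intro x y hxy hne
        have : x⁻¹ * y = t := by
          by_contra hc
          exact hne (QuotientGroup.eq.2 (hA ▸ Subgroup.subset_closure ⟨hxy, hc⟩))
        have h := hnnGraph_adj htA x
        have hy : x * t = y := by rw [← this, mul_inv_cancel_left]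
        rwa [hy] at h
      have hvv : (cayley B).Adj v v' := hvv'
      rcases hvv.2 with h | h
      · exact key _ _ h hne
      · exact (key _ _ h hne.symm).symm

theorem IsCollapse.gNear {S T : FreeSplitting n} (h : S.IsCollapse T) :
    GNear (FS n) 1 (FSVertex.mk S) (FSVertex.mk T) :=
  gNear_of_fromRel ⟨S, T, rfl, rfl, h⟩

/-- Two stable letters for one factor differ by inversion and by multiplication by elements of `A`,
which does not affect the graph. So a corank one factor alone determines a vertex of the free
splitting graph. -/
theorem mk_hnnSplitting_eq (hn : 3 ≤ n) {B B' : Set (F n)} (hB : IsBasis B) (hB' : IsBasis B')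
    {t t' : F n} (ht : t ∈ B) (ht' : t' ∈ B') {A : Subgroup (F n)}
    (hA : Subgroup.closure (B \ {t}) = A) (hA' : Subgroup.closure (B' \ {t'}) = A) :
    FSVertex.mk (hnnSplitting hn hB ht hA) = FSVertex.mk (hnnSplitting hn hB' ht' hA') := by
  obtain ⟨a, ha, b, hb, h⟩ := stable_letter_unique hB' hB ht' ht hA' hA
  obtain ⟨a', ha', b', hb', h'⟩ := stable_letter_unique hB hB' ht ht' hA hA'
  have heq : hnnGraph A t = hnnGraph A t' :=
    le_antisymm (hnnGraph_le ha hb h) (hnnGraph_le ha' hb' h')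
  refine Quotient.sound ⟨⟨Equiv.refl (F n ⧸ A), fun {x y} => ?_⟩, fun _ _ => rfl⟩
  change (hnnGraph A t').Adj x y ↔ (hnnGraph A t).Adj x y
  rw [heq]

/-- Right multiplication by `g` commutes with left translations and carries one Cayley tree to the
other. -/
theorem mk_roseSplitting_conj (hn : 3 ≤ n) {B : Set (F n)} (hB : IsBasis B) (g : F n) :
    FSVertex.mk (roseSplitting hn (hB.conj g)) = FSVertex.mk (roseSplitting hn hB) := by
  have key : ∀ x y : F n, (x * g)⁻¹ * (y * g) ∈ B ↔
      x⁻¹ * y ∈ (fun c => g * c * g⁻¹) '' B := by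
    intro x y
    constructor
    · intro h
      exact ⟨_, h, by group⟩
    · rintro ⟨c, hc, h⟩
      have : (x * g)⁻¹ * (y * g) = g⁻¹ * (x⁻¹ * y) * g := by group
      rw [this, ← h]
      have : g⁻¹ * (g * c * g⁻¹) * g = c := by group
      rwa [this]
  have hadj : ∀ x y : F n, (cayley B).Adj (x * g) (y * g) ↔
      (cayley ((fun c => g * c * g⁻¹) '' B)).Adj x y := fun x y => by
    simp only [cayley, key, ne_eq, mul_left_inj]
  let f : cayley ((fun c => g * c * g⁻¹) '' B) ≃g cayley B :=
    ⟨Equiv.mulRight g, fun {x y} => hadj x y⟩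
  exact Quotient.sound ⟨f, fun (h v : F n) => mul_assoc h v g⟩

/-- After a conjugation both roses collapse to the splitting defined by the common corank one
factor. -/
theorem BAdj.gNear_FS (hn : 3 ≤ n) {B B' : Set (F n)} (h : BAdj B B') :
    GNear (FS n) 2 (FSVertex.mk (roseSplitting hn h.1)) (FSVertex.mk (roseSplitting hn h.2.1)) := by
  obtain ⟨hB, hB', b, hb, b', hb', g, hg⟩ := id h
  have hbg : g * b * g⁻¹ ∈ (fun c => g * c * g⁻¹) '' B := ⟨b, hb, rfl⟩
  have hA : Subgroup.closure ((fun c => g * c * g⁻¹) '' B \ {g * b * g⁻¹}) =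
      Subgroup.closure (B' \ {b'}) := by
    rw [← hg, conjSub_closure, Set.image_sdiff (f := fun c => g * c * g⁻¹) (MulAut.conj g).injective,
      Set.image_singleton]
  have h1 := IsCollapse.gNear (roseSplitting_isCollapse_hnn hn (hB.conj g) hbg hA)
  have h2 := IsCollapse.gNear (roseSplitting_isCollapse_hnn hn hB' hb' rfl)
  rw [mk_roseSplitting_conj, mk_hnnSplitting_eq hn (hB.conj g) hB' hbg hb' hA rfl] at h1
  exact h1.trans h2.symm

theorem BNear.gNear_FS (hn : 3 ≤ n) {s : ℕ} {B B' : Set (F n)} (h : BNear s B B') (hB : IsBasis B)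
    (hB' : IsBasis B') : GNear (FS n) (2 * s) (FSVertex.mk (roseSplitting hn hB))
      (FSVertex.mk (roseSplitting hn hB')) := by
  induction h with
  | refl => exact GNear.refl _ _
  | step h hadj ih => exact (ih hB hadj.1).trans (hadj.gNear_FS hn)

end HNN

end OuterSpace

end

noncomputable section

namespace OuterSpace

section Collapses

variable {n : ℕ}

/-! ### Collapsing to a rose -/

theorem IsTransversal.connectedOn_fibre {Γ V : Type*} [Group Γ] [MulAction Γ V] {G : SimpleGraph V}
    (hG : IsInvariant Γ G) {X : Set V} (hX : IsTransversal Γ G X) (g : Γ) :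
    ConnectedOn G (hX.pos ⁻¹' {g}) := by
  have hmem : ∀ {v : V}, v ∈ X → g • v ∈ hX.pos ⁻¹' {g} := fun {v} hv =>
    hX.pos_eq (by rwa [inv_smul_smul])
  have hmem' : ∀ {v : V}, v ∈ hX.pos ⁻¹' {g} → g⁻¹ • v ∈ X := fun {v} hv => by
    have h := hX.pos_inv_smul_mem v
    rwa [show hX.pos v = g from hv] at h
  intro x hx y hy
  let f : within G X →g within G (hX.pos ⁻¹' {g}) :=
    ⟨fun v => g • v, fun {a b} hab => ⟨hG g _ _ hab.1, hmem hab.2.1, hmem hab.2.2⟩⟩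
  have := (hX.conn _ (hmem' hx) _ (hmem' hy)).map f
  change (within G _).Reachable (g • g⁻¹ • x) (g • g⁻¹ • y) at this
  rwa [smul_inv_smul, smul_inv_smul] at this

/-- Each translate of the transversal is collapsed to a point. The remaining edges join the
translates according to the steps, which gives the Cayley tree. -/
theorem IsGeometric.isCollapse (hn : 3 ≤ n) {S : FreeSplitting n} {B : Set (F n)}
    (h : IsGeometric S.graph B) (hB : IsBasis B) : S.IsCollapse (roseSplitting hn hB) := by
  obtain ⟨X, hX, hhalf⟩ := h
  have hX1 : ∀ x ∈ X, ∀ g : F n, hX.pos (g • x) = g := fun x hx g =>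
    hX.pos_eq (by rwa [inv_smul_smul])
  refine ⟨hX.pos, fun g v => hX.pos_smul g v, fun w => ?_, fun (w w' : F n) => ⟨fun hadj => ?_, ?_⟩⟩
  · obtain ⟨v⟩ := S.isTree.connected.nonempty
    obtain ⟨x, hx⟩ := hX.nonempty v
    exact (hX.connectedOn_fibre S.isInvariant w).induce_connected ⟨(show F n from w) • x, hX1 x hx w⟩
  · have key : ∀ w w' : F n, w⁻¹ * w' ∈ B → ∃ v v' : S.V, hX.pos v = w ∧ hX.pos v' = w' ∧
        S.graph.Adj v v' := by
      intro w w' hb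
      obtain ⟨-, x, hx, y, hy, hxy⟩ := hhalf.sub hb
      refine ⟨w • x, w' • y, hX1 x hx w, hX1 y hy w', ?_⟩
      have := S.isInvariant w _ _ hxy
      rwa [smul_smul, mul_inv_cancel_left] at this
    have hadj' : (cayley B).Adj w w' := hadj
    refine ⟨hadj'.1, ?_⟩
    rcases hadj'.2 with hb | hb
    · exact key w w' hb
    · obtain ⟨v, v', h1, h2, h3⟩ := key w' w hb
      exact ⟨v', v, h2, h1, h3.symm⟩
  · rintro ⟨hne, v, v', rfl, rfl, hadj⟩
    refine ⟨hne, ?_⟩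
    rcases hX.step_of_adj S.isInvariant hadj with h | h
    · exact absurd (inv_mul_eq_one.1 h) hne
    · rcases hhalf.cover _ h with h | h
      · exact Or.inl h
      · rw [mul_inv_rev, inv_inv] at h
        exact Or.inr h

theorem Geo.gNear_FS (hn : 3 ≤ n) {x : Cv0 n} {B : Set (F n)} (h : Geo x B) :
    GNear (FS n) 1 (Upsilon x) (FSVertex.mk (roseSplitting hn h.isBasis)) := by
  have hB := h.isBasis
  obtain ⟨T, rfl, hT⟩ := h
  exact IsCollapse.gNear (hT.isCollapse hn hB)

/-- Trees which are `(n - 1)`-tied are close in the free splitting graph. -/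
theorem Tied.gNear_FS (hn : 3 ≤ n) {k : ℝ} (hk : 0 ≤ k) {x y : Cv0 n} (h : Tied k (n - 1) x y) :
    GNear (FS n) (4 * nearBound n k + 12) (Upsilon x) (Upsilon y) := by
  obtain ⟨A, hx, hy⟩ := h
  obtain ⟨C, B, h1, h2, h3, h4, h5⟩ := hx.exists_near hn hk (by omega) le_rfl
  obtain ⟨C', B', h1', h2', h3', h4', h5'⟩ := hy.exists_near hn hk (by omega) le_rfl
  have hadj : BAdj B B' := bAdj_of_closure_eq (by omega) h4 h4' h3 h3' h2 h2' 1
    (by rw [conjSub_one, h1, h1'])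
  obtain ⟨D, hD⟩ := exists_geo x
  obtain ⟨D', hD'⟩ := exists_geo y
  have hnear := ((h5 _ hD).symm.trans hadj.near).trans (h5' _ hD')
  exact (((hD.gNear_FS hn).trans (hnear.gNear_FS hn hD.isBasis hD'.isBasis)).trans
    (hD'.gNear_FS hn).symm).mono (by omega)

/-! ### Resolutions -/

/-- An equivariant map of trees which may collapse edges, and for which each edge of the target has
a unique preimage. -/
structure IsResolution (T S : FreeSplitting n) (q : T.V → S.V) : Prop where
  isTreeMap : IsTreeMap (F n) T.graph S.graph q
  exists_edge : ∀ w w', S.graph.Adj w w' → ∃ v v', T.graph.Adj v v' ∧ q v = w ∧ q v' = w'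
  unique : ∀ v v' u u', T.graph.Adj v v' → T.graph.Adj u u' → q v ≠ q v' → q u = q v →
    q u' = q v' → u = v ∧ u' = v'

theorem IsResolution.refl (S : FreeSplitting n) : IsResolution S S id :=
  ⟨⟨fun _ _ => rfl, fun _ _ h => Or.inr h⟩, fun w w' h => ⟨w, w', h, rfl, rfl⟩,
    fun _ _ _ _ _ _ _ h h' => ⟨h, h'⟩⟩

theorem IsResolution.comp {T S R : FreeSplitting n} {q : T.V → S.V} {p : S.V → R.V}
    (hp : IsResolution S R p) (hq : IsResolution T S q) : IsResolution T R (p ∘ q) := by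
  refine ⟨⟨fun g v => ?_, fun x y h => ?_⟩, fun w w' h => ?_, ?_⟩
  · simp only [Function.comp_apply]
    rw [hq.isTreeMap.equivariant, hp.isTreeMap.equivariant]
  · rcases hq.isTreeMap.adj x y h with h | h
    · exact Or.inl (congrArg p h)
    · exact hp.isTreeMap.adj _ _ h
  · obtain ⟨v, v', h1, h2, h3⟩ := hp.exists_edge w w' h
    obtain ⟨u, u', h4, h5, h6⟩ := hq.exists_edge v v' h1
    exact ⟨u, u', h4, by simp [h5, h2], by simp [h6, h3]⟩
  · intro v v' u u' hv hu hne h h'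
    have hne1 : q v ≠ q v' := fun h => hne (congrArg p h)
    have hne2 : q u ≠ q u' := fun h'' => hne (h.symm.trans ((congrArg p h'').trans h'))
    have hadj := (hq.isTreeMap.adj _ _ hv).resolve_left hne1
    have hadj' := (hq.isTreeMap.adj _ _ hu).resolve_left hne2
    obtain ⟨h1, h2⟩ := hp.unique _ _ _ _ hadj hadj' hne h h'
    exact hq.unique _ _ _ _ hv hu hne1 h1 h2

theorem IsResolution.of_iso {S R : FreeSplitting n} (h : S.Iso R) : ∃ p, IsResolution S R p := by
  obtain ⟨f, hf⟩ := h
  refine ⟨f, ⟨hf, fun x y h => Or.inr (f.map_rel_iff.2 h)⟩, fun w w' h =>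
    ⟨f.symm w, f.symm w', f.symm.map_rel_iff.2 h, by simp, by simp⟩, ?_⟩
  intro v v' u u' _ _ _ h h'
  exact ⟨f.injective h, f.injective h'⟩

/-- For the uniqueness of preimages: the fibres are connected and do not contain the edge, so a
second edge with the same image would connect its endpoints in its complement. -/
theorem FreeSplitting.IsCollapse.isResolution {T S : FreeSplitting n} (h : T.IsCollapse S) :
    ∃ q, IsResolution T S q := by
  obtain ⟨f, h1, h2, h3⟩ := h
  refine ⟨f, ⟨h1, fun x y hxy => ?_⟩, fun w w' h => ?_, ?_⟩
  · by_cases hxy' : f x = f y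
    · exact Or.inl hxy'
    · exact Or.inr ((h3 _ _).2 ⟨hxy', x, y, rfl, rfl, hxy⟩)
  · obtain ⟨-, v, v', rfl, rfl, hv⟩ := (h3 _ _).1 h
    exact ⟨v, v', hv, rfl, rfl⟩
  · intro v v' u u' hv hu hne h h'
    have hreach : ∀ {x y : T.V}, f x = f y → (within T.graph (f ⁻¹' {f x})).Reachable x y := by
      intro x y hxy
      exact connectedOn_of_induce (h2 (f x)).preconnected x rfl y hxy.symm
    have hle : ∀ w, within T.graph (f ⁻¹' {w}) ≤ cut T.graph v v' := by
      intro w a b hab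
      refine cut_adj.2 ⟨hab.1, fun he => hne ?_⟩
      have ha : f a = w := hab.2.1
      have hb : f b = w := hab.2.2
      rcases Sym2.eq_iff.1 he with ⟨rfl, rfl⟩ | ⟨rfl, rfl⟩
      · exact ha.trans hb.symm
      · exact hb.trans ha.symm
    by_contra hcon
    have hedge : s(u, u') ≠ s(v, v') := by
      intro he
      rcases Sym2.eq_iff.1 he with h'' | ⟨rfl, rfl⟩
      · exact hcon h''
      · exact hne h'
    refine not_reachable_cut T.isTree.isAcyclic hv ?_
    have r1 := (hreach h.symm).mono (hle _)
    have r2 : (cut T.graph v v').Reachable u u' :=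
      SimpleGraph.Adj.reachable (cut_adj.2 ⟨hu, hedge⟩)
    have r3 := (hreach h').mono (hle _)
    exact (r1.trans r2).trans r3

/-- Every vertex is an endpoint of an edge, and every edge is a translate of one of the finitely
many in `volume_one`. -/
theorem MetricTree.finite_orbits (T : MetricTree n) :
    Finite (MulAction.orbitRel.Quotient (F n) T.V) := by
  obtain ⟨D, -, hD, -⟩ := T.volume_one
  have hfin : (⋃ d ∈ D, {v : T.V | v ∈ d}).Finite := by
    refine Set.Finite.biUnion D.finite_toSet fun d _ => ?_
    induction d with
    | _ a b =>
      refine Set.Finite.subset (Set.toFinite {a, b}) fun v hv => ?_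
      simpa using hv
  have : Finite (⋃ d ∈ D, {v : T.V | v ∈ d} : Set T.V) := hfin
  refine Finite.of_surjective
    (fun v : (⋃ d ∈ D, {v : T.V | v ∈ d} : Set T.V) =>
      (Quotient.mk _ v.1 : MulAction.orbitRel.Quotient (F n) T.V)) ?_
  rintro ⟨v⟩
  have hval := T.valence v
  obtain ⟨w, hw⟩ : (T.graph.neighborSet v).Nonempty := by
    rw [Set.nonempty_iff_ne_empty]
    intro h
    rw [h, Set.encard_empty] at hval
    exact absurd hval (by decide)
  obtain ⟨d, ⟨hd, g, hg⟩, -⟩ := hD s(v, w) hw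
  have hv : v ∈ d.map (T.ρ g) := by
    rw [hg]
    exact Sym2.mem_mk_left v w
  obtain ⟨u, hu, huv⟩ := Sym2.mem_map.1 hv
  refine ⟨⟨u, Set.mem_biUnion hd hu⟩, ?_⟩
  refine Quotient.sound ((MulAction.orbitRel_apply).2 ⟨g⁻¹, ?_⟩)
  change g⁻¹ • v = u
  rw [← huv]
  exact inv_smul_smul g u

theorem FreeSplitting.exists_two (S : FreeSplitting n) (v : S.V) :
    ∃ a b, a ≠ b ∧ S.graph.Adj v a ∧ S.graph.Adj v b := by
  have h : 1 < (S.graph.neighborSet v).encard := lt_of_lt_of_le (by decide) (S.valence v)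
  obtain ⟨a, b, ha, hb, hab⟩ := Set.one_lt_encard_iff.1 h
  exact ⟨a, b, hab, ha, hb⟩

/-- Two trees in outer space which resolve the same free splitting are close to each other. -/
theorem chain_of_isResolution (hn : 3 ≤ n) {k : ℝ} (hk : 3 ≤ k) {ℓ : ℕ} (hℓ : ℓ ≤ n - 1)
    {T T' : MetricTree n} {S : FreeSplitting n} {q : T.V → S.V} {q' : T'.V → S.V}
    (h : IsResolution T.toFreeSplitting S q) (h' : IsResolution T'.toFreeSplitting S q') :
    IsTiedChain k ℓ (Cv0.mk T) (Cv0.mk T') 6 := by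
  obtain ⟨w₀⟩ := S.isTree.connected.nonempty
  obtain ⟨w, -, -, hw, -⟩ := S.exists_two w₀
  have hpre : ∀ {T : MetricTree n} {q : T.V → S.V}, IsResolution T.toFreeSplitting S q →
      ∃ p r, T.graph.Adj p r ∧ q p = w₀ ∧ q r = w ∧
        ∀ x y, T.graph.Adj x y → s(q x, q y) = s(q p, q r) → s(x, y) = s(p, r) := by
    intro T q h
    obtain ⟨p, r, hpr, hp, hr⟩ := h.exists_edge _ _ hw
    refine ⟨p, r, hpr, hp, hr, fun x y hxy hs => ?_⟩
    have hne : q p ≠ q r := by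
      rw [hp, hr]
      exact hw.ne
    rcases Sym2.eq_iff.1 hs with ⟨h1, h2⟩ | ⟨h1, h2⟩
    · obtain ⟨rfl, rfl⟩ := h.unique _ _ _ _ hpr hxy hne h1 h2
      rfl
    · obtain ⟨rfl, rfl⟩ := h.unique _ _ _ _ hpr hxy.symm hne h2 h1
      exact Sym2.eq_swap
  obtain ⟨p, r, hpr, rfl, rfl, huniq⟩ := hpre h
  obtain ⟨p', r', hpr', hp', hr', huniq'⟩ := hpre h'
  -- The chosen edge of `S` has a single preimage in each of the two trees. So the complements of
  -- the orbits of these preimages have the same stabilizers, namely those in `S`, although `S`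
  -- itself need not be a free tree.
  obtain ⟨e1, e2⟩ := h.isTreeMap.same_edge T.isTree S.isTree T.isInvariant S.isInvariant hw huniq
  obtain ⟨e1', e2'⟩ := h'.isTreeMap.same_edge T'.isTree S.isTree T'.isInvariant S.isInvariant
    (by rw [hp', hr']; exact hw) huniq'
  have := T.finite_orbits
  obtain ⟨B, B', hB, hB', hnear⟩ := exists_near_of_same_edge T.isTree T'.isTree T.isInvariant
    T'.isInvariant T.isFreeAction T'.isFreeAction freeGroup_torsionFree hpr hpr'
    (by simp only [e1, e1', hp', hr']) (by simp only [e1, e1', hp', hr'])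
    (by rw [e2, e2', hp', hr'])
    fun hns => ⟨compStab_ne_bot T.isTree T.isInvariant T.exists_two hns,
      compStab_ne_bot_right T.isTree T.isInvariant T.exists_two hns⟩
  -- Bases at distance two give `2 * 2 + 2` ties.
  exact Geo.chain hn hk hℓ hnear ⟨T, rfl, hB⟩ ⟨T', rfl, hB'⟩

end Collapses

end OuterSpace

end

noncomputable section

namespace OuterSpace

/-! ### Parities for bases of subgroups -/

section FreeSets

variable {Γ : Type*} [Group Γ]

theorem IsFreeSet.ne_one {D : Set Γ} (hD : IsFreeSet D) {d : Γ} (hd : d ∈ D) : d ≠ 1 := by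
  intro h
  have h1 : FreeGroup.lift ((↑) : D → Γ) (FreeGroup.of ⟨d, hd⟩) = FreeGroup.lift ((↑) : D → Γ) 1 := by
    simpa using h
  exact FreeGroup.of_ne_one _ (hD h1)

theorem IsFreeSet.isBasis_preimage {D : Set Γ} (hD : IsFreeSet D) :
    IsBasis (Subtype.val ⁻¹' D : Set (Subgroup.closure D)) := by
  refine IsFreeSet.isBasis ?_ (Subgroup.closure_closure_coe_preimage)
  let e : (Subtype.val ⁻¹' D : Set (Subgroup.closure D)) → D := fun x => ⟨x.1.1, x.2⟩
  have he : Function.Injective e := fun x y h =>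
    Subtype.ext (Subtype.ext (congrArg (fun z : D => (z : Γ)) h))
  have hcomp : (Subgroup.closure D).subtype.comp (FreeGroup.lift
      ((↑) : (Subtype.val ⁻¹' D : Set (Subgroup.closure D)) → Subgroup.closure D)) =
      (FreeGroup.lift ((↑) : D → Γ)).comp (FreeGroup.map e) := by
    ext x
    simp [e]
  have hinj : Function.Injective ((Subgroup.closure D).subtype.comp (FreeGroup.lift
      ((↑) : (Subtype.val ⁻¹' D : Set (Subgroup.closure D)) → Subgroup.closure D))) := by
    rw [hcomp]
    exact hD.comp (FreeGroup.map_injective he)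
  rw [MonoidHom.coe_comp] at hinj
  exact hinj.of_comp

/-- A function on the group which, in the forest defined by a free set, changes exactly across one
edge. -/
theorem IsFreeSet.exists_parity {D : Set Γ} (hD : IsFreeSet D) {d : Γ} (hd : d ∈ D) :
    ∃ ψ : Γ → ZMod 2, ψ d = ψ 1 + 1 ∧
      ∀ g : Γ, ∀ c ∈ D, ¬ (g = 1 ∧ c = d) → ψ (g * c) = ψ g := by
  classical
  obtain ⟨χ, -, hχ⟩ := hD.isBasis_preimage.exists_parity 1 ⟨d, Subgroup.subset_closure hd⟩
  have hmem : ∀ {c}, c ∈ D → c ∈ Subgroup.closure D := fun hc => Subgroup.subset_closure hc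
  refine ⟨fun g => if hg : g ∈ Subgroup.closure D then χ ⟨g, hg⟩ else 0, ?_, fun g c hc hgc => ?_⟩
  · have h := (hχ 1 ⟨d, hmem hd⟩ hd).1 ⟨rfl, rfl⟩
    rw [one_mul] at h
    simp only [dif_pos (hmem hd), dif_pos (one_mem (Subgroup.closure D))]
    exact h
  · by_cases hg : g ∈ Subgroup.closure D
    · have h := (hχ ⟨g, hg⟩ ⟨c, hmem hc⟩ hc).2 fun h => hgc
        ⟨congrArg Subtype.val h.1, congrArg Subtype.val h.2⟩
      simp only [dif_pos hg, dif_pos (mul_mem hg (hmem hc))]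
      exact h
    · have hg' : g * c ∉ Subgroup.closure D := fun h => hg
        ((Subgroup.mul_mem_cancel_right _ (hmem hc)).1 h)
      simp only [dif_neg hg, dif_neg hg']

end FreeSets

namespace FreeSplitting

variable {n : ℕ} (S : FreeSplitting n)

/-! ### Blowing up the vertices of a free splitting -/

/-- The vertices of the tree obtained from `S` by replacing each vertex by a Cayley tree of its
stabilizer. -/
def BlowUp : Type := F n × MulAction.orbitRel.Quotient (F n) S.V

instance : MulAction (F n) S.BlowUp where
  smul g y := (g * y.1, y.2)
  one_smul _ := Prod.ext (one_mul _) rfl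
  mul_smul _ _ _ := Prod.ext (mul_assoc _ _ _) rfl

variable {S}

theorem smul_fst (g : F n) (y : S.BlowUp) : (g • y).1 = g * y.1 := rfl

theorem smul_snd (g : F n) (y : S.BlowUp) : (g • y).2 = y.2 := rfl

variable (S) in
/-- A vertex in the given orbit. -/
def rep (ω : MulAction.orbitRel.Quotient (F n) S.V) : S.V := Quotient.out ω

variable (S) in
/-- The projection to the vertices of `S`. -/
def proj (y : S.BlowUp) : S.V := y.1 • S.rep y.2

theorem proj_smul (g : F n) (y : S.BlowUp) : S.proj (g • y) = g • S.proj y := mul_smul _ _ _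

theorem exists_smul_rep (v : S.V) :
    ∃ g : F n, g • S.rep (Quotient.mk (MulAction.orbitRel (F n) S.V) v) = v := by
  have h : (MulAction.orbitRel (F n) S.V) v (S.rep (Quotient.mk _ v)) :=
    Setoid.symm' _ (Quotient.mk_out v)
  exact MulAction.orbitRel_apply.1 h

theorem mk_rep (ω : MulAction.orbitRel.Quotient (F n) S.V) :
    Quotient.mk (MulAction.orbitRel (F n) S.V) (S.rep ω) = ω := Quotient.out_eq ω

theorem proj_surjective : Function.Surjective S.proj := fun v => by
  obtain ⟨g, hg⟩ := exists_smul_rep v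
  exact ⟨(g, _), hg⟩

theorem exists_of_proj_eq {y z : S.BlowUp} (h : S.proj y = S.proj z) :
    y.2 = z.2 ∧ y.1⁻¹ * z.1 ∈ MulAction.stabilizer (F n) (S.rep y.2) := by
  have h1 : y.2 = z.2 := by
    rw [← mk_rep y.2, ← mk_rep z.2]
    refine Quotient.sound (MulAction.orbitRel_apply.2 ⟨y.1⁻¹ * z.1, ?_⟩)
    change (y.1⁻¹ * z.1) • S.rep z.2 = S.rep y.2
    have h' : y.1 • S.rep y.2 = z.1 • S.rep z.2 := h
    rw [mul_smul, ← h', inv_smul_smul]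
  refine ⟨h1, ?_⟩
  have h' : y.1 • S.rep y.2 = z.1 • S.rep z.2 := h
  rw [MulAction.mem_stabilizer_iff, mul_smul]
  rw [← h1] at h'
  rw [← h', inv_smul_smul]

variable (S) in
/-- A free basis of the stabilizer of a vertex. -/
def stabBasis (ω : MulAction.orbitRel.Quotient (F n) S.V) : Set (F n) :=
  (exists_freeSet (MulAction.stabilizer (F n) (S.rep ω))).choose

theorem stabBasis_isFreeSet (ω : MulAction.orbitRel.Quotient (F n) S.V) :
    IsFreeSet (S.stabBasis ω) :=
  (exists_freeSet (MulAction.stabilizer (F n) (S.rep ω))).choose_spec.1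

theorem closure_stabBasis (ω : MulAction.orbitRel.Quotient (F n) S.V) :
    Subgroup.closure (S.stabBasis ω) = MulAction.stabilizer (F n) (S.rep ω) :=
  (exists_freeSet (MulAction.stabilizer (F n) (S.rep ω))).choose_spec.2

/-- A lift is chosen for one oriented edge in each orbit and extended equivariantly. This is
consistent because oriented edges have trivial stabilizers. -/
theorem exists_attach (S : FreeSplitting n) : ∃ α : S.V → S.V → S.BlowUp,
    (∀ v w, S.graph.Adj v w → S.proj (α v w) = v) ∧
    ∀ (g : F n) v w, S.graph.Adj v w → α (g • v) (g • w) = g • α v w := by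
  choose y₀ hy₀ using proj_surjective (S := S)
  let r : S.V × S.V → S.V × S.V := fun p =>
    Quotient.out (Quotient.mk (MulAction.orbitRel (F n) (S.V × S.V)) p)
  have hr : ∀ p, ∃ g : F n, g • r p = p := fun p => by
    have h : (MulAction.orbitRel (F n) (S.V × S.V)) p (r p) := Setoid.symm' _ (Quotient.mk_out p)
    exact MulAction.orbitRel_apply.1 h
  choose γ hγ using hr
  have hrg : ∀ (g : F n) p, r (g • p) = r p := fun g p => by
    refine congrArg Quotient.out (Quotient.sound ?_)
    exact MulAction.orbitRel_apply.2 ⟨g, rfl⟩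
  refine ⟨fun v w => γ (v, w) • y₀ (r (v, w)).1, fun v w _ => ?_, fun g v w hvw => ?_⟩
  · rw [proj_smul, hy₀]
    exact congrArg Prod.fst (hγ (v, w))
  · have h1 : r (g • v, g • w) = r (v, w) := hrg g (v, w)
    have h2 : γ (g • v, g • w) • r (v, w) = (g • v, g • w) := h1 ▸ hγ (g • v, g • w)
    have h3 := hγ (v, w)
    have h4 : γ (g • v, g • w) = g * γ (v, w) := by
      have e : ((g * γ (v, w))⁻¹ * γ (g • v, g • w)) • r (v, w) = r (v, w) := by
        rw [mul_smul, h2, mul_inv_rev, mul_smul]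
        change (γ (v, w))⁻¹ • g⁻¹ • g • (v, w) = _
        rw [inv_smul_smul, inv_smul_eq_iff, h3]
      have hadj : S.graph.Adj (r (v, w)).1 (r (v, w)).2 := by
        rw [← S.isInvariant.adj_iff (γ (v, w))]
        have e1 := congrArg Prod.fst h3
        have e2 := congrArg Prod.snd h3
        change γ (v, w) • (r (v, w)).1 = v at e1
        change γ (v, w) • (r (v, w)).2 = w at e2
        rwa [e1, e2]
      have := S.edge_stab _ _ _ hadj (congrArg Prod.fst e) (congrArg Prod.snd e)
      exact (inv_mul_eq_one.1 this).symm
    change γ (g • v, g • w) • y₀ (r (g • v, g • w)).1 = g • γ (v, w) • y₀ (r (v, w)).1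
    rw [h1, h4, mul_smul]

variable (S) in
/-- The vertex to which the edge from `v` to `w` is attached. -/
def attach : S.V → S.V → S.BlowUp := S.exists_attach.choose

theorem proj_attach {v w : S.V} (h : S.graph.Adj v w) : S.proj (S.attach v w) = v :=
  S.exists_attach.choose_spec.1 v w h

theorem attach_smul (g : F n) {v w : S.V} (h : S.graph.Adj v w) :
    S.attach (g • v) (g • w) = g • S.attach v w :=
  S.exists_attach.choose_spec.2 g v w h

variable (S) in
/-- The edges of the blow-up which are collapsed by the projection. -/
def FibreAdj (y z : S.BlowUp) : Prop := y.2 = z.2 ∧ y.1⁻¹ * z.1 ∈ S.stabBasis y.2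

variable (S) in
/-- The edges of the blow-up which come from edges of `S`. -/
def DartAdj (y z : S.BlowUp) : Prop :=
  S.graph.Adj (S.proj y) (S.proj z) ∧ S.attach (S.proj y) (S.proj z) = y ∧
    S.attach (S.proj z) (S.proj y) = z

theorem FibreAdj.proj_eq {y z : S.BlowUp} (h : S.FibreAdj y z) : S.proj y = S.proj z := by
  have h1 : y.1⁻¹ * z.1 ∈ MulAction.stabilizer (F n) (S.rep y.2) := by
    rw [← closure_stabBasis]
    exact Subgroup.subset_closure h.2
  rw [MulAction.mem_stabilizer_iff, mul_smul, inv_smul_eq_iff] at h1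
  change y.1 • S.rep y.2 = z.1 • S.rep z.2
  rw [← h.1, h1]

theorem FibreAdj.ne {y z : S.BlowUp} (h : S.FibreAdj y z) : y ≠ z := by
  rintro rfl
  exact (stabBasis_isFreeSet y.2).ne_one h.2 (inv_mul_cancel _)

theorem DartAdj.symm {y z : S.BlowUp} (h : S.DartAdj y z) : S.DartAdj z y :=
  ⟨h.1.symm, h.2.2, h.2.1⟩

theorem dartAdj_attach {v w : S.V} (h : S.graph.Adj v w) :
    S.DartAdj (S.attach v w) (S.attach w v) := by
  unfold DartAdj
  rw [proj_attach h, proj_attach h.symm]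
  exact ⟨h, rfl, rfl⟩

variable (S) in
/-- The graph obtained from `S` by replacing each vertex by a Cayley tree of its stabilizer. -/
def blowUpGraph : SimpleGraph S.BlowUp where
  Adj y z := S.FibreAdj y z ∨ S.FibreAdj z y ∨ S.DartAdj y z
  symm := ⟨fun _ _ h => by
    rcases h with h | h | h
    · exact Or.inr (Or.inl h)
    · exact Or.inl h
    · exact Or.inr (Or.inr h.symm)⟩
  loopless := ⟨fun _ h => by
    rcases h with h | h | h
    · exact h.ne rfl
    · exact h.ne rfl
    · exact h.1.ne rfl⟩

theorem proj_eq_or_adj {y z : S.BlowUp} (h : S.blowUpGraph.Adj y z) :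
    S.proj y = S.proj z ∨ S.DartAdj y z := by
  rcases h with h | h | h
  · exact Or.inl h.proj_eq
  · exact Or.inl h.proj_eq.symm
  · exact Or.inr h

theorem FibreAdj.smul (g : F n) {y z : S.BlowUp} (h : S.FibreAdj y z) :
    S.FibreAdj (g • y) (g • z) := by
  refine ⟨h.1, ?_⟩
  rw [smul_fst, smul_fst, smul_snd, mul_inv_rev, mul_assoc, inv_mul_cancel_left]
  exact h.2

theorem blowUpGraph_isInvariant : IsInvariant (F n) S.blowUpGraph := by
  intro g y z h
  rcases h with h | h | h
  · exact Or.inl (h.smul g)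
  · exact Or.inr (Or.inl (h.smul g))
  · refine Or.inr (Or.inr ⟨?_, ?_, ?_⟩)
    · rw [proj_smul, proj_smul]
      exact S.isInvariant g _ _ h.1
    · rw [proj_smul, proj_smul, attach_smul g h.1, h.2.1]
    · rw [proj_smul, proj_smul, attach_smul g h.1.symm, h.2.2]

theorem blowUp_isFreeAction : IsFreeAction (F n) S.BlowUp := by
  intro g y h
  have h1 : g * y.1 = y.1 := congrArg Prod.fst h
  exact mul_eq_right.1 h1

/-- The fibre is a left coset of the stabilizer of the representative vertex, and the edges inside
it are labelled by generators of this stabilizer. -/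
theorem connectedOn_fibre (v : S.V) : ConnectedOn S.blowUpGraph (S.proj ⁻¹' {v}) := by
  have key : ∀ (ω : MulAction.orbitRel.Quotient (F n) S.V), ∀ h ∈ Subgroup.closure (S.stabBasis ω),
      ∀ x : F n, S.proj (x, ω) = v →
      (within S.blowUpGraph (S.proj ⁻¹' {v})).Reachable (x, ω) (x * h, ω) ∧
        S.proj (x * h, ω) = v := by
    intro ω h hh
    induction hh using Subgroup.closure_induction with
    | mem d hd =>
      intro x hx
      have hadj : S.FibreAdj (x, ω) (x * d, ω) :=
        ⟨rfl, by change x⁻¹ * (x * d) ∈ _; rwa [inv_mul_cancel_left]⟩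
      have hp := hadj.proj_eq.symm.trans hx
      exact ⟨SimpleGraph.Adj.reachable ⟨Or.inl hadj, hx, hp⟩, hp⟩
    | one =>
      intro x hx
      rw [mul_one]
      exact ⟨SimpleGraph.Reachable.refl _, hx⟩
    | mul a b _ _ ha hb =>
      intro x hx
      obtain ⟨h1, h2⟩ := ha x hx
      obtain ⟨h3, h4⟩ := hb _ h2
      rw [← mul_assoc]
      exact ⟨h1.trans h3, h4⟩
    | inv a ha iha =>
      intro x hx
      have hp : S.proj (x * a⁻¹, ω) = v := by
        rw [closure_stabBasis] at ha
        change (x * a⁻¹) • S.rep ω = v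
        rw [mul_smul, MulAction.mem_stabilizer_iff.1 (inv_mem ha)]
        exact hx
      obtain ⟨h1, -⟩ := iha _ hp
      rw [inv_mul_cancel_right] at h1
      exact ⟨h1.symm, hp⟩
  intro y hy z hz
  obtain ⟨h1, h2⟩ := exists_of_proj_eq (Eq.trans hy (Eq.symm hz))
  rw [← closure_stabBasis] at h2
  have := (key y.2 _ h2 y.1 hy).1
  rw [mul_inv_cancel_left] at this
  have hz' : (z.1, y.2) = z := Prod.ext rfl h1
  exact hz' ▸ this

theorem blowUpGraph_connected : S.blowUpGraph.Connected := by
  obtain ⟨v₀⟩ := S.isTree.connected.nonempty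
  obtain ⟨y₀, hy₀⟩ := proj_surjective v₀
  have hfib : ∀ {y z : S.BlowUp}, S.proj y = S.proj z → S.blowUpGraph.Reachable y z :=
    fun {y z} h => (connectedOn_fibre (S.proj z) y h z rfl).mono (within_le _)
  have key : ∀ v, ∀ y, S.proj y = v → S.blowUpGraph.Reachable y₀ y := by
    intro v
    refine reachable_of_closed (P := fun v => ∀ y, S.proj y = v → S.blowUpGraph.Reachable y₀ y) ?_
      (S.isTree.connected v₀ v) fun y hy => hfib (hy₀.trans hy.symm)
    intro v w hvw hv y hy
    have h1 := hv _ (proj_attach hvw)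
    have h2 : S.blowUpGraph.Adj (S.attach v w) (S.attach w v) := Or.inr (Or.inr (dartAdj_attach hvw))
    exact (h1.trans h2.reachable).trans (hfib ((proj_attach hvw.symm).trans hy.symm))
  have : Nonempty S.BlowUp := ⟨y₀⟩
  exact ⟨fun y z => (key _ y rfl).symm.trans (key _ z rfl)⟩

/-- The parity `χ₀` jumps in the right way inside the fibres, but it may also jump along edges
coming from `S`. These jumps form a cocycle on the tree `S`; adding the pullback of its potential
cancels them without changing anything inside the fibres. -/
theorem exists_cut_of_fibreAdj {a b : S.BlowUp} (hab : S.FibreAdj a b) :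
    ∃ χ : S.BlowUp → ZMod 2, χ b = χ a + 1 ∧
      ∀ y z, S.blowUpGraph.Adj y z → s(y, z) ≠ s(a, b) → χ y = χ z := by
  classical
  obtain ⟨ψ, hψ1, hψ2⟩ := (stabBasis_isFreeSet a.2).exists_parity hab.2
  let χ₀ : S.BlowUp → ZMod 2 := fun y => if y.2 = a.2 then ψ (a.1⁻¹ * y.1) else 0
  have hfib : ∀ y z, S.FibreAdj y z → s(y, z) ≠ s(a, b) → χ₀ z = χ₀ y := by
    intro y z h hne
    by_cases hya : y.2 = a.2
    · have hza : z.2 = a.2 := h.1.symm.trans hya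
      simp only [χ₀, if_pos hya, if_pos hza]
      have hmem := h.2
      rw [hya] at hmem
      have := hψ2 (a.1⁻¹ * y.1) (y.1⁻¹ * z.1) hmem fun h' => hne ?_
      · rwa [mul_assoc, mul_inv_cancel_left] at this
      · have e1 : y.1 = a.1 := (inv_mul_eq_one.1 h'.1).symm
        have e2 : z.1 = b.1 := by
          have := h'.2
          rw [e1] at this
          exact mul_left_cancel this
        rw [show y = a from Prod.ext e1 hya, show z = b from Prod.ext e2 (hza.trans hab.1)]
    · have hza : z.2 ≠ a.2 := fun h' => hya (h.1.trans h')
      simp only [χ₀, if_neg hya, if_neg hza]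
  obtain ⟨v₀⟩ := S.isTree.connected.nonempty
  obtain ⟨Φ, -, hΦ⟩ := exists_potential (M := Multiplicative (ZMod 2)) S.isTree
    (fun v w => Multiplicative.ofAdd (χ₀ (S.attach v w) - χ₀ (S.attach w v)))
    (fun v w _ => by rw [← ofAdd_neg, neg_sub]) v₀
  refine ⟨fun y => χ₀ y + Multiplicative.toAdd (Φ (S.proj y)), ?_, fun y z hyz hne => ?_⟩
  · have h1 : χ₀ b = χ₀ a + 1 := by
      simp only [χ₀, if_pos hab.1.symm, if_true, inv_mul_cancel]
      exact hψ1
    simp only [h1, hab.proj_eq]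
    ring
  · rcases hyz with h | h | h
    · simp only [hfib y z h hne, h.proj_eq]
    · simp only [hfib z y h (by rwa [Sym2.eq_swap]), h.proj_eq]
    · simp only [hΦ _ _ h.1, h.2.1, h.2.2, toAdd_mul, toAdd_ofAdd]
      ring

theorem blowUpGraph_isTree : S.blowUpGraph.IsTree := by
  have hz : ∀ z w : ZMod 2, w = z + 1 → ((z = 0) ≠ (w = 0)) := by decide
  refine isTree_of_cut blowUpGraph_connected fun a b hab => ?_
  rcases hab with hab | hab | hab
  · obtain ⟨χ, h1, h2⟩ := exists_cut_of_fibreAdj hab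
    exact ⟨fun y => χ y = 0, hz _ _ h1, fun y z hyz hne => congrArg (· = 0) (h2 y z hyz hne)⟩
  · obtain ⟨χ, h1, h2⟩ := exists_cut_of_fibreAdj hab
    exact ⟨fun y => χ y = 0, (hz _ _ h1).symm, fun y z hyz hne =>
      congrArg (· = 0) (h2 y z hyz (by rwa [Sym2.eq_swap (a := b)]))⟩
  -- An edge coming from `S` is separated in `S`: it is the only edge over its image.
  · refine ⟨fun y => (cut S.graph (S.proj a) (S.proj b)).Reachable (S.proj a) (S.proj y), ?_,
      fun y z hyz hne => ?_⟩
    · have h1 := not_reachable_cut S.isTree.isAcyclic hab.1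
      intro h
      exact h1 (h.mp (SimpleGraph.Reachable.refl _))
    · rcases proj_eq_or_adj hyz with h | h
      · simp only [h]
      · have hadj : (cut S.graph (S.proj a) (S.proj b)).Adj (S.proj y) (S.proj z) := by
          refine cut_adj.2 ⟨h.1, fun he => hne ?_⟩
          rcases Sym2.eq_iff.1 he with ⟨e1, e2⟩ | ⟨e1, e2⟩
          · have h1 := h.2.1
            have h2 := h.2.2
            rw [e1, e2] at h1 h2
            rw [← h1, ← h2, hab.2.1, hab.2.2]
          · have h1 := h.2.1
            have h2 := h.2.2
            rw [e1, e2] at h1 h2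
            rw [← h1, ← h2, hab.2.1, hab.2.2]
            exact Sym2.eq_swap
        exact propext ⟨fun r => r.trans hadj.reachable, fun r => r.trans hadj.symm.reachable⟩

/-- If the stabilizer of the vertex below is trivial, the fibre is a point and its valence is at
least that in `S`. Otherwise a basis element and its inverse give two neighbours in the fibre. A
third comes from `S`: the stabilizer is transitive on the fibre, so it moves some attached edge to
the given vertex. -/
theorem blowUp_valence (y : S.BlowUp) : 3 ≤ (S.blowUpGraph.neighborSet y).encard := by
  have hdart : ∀ {w}, S.graph.Adj (S.proj y) w → S.attach (S.proj y) w = y →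
      S.attach w (S.proj y) ∈ S.blowUpGraph.neighborSet y := by
    intro w hw h
    have := dartAdj_attach hw
    rw [h] at this
    exact Or.inr (Or.inr this)
  by_cases hbot : MulAction.stabilizer (F n) (S.rep y.2) = ⊥
  · have huniq : ∀ z, S.proj z = S.proj y → z = y := by
      intro z hz
      obtain ⟨h1, h2⟩ := exists_of_proj_eq hz.symm
      rw [hbot, Subgroup.mem_bot] at h2
      exact Prod.ext (inv_mul_eq_one.1 h2).symm h1.symm
    have hinj : Set.InjOn (fun w => S.attach w (S.proj y)) (S.graph.neighborSet (S.proj y)) := by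
      intro w hw w' hw' h
      have := congrArg S.proj h
      rwa [proj_attach (SimpleGraph.Adj.symm hw), proj_attach (SimpleGraph.Adj.symm hw')] at this
    calc 3 ≤ (S.graph.neighborSet (S.proj y)).encard := S.valence _
      _ = ((fun w => S.attach w (S.proj y)) '' S.graph.neighborSet (S.proj y)).encard :=
        hinj.encard_image.symm
      _ ≤ _ := by
        refine Set.encard_le_encard ?_
        rintro _ ⟨w, hw, rfl⟩
        exact hdart hw (huniq _ (proj_attach hw))
  · have hne : (S.stabBasis y.2).Nonempty := by
      rw [Set.nonempty_iff_ne_empty]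
      intro h
      rw [← closure_stabBasis, h, Subgroup.closure_empty] at hbot
      exact hbot rfl
    obtain ⟨d, hd⟩ := hne
    have hd1 := (stabBasis_isFreeSet y.2).ne_one hd
    obtain ⟨w, -, -, hw, -⟩ := S.exists_two (S.proj y)
    obtain ⟨h1, h2⟩ := exists_of_proj_eq (proj_attach hw).symm
    set z := S.attach (S.proj y) w with hz
    let k : F n := y.1 * z.1⁻¹
    have hky : k • z = y := Prod.ext (inv_mul_cancel_right _ _) h1.symm
    have hkp : k • S.proj y = S.proj y := by
      conv_lhs => rw [← proj_attach hw]
      rw [← proj_smul, ← hz, hky]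
    have hadj : S.graph.Adj (S.proj y) (k • w) := by
      have := S.isInvariant k _ _ hw
      rwa [hkp] at this
    have hatt : S.attach (S.proj y) (k • w) = y := by
      have := attach_smul k hw
      rwa [hkp, ← hz, hky] at this
    let u : S.BlowUp := (y.1 * d, y.2)
    let u' : S.BlowUp := (y.1 * d⁻¹, y.2)
    have hu : S.FibreAdj y u := ⟨rfl, by
      change y.1⁻¹ * (y.1 * d) ∈ _
      rwa [inv_mul_cancel_left]⟩
    have hu' : S.FibreAdj u' y := ⟨rfl, by
      change (y.1 * d⁻¹)⁻¹ * y.1 ∈ S.stabBasis y.2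
      rwa [mul_inv_rev, inv_inv, inv_mul_cancel_right]⟩
    refine three_le_encard (a := u) (b := u') (Or.inl hu) (Or.inr (Or.inl hu')) (hdart hadj hatt)
      ?_ ?_ ?_
    · intro h
      have : y.1 * d = y.1 * d⁻¹ := congrArg Prod.fst h
      exact hd1 (freeGroup_torsionFree d (mul_eq_one_iff_eq_inv.2 (mul_left_cancel this)))
    · intro h
      have := congrArg S.proj h
      rw [proj_attach hadj.symm, ← hu.proj_eq] at this
      exact hadj.ne this
    · intro h
      have := congrArg S.proj h
      rw [proj_attach hadj.symm, hu'.proj_eq] at this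
      exact hadj.ne this

/-- By minimality of `S` the invariant subtree meets every fibre, and each fibre lies in a single
orbit. -/
theorem blowUp_minimal (X : Set S.BlowUp) (hX : X.Nonempty) (hinv : ∀ g : F n, ∀ v ∈ X, g • v ∈ X)
    (hconn : (S.blowUpGraph.induce X).Connected) : X = Set.univ := by
  have hconn' := connectedOn_of_induce hconn.preconnected
  have himg : S.proj '' X = Set.univ := by
    refine S.isMinimalTree _ (hX.image _) ?_ ?_
    · rintro g _ ⟨y, hy, rfl⟩
      exact ⟨g • y, hinv g y hy, proj_smul g y⟩
    · rintro _ ⟨y, hy, rfl⟩ _ ⟨z, hz, rfl⟩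
      refine reachable_of_closed
        (P := fun z => (within S.graph (S.proj '' X)).Reachable (S.proj y) (S.proj z)) ?_
        (hconn' y hy z hz) (SimpleGraph.Reachable.refl _)
      rintro a b ⟨hab, ha, hb⟩ h
      rcases proj_eq_or_adj hab with h' | h'
      · exact h' ▸ h
      · exact h.trans (SimpleGraph.Adj.reachable ⟨h'.1, ⟨a, ha, rfl⟩, ⟨b, hb, rfl⟩⟩)
  refine Set.eq_univ_of_forall fun y => ?_
  obtain ⟨x, hx, hxy⟩ : S.proj y ∈ S.proj '' X := himg ▸ Set.mem_univ _
  have h1 := (exists_of_proj_eq hxy).1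
  have : (y.1 * x.1⁻¹) • x = y := Prod.ext (inv_mul_cancel_right _ _) h1
  exact this ▸ hinv _ x hx

variable (S) in
/-- The free splitting with trivial vertex stabilizers obtained by blowing up the vertices of `S`. -/
def blowUp : FreeSplitting n where
  V := S.BlowUp
  graph := S.blowUpGraph
  isTree := blowUpGraph_isTree
  ρ := actionHom blowUpGraph_isInvariant
  edge_stab g v _ _ hv _ := blowUp_isFreeAction g v hv
  minimal := blowUp_minimal
  valence := blowUp_valence

theorem blowUp_isCollapse : S.blowUp.IsCollapse S := by
  refine ⟨S.proj, fun g v => proj_smul g v, fun w => ?_, fun w w' => ⟨fun h => ?_, ?_⟩⟩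
  · obtain ⟨y, hy⟩ := proj_surjective w
    exact (connectedOn_fibre w).induce_connected ⟨y, hy⟩
  · exact ⟨h.ne, _, _, proj_attach h, proj_attach h.symm, Or.inr (Or.inr (dartAdj_attach h))⟩
  · rintro ⟨hne, v, v', rfl, rfl, h⟩
    exact ((proj_eq_or_adj h).resolve_left hne).1

end FreeSplitting

end OuterSpace

end

noncomputable section

namespace OuterSpace

/-! ### Comparison with the free splitting graph -/

section FreeSplittingGraph

variable {n : ℕ}

/-- Finite generation makes the quotient finite: the translates of the paths from a vertex to its
images under the generators form an invariant subtree, which is everything by minimality. -/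
theorem FreeSplitting.exists_finset_edges (S : FreeSplitting n) : ∃ E : Finset (Sym2 S.V),
    (∀ e ∈ E, e ∈ S.graph.edgeSet) ∧
      ∀ e ∈ S.graph.edgeSet, ∃ d ∈ E, ∃ g : F n, d.map (S.ρ g) = e := by
  classical
  obtain ⟨v₀⟩ := S.isTree.connected.nonempty
  let p : ∀ i : Fin n, S.graph.Walk v₀ ((FreeGroup.of i : F n) • v₀) := fun i =>
    (S.isTree.connected v₀ _).some
  let E : Finset (Sym2 S.V) := Finset.univ.biUnion fun i => (p i).edges.toFinset
  have hE : ∀ e ∈ E, e ∈ S.graph.edgeSet := by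
    intro e he
    obtain ⟨i, -, hi⟩ := Finset.mem_biUnion.1 he
    exact (p i).edges_subset_edgeSet (List.mem_toFinset.1 hi)
  let H : SimpleGraph S.V :=
    { Adj := fun x y => S.graph.Adj x y ∧ ∃ d ∈ E, ∃ g : F n, d.map (S.ρ g) = s(x, y)
      symm := ⟨fun x y h => ⟨h.1.symm, by
        rw [Sym2.eq_swap]
        exact h.2⟩⟩
      loopless := ⟨fun x h => h.1.ne rfl⟩ }
  have hHS : H ≤ S.graph := fun _ _ h => h.1
  have hH : IsInvariant (F n) H := by
    rintro g x y ⟨h1, d, hd, k, hk⟩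
    refine ⟨S.isInvariant g _ _ h1, d, hd, g * k, ?_⟩
    have h2 : d.map (S.ρ (g * k)) = (d.map (S.ρ k)).map (S.ρ g) := by
      rw [Sym2.map_map, map_mul]
      rfl
    rw [h2, hk]
    rfl
  have hgen : ∀ i : Fin n, H.Reachable v₀ ((FreeGroup.of i : F n) • v₀) := by
    intro i
    refine ⟨(p i).transfer H fun e he => ?_⟩
    have heE : e ∈ E := Finset.mem_biUnion.2 ⟨i, Finset.mem_univ _, List.mem_toFinset.2 he⟩
    have heS := hE e heE
    induction e with
    | _ x y =>
      refine ⟨heS, s(x, y), heE, 1, ?_⟩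
      rw [map_one]
      rfl
  have htop : compStab hH v₀ = ⊤ := by
    rw [eq_top_iff, ← (isBasis_range_of n).closure_eq, Subgroup.closure_le]
    rintro _ ⟨i, rfl⟩
    exact hgen i
  have hall : {v | H.Reachable v₀ v} = Set.univ := by
    refine S.isMinimalTree _ ⟨v₀, SimpleGraph.Reachable.refl _⟩ (fun g v hv => ?_)
      ((connectedOn_component v₀).mono hHS)
    have h1 : H.Reachable v₀ (g • v₀) := (mem_compStab hH).1 (htop ▸ Subgroup.mem_top g)
    exact h1.trans (hH.reachable g hv)
  have hreach : ∀ v, H.Reachable v₀ v := fun v => by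
    have : v ∈ {v | H.Reachable v₀ v} := hall ▸ Set.mem_univ v
    exact this
  refine ⟨E, hE, fun e he => ?_⟩
  induction e with
  | _ x y => exact (adj_of_reachable S.isTree.isAcyclic hHS ((hreach x).symm.trans (hreach y)) he).2

/-- A free splitting with trivial vertex stabilizers carries an invariant length function with
volume one. -/
theorem FreeSplitting.exists_metricTree (S : FreeSplitting n) (hfree : IsFreeAction (F n) S.V) :
    ∃ T : MetricTree n, T.toFreeSplitting = S := by
  classical
  obtain ⟨E, hE, hcov⟩ := S.exists_finset_edges
  have hmul : ∀ (g h : F n) (e : Sym2 S.V), (e.map (S.ρ h)).map (S.ρ g) = e.map (S.ρ (g * h)) := by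
    intro g h e
    rw [Sym2.map_map, map_mul]
    rfl
  have hone : ∀ e : Sym2 S.V, e.map (S.ρ 1) = e := by
    intro e
    rw [map_one]
    exact congrFun Sym2.map_id' e
  let r : Setoid (Sym2 S.V) :=
    { r := fun e e' => ∃ g : F n, e.map (S.ρ g) = e'
      iseqv :=
        { refl := fun e => ⟨1, hone e⟩
          symm := by
            rintro e _ ⟨g, rfl⟩
            exact ⟨g⁻¹, by rw [hmul, inv_mul_cancel, hone]⟩
          trans := by
            rintro e _ _ ⟨g, rfl⟩ ⟨h, rfl⟩
            exact ⟨h * g, (hmul h g e).symm⟩ } }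
  let D : Finset (Sym2 S.V) := E.image fun e => Quotient.out (Quotient.mk r e)
  have hout : ∀ e, ∃ g : F n, (Quotient.out (Quotient.mk r e)).map (S.ρ g) = e := fun e =>
    Quotient.mk_out (s := r) e
  have hD : ∀ d ∈ D, d ∈ S.graph.edgeSet := by
    intro d hd
    obtain ⟨e, he, rfl⟩ := Finset.mem_image.1 hd
    obtain ⟨g, hg⟩ := (r.iseqv.symm (hout e) : ∃ g : F n, e.map (S.ρ g) = _)
    rw [← hg]
    exact MetricTree.map_edge (S.ρ g) (hE e he)
  have hDcov : ∀ e ∈ S.graph.edgeSet, ∃! d, d ∈ D ∧ ∃ g : F n, d.map (S.ρ g) = e := by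
    intro e he
    obtain ⟨d, hd, hde⟩ := hcov e he
    refine ⟨Quotient.out (Quotient.mk r d), ⟨Finset.mem_image.2 ⟨d, hd, rfl⟩,
      r.iseqv.trans (hout d) hde⟩, ?_⟩
    rintro d' ⟨hd', hd'e⟩
    obtain ⟨d₁, -, rfl⟩ := Finset.mem_image.1 hd'
    refine congrArg Quotient.out (Quotient.sound ?_)
    exact r.iseqv.trans (r.iseqv.symm (hout d₁)) (r.iseqv.trans hd'e (r.iseqv.symm hde))
  have hDne : D.Nonempty := by
    obtain ⟨v⟩ := S.isTree.connected.nonempty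
    obtain ⟨w, -, -, hw, -⟩ := S.exists_two v
    obtain ⟨d, hd, -⟩ := hDcov s(v, w) hw
    exact ⟨d, hd.1⟩
  have hcard : (0 : ℝ) < D.card := by exact_mod_cast hDne.card_pos
  let T : MetricTree n :=
    { S with
      free := hfree
      len := fun _ => 1 / (D.card : ℝ)
      len_pos := fun _ _ => by positivity
      len_inv := fun _ _ _ => rfl
      volume_one := ⟨D, hD, hDcov, by
        rw [Finset.sum_const, nsmul_eq_mul, mul_one_div, div_self hcard.ne']⟩ }
  exact ⟨T, rfl⟩

/-- The point `x` of outer space resolves the free splitting `s`. -/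
def Resolves (s : FSVertex n) (x : Cv0 n) : Prop :=
  ∃ (T : MetricTree n) (S : FreeSplitting n) (q : T.V → S.V), Cv0.mk T = x ∧ FSVertex.mk S = s ∧
    IsResolution T.toFreeSplitting S q

theorem resolves_upsilon (x : Cv0 n) : Resolves (Upsilon x) x := by
  obtain ⟨T, rfl⟩ := x.exists_rep
  exact ⟨T, T.toFreeSplitting, id, rfl, rfl, IsResolution.refl _⟩

theorem FreeSplitting.exists_blowUp (S : FreeSplitting n) :
    ∃ T : MetricTree n, T.toFreeSplitting.IsCollapse S := by
  obtain ⟨T, hT⟩ := S.blowUp.exists_metricTree FreeSplitting.blowUp_isFreeAction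
  exact ⟨T, hT ▸ FreeSplitting.blowUp_isCollapse⟩

theorem Resolves.chain (hn : 3 ≤ n) {k : ℝ} (hk : 3 ≤ k) {ℓ : ℕ} (hℓ : ℓ ≤ n - 1) {s : FSVertex n}
    {x y : Cv0 n} (hx : Resolves s x) (hy : Resolves s y) : IsTiedChain k ℓ x y 6 := by
  obtain ⟨T, S, q, rfl, rfl, h⟩ := hx
  obtain ⟨T', S', q', rfl, hS, h'⟩ := hy
  obtain ⟨p, hp⟩ := IsResolution.of_iso (Quotient.exact hS)
  exact chain_of_isResolution hn hk hℓ h (hp.comp h')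

/-- The blow-up of the less collapsed splitting resolves it, and hence also its collapse. -/
theorem exists_resolves_of_adj {s t : FSVertex n} (h : (FS n).Adj s t) :
    ∃ x : Cv0 n, Resolves s x ∧ Resolves t x := by
  have key : ∀ {s t : FSVertex n}, (∃ S T : FreeSplitting n, FSVertex.mk S = s ∧ FSVertex.mk T = t ∧
      S.IsCollapse T) → ∃ x : Cv0 n, Resolves s x ∧ Resolves t x := by
    rintro s t ⟨S, S', rfl, rfl, h⟩
    obtain ⟨T, hT⟩ := S.exists_blowUp
    obtain ⟨q, hq⟩ := hT.isResolution
    obtain ⟨p, hp⟩ := h.isResolution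
    exact ⟨Cv0.mk T, ⟨T, S, q, rfl, rfl, hq⟩, ⟨T, S', _, rfl, rfl, hp.comp hq⟩⟩
  rcases ((SimpleGraph.fromRel_adj _ _ _).1 h).2 with h | h
  · exact key h
  · obtain ⟨x, h1, h2⟩ := key h
    exact ⟨x, h2, h1⟩

theorem exists_upsilon_gNear (s : FSVertex n) : ∃ x : Cv0 n, GNear (FS n) 1 (Upsilon x) s := by
  obtain ⟨S, rfl⟩ := Quotient.exists_rep s
  obtain ⟨T, hT⟩ := S.exists_blowUp
  exact ⟨Cv0.mk T, IsCollapse.gNear hT⟩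

theorem FS_connected (hn : 3 ≤ n) : (FS n).Connected := by
  have : Nonempty (FSVertex n) := ⟨FSVertex.mk (roseSplitting hn (isBasis_range_of n))⟩
  refine ⟨fun s t => ?_⟩
  obtain ⟨x, hx⟩ := exists_upsilon_gNear s
  obtain ⟨y, hy⟩ := exists_upsilon_gNear t
  obtain ⟨B, hB⟩ := exists_geo x
  obtain ⟨B', hB'⟩ := exists_geo y
  obtain ⟨m, hm⟩ := exists_bNear hn hB.isBasis hB'.isBasis
  exact ((((hx.symm.trans (hB.gNear_FS hn)).trans (hm.gNear_FS hn hB.isBasis hB'.isBasis)).trans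
    (hB'.gNear_FS hn).symm).trans hy).reachable

theorem isEquivariantQI_FS (hn : 3 ≤ n) {k : ℝ} (hk : 3 ≤ k) :
    ∃ L : ℝ, IsEquivariantQI (Out n) L (ngDist k (n - 1)) (FS n).dist (Upsilon (n := n)) := by
  have hk0 : 0 ≤ k := by linarith
  set N := nearBound n k
  -- A tie moves the image by at most `4 * N + 12`. In the other direction a path of length `d`
  -- gives `6 * d + 6` ties, six for each vertex on it.
  refine ⟨((4 * N + 12 : ℕ) : ℝ), fun x y => ?_, fun x y => ?_, fun s => ?_, ?_⟩
  · have hch := isTiedChain_ngDist (exists_chain hn hk (le_refl (n - 1)) x y)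
    have h2 : GNear (FS n) ((4 * N + 12) * ngDist k (n - 1) x y) (Upsilon x) (Upsilon y) :=
      IsTiedChain.induction
        (P := fun s y => GNear (FS n) ((4 * N + 12) * s) (Upsilon x) (Upsilon y))
        (GNear.refl _ _) (fun s y z _ ih hyz => ih.trans (hyz.gNear_FS hn hk0)) hch
    have h3 := h2.dist_le.trans (Nat.le_add_right _ (4 * N + 12))
    exact_mod_cast h3
  · have h1 := GNear.induction (near := fun s x y => IsTiedChain k (n - 1) x y s) (a := 6) (b := 0)
      Resolves IsTiedChain.trans (fun hst h => h.mono hk (by omega) hst)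
      (fun s x y hx hy => hx.chain hn hk le_rfl hy) (fun s t hst => by
        obtain ⟨x, h1, h2⟩ := exists_resolves_of_adj hst
        exact ⟨x, x, h1, h2, IsTiedChain.refl _ _ _⟩)
      (gNear_dist (FS_connected hn) (Upsilon x) (Upsilon y)) (resolves_upsilon x)
      (resolves_upsilon y)
    have h2 := ngDist_le h1
    have h3 : ngDist k (n - 1) x y ≤
        (4 * N + 12) * (FS n).dist (Upsilon x) (Upsilon y) + (4 * N + 12) := by
      nlinarith
    exact_mod_cast h3
  · obtain ⟨x, hx⟩ := exists_upsilon_gNear s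
    exact ⟨x, by exact_mod_cast hx.dist_le.trans (by omega)⟩
  · rintro ⟨φ⟩ x
    obtain ⟨T, rfl⟩ := x.exists_rep
    have : (QuotientGroup.mk φ : Out n) • Upsilon (Cv0.mk T) =
        Upsilon ((QuotientGroup.mk φ : Out n) • Cv0.mk T) := rfl
    have h1 : (FS n).dist ((QuotientGroup.mk φ : Out n) • Upsilon (Cv0.mk T))
        (Upsilon ((QuotientGroup.mk φ : Out n) • Cv0.mk T)) ≤ 4 * N + 12 := by
      rw [this, SimpleGraph.dist_self]
      exact Nat.zero_le _
    exact_mod_cast h1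

end FreeSplittingGraph

end OuterSpace

end

theorem mainTheorem7 (n : ℕ) (hn : 3 ≤ n) (k : ℝ) (hk : 4 ≤ k) :
    -- the electrified distances are (finite) distances
    (∀ ℓ : ℕ, 1 ≤ ℓ → ℓ ≤ n - 1 →
      (∀ x y : Cv0 n, ∃ s : ℕ, 1 ≤ s ∧ IsTiedChain k ℓ x y s) ∧
      IsDistance (ngDist (n := n) k ℓ)) ∧
    -- short corank one free factors exist
    (∃ Υ : Cv0 n → CorankOne n, IsShortFactorMap k Υ) ∧
    -- the graphs `FF_ℓ`
    (∀ ℓ : ℕ, 1 ≤ ℓ → ℓ ≤ n - 2 →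
      (FFl n ℓ).Connected ∧
      ∃ L : ℝ, ∀ Υ : Cv0 n → CorankOne n, IsShortFactorMap k Υ →
        IsEquivariantQI (Out n) L (ngDist k ℓ) (FFl n ℓ).dist Υ) ∧
    -- the case `ℓ = 1` and the free factor graph
    ((FF n).Connected ∧
      ∃ ι : CorankOne n → ProperFactor n,
        (∀ c : CorankOne n, (ι c : SubgroupConj n) = (c : SubgroupConj n)) ∧
        ∃ L : ℝ, IsEquivariantQI (Out n) L (FFl n 1).dist (FF n).dist ι ∧
          ∀ Υ : Cv0 n → CorankOne n, IsShortFactorMap k Υ →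
            IsEquivariantQI (Out n) L (ngDist k 1) (FF n).dist (fun x => ι (Υ x))) ∧
    -- the free splitting graph
    ((FS n).Connected ∧
      ∃ L : ℝ, IsEquivariantQI (Out n) L (ngDist k (n - 1)) (FS n).dist (Upsilon (n := n))) := by
  have hk3 : 3 ≤ k := by linarith
  refine ⟨fun ℓ _ hℓ => ?_, exists_isShortFactorMap hk3, fun ℓ h1 hℓ => ?_, ?_, ?_⟩
  · have h := exists_chain hn hk3 hℓ
    exact ⟨h, isDistance_ngDist h⟩
  · obtain ⟨L, -, h⟩ := isEquivariantQI_FFl hn h1 hℓ hk3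
    exact ⟨FFl_connected hn hℓ, L, h⟩
  · exact ⟨FF_connected hn, corankIncl hn, fun _ => rfl, isEquivariantQI_FF hn hk3⟩
  · exact ⟨FS_connected hn, isEquivariantQI_FS hn hk3⟩
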